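/- Let $(A,\mathbb R^2,\alpha)$ be a $C^*$-dynamical system with $A$ unital, let $A^\infty$ be the algebra of smooth elements, and let $\delta_j a=i\,\partial_{x_j}|_{x=0}\alpha_x(a)$ for $a\in A^\infty$, $j=1,2$. Let $B$ be a real skew-symmetric $2\times2$ matrix and let $\tau\in\mathbb C$, $\operatorname{Im}\tau>0$. On $A^\infty$ put $\partial_\tau=\delta_1+\bar\tau\delta_2$, $\partial_\tau^*=\delta_1+\tau\delta_2$, $\Delta_\tau=\partial_\tau\partial_\tau^*$. For a symbol $f:\mathbb R^2\to A^\infty$, the twisted pseudodifferential multiplier $P_f$ on the Schwartz space $\mathscr S(\mathbb R^2,A^\infty)$ is $$(P_fu)(x)=(2\pi)^{-2}\int_{\mathbb R^2}e^{i\langle x,\xi\rangle}\,\alpha_{-x}(f(\xi))\,\hat u(\xi-Bx)\,d\xi ,\qquad \hat u(\xi)=\int_{\mathbb R^2} e^{-i\langle x,\xi\rangle}u(x)\,dx .$$ Let $D_j=P_{\xi_j}$, $D_\tau=D_1+\bar\tau D_2$, $D_\tau^*=D_1+\tau D_2$, let $\underline\Delta_\tau=\frac12(D_\tau^*D_\tau+D_\tau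 D_\tau^*)$, and let $a\in A^\infty$ act by $(au)(x)=\alpha_{-x}(a)u(x)$. Let $k=k^*\in A^\infty$ be invertible, $a_0\in A^\infty$, $\varepsilon_1,\varepsilon_2\in\mathbb R$, and $$P=k^2\underline\Delta_\tau+\varepsilon_1(\partial_\tau k^2)D_\tau^*+\varepsilon_2(\partial_\tau^*k^2)D_\tau+a_0 .$$ Put $\eta=\xi_1+\bar\tau\xi_2$ and $a_1(\xi)=\varepsilon_1(\partial_\tau k^2)\bar\eta+\varepsilon_2(\partial_\tau^*k^2)\eta$. For open $\Lambda\subseteq\mathbb C$, a smooth $f:\mathbb R^2\times\Lambda\to A^\infty$ is a parameter-dependent symbol of order $m$ if for all multiindices $\beta,\kappa,\gamma$ there is $C$ with $$\|\delta^\gamma\partial_\xi^\beta\partial_{(\operatorname{Re}\lambda,\operatorname{Im}\lambda)}^\kappa f(\xi,\lambda)\|\le C(1+|\xi|+|\lambda|^{1/2})^{m-|\beta|-2|\kappa|}\quad\text{on }\mathbb R^2\times\Lambda .$$ **Theorem.** There are smooth functions $b_{-2-j}:\mathbb R^2\times(\mathbb C\setminus[0,\infty))\to A^\infty$, $j=0,1,2,\dots$,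 homogeneous in the sense that $b_{-2-j}(t\xi,t^2\lambda)=t^{-2-j}b_{-2-j}(\xi,\lambda)$ for $t>0$, with the following properties. (1) Let $\Gamma\subseteq\mathbb C$ be an open cone with $\overline\Gamma\cap[0,\infty)\subseteq\{0\}$. Then there are $R>0$ and a function $r$, with values in $A^\infty$ on $\mathbb R^2\times\Gamma_R$, $\Gamma_R=\{\lambda\in\Gamma:|\lambda|>R\}$, such that for every $\lambda\in\Gamma_R$ the map $P-\lambda$ is a bijection of $\mathscr S(\mathbb R^2,A^\infty)$ whose inverse is $P_{r(\cdot,\lambda)}$, this inverse is bounded for the Hilbert module norm $\|\int u^*u\,dx\|^{1/2}$, and $r\sim b_{-2}+b_{-3}+b_{-4}+\cdots$, that is, for every $N\ge0$ the function $r-\sum_{j<N}b_{-2-j}$ is a parameter-dependent symbol of order $-2-N$ on $\mathbb R^2\times\Gamma_R$. (2) For all $\xi\in\mathbb R^2$ and $\lambda\in\mathbb C\setminus[0,\infty)$ the element $k^2|\eta|^2-\lambda$ is invertible and $$b_{-2}=b:=(k^2|\eta|^2-\lambda)^{-1},\qquad b_{-3}=-bk^2(\eta\,\partial_\tau^*+\bar\eta\,\partial_\tau)b-b\,a_1b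 .$$ (3) For every $\lambda\in\mathbb C\setminus[0,\infty)$, up to an integrable function of $\xi$ whose integral over $\mathbb R^2$ is $0$, the term $b_{-4}$ equals $$\begin{aligned}&(2bk^2|\eta|^2-1-\varepsilon_1-\varepsilon_2)\,bk^2\Delta_\tau b+\lambda\,bk^2\bigl((\partial_\tau^*b)(\partial_\tau b)+(\partial_\tau b)(\partial_\tau^*b)\bigr)\\&+\varepsilon_1\lambda\,b(\partial_\tau k^2)b\,\partial_\tau^*b+\varepsilon_2\lambda\,b(\partial_\tau^*k^2)b\,\partial_\tau b\\&+\varepsilon_1\varepsilon_2|\eta|^2\,b\bigl((\partial_\tau k^2)b(\partial_\tau^*k^2)+(\partial_\tau^*k^2)b(\partial_\tau k^2)\bigr)b-b\,a_0\,b .\end{aligned}$$ -/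

import Mathlib

open scoped ContDiff

/-- The Euclidean plane. -/
abbrev Plane : Type := EuclideanSpace ℝ (Fin 2)

/-- The canonical basis vectors of the plane. -/
noncomputable def basisVec (j : Fin 2) : Plane := EuclideanSpace.single j (1 : ℝ)

/-- A C*-dynamical system `(A, ℝ², α)`: a strongly continuous action of the additive group `ℝ²`
on the unital C*-algebra `A` by `*`-automorphisms. -/
structure PlaneAction (A : Type*) [CStarAlgebra A] where
  /-- the automorphism `α_x` -/
  act : Plane → (A ≃⋆ₐ[ℂ] A)
  act_zero : ∀ a, act 0 a = a
  act_add : ∀ x y a, act (x + y) a = act x (act y a)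
  continuous_act : ∀ a, Continuous fun x => act x a

namespace PlaneAction

variable {A : Type*} [CStarAlgebra A] (α : PlaneAction A)

/-- `a` is a smooth element, `a ∈ A^∞`. -/
def IsSmooth (a : A) : Prop := ContDiff ℝ ∞ fun x : Plane => α.act x a

/-- The basic derivations `δ_j a = i ∂_{x_j}|_{x=0} α_x(a) = i⁻¹ ∂_{x_j}|_{x=0} α_{-x}(a)`. -/
noncomputable def der (j : Fin 2) (a : A) : A :=
  Complex.I • fderiv ℝ (fun x : Plane => α.act x a) 0 (basisVec j)

/-- `δ^γ = δ_1^{γ_1} δ_2^{γ_2}`. -/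
noncomputable def derPow (γ : Fin 2 → ℕ) (a : A) : A :=
  (α.der 0)^[γ 0] ((α.der 1)^[γ 1] a)

/-- `∂_τ a = δ_1 a + τ̄ δ_2 a`. -/
noncomputable def dtau (τ : ℂ) (a : A) : A := α.der 0 a + (starRingEnd ℂ τ) • α.der 1 a

/-- `∂_τ^* a = δ_1 a + τ δ_2 a`. -/
noncomputable def dtauStar (τ : ℂ) (a : A) : A := α.der 0 a + τ • α.der 1 a

/-- `Δ_τ = ∂_τ ∂_τ^*` on `A^∞`. -/
noncomputable def lapl (τ : ℂ) (a : A) : A := α.dtau τ (α.dtauStar τ a)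

/-! ### The Schwartz space -/

/-- Partial derivative of an `A`-valued function on the plane. -/
noncomputable def partialX (j : Fin 2) (u : Plane → A) : Plane → A :=
  fun x => fderiv ℝ u x (basisVec j)

/-- The Schwartz space `𝓢(ℝ², A^∞)`. A map `u` into the Fréchet space `A^∞` is smooth iff
`(x, y) ↦ α_y(u(x))` is smooth as a map into `A`; the seminorms of `A^∞` are `‖δ^γ a‖`. -/
structure IsSchwartz (u : Plane → A) : Prop where
  smooth : ContDiff ℝ ∞ fun p : Plane × Plane => α.act p.2 (u p.1)
  decay : ∀ (N : ℕ) (β γ : Fin 2 → ℕ), ∃ C : ℝ, ∀ x : Plane,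
    ‖x‖ ^ N * ‖α.derPow γ ((partialX 0)^[β 0] ((partialX 1)^[β 1] u) x)‖ ≤ C

/-- The set `𝓢(ℝ², A^∞)`. -/
def schwartzSet : Set (Plane → A) := {u | α.IsSchwartz u}

/-! ### Twisted multipliers -/

/-- Application of the real matrix `B` to a vector of the plane. -/
noncomputable def matApply (B : Matrix (Fin 2) (Fin 2) ℝ) (x : Plane) : Plane :=
  WithLp.toLp 2 (B.mulVec (WithLp.ofLp x))

/-- The Fourier transform `û(ξ) = ∫ e^{-i⟨x,ξ⟩} u(x) dx`. -/
noncomputable def fourierHat (u : Plane → A) (ξ : Plane) : A :=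
  ∫ x : Plane, Complex.exp (-(Complex.I * ((inner ℝ x ξ : ℝ) : ℂ))) • u x

/-- The twisted pseudodifferential multiplier with symbol `f`:
`(P_f u)(x) = (2π)⁻² ∫ e^{i⟨x,ξ⟩} α_{-x}(f(ξ)) û(ξ - Bx) dξ`. -/
noncomputable def mult (B : Matrix (Fin 2) (Fin 2) ℝ) (f : Plane → A) (u : Plane → A) :
    Plane → A :=
  fun x => (((2 * Real.pi) ^ 2)⁻¹ : ℝ) •
    ∫ ξ : Plane, Complex.exp (Complex.I * ((inner ℝ x ξ : ℝ) : ℂ)) •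
      (α.act (-x) (f ξ) * fourierHat u (ξ - matApply B x))

/-- The left action `(a u)(x) = α_{-x}(a) u(x)` of `A`. -/
noncomputable def leftMul (a : A) (u : Plane → A) : Plane → A := fun x => α.act (-x) a * u x

/-- The basic differential multiplier `D_j = P_{ξ_j}`. -/
noncomputable def diffMult (B : Matrix (Fin 2) (Fin 2) ℝ) (j : Fin 2) (u : Plane → A) :
    Plane → A :=
  α.mult B (fun ξ => ((ξ j : ℝ) : ℂ) • (1 : A)) u

/-- The multiplier `D_τ = D_1 + τ̄ D_2`. -/
noncomputable def multTau (B : Matrix (Fin 2) (Fin 2) ℝ) (τ : ℂ) (u : Plane → A) : Plane → A :=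
  α.diffMult B 0 u + (starRingEnd ℂ τ) • α.diffMult B 1 u

/-- The multiplier `D_τ^* = D_1 + τ D_2`. -/
noncomputable def multTauStar (B : Matrix (Fin 2) (Fin 2) ℝ) (τ : ℂ) (u : Plane → A) :
    Plane → A :=
  α.diffMult B 0 u + τ • α.diffMult B 1 u

/-- The Laplace multiplier `½ (D_τ^* D_τ + D_τ D_τ^*)`. -/
noncomputable def multLapl (B : Matrix (Fin 2) (Fin 2) ℝ) (τ : ℂ) (u : Plane → A) : Plane → A :=
  (1 / 2 : ℂ) • (α.multTauStar B τ (α.multTau B τ u) + α.multTau B τ (α.multTauStar B τ u))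

/-- The differential multiplier
`P = k² Δ_τ + ε₁ (∂_τ k²) D_τ^* + ε₂ (∂_τ^* k²) D_τ + a₀`,
where `Δ_τ` here is the Laplace multiplier. -/
noncomputable def opP (B : Matrix (Fin 2) (Fin 2) ℝ) (τ : ℂ) (k a₀ : A) (ε₁ ε₂ : ℝ)
    (u : Plane → A) : Plane → A :=
  α.leftMul (k ^ 2) (α.multLapl B τ u)
    + (ε₁ : ℂ) • α.leftMul (α.dtau τ (k ^ 2)) (α.multTauStar B τ u)
    + (ε₂ : ℂ) • α.leftMul (α.dtauStar τ (k ^ 2)) (α.multTau B τ u)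
    + α.leftMul a₀ u

/-! ### Parameter dependent symbols -/

/-- `∂_{ξ_j}` of a function of `(ξ, z)`. -/
noncomputable def dXi (j : Fin 2) (f : Plane → ℂ → A) : Plane → ℂ → A :=
  fun ξ z => fderiv ℝ (fun ξ' => f ξ' z) ξ (basisVec j)

/-- `∂_{Re z}` of a function of `(ξ, z)`. -/
noncomputable def dRe (f : Plane → ℂ → A) : Plane → ℂ → A :=
  fun ξ z => fderiv ℝ (f ξ) z 1

/-- `∂_{Im z}` of a function of `(ξ, z)`. -/
noncomputable def dIm (f : Plane → ℂ → A) : Plane → ℂ → A :=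
  fun ξ z => fderiv ℝ (f ξ) z Complex.I

/-- Smoothness, as an `A^∞`-valued map, of a function on `ℝ² × Λ`. -/
def SmoothOn (Λ : Set ℂ) (f : Plane → ℂ → A) : Prop :=
  ContDiffOn ℝ ∞ (fun p : Plane × ℂ × Plane => α.act p.2.2 (f p.1 p.2.1))
    (Set.univ ×ˢ Λ ×ˢ Set.univ)

/-- The parameter dependent symbols of order `m` on `ℝ² × Λ` with values in `A^∞`
(`Λ ⊆ ℂ` open); the parameter is a variable of degree two. -/
structure IsParamSymbol (m : ℝ) (Λ : Set ℂ) (f : Plane → ℂ → A) : Prop where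
  smooth : α.SmoothOn Λ f
  bound : ∀ β κ γ : Fin 2 → ℕ, ∃ C : ℝ, ∀ ξ : Plane, ∀ z ∈ Λ,
    ‖α.derPow γ ((dXi 0)^[β 0] ((dXi 1)^[β 1] (dRe^[κ 0] (dIm^[κ 1] f))) ξ z)‖
      ≤ C * (1 + ‖ξ‖ + Real.sqrt ‖z‖)
          ^ (m - ((β 0 + β 1 : ℕ) : ℝ) - 2 * ((κ 0 + κ 1 : ℕ) : ℝ))

/-! ### The explicit symbols -/

/-- `η = ξ₁ + τ̄ ξ₂`. -/
noncomputable def eta (τ : ℂ) (ξ : Plane) : ℂ := (ξ 0 : ℂ) + starRingEnd ℂ τ * (ξ 1 : ℂ)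

/-- `|η|²`, as a complex number. -/
noncomputable def etaSq (τ : ℂ) (ξ : Plane) : ℂ := ((‖eta τ ξ‖ ^ 2 : ℝ) : ℂ)

/-- `b(ξ, z) = (k² |η|² - z)⁻¹`. -/
noncomputable def bSym (τ : ℂ) (k : A) (ξ : Plane) (z : ℂ) : A :=
  Ring.inverse (etaSq τ ξ • k ^ 2 - z • (1 : A))

/-- `a₁(ξ) = ε₁ (∂_τ k²) η̄ + ε₂ (∂_τ^* k²) η`. -/
noncomputable def a1Sym (τ : ℂ) (k : A) (ε₁ ε₂ : ℝ) (ξ : Plane) : A :=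
  ((ε₁ : ℂ) * starRingEnd ℂ (eta τ ξ)) • α.dtau τ (k ^ 2)
    + ((ε₂ : ℂ) * eta τ ξ) • α.dtauStar τ (k ^ 2)

/-- The closed formula for `b₋₃`. -/
noncomputable def b3Formula (τ : ℂ) (k : A) (ε₁ ε₂ : ℝ) (ξ : Plane) (z : ℂ) : A :=
  let b : A := bSym τ k ξ z;
  -(b * k ^ 2 * (eta τ ξ • α.dtauStar τ b + starRingEnd ℂ (eta τ ξ) • α.dtau τ b))
    - b * α.a1Sym τ k ε₁ ε₂ ξ * b

/-- The closed formula for `b₋₄`. -/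
noncomputable def b4Formula (τ : ℂ) (k a₀ : A) (ε₁ ε₂ : ℝ) (ξ : Plane) (z : ℂ) : A :=
  let b : A := bSym τ k ξ z;
  let d : A → A := α.dtau τ;
  let d' : A → A := α.dtauStar τ;
  ((2 * etaSq τ ξ) • (b * k ^ 2) - (1 + (ε₁ : ℂ) + (ε₂ : ℂ)) • (1 : A)) * b * k ^ 2 * α.lapl τ b
    + z • (b * k ^ 2 * (d' b * d b + d b * d' b))
    + ((ε₁ : ℂ) * z) • (b * d (k ^ 2) * b * d' b)
    + ((ε₂ : ℂ) * z) • (b * d' (k ^ 2) * b * d b)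
    + ((ε₁ : ℂ) * (ε₂ : ℂ) * etaSq τ ξ) •
        (b * (d (k ^ 2) * b * d' (k ^ 2) + d' (k ^ 2) * b * d (k ^ 2)) * b)
    - b * a₀ * b

/-- The complement of the half line `[0, ∞)` in the complex plane. -/
def offRay : Set ℂ := {z | z.re < 0 ∨ z.im ≠ 0}

/-- An open cone in `ℂ` whose closure meets `[0, ∞)` at most in the origin. -/
structure IsResolventCone (Γ : Set ℂ) : Prop where
  isOpen : IsOpen Γ
  cone : ∀ z ∈ Γ, ∀ t : ℝ, 0 < t → (t : ℂ) * z ∈ Γ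
  off_ray : ∀ z ∈ closure Γ, z ≠ 0 → z ∈ offRay

/-- `T` is the inverse of `Q` on `𝓢(ℝ², A^∞)`, and it is bounded for the norm
`‖⟨u, u⟩‖^{1/2}`, `⟨u, u⟩ = ∫ u^* u`, of the Hilbert module `L²(ℝ², A)`. -/
structure IsBoundedInverse (Q T : (Plane → A) → (Plane → A)) : Prop where
  bijOn : Set.BijOn Q α.schwartzSet α.schwartzSet
  invOn : Set.InvOn T Q α.schwartzSet α.schwartzSet
  bounded : ∃ C : ℝ, ∀ u ∈ α.schwartzSet,
    ‖∫ x : Plane, star (T u x) * T u x‖ ≤ C * ‖∫ x : Plane, star (u x) * u x‖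

end PlaneAction

/-! Composing with the coordinate multipliers stays inside the calculus: D_j P_f = P_g with g = ξ_j
f + δ_j f - i Σ_k B_kj ∂_k f. Hence P P_f is the multiplier of a symbol `sym f`, which is k²|η|² f
plus four operators of degrees 1, 0, -1, -2 applied to f, the parameter λ having degree two. The
scalars produced by the commutator of D_τ and D_τ^* cancel in the symmetrised Laplacian, because B
is skew. Solving sym f - λ f = 1 degree by degree gives b = (k²|η|² - λ)⁻¹ and then each further
term as b times minus the top part of the residual (`residual`, `term`). The N-th partial sum q_N
satisfies (sym - λ) q_N = 1 + e_N with e_N of order -N (`sym_approx`).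

To pass to the true resolvent, a symbol f of order -2 is written as the Fourier transform of an
integrable kernel κ, although f need not be integrable (`integral_osc_ker`). Then P_f is a twisted
convolution, bounded on the Hilbert module by Cauchy–Schwarz, and P_f P_g has the symbol ∫
e^{-i⟨ξ,v⟩} κ(v) α_v(g(ξ - Bv)) dv (`mult_mult`). Left composition with f is therefore a bounded
operator on bounded continuous symbols, of norm O(|λ|^{-1/2}) when f has order -3. So 1 + e_3 is
invertible for large λ, by some W, and the composition r of q_3 with W is the symbol of a right
inverse of P - λ.

Regularity of r is obtained by conjugation: translating in ξ and acting by α_y turns left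
composition into a family of operators depending smoothly on (ξ, λ, y), inversion preserves
smoothness, and evaluation of the inverse at the constant symbol 1 and the origin returns α_y(W(ξ,
λ)) (`exists_inverse_symbol`). This bounds all derivatives of r but shows no gain under
differentiation, i.e. r is of type zero. By `eq_zero_of_mult_eq_zero` the symbol identity sym r - λ
r = 1 holds, so r - q_M solves the same equation with right side -e_M; elliptic regularity
(`symb_of_sym`) gives it order -2-M in type zero. As M is arbitrary and q_M has type one, r has type
one together with the whole expansion (`symb_resolvent`).

Injectivity of P - λ follows by duality: the formal adjoint has the same shape and thus also has a
right inverse at the conjugate parameter, so u in the kernel pairs to zero with every test function.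

For the closed formulas, b_{-4} splits into a part containing η only through |η|² and a part
carrying η² or η̄². A real linear map of the plane with η ↦ iη fixes |η|² and reverses the sign of
η² and η̄², so the second part integrates to zero. The first part is rewritten by the two identities
|η|² b k² = 1 + λ b and ∂b = -|η|² b (∂k²) b. -/

section WordBounds

/-! ### Calculus of weighted bounds on iterated directional derivatives. -/

variable {ι E F G H : Type*} [NormedAddCommGroup E] [NormedSpace ℝ E]
  [NormedAddCommGroup F] [NormedSpace ℝ F] [NormedAddCommGroup G] [NormedSpace ℝ G]
  [NormedAddCommGroup H] [NormedSpace ℝ H]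

/-- The directional derivative of `φ` along `v`. -/
noncomputable def dirDeriv (v : E) (φ : E → F) : E → F := fun p => fderiv ℝ φ p v

/-- All iterated directional derivatives of `φ` of length at most `n` along the vectors `e i` are
bounded on `U` by a multiple of the weight `w`, each derivative along `e i` contributing a
factor `h i`. -/
def WordBound (e : ι → E) (U : Set E) (h : ι → E → ℝ) : ℕ → (E → ℝ) → (E → F) → Prop
  | 0, w, φ => ∃ C, ∀ p ∈ U, ‖φ p‖ ≤ C * w p
  | n + 1, w, φ => (∃ C, ∀ p ∈ U, ‖φ p‖ ≤ C * w p) ∧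
      ∀ i, WordBound e U h n (w * h i) (dirDeriv (e i) φ)

/-- Smooth functions on `U` all of whose iterated directional derivatives are bounded by the
weight `w`, adjusted by `h`. -/
structure WeightedSmooth (e : ι → E) (U : Set E) (h : ι → E → ℝ) (w : E → ℝ) (φ : E → F) :
    Prop where
  smooth : ContDiffOn ℝ ∞ φ U
  words : ∀ n, WordBound e U h n w φ

variable {e : ι → E} {U V : Set E} {h h' : ι → E → ℝ} {w w₁ w₂ : E → ℝ} {φ ψ : E → F} {n : ℕ}

theorem ContDiffOn.dirDeriv (hU : IsOpen U) (hφ : ContDiffOn ℝ ∞ φ U) (v : E) :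
    ContDiffOn ℝ ∞ (dirDeriv v φ) U :=
  ((contDiffOn_infty_iff_fderiv_of_isOpen hU).1 hφ).2.clm_apply contDiffOn_const

theorem ContDiffOn.diffAt (hU : IsOpen U) (hφ : ContDiffOn ℝ ∞ φ U) {p : E} (hp : p ∈ U) :
    DifferentiableAt ℝ φ p :=
  (hφ.contDiffAt (hU.mem_nhds hp)).differentiableAt (by simp)

theorem Set.EqOn.dirDeriv (hU : IsOpen U) (hf : Set.EqOn φ ψ U) (v : E) :
    Set.EqOn (dirDeriv v φ) (dirDeriv v ψ) U := fun p hp => by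
  have : φ =ᶠ[nhds p] ψ := Filter.eventuallyEq_of_mem (hU.mem_nhds hp) hf
  simp only [_root_.dirDeriv, this.fderiv_eq]

namespace WordBound

theorem bound (hφ : WordBound e U h n w φ) : ∃ C, ∀ p ∈ U, ‖φ p‖ ≤ C * w p := by
  cases n with
  | zero => exact hφ
  | succ n => exact hφ.1

theorem of_succ (hφ : WordBound e U h (n + 1) w φ) : WordBound e U h n w φ := by
  induction n generalizing w φ with
  | zero => exact hφ.1
  | succ n ih => exact ⟨hφ.1, fun i => ih (hφ.2 i)⟩

theorem congr (hU : IsOpen U) (hφ : WordBound e U h n w φ) (hf : Set.EqOn φ ψ U) :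
    WordBound e U h n w ψ := by
  induction n generalizing w φ ψ with
  | zero => obtain ⟨C, hC⟩ := hφ; exact ⟨C, fun p hp => hf hp ▸ hC p hp⟩
  | succ n ih =>
    obtain ⟨⟨C, hC⟩, h2⟩ := hφ
    exact ⟨⟨C, fun p hp => hf hp ▸ hC p hp⟩, fun i => ih (h2 i) (hf.dirDeriv hU _)⟩

theorem mono (hh : ∀ i, ∀ p ∈ U, 0 ≤ h i p) (hh' : ∀ i, ∀ p ∈ U, h i p ≤ h' i p)
    (hw : ∀ p ∈ U, 0 ≤ w₁ p) (hVU : V ⊆ U) (hw₂ : ∀ p ∈ V, 0 ≤ w₂ p)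
    (hww : ∃ C, ∀ p ∈ V, w₁ p ≤ C * w₂ p) (hφ : WordBound e U h n w₁ φ) :
    WordBound e V h' n w₂ φ := by
  have key : ∀ (w₁ w₂ : E → ℝ) (φ : E → F), (∀ p ∈ U, 0 ≤ w₁ p) →
      (∃ C, ∀ p ∈ V, w₁ p ≤ C * w₂ p) →
      (∃ C, ∀ p ∈ U, ‖φ p‖ ≤ C * w₁ p) → ∃ C, ∀ p ∈ V, ‖φ p‖ ≤ C * w₂ p := by
    rintro w₁ w₂ φ hw ⟨D, hD⟩ ⟨C, hC⟩
    refine ⟨|C| * D, fun p hp => (hC p (hVU hp)).trans ?_⟩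
    calc C * w₁ p ≤ |C| * w₁ p := mul_le_mul_of_nonneg_right (le_abs_self _) (hw p (hVU hp))
      _ ≤ |C| * (D * w₂ p) := mul_le_mul_of_nonneg_left (hD p hp) (abs_nonneg _)
      _ = _ := by ring
  induction n generalizing w₁ w₂ φ with
  | zero => exact key _ _ _ hw hww hφ
  | succ n ih =>
    refine ⟨key _ _ _ hw hww hφ.1, fun i => ih (fun p hp => mul_nonneg (hw p hp) (hh i p hp))
      (fun p hp => mul_nonneg (hw₂ p hp) ((hh i p (hVU hp)).trans (hh' i p (hVU hp)))) ?_
      (hφ.2 i)⟩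
    obtain ⟨D, hD⟩ := hww
    refine ⟨|D|, fun p hp => ?_⟩
    have h1 := hh i p (hVU hp)
    have h3 : w₁ p ≤ |D| * w₂ p :=
      (hD p hp).trans (mul_le_mul_of_nonneg_right (le_abs_self _) (hw₂ p hp))
    calc w₁ p * h i p ≤ (|D| * w₂ p) * h' i p :=
          mul_le_mul h3 (hh' i p (hVU hp)) h1 (mul_nonneg (abs_nonneg _) (hw₂ p hp))
      _ = _ := by simp only [Pi.mul_apply]; ring

theorem add (hU : IsOpen U) (hφ : ContDiffOn ℝ ∞ φ U) (hψ : ContDiffOn ℝ ∞ ψ U)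
    (h₁ : WordBound e U h n w φ) (h₂ : WordBound e U h n w ψ) :
    WordBound e U h n w (fun p => φ p + ψ p) := by
  have key : ∀ (w : E → ℝ) (φ ψ : E → F), (∃ C, ∀ p ∈ U, ‖φ p‖ ≤ C * w p) →
      (∃ C, ∀ p ∈ U, ‖ψ p‖ ≤ C * w p) → ∃ C, ∀ p ∈ U, ‖φ p + ψ p‖ ≤ C * w p := by
    rintro w φ ψ ⟨C, hC⟩ ⟨D, hD⟩
    exact ⟨C + D, fun p hp => (norm_add_le _ _).trans
      ((add_le_add (hC p hp) (hD p hp)).trans (add_mul _ _ _).ge)⟩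
  induction n generalizing w φ ψ with
  | zero => exact key _ _ _ h₁ h₂
  | succ n ih =>
    refine ⟨key _ _ _ h₁.1 h₂.1, fun i => ?_⟩
    refine (ih (hφ.dirDeriv hU _) (hψ.dirDeriv hU _) (h₁.2 i) (h₂.2 i)).congr hU fun p hp => ?_
    simp only [dirDeriv]
    rw [fderiv_fun_add (hφ.diffAt hU hp) (hψ.diffAt hU hp)]
    rfl

theorem bilin (hU : IsOpen U) (B : F →L[ℝ] G →L[ℝ] H) {ψ : E → G}
    (hφ : ContDiffOn ℝ ∞ φ U) (hψ : ContDiffOn ℝ ∞ ψ U)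
    (h₁ : WordBound e U h n w₁ φ) (h₂ : WordBound e U h n w₂ ψ) :
    WordBound e U h n (w₁ * w₂) (fun p => B (φ p) (ψ p)) := by
  have key : ∀ (w₁ w₂ : E → ℝ) (φ : E → F) (ψ : E → G), (∃ C, ∀ p ∈ U, ‖φ p‖ ≤ C * w₁ p) →
      (∃ C, ∀ p ∈ U, ‖ψ p‖ ≤ C * w₂ p) →
      ∃ C, ∀ p ∈ U, ‖B (φ p) (ψ p)‖ ≤ C * (w₁ * w₂) p := by
    rintro w₁ w₂ φ ψ ⟨C, hC⟩ ⟨D, hD⟩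
    refine ⟨‖B‖ * C * D, fun p hp => (B.le_opNorm₂ _ _).trans ?_⟩
    calc ‖B‖ * ‖φ p‖ * ‖ψ p‖ ≤ ‖B‖ * (C * w₁ p) * (D * w₂ p) := by
          have := (norm_nonneg _).trans (hC p hp)
          gcongr
          · exact hC p hp
          · exact hD p hp
      _ = _ := by simp only [Pi.mul_apply]; ring
  induction n generalizing w₁ w₂ φ ψ with
  | zero => exact key _ _ _ _ h₁ h₂
  | succ n ih =>
    refine ⟨key _ _ _ _ h₁.1 h₂.1, fun i => ?_⟩
    -- Leibniz rule: in each of the two terms the undifferentiated factor is needed only for words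
    -- of length n, hence `of_succ`.
    have e1 := ih (hφ.dirDeriv hU (e i)) hψ (h₁.2 i) h₂.of_succ
    have e2 := ih hφ (hψ.dirDeriv hU (e i)) h₁.of_succ (h₂.2 i)
    have w1 : w₁ * h i * w₂ = w₁ * w₂ * h i := by ring
    have w2 : w₁ * (w₂ * h i) = w₁ * w₂ * h i := by ring
    rw [w1] at e1
    rw [w2] at e2
    have c1 : ContDiffOn ℝ ∞ (fun p => B (dirDeriv (e i) φ p) (ψ p)) U :=
      (B.contDiff.comp_contDiffOn (hφ.dirDeriv hU (e i))).clm_apply hψ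
    have c2 : ContDiffOn ℝ ∞ (fun p => B (φ p) (dirDeriv (e i) ψ p)) U :=
      (B.contDiff.comp_contDiffOn hφ).clm_apply (hψ.dirDeriv hU (e i))
    refine (add hU c2 c1 e2 e1).congr hU fun p hp => ?_
    have := B.hasFDerivAt_of_bilinear (hφ.diffAt hU hp).hasFDerivAt (hψ.diffAt hU hp).hasFDerivAt
    simp only [dirDeriv]
    rw [this.fderiv]
    simp

theorem clm (hU : IsOpen U) (L : F →L[ℝ] G) (hφ : ContDiffOn ℝ ∞ φ U)
    (h₁ : WordBound e U h n w φ) : WordBound e U h n w (fun p => L (φ p)) := by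
  have key : ∀ (w : E → ℝ) (φ : E → F), (∃ C, ∀ p ∈ U, ‖φ p‖ ≤ C * w p) →
      ∃ C, ∀ p ∈ U, ‖L (φ p)‖ ≤ C * w p := by
    rintro w φ ⟨C, hC⟩
    refine ⟨‖L‖ * C, fun p hp => (L.le_opNorm _).trans ?_⟩
    rw [mul_assoc]
    exact mul_le_mul_of_nonneg_left (hC p hp) (norm_nonneg _)
  induction n generalizing w φ with
  | zero => exact key _ _ h₁
  | succ n ih =>
    refine ⟨key _ _ h₁.1, fun i => (ih (hφ.dirDeriv hU _) (h₁.2 i)).congr hU fun p hp => ?_⟩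
    simp only [dirDeriv]
    rw [HasFDerivAt.fderiv (f := fun p => L (φ p))
      (L.hasFDerivAt.comp p (hφ.diffAt hU hp).hasFDerivAt)]
    rfl

end WordBound

namespace WeightedSmooth

theorem bound (hφ : WeightedSmooth e U h w φ) : ∃ C, ∀ p ∈ U, ‖φ p‖ ≤ C * w p :=
  (hφ.words 0).bound

theorem congr (hU : IsOpen U) (hφ : WeightedSmooth e U h w φ) (hf : Set.EqOn φ ψ U) :
    WeightedSmooth e U h w ψ :=
  ⟨hφ.smooth.congr hf.symm, fun n => (hφ.words n).congr hU hf⟩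

theorem mono (hφ : WeightedSmooth e U h w₁ φ) (hh : ∀ i, ∀ p ∈ U, 0 ≤ h i p)
    (hh' : ∀ i, ∀ p ∈ U, h i p ≤ h' i p)
    (hw : ∀ p ∈ U, 0 ≤ w₁ p) (hVU : V ⊆ U) (hw₂ : ∀ p ∈ V, 0 ≤ w₂ p)
    (hww : ∃ C, ∀ p ∈ V, w₁ p ≤ C * w₂ p) : WeightedSmooth e V h' w₂ φ :=
  ⟨hφ.smooth.mono hVU, fun n => (hφ.words n).mono hh hh' hw hVU hw₂ hww⟩

theorem deriv (hU : IsOpen U) (hφ : WeightedSmooth e U h w φ) (i : ι) :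
    WeightedSmooth e U h (w * h i) (dirDeriv (e i) φ) :=
  ⟨hφ.smooth.dirDeriv hU _, fun n => (hφ.words (n + 1)).2 i⟩

theorem of_deriv (hφ : ContDiffOn ℝ ∞ φ U) (hb : ∃ C, ∀ p ∈ U, ‖φ p‖ ≤ C * w p)
    (hd : ∀ i, WeightedSmooth e U h (w * h i) (dirDeriv (e i) φ)) : WeightedSmooth e U h w φ :=
  ⟨hφ, fun n => by
    cases n with
    | zero => exact hb
    | succ n => exact ⟨hb, fun i => (hd i).words n⟩⟩

theorem add (hU : IsOpen U) (hφ : WeightedSmooth e U h w φ) (hψ : WeightedSmooth e U h w ψ) :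
    WeightedSmooth e U h w (fun p => φ p + ψ p) :=
  ⟨hφ.smooth.add hψ.smooth, fun n => (hφ.words n).add hU hφ.smooth hψ.smooth (hψ.words n)⟩

theorem bilin (hU : IsOpen U) (B : F →L[ℝ] G →L[ℝ] H) {ψ : E → G}
    (hφ : WeightedSmooth e U h w₁ φ) (hψ : WeightedSmooth e U h w₂ ψ) :
    WeightedSmooth e U h (w₁ * w₂) (fun p => B (φ p) (ψ p)) :=
  ⟨(B.contDiff.comp_contDiffOn hφ.smooth).clm_apply hψ.smooth,
    fun n => (hφ.words n).bilin hU B hφ.smooth hψ.smooth (hψ.words n)⟩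

theorem clm (hU : IsOpen U) (L : F →L[ℝ] G) (hφ : WeightedSmooth e U h w φ) :
    WeightedSmooth e U h w (fun p => L (φ p)) :=
  ⟨L.contDiff.comp_contDiffOn hφ.smooth, fun n => (hφ.words n).clm hU L hφ.smooth⟩

theorem neg (hU : IsOpen U) (hφ : WeightedSmooth e U h w φ) :
    WeightedSmooth e U h w (fun p => -φ p) := hφ.clm hU (-ContinuousLinearMap.id ℝ F)

theorem sub (hU : IsOpen U) (hφ : WeightedSmooth e U h w φ) (hψ : WeightedSmooth e U h w ψ) :
    WeightedSmooth e U h w (fun p => φ p - ψ p) := by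
  simpa only [sub_eq_add_neg] using hφ.add hU (hψ.neg hU)

theorem const_smul (hU : IsOpen U) [NormedSpace ℂ F] (c : ℂ) (hφ : WeightedSmooth e U h w φ) :
    WeightedSmooth e U h w (fun p => c • φ p) := 
  hφ.clm hU (ContinuousLinearMap.restrictScalars ℝ (c • ContinuousLinearMap.id ℂ F))

theorem mul {R : Type*} [NormedRing R] [NormedAlgebra ℝ R] (hU : IsOpen U) {φ ψ : E → R}
    (hφ : WeightedSmooth e U h w₁ φ) (hψ : WeightedSmooth e U h w₂ ψ) :
    WeightedSmooth e U h (w₁ * w₂) (fun p => φ p * ψ p) :=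
  hφ.bilin hU (ContinuousLinearMap.mul ℝ R) hψ

theorem smul [NormedSpace ℂ F] (hU : IsOpen U) {c : E → ℂ}
    (hc : WeightedSmooth e U h w₁ c) (hφ : WeightedSmooth e U h w₂ φ) :
    WeightedSmooth e U h (w₁ * w₂) (fun p => c p • φ p) :=
  hc.bilin hU (ContinuousLinearMap.lsmul ℝ ℂ) hφ

theorem zero_fun (hw : ∀ p ∈ U, 0 ≤ w p) (hh : ∀ i, ∀ p ∈ U, 0 ≤ h i p) :
    WeightedSmooth e U h w (fun _ : E => (0 : F)) := by
  refine ⟨contDiffOn_const, fun n => ?_⟩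
  induction n generalizing w with
  | zero => exact ⟨0, fun p hp => by simp⟩
  | succ n ih =>
    refine ⟨⟨0, fun p hp => by simp⟩, fun i => ?_⟩
    have : dirDeriv (e i) (fun _ : E => (0 : F)) = fun _ => 0 := by ext; simp [dirDeriv]
    rw [this]
    exact ih fun p hp => mul_nonneg (hw p hp) (hh i p hp)

theorem const (hw : ∀ p ∈ U, 0 ≤ w p) (hh : ∀ i, ∀ p ∈ U, 0 ≤ h i p)
    (hw1 : ∃ C, ∀ p ∈ U, 1 ≤ C * w p) (c : F) :
    WeightedSmooth e U h w (fun _ : E => c) := by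
  refine of_deriv contDiffOn_const ?_ fun i => ?_
  · obtain ⟨C, hC⟩ := hw1
    refine ⟨‖c‖ * C, fun p hp => ?_⟩
    rw [mul_assoc]
    exact le_mul_of_one_le_right (norm_nonneg _) (hC p hp)
  · have : dirDeriv (e i) (fun _ : E => c) = fun _ => 0 := by ext; simp [dirDeriv]
    rw [this]
    exact zero_fun (fun p hp => mul_nonneg (hw p hp) (hh i p hp)) hh

/-- From ∂(φ⁻¹) = -φ⁻¹ (∂φ) φ⁻¹ the derivative carries the weight w₂ (w₁ h) w₂, which w₁ w₂ ≤ C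
reduces to w₂ h. Bounds on the inverse for words of length n thus give those of length n + 1. -/
theorem ringInverse {R : Type*} [NormedRing R] [NormedAlgebra ℝ R] [CompleteSpace R]
    (hU : IsOpen U) {φ : E → R} (hh : ∀ i, ∀ p ∈ U, 0 ≤ h i p) (hw₁ : ∀ p ∈ U, 0 ≤ w₁ p)
    (hw₂ : ∀ p ∈ U, 0 ≤ w₂ p)
    (hφ : WeightedSmooth e U h w₁ φ) (hu : ∀ p ∈ U, IsUnit (φ p))
    (hb : ∃ C, ∀ p ∈ U, ‖Ring.inverse (φ p)‖ ≤ C * w₂ p)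
    (hww : ∃ C, ∀ p ∈ U, w₁ p * w₂ p ≤ C) :
    WeightedSmooth e U h w₂ (fun p => Ring.inverse (φ p)) := by
  have hs : ContDiffOn ℝ ∞ (fun p => Ring.inverse (φ p)) U := by
    intro p hp
    obtain ⟨x, hx⟩ := hu p hp
    have h1 : ContDiffAt ℝ ∞ Ring.inverse (φ p) := hx ▸ contDiffAt_ringInverse ℝ x
    exact h1.comp_contDiffWithinAt p (hφ.smooth p hp)
  have hd : ∀ i, Set.EqOn (fun p => -(Ring.inverse (φ p) * dirDeriv (e i) φ p * Ring.inverse (φ p)))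
      (dirDeriv (e i) fun p => Ring.inverse (φ p)) U := by
    intro i p hp
    obtain ⟨x, hx⟩ := hu p hp
    have h1 : HasFDerivAt Ring.inverse _ (φ p) := hx ▸ hasFDerivAt_ringInverse (𝕜 := ℝ) x
    simp only [dirDeriv]
    rw [HasFDerivAt.fderiv (f := fun p => Ring.inverse (φ p))
      (h1.comp p (hφ.smooth.diffAt hU hp).hasFDerivAt)]
    simp [← hx]
  refine ⟨hs, fun n => ?_⟩
  induction n with
  | zero => exact hb
  | succ n ih =>
    refine ⟨hb, fun i => ?_⟩
    have h1 := (hφ.deriv hU i)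
    have h2 := ih.bilin hU (ContinuousLinearMap.mul ℝ R) hs h1.smooth (h1.words n)
    have c2 : ContDiffOn ℝ ∞ (fun p => Ring.inverse (φ p) * dirDeriv (e i) φ p) U :=
      hs.mul h1.smooth
    have h3 := h2.bilin hU (ContinuousLinearMap.mul ℝ R) c2 hs ih
    have h4 := (h3.clm hU (-ContinuousLinearMap.id ℝ R) (c2.mul hs)).congr hU (hd i)
    refine h4.mono hh (fun _ _ _ => le_rfl) ?_ subset_rfl ?_ ?_
    · intro p hp
      have := hw₁ p hp; have := hw₂ p hp; have := hh i p hp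
      simp only [Pi.mul_apply]; positivity
    · exact fun p hp => mul_nonneg (hw₂ p hp) (hh i p hp)
    · obtain ⟨C, hC⟩ := hww
      refine ⟨C, fun p hp => ?_⟩
      have := hw₁ p hp; have h5 := hw₂ p hp; have h6 := hh i p hp
      calc _ = (w₁ p * w₂ p) * (w₂ p * h i p) := by simp only [Pi.mul_apply]; ring
        _ ≤ C * (w₂ p * h i p) := mul_le_mul_of_nonneg_right (hC p hp) (mul_nonneg h5 h6)

end WeightedSmooth
end WordBounds

/-! ### Smooth families of bounded functions and integrals with parameters. -/

section UniformSmoothness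

open BoundedContinuousFunction Module

variable {X F : Type*} [TopologicalSpace X] [NormedAddCommGroup F]

open Classical in
/-- A bounded continuous function as an element of `X →ᵇ F`; junk value `0` otherwise. -/
noncomputable def toBCF (f : X → F) : X →ᵇ F :=
  if h : Continuous f ∧ ∃ C, ∀ x, ‖f x‖ ≤ C then
    BoundedContinuousFunction.ofNormedAddCommGroup f h.1 h.2.choose h.2.choose_spec
  else 0

theorem toBCF_apply {f : X → F} (hc : Continuous f) (hb : ∃ C, ∀ x, ‖f x‖ ≤ C) (x : X) :
    toBCF f x = f x := by
  unfold toBCF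
  rw [dif_pos ⟨hc, hb⟩]
  rfl

variable {ι E : Type*} [Fintype ι] [NormedAddCommGroup E] [NormedSpace ℝ E]
  [NormedSpace ℝ F]

/-- A family of functions `E → X → F`, closed under directional derivatives along a basis. -/
structure IsDerivFamily (b : Basis ι ℝ E) (U : Set E) (S : Set (E → X → F)) : Prop where
  cont : ∀ Φ ∈ S, ∀ p ∈ U, Continuous (Φ p)
  bdd : ∀ Φ ∈ S, ∀ p₀ ∈ U, ∃ C, ∀ᶠ p in nhds p₀, ∀ x, ‖Φ p x‖ ≤ C
  diff : ∀ Φ ∈ S, ∀ x, ∀ p ∈ U, DifferentiableAt ℝ (fun p => Φ p x) p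
  closed : ∀ Φ ∈ S, ∀ i, (fun p x => dirDeriv (b i) (fun p => Φ p x) p) ∈ S

namespace IsDerivFamily

variable {b : Basis ι ℝ E} {U : Set E} {S : Set (E → X → F)}

omit [Fintype ι] in
theorem apply (hS : IsDerivFamily b U S) {Φ : E → X → F} (hΦ : Φ ∈ S) {p : E}
    (hp : p ∈ U) (x : X) : toBCF (Φ p) x = Φ p x := by
  obtain ⟨C, hC⟩ := hS.bdd Φ hΦ p hp
  exact toBCF_apply (hS.cont Φ hΦ p hp) ⟨C, hC.self_of_nhds⟩ x

/-- Second derivatives bounded uniformly in x make the first derivatives Lipschitz in p uniformly in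
x, and a second use of the mean value inequality gives a quadratic Taylor remainder uniformly in x.
This is differentiability for the supremum norm, with no compactness of X. -/
theorem hasFDerivAt [FiniteDimensional ℝ E] (hU : IsOpen U) (hS : IsDerivFamily b U S)
    {Φ : E → X → F} (hΦ : Φ ∈ S) {p₀ : E} (hp₀ : p₀ ∈ U) :
    HasFDerivAt (fun p => toBCF (Φ p))
      (∑ i, (LinearMap.toContinuousLinearMap (b.coord i)).smulRight
        (toBCF fun x => dirDeriv (b i) (fun p => Φ p x) p₀)) p₀ := by
  classical
  have hd := fun i => hS.closed Φ hΦ i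
  have hdd := fun i j => hS.closed _ (hd i) j
  choose C hC using fun i j => hS.bdd _ (hdd i j) p₀ hp₀
  -- The constant K converts a bound on the derivatives along the basis into a bound on the operator
  -- norm.
  obtain ⟨K, hK0, hK⟩ := b.exists_opNorm_le (F := F)
  obtain ⟨r, hr0, hr⟩ : ∃ r > 0, ∀ p ∈ Metric.ball p₀ r, p ∈ U ∧ ∀ i j x,
      ‖dirDeriv (b j) (fun p => dirDeriv (b i) (fun p => Φ p x) p) p‖ ≤ C i j := by
    have : ∀ᶠ p in nhds p₀, p ∈ U ∧ ∀ i j x,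
        ‖dirDeriv (b j) (fun p => dirDeriv (b i) (fun p => Φ p x) p) p‖ ≤ C i j :=
      Filter.Eventually.and (hU.mem_nhds hp₀) (Filter.eventually_all.2 fun i => Filter.eventually_all.2 fun j => hC i j)
    exact Metric.eventually_nhds_iff_ball.1 this
  set D : ℝ := ∑ i, ∑ j, |C i j| with hD
  have hD0 : 0 ≤ D := Finset.sum_nonneg fun i _ => Finset.sum_nonneg fun j _ => abs_nonneg _
  have hCD : ∀ i j, C i j ≤ D := fun i j =>
    (le_abs_self _).trans ((Finset.single_le_sum (f := fun j => |C i j|)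
      (fun j _ => abs_nonneg _) (Finset.mem_univ j)).trans
      (Finset.single_le_sum (f := fun i => ∑ j, |C i j|)
        (fun i _ => Finset.sum_nonneg fun j _ => abs_nonneg _) (Finset.mem_univ i)))
  have h1 : ∀ i x, ∀ p ∈ Metric.ball p₀ r,
      ‖dirDeriv (b i) (fun p => Φ p x) p - dirDeriv (b i) (fun p => Φ p x) p₀‖
        ≤ K * D * ‖p - p₀‖ := by
    intro i x p hp
    refine (convex_ball p₀ r).norm_image_sub_le_of_norm_fderiv_le (𝕜 := ℝ)
      (fun q hq => hS.diff _ (hd i) x q (hr q hq).1) (fun q hq => hK hD0 fun j => ?_)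
      (Metric.mem_ball_self hr0) hp
    exact ((hr q hq).2 i j x).trans (hCD i j)
  have h2 : ∀ x, ∀ p ∈ Metric.ball p₀ r,
      ‖Φ p x - Φ p₀ x - fderiv ℝ (fun p => Φ p x) p₀ (p - p₀)‖
        ≤ (K * (K * D * ‖p - p₀‖)) * ‖p - p₀‖ := by
    intro x p hp
    have hsub : Metric.closedBall p₀ ‖p - p₀‖ ⊆ Metric.ball p₀ r :=
      Metric.closedBall_subset_ball (by simpa [dist_eq_norm] using hp)
    refine (convex_closedBall p₀ ‖p - p₀‖).norm_image_sub_le_of_norm_fderiv_le' (𝕜 := ℝ)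
      (fun q hq => hS.diff _ hΦ x q (hr q (hsub hq)).1) (fun q hq => ?_)
      (Metric.mem_closedBall_self (norm_nonneg _)) (by simp [dist_eq_norm])
    refine hK (by positivity) fun i => ?_
    refine (h1 i x q (hsub hq)).trans ?_
    have : ‖q - p₀‖ ≤ ‖p - p₀‖ := by simpa [dist_eq_norm] using hq
    gcongr
  refine HasFDerivAt.of_isLittleO (Asymptotics.isLittleO_iff.2 fun c hc => ?_)
  -- The second radius makes K * K * D * ‖p - p₀‖ at most c; the summand 1 keeps the denominator
  -- positive when D = 0.
  have hpos : 0 < r ⊓ (c / (K * K * D + 1)) := lt_min hr0 (by positivity)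
  filter_upwards [Metric.ball_mem_nhds p₀ hpos] with p hp
  have hp1 : p ∈ Metric.ball p₀ r := Metric.ball_subset_ball inf_le_left hp
  have hp2 : ‖p - p₀‖ ≤ c / (K * K * D + 1) := by
    have : p ∈ Metric.ball p₀ (c / (K * K * D + 1)) := Metric.ball_subset_ball inf_le_right hp
    rw [Metric.mem_ball, dist_eq_norm] at this
    exact this.le
  rw [BoundedContinuousFunction.norm_le (by positivity)]
  intro x
  have e1 : (toBCF (Φ p) - toBCF (Φ p₀) - (∑ i, (LinearMap.toContinuousLinearMap (b.coord i)).smulRight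
        (toBCF fun x => dirDeriv (b i) (fun p => Φ p x) p₀)) (p - p₀)) x =
      Φ p x - Φ p₀ x - fderiv ℝ (fun p => Φ p x) p₀ (p - p₀) := by
    rw [BoundedContinuousFunction.sub_apply, BoundedContinuousFunction.sub_apply,
      hS.apply hΦ (hr p hp1).1, hS.apply hΦ hp₀]
    congr 1
    conv_rhs => rw [← b.sum_repr (p - p₀), map_sum]
    rw [_root_.sum_apply, BoundedContinuousFunction.sum_apply]
    refine Finset.sum_congr rfl fun i _ => ?_
    rw [ContinuousLinearMap.smulRight_apply, BoundedContinuousFunction.smul_apply,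
      hS.apply (hd i) hp₀]
    simp [dirDeriv]
  rw [e1]
  refine (h2 x p hp1).trans ?_
  have : K * K * D * ‖p - p₀‖ ≤ c := by
    calc K * K * D * ‖p - p₀‖ ≤ (K * K * D + 1) * ‖p - p₀‖ := by gcongr; linarith
      _ ≤ (K * K * D + 1) * (c / (K * K * D + 1)) := by gcongr
      _ = c := by field_simp
  calc K * (K * D * ‖p - p₀‖) * ‖p - p₀‖ = (K * K * D * ‖p - p₀‖) * ‖p - p₀‖ := by ring
    _ ≤ c * ‖p - p₀‖ := by gcongr

theorem dirDeriv_toBCF [FiniteDimensional ℝ E] (hU : IsOpen U) (hS : IsDerivFamily b U S)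
    {Φ : E → X → F} (hΦ : Φ ∈ S) {p : E} (hp : p ∈ U) (i : ι) :
    dirDeriv (b i) (fun p => toBCF (Φ p)) p =
      toBCF fun x => dirDeriv (b i) (fun p => Φ p x) p := by
  classical
  rw [dirDeriv, (hS.hasFDerivAt hU hΦ hp).fderiv, _root_.sum_apply]
  rw [Finset.sum_eq_single i]
  · simp
  · intro j _ hj
    simp [Finsupp.single_eq_of_ne hj]
  · simp

/-- The derivative is a finite sum of fixed coordinate functionals times members of the same family,
so the order of differentiability can be raised by induction. -/
theorem contDiffOn [FiniteDimensional ℝ E] (hU : IsOpen U) (hS : IsDerivFamily b U S)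
    {Φ : E → X → F} (hΦ : Φ ∈ S) : ContDiffOn ℝ ∞ (fun p => toBCF (Φ p)) U := by
  rw [contDiffOn_infty]
  intro n
  induction n generalizing Φ with
  | zero =>
    exact contDiffOn_zero.2 fun p hp =>
      (hS.hasFDerivAt hU hΦ hp).continuousAt.continuousWithinAt
  | succ n ih =>
    rw [Nat.cast_succ, contDiffOn_succ_iff_fderiv_of_isOpen hU]
    refine ⟨fun p hp => (hS.hasFDerivAt hU hΦ hp).differentiableAt.differentiableWithinAt,
      by simp, ?_⟩
    have : ContDiffOn ℝ n (fun p => ∑ i, (LinearMap.toContinuousLinearMap (b.coord i)).smulRight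
        (toBCF fun x => dirDeriv (b i) (fun p => Φ p x) p)) U :=
      ContDiffOn.sum fun i _ => contDiffOn_const.smulRight (ih (hS.closed Φ hΦ i))
    exact this.congr fun p hp => (hS.hasFDerivAt hU hΦ hp).fderiv

end IsDerivFamily

section Weighted

variable {Y : Type*} [NormedAddCommGroup Y] [NormedSpace ℝ Y]

-- Growth under differentiation is traded for a larger weight: a word of length at most n costs at
-- most H ^ n. This is how derivatives of an oscillating phase are absorbed by the decay of an
-- amplitude.
omit [Fintype ι] in
theorem WordBound.to_one {G : Type*} [NormedAddCommGroup G] [NormedSpace ℝ G]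
    {e : ι → E} {U : Set E} {h : ι → E → ℝ} {H w : E → ℝ} {φ : E → G} {n : ℕ}
    (hh : ∀ i, ∀ p ∈ U, 0 ≤ h i p) (hH : ∀ i, ∀ p ∈ U, h i p ≤ H p) (hH1 : ∀ p ∈ U, 1 ≤ H p)
    (hw : ∀ p ∈ U, 0 ≤ w p) (hφ : WordBound e U h n w φ) :
    WordBound e U (fun _ _ => 1) n (w * H ^ n) φ := by
  have key : ∀ {w : E → ℝ} {φ : E → G} (n : ℕ), (∀ p ∈ U, 0 ≤ w p) →
      (∃ C, ∀ p ∈ U, ‖φ p‖ ≤ C * w p) → ∃ C, ∀ p ∈ U, ‖φ p‖ ≤ C * (w * H ^ n) p := by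
    rintro w φ n hw ⟨C, hC⟩
    refine ⟨|C|, fun p hp => (hC p hp).trans ?_⟩
    have h1 := one_le_pow₀ (hH1 p hp) (n := n)
    calc C * w p ≤ |C| * w p := mul_le_mul_of_nonneg_right (le_abs_self _) (hw p hp)
      _ ≤ |C| * (w p * H p ^ n) :=
        mul_le_mul_of_nonneg_left (le_mul_of_one_le_right (hw p hp) h1) (abs_nonneg _)
  induction n generalizing w φ with
  | zero => exact key 0 hw hφ
  | succ n ih =>
    refine ⟨key (n + 1) hw hφ.1, fun i => ?_⟩
    have h1 := ih (fun p hp => mul_nonneg (hw p hp) (hh i p hp)) (hφ.2 i)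
    refine h1.mono (fun _ _ _ => zero_le_one) (fun _ _ _ => le_rfl) ?_ subset_rfl ?_ ⟨1, ?_⟩
    · intro p hp
      have := zero_le_one.trans (hH1 p hp)
      exact mul_nonneg (mul_nonneg (hw p hp) (hh i p hp)) (pow_nonneg this _)
    · intro p hp
      have := zero_le_one.trans (hH1 p hp)
      exact mul_nonneg (mul_nonneg (hw p hp) (pow_nonneg this _)) zero_le_one
    · intro p hp
      have h3 := zero_le_one.trans (hH1 p hp)
      simp only [Pi.mul_apply, Pi.pow_apply, one_mul, mul_one]
      calc w p * h i p * H p ^ n ≤ w p * H p * H p ^ n :=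
            mul_le_mul_of_nonneg_right (mul_le_mul_of_nonneg_left (hH i p hp) (hw p hp))
              (pow_nonneg h3 _)
        _ = w p * H p ^ (n + 1) := by ring

/-- Functions on `U × Y`, smooth, whose derivatives in the first variable are `O(ρ⁻¹)` locally
uniformly in the first variable. -/
structure LocallyDominated (b : Basis ι ℝ E) (U : Set E) (ρ : Y → ℝ) (Ψ : E × Y → F) : Prop where
  smooth : ContDiffOn ℝ ∞ Ψ (U ×ˢ Set.univ)
  words : ∀ n, ∀ p₀ ∈ U, ∃ V, IsOpen V ∧ p₀ ∈ V ∧ V ⊆ U ∧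
    WordBound (fun i => ((b i, 0) : E × Y)) (V ×ˢ Set.univ) (fun _ _ => 1) n
      (fun q => (ρ q.2)⁻¹) Ψ

variable {b : Basis ι ℝ E} {U : Set E} {ρ : Y → ℝ} {Ψ : E × Y → F}

omit [Fintype ι] in
theorem LocallyDominated.deriv (hU : IsOpen U) (hΨ : LocallyDominated b U ρ Ψ) (i : ι) :
    LocallyDominated b U ρ (dirDeriv ((b i, 0) : E × Y) Ψ) := by
  refine ⟨hΨ.smooth.dirDeriv (hU.prod isOpen_univ) _, fun n p₀ hp₀ => ?_⟩
  obtain ⟨V, h1, h2, h3, h4⟩ := hΨ.words (n + 1) p₀ hp₀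
  refine ⟨V, h1, h2, h3, ?_⟩
  have := h4.2 i
  rwa [show ((fun q : E × Y => (ρ q.2)⁻¹) * fun _ => (1 : ℝ)) = fun q => (ρ q.2)⁻¹ by
    ext; simp] at this

omit [Fintype ι] in
theorem LocallyDominated.hasFDerivAt_slice (hU : IsOpen U) (hΨ : LocallyDominated b U ρ Ψ)
    {p : E} (hp : p ∈ U) (y : Y) :
    HasFDerivAt (fun p => Ψ (p, y)) ((fderiv ℝ Ψ (p, y)).comp (.inl ℝ E Y)) p := by
  have h1 := (hΨ.smooth.diffAt (hU.prod isOpen_univ) (p := (p, y)) ⟨hp, trivial⟩).hasFDerivAt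
  exact h1.comp p (hasFDerivAt_prodMk_left p y)

-- Multiplication by ρ makes the functions bounded in y, and ρ does not involve p, so it commutes
-- with the derivatives. Members are required to agree with ρ • Ψ over U only, since nothing is
-- known about derivatives at other points.
omit [Fintype ι] in
theorem LocallyDominated.isDerivFamily (hU : IsOpen U) (hρ : Continuous ρ) (hρ0 : ∀ y, 0 < ρ y) :
    IsDerivFamily b U {Φ : E → Y → F | ∃ Ψ, LocallyDominated b U ρ Ψ ∧
      ∀ p ∈ U, ∀ y, Φ p y = ρ y • Ψ (p, y)} := by
  constructor
  · rintro Φ ⟨Ψ, hΨ, hΦ⟩ p hp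
    rw [funext (hΦ p hp)]
    refine hρ.smul (continuousOn_univ.1 ?_)
    exact hΨ.smooth.continuousOn.comp (by fun_prop) fun y _ => ⟨hp, trivial⟩
  · rintro Φ ⟨Ψ, hΨ, hΦ⟩ p₀ hp₀
    obtain ⟨V, h1, h2, h3, C, hC⟩ := hΨ.words 0 p₀ hp₀
    refine ⟨C, ?_⟩
    filter_upwards [h1.mem_nhds h2] with p hp y
    rw [hΦ p (h3 hp) y, norm_smul, Real.norm_of_nonneg (hρ0 y).le]
    calc ρ y * ‖Ψ (p, y)‖ ≤ ρ y * (C * (ρ y)⁻¹) :=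
          mul_le_mul_of_nonneg_left (hC (p, y) ⟨hp, trivial⟩) (hρ0 y).le
      _ = C := by field_simp [(hρ0 y).ne']
  · rintro Φ ⟨Ψ, hΨ, hΦ⟩ y p hp
    have h1 := ((hΨ.hasFDerivAt_slice hU hp y).const_smul (ρ y)).differentiableAt
    exact h1.congr_of_eventuallyEq
      (Filter.eventuallyEq_of_mem (hU.mem_nhds hp) fun q hq => hΦ q hq y)
  · rintro Φ ⟨Ψ, hΨ, hΦ⟩ i
    refine ⟨_, hΨ.deriv hU i, fun p hp y => ?_⟩
    have h1 : Set.EqOn (fun p => Φ p y) (fun p => ρ y • Ψ (p, y)) U := fun q hq => hΦ q hq y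
    change dirDeriv (b i) (fun p => Φ p y) p = _
    rw [h1.dirDeriv hU (b i) hp]
    simp only [dirDeriv]
    rw [HasFDerivAt.fderiv (f := fun p => ρ y • Ψ (p, y))
      ((hΨ.hasFDerivAt_slice hU hp y).const_smul (ρ y))]
    simp

theorem LocallyDominated.contDiffOn [FiniteDimensional ℝ E] (hU : IsOpen U) (hρ : Continuous ρ)
    (hρ0 : ∀ y, 0 < ρ y) (hΨ : LocallyDominated b U ρ Ψ) :
    ContDiffOn ℝ ∞ (fun p => toBCF fun y => ρ y • Ψ (p, y)) U :=
  (isDerivFamily hU hρ hρ0).contDiffOn hU ⟨Ψ, hΨ, fun _ _ _ => rfl⟩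

omit [Fintype ι] in
theorem LocallyDominated.toBCF_apply (hU : IsOpen U) (hρ : Continuous ρ)
    (hρ0 : ∀ y, 0 < ρ y) (hΨ : LocallyDominated b U ρ Ψ) {p : E} (hp : p ∈ U) (y : Y) :
    toBCF (fun y => ρ y • Ψ (p, y)) y = ρ y • Ψ (p, y) :=
  (isDerivFamily hU hρ hρ0).apply (Φ := fun p y => ρ y • Ψ (p, y)) ⟨Ψ, hΨ, fun _ _ _ => rfl⟩ hp y

theorem LocallyDominated.dirDeriv_toBCF [FiniteDimensional ℝ E] (hU : IsOpen U)
    (hρ : Continuous ρ) (hρ0 : ∀ y, 0 < ρ y) (hΨ : LocallyDominated b U ρ Ψ) {p : E} (hp : p ∈ U)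
    (i : ι) : dirDeriv (b i) (fun p => toBCF fun y => ρ y • Ψ (p, y)) p =
      toBCF fun y => ρ y • dirDeriv ((b i, 0) : E × Y) Ψ (p, y) := by
  rw [(isDerivFamily hU hρ hρ0).dirDeriv_toBCF hU ⟨Ψ, hΨ, fun _ _ _ => rfl⟩ hp]
  congr 1
  ext y
  simp only [dirDeriv]
  rw [HasFDerivAt.fderiv (f := fun p => ρ y • Ψ (p, y))
    ((hΨ.hasFDerivAt_slice hU hp y).const_smul (ρ y))]
  simp

open MeasureTheory

variable [MeasurableSpace Y] [BorelSpace Y] [SecondCountableTopology Y]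
  {μ : Measure Y} [CompleteSpace F]

/-- Integration against an integrable weight, on bounded continuous functions. -/
noncomputable def weightIntegral (μ : Measure Y) (θ : Y → ℝ) (hθ : Integrable θ μ) :
    (Y →ᵇ F) →L[ℝ] F :=
  LinearMap.mkContinuous
    { toFun := fun g => ∫ y, θ y • g y ∂μ
      map_add' := fun g g' => by
        simp only [BoundedContinuousFunction.add_apply, smul_add]
        exact integral_add (hθ.smul_bdd _ g.continuous.aestronglyMeasurable
            (Filter.Eventually.of_forall g.norm_coe_le_norm))
          (hθ.smul_bdd _ g'.continuous.aestronglyMeasurable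
            (Filter.Eventually.of_forall g'.norm_coe_le_norm))
      map_smul' := fun c g => by
        simp only [BoundedContinuousFunction.smul_apply, smul_comm _ c, RingHom.id_apply]
        exact integral_smul c _ }
    (∫ y, ‖θ y‖ ∂μ) fun g => by
      rw [← integral_mul_const]
      refine norm_integral_le_of_norm_le (hθ.norm.mul_const _) (Filter.Eventually.of_forall fun y => ?_)
      rw [norm_smul]
      exact mul_le_mul_of_nonneg_left (g.norm_coe_le_norm y) (norm_nonneg _)

omit [Fintype ι] [CompleteSpace F] in
theorem LocallyDominated.integral_eq (hU : IsOpen U) (hρ : Continuous ρ)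
    (hρ0 : ∀ y, 0 < ρ y) (hi : Integrable (fun y => (ρ y)⁻¹) μ)
    (hΨ : LocallyDominated b U ρ Ψ) {p : E} (hp : p ∈ U) :
    ∫ y, Ψ (p, y) ∂μ = weightIntegral μ _ hi (toBCF fun y => ρ y • Ψ (p, y)) := by
  change _ = ∫ y, (ρ y)⁻¹ • _ ∂μ
  congr 1
  ext y
  rw [hΨ.toBCF_apply hU hρ hρ0 hp, smul_smul, inv_mul_cancel₀ (hρ0 y).ne', one_smul]

-- The integral is a fixed continuous functional, integration against ρ⁻¹, applied to the smooth
-- family y ↦ ρ y • Ψ (p, y) of bounded functions.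
omit [CompleteSpace F] in
theorem LocallyDominated.contDiffOn_integral [FiniteDimensional ℝ E] (hU : IsOpen U)
    (hρ : Continuous ρ) (hρ0 : ∀ y, 0 < ρ y) (hi : Integrable (fun y => (ρ y)⁻¹) μ)
    (hΨ : LocallyDominated b U ρ Ψ) : ContDiffOn ℝ ∞ (fun p => ∫ y, Ψ (p, y) ∂μ) U :=
  ((contDiffOn_const (c := weightIntegral μ _ hi)).clm_apply (hΨ.contDiffOn hU hρ hρ0)).congr
    fun _ hp => hΨ.integral_eq hU hρ hρ0 hi hp

omit [CompleteSpace F] in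
theorem LocallyDominated.dirDeriv_integral [FiniteDimensional ℝ E] (hU : IsOpen U)
    (hρ : Continuous ρ) (hρ0 : ∀ y, 0 < ρ y) (hi : Integrable (fun y => (ρ y)⁻¹) μ)
    (hΨ : LocallyDominated b U ρ Ψ) {p : E} (hp : p ∈ U) (i : ι) :
    dirDeriv (b i) (fun p => ∫ y, Ψ (p, y) ∂μ) p =
      ∫ y, dirDeriv ((b i, 0) : E × Y) Ψ (p, y) ∂μ := by
  have h1 : Set.EqOn (fun p => ∫ y, Ψ (p, y) ∂μ)
      (fun p => weightIntegral μ _ hi (toBCF fun y => ρ y • Ψ (p, y))) U :=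
    fun q hq => hΨ.integral_eq hU hρ hρ0 hi hq
  rw [h1.dirDeriv hU _ hp, (hΨ.deriv hU i).integral_eq hU hρ hρ0 hi hp,
    ← hΨ.dirDeriv_toBCF hU hρ hρ0 hp i]
  simp only [dirDeriv]
  rw [HasFDerivAt.fderiv (f := fun p => weightIntegral μ _ hi (toBCF fun y => ρ y • Ψ (p, y)))
    ((weightIntegral μ _ hi).hasFDerivAt.comp p
      ((hΨ.contDiffOn hU hρ hρ0).diffAt hU hp).hasFDerivAt)]
  rfl

end Weighted

end UniformSmoothness

/-! ### Coordinate bases of the product spaces. -/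

section Directions

open Module

/-- The basis of the plane. -/
noncomputable def planeBasis : Basis (Fin 2) ℝ Plane := (EuclideanSpace.basisFun (Fin 2) ℝ).toBasis

@[simp] theorem planeBasis_apply (j : Fin 2) : planeBasis j = basisVec j := by
  simp [planeBasis, basisVec]

/-- The basis of `ℝ² × ℂ × ℝ²`. -/
noncomputable def tripleBasis : Basis (Fin 2 ⊕ (Fin 2 ⊕ Fin 2)) ℝ (Plane × ℂ × Plane) :=
  planeBasis.prod (Complex.basisOneI.prod planeBasis)

/-- The basis of `ℝ² × ℝ²`. -/
noncomputable def pairBasis : Basis (Fin 2 ⊕ Fin 2) ℝ (Plane × Plane) :=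
  planeBasis.prod planeBasis

@[simp] theorem tripleBasis_inl (j : Fin 2) :
    tripleBasis (.inl j) = ((basisVec j, 0, 0) : Plane × ℂ × Plane) := by
  simp [tripleBasis]
  rfl

@[simp] theorem tripleBasis_inr_inl_zero :
    tripleBasis (.inr (.inl 0)) = ((0, 1, 0) : Plane × ℂ × Plane) := by simp [tripleBasis]

@[simp] theorem tripleBasis_inr_inl_one :
    tripleBasis (.inr (.inl 1)) = ((0, Complex.I, 0) : Plane × ℂ × Plane) := by simp [tripleBasis]

@[simp] theorem tripleBasis_inr_inr (j : Fin 2) :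
    tripleBasis (.inr (.inr j)) = ((0, 0, basisVec j) : Plane × ℂ × Plane) := by
  simp [tripleBasis]

@[simp] theorem pairBasis_inl (j : Fin 2) :
    pairBasis (.inl j) = ((basisVec j, 0) : Plane × Plane) := by simp [pairBasis]

@[simp] theorem pairBasis_inr (j : Fin 2) :
    pairBasis (.inr j) = ((0, basisVec j) : Plane × Plane) := by simp [pairBasis]

end Directions

/-! ### The action, its smooth elements and the derivations. -/

namespace PlaneAction

variable {A : Type*} [CStarAlgebra A] (α : PlaneAction A)

theorem norm_act (x : Plane) (a : A) : ‖α.act x a‖ = ‖a‖ :=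
  NonUnitalStarAlgHom.norm_map (α.act x) (α.act x).injective a

theorem act_neg_act (x : Plane) (a : A) : α.act (-x) (α.act x a) = a := by
  rw [← α.act_add, neg_add_cancel, α.act_zero]

theorem act_act_neg (x : Plane) (a : A) : α.act x (α.act (-x) a) = a := by
  rw [← α.act_add, add_neg_cancel, α.act_zero]

/-- `α_x` as a continuous real linear map. -/
noncomputable def actL (x : Plane) : A →L[ℝ] A :=
  LinearMap.mkContinuous
    { toFun := α.act x
      map_add' := map_add _
      map_smul' := fun c a => by
        have := map_smul (α.act x) (c : ℂ) a
        simpa using this } 1 fun a => by simp [α.norm_act]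

@[simp] theorem actL_apply (x : Plane) (a : A) : α.actL x a = α.act x a := rfl

theorem act_real_smul (x : Plane) (c : ℝ) (a : A) : α.act x (c • a) = c • α.act x a :=
  (α.actL x).map_smul c a

/-- Each α_x is isometric, so strong continuity at a fixed element controls nearby elements as well.
-/
theorem continuous_act_uncurry : Continuous fun p : Plane × A => α.act p.1 p.2 := by
  rw [continuous_iff_continuousAt]
  rintro ⟨x, a⟩
  rw [ContinuousAt, tendsto_iff_norm_sub_tendsto_zero]
  have h1 : Filter.Tendsto (fun p : Plane × A => ‖p.2 - a‖ + ‖α.act p.1 a - α.act x a‖)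
      (nhds (x, a)) (nhds 0) := by
    have : Continuous fun p : Plane × A => ‖p.2 - a‖ + ‖α.act p.1 a - α.act x a‖ := by
      have := (α.continuous_act a).comp (continuous_fst (X := Plane) (Y := A))
      exact (by fun_prop : Continuous fun p : Plane × A => ‖p.2 - a‖).add
        (this.sub continuous_const).norm
    simpa using this.tendsto (x, a)
  refine squeeze_zero (fun _ => norm_nonneg _) (fun p => ?_) h1
  calc ‖α.act p.1 p.2 - α.act x a‖
      = ‖α.act p.1 (p.2 - a) + (α.act p.1 a - α.act x a)‖ := by rw [map_sub]; abel_nf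
    _ ≤ _ := (norm_add_le _ _).trans (by rw [α.norm_act])

theorem continuous_act_comp {X : Type*} [TopologicalSpace X] {f : X → Plane} {g : X → A}
    (hf : Continuous f) (hg : Continuous g) : Continuous fun x => α.act (f x) (g x) :=
  α.continuous_act_uncurry.comp (hf.prodMk hg)

theorem act_ringInverse (x : Plane) (a : A) :
    α.act x (Ring.inverse a) = Ring.inverse (α.act x a) := by
  by_cases ha : IsUnit a
  · obtain ⟨u, rfl⟩ := ha
    have h1 : α.act x (u : A) = ((Units.map (α.act x : A →* A) u : Aˣ) : A) := rfl
    rw [h1, Ring.inverse_unit, Ring.inverse_unit]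
    rfl
  · have : ¬ IsUnit (α.act x a) := fun h => ha (by
      have := h.map (α.act (-x))
      rwa [α.act_neg_act] at this)
    rw [Ring.inverse_non_unit _ ha, Ring.inverse_non_unit _ this, map_zero]

/-! ### Smooth elements -/

variable {α}

/-- The group law α_x a = α_y (α_{x-y} a) transports the derivative at the origin to the point y. -/
theorem IsSmooth.hasFDerivAt {a : A} (ha : α.IsSmooth a) (y : Plane) :
    HasFDerivAt (fun x => α.act x a) ((α.actL y).comp (fderiv ℝ (fun x => α.act x a) 0)) y := by
  have h0 : HasFDerivAt (fun x => α.act x a) (fderiv ℝ (fun x => α.act x a) 0) (y - y) := by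
    rw [sub_self]
    exact (ha.differentiable (by simp) 0).hasFDerivAt
  have h1 := (α.actL y).hasFDerivAt.comp y (h0.comp (f := fun x => x - y) y ((hasFDerivAt_id y).sub_const y))
  refine h1.congr_of_eventuallyEq (Filter.Eventually.of_forall fun x => ?_)
  simp only [Function.comp_apply, actL_apply]
  rw [← α.act_add, add_sub_cancel]

theorem act_der {a : A} (ha : α.IsSmooth a) (j : Fin 2) (y : Plane) :
    α.act y (α.der j a) = Complex.I • fderiv ℝ (fun x => α.act x a) y (basisVec j) := by
  rw [(ha.hasFDerivAt y).fderiv, der, map_smul]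
  rfl

theorem IsSmooth.der {a : A} (ha : α.IsSmooth a) (j : Fin 2) : α.IsSmooth (α.der j a) := by
  have h1 : ContDiff ℝ ∞ (fderiv ℝ fun x => α.act x a) := ha.fderiv_right (by simp)
  have h2 : ContDiff ℝ ∞ fun y =>
      Complex.I • fderiv ℝ (fun x => α.act x a) y (basisVec j) :=
    (h1.clm_apply contDiff_const).const_smul Complex.I
  rw [IsSmooth]
  simpa only [act_der ha] using h2

theorem IsSmooth.add {a b : A} (ha : α.IsSmooth a) (hb : α.IsSmooth b) : α.IsSmooth (a + b) := by
  simpa only [IsSmooth, map_add] using ContDiff.add ha hb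

theorem IsSmooth.mul {a b : A} (ha : α.IsSmooth a) (hb : α.IsSmooth b) : α.IsSmooth (a * b) := by
  simpa only [IsSmooth, map_mul] using ContDiff.mul ha hb

theorem IsSmooth.const_smul {a : A} (ha : α.IsSmooth a) (c : ℂ) : α.IsSmooth (c • a) := by
  simpa only [IsSmooth, map_smul] using ContDiff.const_smul c ha

theorem IsSmooth.star {a : A} (ha : α.IsSmooth a) : α.IsSmooth (star a) := by
  rw [IsSmooth]
  simp only [map_star]
  exact (starL' ℝ : A ≃L[ℝ] A).contDiff.comp ha

theorem isSmooth_one : α.IsSmooth 1 := by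
  simpa only [IsSmooth, map_one] using contDiff_const

theorem IsSmooth.sub {a b : A} (ha : α.IsSmooth a) (hb : α.IsSmooth b) : α.IsSmooth (a - b) := by
  simpa only [IsSmooth, map_sub] using ContDiff.sub ha hb

theorem IsSmooth.differentiableAt {a : A} (ha : α.IsSmooth a) (y : Plane) :
    DifferentiableAt ℝ (fun x => α.act x a) y := ha.differentiable (by simp) y

theorem der_mul {a b : A} (ha : α.IsSmooth a) (hb : α.IsSmooth b) (j : Fin 2) :
    α.der j (a * b) = a * α.der j b + α.der j a * b := by
  simp only [PlaneAction.der, map_mul]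
  rw [fderiv_fun_mul' (ha.differentiableAt 0) (hb.differentiableAt 0)]
  simp [α.act_zero]

theorem der_add {a b : A} (ha : α.IsSmooth a) (hb : α.IsSmooth b) (j : Fin 2) :
    α.der j (a + b) = α.der j a + α.der j b := by
  simp only [PlaneAction.der, map_add]
  rw [fderiv_fun_add (ha.differentiableAt 0) (hb.differentiableAt 0)]
  simp

theorem der_const_smul {a : A} (ha : α.IsSmooth a) (c : ℂ) (j : Fin 2) :
    α.der j (c • a) = c • α.der j a := by
  simp only [PlaneAction.der, map_smul]
  rw [fderiv_fun_const_smul (ha.differentiableAt 0)]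
  rw [_root_.smul_apply, smul_comm]

theorem der_one (j : Fin 2) : α.der j (1 : A) = 0 := by
  simp [PlaneAction.der]

theorem der_comm {a : A} (ha : α.IsSmooth a) (i j : Fin 2) :
    α.der i (α.der j a) = α.der j (α.der i a) := by
  have key : ∀ i j, α.der i (α.der j a) = 
      -(fderiv ℝ (fderiv ℝ fun x => α.act x a) 0 (basisVec i) (basisVec j)) := by
    intro i j
    have h1 : DifferentiableAt ℝ (fderiv ℝ fun x => α.act x a) 0 :=
      (ContDiff.fderiv_right (m := ∞) ha (by simp)).differentiable (by simp) 0
    conv_lhs => rw [PlaneAction.der]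
    simp only [act_der ha]
    rw [fderiv_fun_const_smul (h1.clm_apply (differentiableAt_const _)),
      fderiv_clm_apply h1 (differentiableAt_const _)]
    simp [smul_smul]
  rw [key, key]
  congr 1
  exact (ha.contDiffAt.isSymmSndFDerivAt (by
    rw [minSmoothness_of_isRCLikeNormedField]
    exact WithTop.coe_le_coe.2 (le_top : (2 : ℕ∞) ≤ ⊤))) _ _

theorem IsSmooth.dtau {a : A} (ha : α.IsSmooth a) (τ : ℂ) : α.IsSmooth (α.dtau τ a) :=
  (ha.der 0).add ((ha.der 1).const_smul _)

theorem IsSmooth.dtauStar {a : A} (ha : α.IsSmooth a) (τ : ℂ) : α.IsSmooth (α.dtauStar τ a) :=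
  (ha.der 0).add ((ha.der 1).const_smul _)

end PlaneAction

/-! ### Parameter-dependent symbols with values in the smooth elements. -/

namespace PlaneAction

variable {A : Type*} [CStarAlgebra A] (α : PlaneAction A)

/-- The domain `ℝ² × Λ × ℝ²`. -/
abbrev tripleDom (Λ : Set ℂ) : Set (Plane × ℂ × Plane) := Set.univ ×ˢ Λ ×ˢ Set.univ

/-- The function `(ξ, z, y) ↦ α_y(f(ξ, z))`. -/
noncomputable def lift (f : Plane → ℂ → A) : Plane × ℂ × Plane → A :=
  fun p => α.act p.2.2 (f p.1 p.2.1)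

/-- The derivation `δ_j` applied pointwise. -/
noncomputable def derFun (j : Fin 2) (f : Plane → ℂ → A) : Plane → ℂ → A :=
  fun ξ z => α.der j (f ξ z)

theorem isOpen_tripleDom {Λ : Set ℂ} (hΛ : IsOpen Λ) : IsOpen (tripleDom Λ) :=
  isOpen_univ.prod (hΛ.prod isOpen_univ)

theorem mem_tripleDom {Λ : Set ℂ} {z : ℂ} (hz : z ∈ Λ) (ξ y : Plane) : (ξ, z, y) ∈ tripleDom Λ :=
  ⟨trivial, hz, trivial⟩

variable {α} {Λ Λ' : Set ℂ} {f g : Plane → ℂ → A}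

namespace SmoothOn

theorem contDiffOn (hf : α.SmoothOn Λ f) : ContDiffOn ℝ ∞ (α.lift f) (tripleDom Λ) := hf

/-- The function is recovered from its lift by applying α_{-y}, for any y. Leaving y free allows the
derivative of the lift at (ξ, z, y) to be identified with α_y of the derivative of the function. -/
theorem hasFDerivAt (hΛ : IsOpen Λ) (hf : α.SmoothOn Λ f) {z : ℂ} (hz : z ∈ Λ) (ξ y : Plane) :
    HasFDerivAt (fun q : Plane × ℂ => f q.1 q.2)
      ((α.actL (-y)).comp ((fderiv ℝ (α.lift f) (ξ, z, y)).comp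
        ((ContinuousLinearMap.fst ℝ Plane ℂ).prod
          ((ContinuousLinearMap.snd ℝ Plane ℂ).prod 0)))) (ξ, z) := by
  have h1 := (hf.contDiffOn.diffAt (isOpen_tripleDom hΛ) (mem_tripleDom hz ξ y)).hasFDerivAt
  have h2 : HasFDerivAt (fun q : Plane × ℂ => (q.1, q.2, y))
      ((ContinuousLinearMap.fst ℝ Plane ℂ).prod
          ((ContinuousLinearMap.snd ℝ Plane ℂ).prod 0)) (ξ, z) :=
    hasFDerivAt_fst.prodMk (hasFDerivAt_snd.prodMk (hasFDerivAt_const _ _))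
  have h3 := (α.actL (-y)).hasFDerivAt.comp (ξ, z)
    (h1.comp (f := fun q : Plane × ℂ => (q.1, q.2, y)) (ξ, z) h2)
  refine h3.congr_of_eventuallyEq (Filter.Eventually.of_forall fun q => ?_)
  simp [lift, α.act_neg_act]

theorem hasFDerivAt_fst (hΛ : IsOpen Λ) (hf : α.SmoothOn Λ f) {z : ℂ} (hz : z ∈ Λ) (ξ y : Plane) :
    HasFDerivAt (fun ξ => f ξ z) ((α.actL (-y)).comp ((fderiv ℝ (α.lift f) (ξ, z, y)).comp
      (.inl ℝ Plane (ℂ × Plane)))) ξ := by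
  refine ((hf.hasFDerivAt hΛ hz ξ y).comp (f := fun ξ => (ξ, z)) ξ (hasFDerivAt_prodMk_left ξ z)).congr_fderiv ?_
  ext v
  simp
  rfl

theorem hasFDerivAt_snd (hΛ : IsOpen Λ) (hf : α.SmoothOn Λ f) {z : ℂ} (hz : z ∈ Λ) (ξ y : Plane) :
    HasFDerivAt (f ξ) ((α.actL (-y)).comp ((fderiv ℝ (α.lift f) (ξ, z, y)).comp
      ((ContinuousLinearMap.inr ℝ Plane (ℂ × Plane)).comp (.inl ℝ ℂ Plane)))) z := by
  refine ((hf.hasFDerivAt hΛ hz ξ y).comp (f := fun z => (ξ, z)) z (hasFDerivAt_prodMk_right ξ z)).congr_fderiv ?_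
  ext
  simp

theorem isSmooth (hf : α.SmoothOn Λ f) {z : ℂ} (hz : z ∈ Λ) (ξ : Plane) : α.IsSmooth (f ξ z) := by
  have : ContDiffOn ℝ ∞ (fun y : Plane => α.lift f (ξ, z, y)) Set.univ :=
    hf.contDiffOn.comp (by fun_prop) fun y _ => mem_tripleDom hz ξ y
  exact contDiffOn_univ.1 this

theorem lift_dXi (hΛ : IsOpen Λ) (hf : α.SmoothOn Λ f) (j : Fin 2) :
    Set.EqOn (dirDeriv (tripleBasis (.inl j)) (α.lift f)) (α.lift (dXi j f)) (tripleDom Λ) := by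
  rintro ⟨ξ, z, y⟩ ⟨-, hz, -⟩
  simp only [lift, dXi, dirDeriv]
  rw [(hf.hasFDerivAt_fst hΛ hz ξ y).fderiv]
  simp [α.act_act_neg]
  rfl

theorem lift_dRe (hΛ : IsOpen Λ) (hf : α.SmoothOn Λ f) :
    Set.EqOn (dirDeriv (tripleBasis (.inr (.inl 0))) (α.lift f)) (α.lift (dRe f))
      (tripleDom Λ) := by
  rintro ⟨ξ, z, y⟩ ⟨-, hz, -⟩
  simp only [lift, dRe, dirDeriv]
  rw [(hf.hasFDerivAt_snd hΛ hz ξ y).fderiv]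
  simp [α.act_act_neg]

theorem lift_dIm (hΛ : IsOpen Λ) (hf : α.SmoothOn Λ f) :
    Set.EqOn (dirDeriv (tripleBasis (.inr (.inl 1))) (α.lift f)) (α.lift (dIm f))
      (tripleDom Λ) := by
  rintro ⟨ξ, z, y⟩ ⟨-, hz, -⟩
  simp only [lift, dIm, dirDeriv]
  rw [(hf.hasFDerivAt_snd hΛ hz ξ y).fderiv]
  simp [α.act_act_neg]

/-- On the lift the derivations are, up to the factor i, the directional derivatives in y. One class
of derivative bounds on the lift therefore covers the derivatives in ξ, in the parameter and along
the action. -/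
theorem lift_derFun (hΛ : IsOpen Λ) (hf : α.SmoothOn Λ f) (j : Fin 2) :
    Set.EqOn (fun p => Complex.I • dirDeriv (tripleBasis (.inr (.inr j))) (α.lift f) p)
      (α.lift (α.derFun j f)) (tripleDom Λ) := by
  rintro ⟨ξ, z, y⟩ ⟨-, hz, -⟩
  simp only [lift, derFun, dirDeriv]
  rw [act_der (hf.isSmooth hz ξ)]
  have h1 := (hf.contDiffOn.diffAt (isOpen_tripleDom hΛ) (mem_tripleDom hz ξ y)).hasFDerivAt
  have h2 : HasFDerivAt (fun y : Plane => (ξ, z, y))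
      ((ContinuousLinearMap.inr ℝ Plane (ℂ × Plane)).comp (.inr ℝ ℂ Plane)) y :=
    (hasFDerivAt_prodMk_right ξ (z, y)).comp y (hasFDerivAt_prodMk_right z y)
  have h3 := h1.comp (f := fun y : Plane => (ξ, z, y)) y h2
  rw [HasFDerivAt.fderiv (f := fun x => α.act x (f ξ z)) h3]
  simp

theorem congr (hf : α.SmoothOn Λ f) (h : ∀ ξ, ∀ z ∈ Λ, g ξ z = f ξ z) : α.SmoothOn Λ g :=
  ContDiffOn.congr (f₁ := α.lift g) hf fun p hp => by simp only [lift, h p.1 p.2.1 hp.2.1]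

theorem dXi (hΛ : IsOpen Λ) (hf : α.SmoothOn Λ f) (j : Fin 2) : α.SmoothOn Λ (dXi j f) :=
  (hf.contDiffOn.dirDeriv (isOpen_tripleDom hΛ) _).congr (hf.lift_dXi hΛ j).symm

theorem derFun (hΛ : IsOpen Λ) (hf : α.SmoothOn Λ f) (j : Fin 2) : α.SmoothOn Λ (α.derFun j f) :=
  ((hf.contDiffOn.dirDeriv (isOpen_tripleDom hΛ) _).const_smul Complex.I).congr
    (hf.lift_derFun hΛ j).symm

theorem add (hf : α.SmoothOn Λ f) (hg : α.SmoothOn Λ g) :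
    α.SmoothOn Λ (fun ξ z => f ξ z + g ξ z) := by
  simpa only [SmoothOn, map_add] using ContDiffOn.add hf hg

theorem mul (hf : α.SmoothOn Λ f) (hg : α.SmoothOn Λ g) :
    α.SmoothOn Λ (fun ξ z => f ξ z * g ξ z) := by
  simpa only [SmoothOn, map_mul] using ContDiffOn.mul hf hg

theorem neg (hf : α.SmoothOn Λ f) : α.SmoothOn Λ (fun ξ z => -f ξ z) := by
  simpa only [SmoothOn, map_neg] using ContDiffOn.neg hf

theorem smul {c : Plane → ℂ → ℂ}
    (hc : ContDiff ℝ ∞ fun p : Plane × ℂ × Plane => c p.1 p.2.1) (hf : α.SmoothOn Λ f) :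
    α.SmoothOn Λ (fun ξ z => c ξ z • f ξ z) := by
  simp only [SmoothOn, map_smul]
  exact ContDiffOn.smul hc.contDiffOn hf

theorem const {a : A} (ha : α.IsSmooth a) : α.SmoothOn Λ (fun _ _ => a) :=
  (ContDiff.comp ha (by fun_prop : ContDiff ℝ ∞ fun p : Plane × ℂ × Plane => p.2.2)).contDiffOn

end SmoothOn

theorem lift_add : α.lift (fun ξ z => f ξ z + g ξ z) = fun p => α.lift f p + α.lift g p := by
  ext; simp [lift]

theorem lift_sub : α.lift (fun ξ z => f ξ z - g ξ z) = fun p => α.lift f p - α.lift g p := by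
  ext; simp [lift]

theorem lift_neg : α.lift (fun ξ z => -f ξ z) = fun p => -α.lift f p := by
  ext; simp [lift]

theorem lift_mul : α.lift (fun ξ z => f ξ z * g ξ z) = fun p => α.lift f p * α.lift g p := by
  ext; simp [lift]

theorem lift_smul (c : Plane → ℂ → ℂ) :
    α.lift (fun ξ z => c ξ z • f ξ z) = fun p => c p.1 p.2.1 • α.lift f p := by
  ext; simp [lift]

/-! ### Symbol classes -/

/-- The weight `(1 + |ξ| + |z|^{1/2})^m`. -/
noncomputable def symWeight (m : ℝ) : Plane × ℂ × Plane → ℝ :=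
  fun p => (1 + ‖p.1‖ + Real.sqrt ‖p.2.1‖) ^ m

/-- The change of order under differentiation: `s` for `ξ`, `2 s` for the parameter. -/
noncomputable def symDrop (s : ℝ) : Fin 2 ⊕ (Fin 2 ⊕ Fin 2) → Plane × ℂ × Plane → ℝ :=
  Sum.elim (fun _ => symWeight (-s)) (Sum.elim (fun _ => symWeight (-(2 * s))) fun _ => symWeight 0)

theorem one_le_symBase (p : Plane × ℂ × Plane) : 1 ≤ 1 + ‖p.1‖ + Real.sqrt ‖p.2.1‖ := by
  have := Real.sqrt_nonneg ‖p.2.1‖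
  have := norm_nonneg p.1
  linarith

theorem symWeight_pos (m : ℝ) (p) : 0 < symWeight m p :=
  Real.rpow_pos_of_pos (zero_lt_one.trans_le (one_le_symBase p)) _

theorem symWeight_mul (m m' : ℝ) : symWeight m * symWeight m' = symWeight (m + m') := by
  ext p
  exact (Real.rpow_add (zero_lt_one.trans_le (one_le_symBase p)) _ _).symm

theorem symWeight_mono {m m' : ℝ} (h : m ≤ m') (p) : symWeight m p ≤ symWeight m' p :=
  Real.rpow_le_rpow_of_exponent_le (one_le_symBase p) h

theorem one_le_symWeight {m : ℝ} (h : 0 ≤ m) (p) : 1 ≤ symWeight m p :=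
  Real.one_le_rpow (one_le_symBase p) h

theorem symDrop_pos (s : ℝ) (i p) : 0 < symDrop s i p := by
  rcases i with i | i | i <;> exact symWeight_pos _ _

variable (α) in
/-- Symbols of order `m` of type `s` on `ℝ² × Λ`. -/
def Symb (Λ : Set ℂ) (s m : ℝ) (f : Plane → ℂ → A) : Prop :=
  WeightedSmooth tripleBasis (tripleDom Λ) (symDrop s) (symWeight m) (α.lift f)

/-- Scalar symbols of order `m` of type `s` on `ℝ² × Λ`. -/
def ScalarSymb (Λ : Set ℂ) (s m : ℝ) (c : Plane → ℂ → ℂ) : Prop :=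
  WeightedSmooth tripleBasis (tripleDom Λ) (symDrop s) (symWeight m) (fun p => c p.1 p.2.1)

variable {s m m' : ℝ}

namespace Symb

theorem smoothOn (hf : α.Symb Λ s m f) : α.SmoothOn Λ f := hf.smooth

theorem mono (hf : α.Symb Λ s m f) (h : m ≤ m') : α.Symb Λ s m' f :=
  WeightedSmooth.mono hf (fun i p _ => (symDrop_pos s i p).le) (fun _ _ _ => le_rfl)
    (fun p _ => (symWeight_pos m p).le) subset_rfl (fun p _ => (symWeight_pos m' p).le)
    ⟨1, fun p _ => by rw [one_mul]; exact symWeight_mono h p⟩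

theorem mono_set (hf : α.Symb Λ s m f) (h : Λ' ⊆ Λ) : α.Symb Λ' s m f :=
  WeightedSmooth.mono hf (fun i p _ => (symDrop_pos s i p).le) (fun _ _ _ => le_rfl)
    (fun p _ => (symWeight_pos m p).le) (Set.prod_mono subset_rfl (Set.prod_mono h subset_rfl))
    (fun p _ => (symWeight_pos m p).le) ⟨1, fun p _ => by rw [one_mul]⟩

theorem to_zero (hf : α.Symb Λ s m f) (hs : 0 ≤ s) : α.Symb Λ 0 m f := by
  refine WeightedSmooth.mono hf (fun i p _ => (symDrop_pos s i p).le) (fun i p _ => ?_)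
    (fun p _ => (symWeight_pos m p).le) subset_rfl
    (fun p _ => (symWeight_pos m p).le) ⟨1, fun p _ => by rw [one_mul]⟩
  rcases i with i | i | i <;> exact symWeight_mono (by linarith) _

theorem congr (hΛ : IsOpen Λ) (hf : α.Symb Λ s m f) (h : ∀ ξ, ∀ z ∈ Λ, f ξ z = g ξ z) :
    α.Symb Λ s m g :=
  WeightedSmooth.congr (isOpen_tripleDom hΛ) hf
    fun p hp => by simp only [lift, h p.1 p.2.1 hp.2.1]

theorem add (hΛ : IsOpen Λ) (hf : α.Symb Λ s m f) (hg : α.Symb Λ s m g) :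
    α.Symb Λ s m (fun ξ z => f ξ z + g ξ z) := by
  have := WeightedSmooth.add (isOpen_tripleDom hΛ) hf hg
  rwa [← lift_add] at this

theorem sub (hΛ : IsOpen Λ) (hf : α.Symb Λ s m f) (hg : α.Symb Λ s m g) :
    α.Symb Λ s m (fun ξ z => f ξ z - g ξ z) := by
  have := WeightedSmooth.sub (isOpen_tripleDom hΛ) hf hg
  rwa [← lift_sub] at this

theorem neg (hΛ : IsOpen Λ) (hf : α.Symb Λ s m f) : α.Symb Λ s m (fun ξ z => -f ξ z) := by
  have := WeightedSmooth.neg (isOpen_tripleDom hΛ) hf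
  rwa [← lift_neg] at this

theorem const_smul (hΛ : IsOpen Λ) (hf : α.Symb Λ s m f) (c : ℂ) :
    α.Symb Λ s m (fun ξ z => c • f ξ z) := by
  have := WeightedSmooth.const_smul (isOpen_tripleDom hΛ) c hf
  rwa [← lift_smul (fun _ _ => c)] at this

theorem mul (hΛ : IsOpen Λ) (hf : α.Symb Λ s m f) (hg : α.Symb Λ s m' g) :
    α.Symb Λ s (m + m') (fun ξ z => f ξ z * g ξ z) := by
  have := WeightedSmooth.mul (isOpen_tripleDom hΛ) hf hg
  rw [symWeight_mul] at this
  rwa [← lift_mul] at this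

theorem smul (hΛ : IsOpen Λ) {c : Plane → ℂ → ℂ} (hc : ScalarSymb Λ s m c)
    (hf : α.Symb Λ s m' f) : α.Symb Λ s (m + m') (fun ξ z => c ξ z • f ξ z) := by
  have := WeightedSmooth.smul (isOpen_tripleDom hΛ) hc hf
  rw [symWeight_mul] at this
  rwa [← lift_smul c] at this

theorem zero : α.Symb Λ s m (fun _ _ => 0) := by
  have : WeightedSmooth tripleBasis (tripleDom Λ) (symDrop s) (symWeight m)
    (fun _ => (0 : A)) := WeightedSmooth.zero_fun (fun p _ => (symWeight_pos m p).le)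
      (fun i p _ => (symDrop_pos s i p).le)
  unfold Symb
  convert this using 1
  ext p
  simp [lift]

theorem dXi (hΛ : IsOpen Λ) (hf : α.Symb Λ s m f) (j : Fin 2) :
    α.Symb Λ s (m - s) (dXi j f) := by
  have := WeightedSmooth.deriv (isOpen_tripleDom hΛ) hf (.inl j)
  have h2 : symWeight m * symDrop s (.inl j) = symWeight (m - s) := symWeight_mul _ _
  rw [h2] at this
  exact this.congr (isOpen_tripleDom hΛ) (hf.smoothOn.lift_dXi hΛ j)

theorem dRe (hΛ : IsOpen Λ) (hf : α.Symb Λ s m f) :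
    α.Symb Λ s (m - 2 * s) (dRe f) := by
  have := WeightedSmooth.deriv (isOpen_tripleDom hΛ) hf (.inr (.inl 0))
  have h2 : symWeight m * symDrop s (.inr (.inl 0)) = symWeight (m - 2 * s) := symWeight_mul _ _
  rw [h2] at this
  exact this.congr (isOpen_tripleDom hΛ) (hf.smoothOn.lift_dRe hΛ)

theorem dIm (hΛ : IsOpen Λ) (hf : α.Symb Λ s m f) :
    α.Symb Λ s (m - 2 * s) (dIm f) := by
  have := WeightedSmooth.deriv (isOpen_tripleDom hΛ) hf (.inr (.inl 1))
  have h2 : symWeight m * symDrop s (.inr (.inl 1)) = symWeight (m - 2 * s) := symWeight_mul _ _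
  rw [h2] at this
  exact this.congr (isOpen_tripleDom hΛ) (hf.smoothOn.lift_dIm hΛ)

theorem derFun (hΛ : IsOpen Λ) (hf : α.Symb Λ s m f) (j : Fin 2) :
    α.Symb Λ s m (α.derFun j f) := by
  have := WeightedSmooth.deriv (isOpen_tripleDom hΛ) hf (.inr (.inr j))
  have h2 : symWeight m * symDrop s (.inr (.inr j)) = symWeight m :=
    (symWeight_mul _ _).trans (by rw [add_zero])
  rw [h2] at this
  exact (this.const_smul (isOpen_tripleDom hΛ) Complex.I).congr (isOpen_tripleDom hΛ)
    (hf.smoothOn.lift_derFun hΛ j)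

theorem bound (hf : α.Symb Λ s m f) : ∃ C, ∀ ξ, ∀ z ∈ Λ,
    ‖f ξ z‖ ≤ C * (1 + ‖ξ‖ + Real.sqrt ‖z‖) ^ m := by
  obtain ⟨C, hC⟩ := WeightedSmooth.bound hf
  exact ⟨C, fun ξ z hz => by simpa [lift, α.act_zero] using! hC (ξ, z, 0) (mem_tripleDom hz ξ 0)⟩

/-- Derivatives along the action of a constant symbol a are again constant symbols, multiples of δ_j
a, so the induction on the length of words runs over all smooth elements at once. -/
theorem const (hΛ : IsOpen Λ) (hm : 0 ≤ m) {a : A} (ha : α.IsSmooth a) :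
    α.Symb Λ s m (fun _ _ => a) := by
  refine ⟨SmoothOn.const ha, fun n => ?_⟩
  induction n generalizing a with
  | zero =>
    exact ⟨‖a‖, fun p _ => by
      simpa [lift, α.norm_act] using le_mul_of_one_le_right (norm_nonneg a) (one_le_symWeight hm p)⟩
  | succ n ih =>
    refine ⟨⟨‖a‖, fun p _ => by
      simpa [lift, α.norm_act] using le_mul_of_one_le_right (norm_nonneg a)
        (one_le_symWeight hm p)⟩, fun i => ?_⟩
    have hz : ∀ v : Plane × ℂ, dirDeriv (v.1, v.2, 0) (α.lift fun _ _ => a) = fun _ => 0 := by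
      rintro v
      ext p
      have h1 := (ha.hasFDerivAt p.2.2).comp (f := fun p : Plane × ℂ × Plane => p.2.2) p
        (hasFDerivAt_snd.comp (f := fun p : Plane × ℂ × Plane => p.2) p hasFDerivAt_snd)
      rw [dirDeriv, HasFDerivAt.fderiv (f := α.lift fun _ _ => a) h1]
      simp
    have hz' : ∀ v : Plane × ℂ, WordBound tripleBasis (tripleDom Λ) (symDrop s) n
        (symWeight m * symDrop s i) (dirDeriv (v.1, v.2, 0) (α.lift fun _ _ => a)) := by
      intro v
      rw [hz v]
      exact (WeightedSmooth.zero_fun (fun p _ => mul_nonneg (symWeight_pos m p).le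
        (symDrop_pos s i p).le) (fun i p _ => (symDrop_pos s i p).le)).words n
    rcases i with j | j | j
    · simpa using hz' (basisVec j, 0)
    · fin_cases j
      · simpa using hz' (0, 1)
      · simpa using hz' (0, Complex.I)
    · have h2 : symWeight m * symDrop s (.inr (.inr j)) = symWeight m :=
        (symWeight_mul _ _).trans (by rw [add_zero])
      rw [h2]
      have h3 := (SmoothOn.const (Λ := Λ) ha).lift_derFun hΛ j
      have h4 := (ih (ha.der j)).clm (isOpen_tripleDom hΛ)
        (ContinuousLinearMap.restrictScalars ℝ ((-Complex.I) • ContinuousLinearMap.id ℂ A))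
        (SmoothOn.const (ha.der j))
      refine h4.congr (isOpen_tripleDom hΛ) fun p hp => ?_
      have h5 := h3 hp
      change -Complex.I • α.lift (α.derFun j fun _ _ => a) p = _
      rw [← h5, smul_smul]
      simp

end Symb

namespace ScalarSymb

theorem add {c d : Plane → ℂ → ℂ} (hΛ : IsOpen Λ) (hc : ScalarSymb Λ s m c)
    (hd : ScalarSymb Λ s m d) : ScalarSymb Λ s m (fun ξ z => c ξ z + d ξ z) :=
  WeightedSmooth.add (isOpen_tripleDom hΛ) hc hd

theorem mul {c d : Plane → ℂ → ℂ} (hΛ : IsOpen Λ) (hc : ScalarSymb Λ s m c)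
    (hd : ScalarSymb Λ s m' d) : ScalarSymb Λ s (m + m') (fun ξ z => c ξ z * d ξ z) := by
  have := WeightedSmooth.mul (isOpen_tripleDom hΛ) hc hd
  rwa [symWeight_mul] at this

theorem const_mul {d : Plane → ℂ → ℂ} (hΛ : IsOpen Λ) (c : ℂ)
    (hd : ScalarSymb Λ s m d) : ScalarSymb Λ s m (fun ξ z => c * d ξ z) :=
  WeightedSmooth.const_smul (isOpen_tripleDom hΛ) c hd

/-- The first derivatives of a linear function are constants, so only the directions in which it
does not vanish restrict the weights. -/
theorem of_linear (L : Plane × ℂ × Plane →L[ℝ] ℂ)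
    (hb : ∃ C, ∀ p, ‖L p‖ ≤ C * symWeight m p)
    (hd : ∀ i, L (tripleBasis i) ≠ 0 → ∀ p, 1 ≤ (symWeight m * symDrop s i) p) :
    WeightedSmooth tripleBasis (tripleDom Λ) (symDrop s) (symWeight m) L := by
  refine WeightedSmooth.of_deriv L.contDiff.contDiffOn (hb.imp fun C h p _ => h p) fun i => ?_
  have h1 : dirDeriv (tripleBasis i) L = fun _ => L (tripleBasis i) := by
    ext p; simp [dirDeriv]
  rw [h1]
  by_cases h : L (tripleBasis i) = 0
  · rw [h]
    exact WeightedSmooth.zero_fun (fun p _ => mul_nonneg (symWeight_pos m p).le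
        (symDrop_pos s i p).le) (fun i p _ => (symDrop_pos s i p).le)
  · exact WeightedSmooth.const (fun p _ => mul_nonneg (symWeight_pos m p).le
        (symDrop_pos s i p).le) (fun i p _ => (symDrop_pos s i p).le)
        ⟨1, fun p _ => by rw [one_mul]; exact hd i h p⟩ _

theorem coord (hs : s ≤ 1) (j : Fin 2) : ScalarSymb Λ s 1 (fun ξ _ => (ξ j : ℂ)) := by
  have := of_linear (Λ := Λ) (s := s) (m := 1)
    (Complex.ofRealCLM.comp ((EuclideanSpace.proj j).comp (ContinuousLinearMap.fst ℝ Plane (ℂ × Plane))))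
    ⟨1, fun p => ?_⟩ fun i hi p => ?_
  · exact this
  · have h1 : ‖p.1 j‖ ≤ ‖p.1‖ := PiLp.norm_apply_le p.1 j
    have h2 := Real.sqrt_nonneg ‖p.2.1‖
    simp only [symWeight, Real.rpow_one, one_mul]
    change ‖((p.1 j : ℝ) : ℂ)‖ ≤ _
    rw [Complex.norm_real]
    linarith
  · rcases i with i | i | i
    · rw [show symDrop s (.inl i) = symWeight (-s) from rfl, symWeight_mul]
      exact one_le_symWeight (by linarith) p
    · exfalso; apply hi; fin_cases i <;> simp
    · exfalso; apply hi; simp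

theorem param (hs : s ≤ 1) : ScalarSymb Λ s 2 (fun _ z => z) := by
  have := of_linear (Λ := Λ) (s := s) (m := 2)
    ((ContinuousLinearMap.fst ℝ ℂ Plane).comp (ContinuousLinearMap.snd ℝ Plane (ℂ × Plane)))
    ⟨1, fun p => ?_⟩ fun i hi p => ?_
  · exact this
  · have h1 := norm_nonneg p.1
    have h2 := Real.sqrt_nonneg ‖p.2.1‖
    have h3 := Real.sq_sqrt (norm_nonneg p.2.1)
    simp only [symWeight, one_mul]
    change ‖p.2.1‖ ≤ _
    rw [Real.rpow_two]
    nlinarith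
  · rcases i with i | i | i
    · exfalso; apply hi; simp
    · rw [show symDrop s (.inr (.inl i)) = symWeight (-(2*s)) from rfl, symWeight_mul]
      exact one_le_symWeight (by linarith) p
    · exfalso; apply hi; simp

theorem eta (hΛ : IsOpen Λ) (hs : s ≤ 1) (τ : ℂ) : ScalarSymb Λ s 1 (fun ξ _ => eta τ ξ) :=
  (coord hs 0).add hΛ ((coord hs 1).const_mul hΛ _)

theorem conj_eta (hΛ : IsOpen Λ) (hs : s ≤ 1) (τ : ℂ) :
    ScalarSymb Λ s 1 (fun ξ _ => starRingEnd ℂ (PlaneAction.eta τ ξ)) := by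
  have := (coord (Λ := Λ) hs 0).add hΛ ((coord hs 1).const_mul hΛ τ)
  simpa [PlaneAction.eta] using this

theorem etaSq (hΛ : IsOpen Λ) (hs : s ≤ 1) (τ : ℂ) :
    ScalarSymb Λ s 2 (fun ξ _ => etaSq τ ξ) := by
  have h := (eta (Λ := Λ) hΛ hs τ).mul hΛ (conj_eta hΛ hs τ)
  have h1 : (1 : ℝ) + 1 = 2 := by norm_num
  rw [h1] at h
  simpa [Complex.mul_conj, Complex.normSq_eq_norm_sq, PlaneAction.etaSq] using h

end ScalarSymb

/-- In type one every elementary operator lowers the order by a fixed amount: 1 for ξ, 2 for the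
parameter, 0 for the derivations. An iterated estimate is then the plain bound for a symbol of the
resulting order. -/
theorem Symb.isParamSymbol (hΛ : IsOpen Λ) (hf : α.Symb Λ 1 m f) : α.IsParamSymbol m Λ f := by
  refine ⟨hf.smoothOn, fun β κ γ => ?_⟩
  have h1 : ∀ n : ℕ, ∀ (op : (Plane → ℂ → A) → Plane → ℂ → A) (c : ℝ),
      (∀ m f, α.Symb Λ 1 m f → α.Symb Λ 1 (m - c) (op f)) →
      ∀ m f, α.Symb Λ 1 m f → α.Symb Λ 1 (m - n * c) (op^[n] f) := by
    intro n op c hop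
    induction n with
    | zero => intro m f hf; simpa using hf
    | succ n ih =>
      intro m f hf
      rw [Function.iterate_succ_apply]
      have := ih _ _ (hop m f hf)
      convert this using 1
      push_cast; ring
  have a1 := h1 (κ 1) PlaneAction.dIm 2 (fun m f hf => by simpa using hf.dIm hΛ) _ _ hf
  have a2 := h1 (κ 0) PlaneAction.dRe 2 (fun m f hf => by simpa using hf.dRe hΛ) _ _ a1
  have a3 := h1 (β 1) (PlaneAction.dXi 1) 1 (fun m f hf => hf.dXi hΛ 1) _ _ a2
  have a4 := h1 (β 0) (PlaneAction.dXi 0) 1 (fun m f hf => hf.dXi hΛ 0) _ _ a3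
  have a5 := h1 (γ 1) (α.derFun 1) 0 (fun m f hf => by simpa using hf.derFun hΛ 1) _ _ a4
  have a6 := h1 (γ 0) (α.derFun 0) 0 (fun m f hf => by simpa using hf.derFun hΛ 0) _ _ a5
  obtain ⟨C, hC⟩ := a6.bound
  have hder : ∀ (j : Fin 2) (n : ℕ) (f : Plane → ℂ → A) ξ z,
      (α.derFun j)^[n] f ξ z = (α.der j)^[n] (f ξ z) := by
    intro j n
    induction n with
    | zero => intros; rfl
    | succ n ih => intro f ξ z; rw [Function.iterate_succ_apply, ih]; rfl
  refine ⟨C, fun ξ z hz => ?_⟩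
  have h := hC ξ z hz
  rw [hder, hder] at h
  rw [derPow]
  convert h using 2
  congr 1
  push_cast; ring

end PlaneAction

/-! ### Linear substitutions in weighted bounds. -/

section LinearPullback

open Module

variable {ι κ E E' F : Type*} [NormedAddCommGroup E] [NormedSpace ℝ E]
  [NormedAddCommGroup E'] [NormedSpace ℝ E'] [NormedAddCommGroup F] [NormedSpace ℝ F]
  {U : Set E} {w : E → ℝ} {φ : E → F}

theorem WeightedSmooth.deriv_one {e : ι → E} (hU : IsOpen U)
    (hφ : WeightedSmooth e U (fun _ _ => 1) w φ) (i : ι) :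
    WeightedSmooth e U (fun _ _ => 1) w (dirDeriv (e i) φ) := by
  have := hφ.deriv hU i
  rwa [show (w * fun _ => (1 : ℝ)) = w by ext; simp] at this

theorem WeightedSmooth.sum {e : ι → E} {h : ι → E → ℝ} {k : Type*} (s : Finset k) {ψ : k → E → F}
    (hU : IsOpen U) (hw : ∀ p ∈ U, 0 ≤ w p) (hh : ∀ i, ∀ p ∈ U, 0 ≤ h i p)
    (hψ : ∀ i ∈ s, WeightedSmooth e U h w (ψ i)) :
    WeightedSmooth e U h w (fun p => ∑ i ∈ s, ψ i p) := by
  classical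
  induction s using Finset.induction_on with
  | empty => simpa using WeightedSmooth.zero_fun hw hh
  | insert i s hi ih =>
    simp only [Finset.sum_insert hi]
    exact (hψ i (Finset.mem_insert_self _ _)).add hU
      (ih fun j hj => hψ j (Finset.mem_insert_of_mem hj))

theorem WeightedSmooth.real_smul {e : ι → E} {h : ι → E → ℝ} (hU : IsOpen U) (c : ℝ)
    (hφ : WeightedSmooth e U h w φ) : WeightedSmooth e U h w (fun p => c • φ p) :=
  hφ.clm hU (c • ContinuousLinearMap.id ℝ F)

theorem dirDeriv_eq_sum [Fintype κ] (b : Basis κ ℝ E) (v p : E) :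
    dirDeriv v φ p = ∑ k, b.repr v k • dirDeriv (b k) φ p := by
  simp only [dirDeriv]
  conv_lhs => rw [← b.sum_repr v, map_sum]
  simp

theorem WeightedSmooth.dirDeriv [Fintype κ] {b : Basis κ ℝ E} (hU : IsOpen U)
    (hw : ∀ p ∈ U, 0 ≤ w p)
    (hφ : WeightedSmooth b U (fun _ _ => 1) w φ) (v : E) :
    WeightedSmooth b U (fun _ _ => 1) w (dirDeriv v φ) := by
  rw [show _root_.dirDeriv v φ = fun p => ∑ k, b.repr v k • _root_.dirDeriv (b k) φ p from
    funext fun p => dirDeriv_eq_sum b v p]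
  exact WeightedSmooth.sum _ hU hw (fun _ _ _ => zero_le_one)
    fun k _ => (hφ.deriv_one hU k).real_smul hU _

/-- By the chain rule a derivative of the pullback along e' i is the derivative of φ along L (e' i),
a combination of basis derivatives. Such combinations mix the directions, which is harmless because
here no direction changes the weight. -/
theorem WeightedSmooth.comp_linear [Fintype κ] {b : Basis κ ℝ E} (hU : IsOpen U)
    (hw : ∀ p ∈ U, 0 ≤ w p)
    (hφ : WeightedSmooth b U (fun _ _ => 1) w φ) (L : E' →L[ℝ] E) (e' : ι → E') :
    WeightedSmooth e' (L ⁻¹' U) (fun _ _ => 1) (fun p => w (L p)) (fun p => φ (L p)) := by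
  have hU' : IsOpen (L ⁻¹' U) := hU.preimage L.continuous
  refine ⟨hφ.smooth.comp L.contDiff.contDiffOn fun p hp => hp, fun n => ?_⟩
  induction n generalizing φ with
  | zero =>
    obtain ⟨C, hC⟩ := hφ.bound
    exact ⟨C, fun p hp => hC _ hp⟩
  | succ n ih =>
    refine ⟨?_, fun i => ?_⟩
    · obtain ⟨C, hC⟩ := hφ.bound
      exact ⟨C, fun p hp => hC _ hp⟩
    · have h1 := ih (hφ.dirDeriv hU hw (L (e' i)))
      rw [show ((fun p => w (L p)) * fun _ => (1 : ℝ)) = fun p => w (L p) by ext; simp]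
      refine h1.congr hU' fun p hp => ?_
      simp only [_root_.dirDeriv]
      rw [HasFDerivAt.fderiv (f := fun p => φ (L p))
        ((hφ.smooth.diffAt hU (p := L p) hp).hasFDerivAt.comp p L.hasFDerivAt)]
      rfl

end LinearPullback

/-! ### Oscillatory integrals with rapidly decreasing amplitudes. -/

section Oscillatory

open Module MeasureTheory
open scoped RealInnerProductSpace

/-- The phase `e^{i ε ⟨a, v⟩}`. -/
noncomputable def osc (ε : ℝ) (a v : Plane) : ℂ := Complex.exp (Complex.I * ((ε * ⟪a, v⟫ : ℝ) : ℂ))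

theorem norm_osc (ε : ℝ) (a v : Plane) : ‖osc ε a v‖ = 1 := by
  rw [osc, mul_comm, Complex.norm_exp_ofReal_mul_I]

theorem contDiff_osc (ε : ℝ) : ContDiff ℝ ∞ fun q : Plane × Plane => osc ε q.1 q.2 := by
  unfold osc
  have h : ContDiff ℝ ∞ fun q : Plane × Plane => ((ε * ⟪q.1, q.2⟫ : ℝ) : ℂ) :=
    Complex.ofRealCLM.contDiff.comp (contDiff_const.mul (contDiff_fst.inner ℝ contDiff_snd))
  exact (contDiff_const.mul h).cexp

theorem fderiv_osc (ε : ℝ) (q v : Plane × Plane) :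
    fderiv ℝ (fun q : Plane × Plane => osc ε q.1 q.2) q v
      = (Complex.I * ((ε * (⟪q.1, v.2⟫ + ⟪v.1, q.2⟫) : ℝ) : ℂ)) * osc ε q.1 q.2 := by
  have h1 : HasFDerivAt (fun q : Plane × Plane => ε * ⟪q.1, q.2⟫) _ q :=
    ((hasFDerivAt_fst (𝕜 := ℝ) (p := q)).inner ℝ (hasFDerivAt_snd (𝕜 := ℝ) (p := q))).const_mul ε
  have h2 := ((Complex.ofRealCLM.hasFDerivAt.comp q h1).const_mul Complex.I).cexp
  unfold osc
  rw [HasFDerivAt.fderiv (f := fun q : Plane × Plane =>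
    Complex.exp (Complex.I * ((ε * ⟪q.1, q.2⟫ : ℝ) : ℂ))) h2]
  simp
  ring

@[simp] theorem inner_basisVec (j : Fin 2) (v : Plane) : ⟪basisVec j, v⟫ = v j := by
  simp [basisVec, EuclideanSpace.inner_single_left]

@[simp] theorem inner_basisVec_right (j : Fin 2) (v : Plane) : ⟪v, basisVec j⟫ = v j := by
  rw [real_inner_comm, inner_basisVec]

/-- The basis of `(ℝ² × ℝ²) × ℝ²`. -/
noncomputable def quadBasis : Basis ((Fin 2 ⊕ Fin 2) ⊕ Fin 2) ℝ ((Plane × Plane) × Plane) :=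
  pairBasis.prod planeBasis

@[simp] theorem quadBasis_inl (i) : quadBasis (.inl i) = (pairBasis i, (0 : Plane)) := by
  simp [quadBasis]

@[simp] theorem quadBasis_inr (j) : quadBasis (.inr j) = ((0 : Plane × Plane), basisVec j) := by
  simp [quadBasis]

/-- The weight `(1 + |x|)^m (1 + |v|)^{-N}`. -/
noncomputable def ampWeight (m N : ℕ) (q : (Plane × Plane) × Plane) : ℝ :=
  (1 + ‖q.1.1‖) ^ m * ((1 + ‖q.2‖) ^ N)⁻¹

theorem ampWeight_pos (m N : ℕ) (q) : 0 < ampWeight m N q := by unfold ampWeight; positivity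

variable {F : Type*} [NormedAddCommGroup F] [NormedSpace ℂ F]

/-- Amplitudes `Ψ(x, y, v)`, rapidly decreasing in `v` and of polynomial growth in `x`. -/
def Amplitude (m : ℕ) (Ψ : (Plane × Plane) × Plane → F) : Prop :=
  ∀ N, WeightedSmooth quadBasis Set.univ (fun _ _ => 1) (ampWeight m N) Ψ

variable {m : ℕ} {Ψ Ψ' : (Plane × Plane) × Plane → F}

namespace Amplitude

theorem contDiff (hΨ : Amplitude m Ψ) : ContDiff ℝ ∞ Ψ := contDiffOn_univ.1 (hΨ 0).smooth

theorem differentiableAt (hΨ : Amplitude m Ψ) (q) : DifferentiableAt ℝ Ψ q :=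
  hΨ.contDiff.differentiable (by simp) q

theorem add (hΨ : Amplitude m Ψ) (hΨ' : Amplitude m Ψ') : Amplitude m (fun q => Ψ q + Ψ' q) :=
  fun N => (hΨ N).add isOpen_univ (hΨ' N)

theorem const_smul (hΨ : Amplitude m Ψ) (c : ℂ) : Amplitude m (fun q => c • Ψ q) :=
  fun N => (hΨ N).const_smul isOpen_univ c

theorem dirDeriv (hΨ : Amplitude m Ψ) (v) : Amplitude m (dirDeriv v Ψ) :=
  fun N => (hΨ N).dirDeriv isOpen_univ (fun p _ => (ampWeight_pos m N p).le) v

/-- Multiplication by v_j costs one power of decay in v, and an amplitude has every power available.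
-/
theorem coord_smul (hΨ : Amplitude m Ψ) (j : Fin 2) :
    Amplitude m (fun q => ((q.2 j : ℝ) : ℂ) • Ψ q) := by
  intro N
  have h1 : WeightedSmooth quadBasis Set.univ (fun _ _ => 1)
      (fun q : (Plane × Plane) × Plane => 1 + ‖q.2‖) (fun q => ((q.2 j : ℝ) : ℂ)) := by
    set L : (Plane × Plane) × Plane →L[ℝ] ℂ := Complex.ofRealCLM.comp
      ((EuclideanSpace.proj j).comp (ContinuousLinearMap.snd ℝ (Plane × Plane) Plane)) with hL
    change WeightedSmooth quadBasis Set.univ (fun _ _ => 1) _ L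
    refine WeightedSmooth.of_deriv L.contDiff.contDiffOn ⟨1, fun q _ => ?_⟩ fun i => ?_
    · have h1 : ‖q.2 j‖ ≤ ‖q.2‖ := PiLp.norm_apply_le q.2 j
      change ‖((q.2 j : ℝ) : ℂ)‖ ≤ _
      rw [Complex.norm_real]
      linarith
    · have h1 : _root_.dirDeriv (quadBasis i) L = fun _ => L (quadBasis i) := by
        ext p; simp [_root_.dirDeriv]
      rw [h1]
      refine WeightedSmooth.const (fun q _ => by simp; positivity) (fun _ _ _ => zero_le_one)
        ⟨1, fun q _ => ?_⟩ _
      simp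
  have h2 := h1.smul isOpen_univ (hΨ (N + 1))
  have h3 : ((fun q : (Plane × Plane) × Plane => 1 + ‖q.2‖) * ampWeight m (N + 1))
      = ampWeight m N := by
    ext q
    simp only [Pi.mul_apply, ampWeight]
    have : 0 < 1 + ‖q.2‖ := by positivity
    field_simp
    ring
  rwa [h3] at h2

theorem bound (hΨ : Amplitude m Ψ) (N : ℕ) :
    ∃ C, ∀ q, ‖Ψ q‖ ≤ C * ampWeight m N q := by
  obtain ⟨C, hC⟩ := (hΨ N).bound
  exact ⟨C, fun q => hC q trivial⟩

theorem integrable_inv_cube : Integrable fun v : Plane => ((1 + ‖v‖) ^ 3)⁻¹ := by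
  have := integrable_one_add_norm (E := Plane) (μ := volume) (r := 3) (by simp; norm_num)
  refine this.congr (Filter.Eventually.of_forall fun v => ?_)
  simp only
  rw [Real.rpow_neg (by positivity)]
  norm_cast

theorem integrable_osc (hΨ : Amplitude m Ψ) (ε : ℝ) (p : Plane × Plane) :
    Integrable fun v => osc ε p.1 v • Ψ (p, v) := by
  obtain ⟨C, hC⟩ := hΨ.bound 3
  have hc : Continuous fun v => osc ε p.1 v • Ψ (p, v) :=
    ((contDiff_osc ε).continuous.comp (by fun_prop : Continuous fun v : Plane => (p.1, v))).smul
      (hΨ.contDiff.continuous.comp (by fun_prop))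
  refine (integrable_inv_cube.const_mul (C * (1 + ‖p.1‖) ^ m)).mono' hc.aestronglyMeasurable
    (Filter.Eventually.of_forall fun v => ?_)
  rw [norm_smul, norm_osc, one_mul]
  exact (hC (p, v)).trans (by simp only [ampWeight]; rw [mul_assoc])

/-- The full amplitude, with its phase. -/
theorem dirDeriv_osc (hΨ : Amplitude m Ψ) (ε : ℝ) (q w : (Plane × Plane) × Plane) :
    _root_.dirDeriv w (fun q => osc ε q.1.1 q.2 • Ψ q) q =
      osc ε q.1.1 q.2 • _root_.dirDeriv w Ψ q +
      ((Complex.I * ((ε * (⟪q.1.1, w.2⟫ + ⟪w.1.1, q.2⟫) : ℝ) : ℂ)) * osc ε q.1.1 q.2) • Ψ q := by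
  have h0 : HasFDerivAt (fun q : (Plane × Plane) × Plane => (q.1.1, q.2)) _ q :=
    ((ContinuousLinearMap.fst ℝ Plane Plane).comp
      (ContinuousLinearMap.fst ℝ (Plane × Plane) Plane)).hasFDerivAt.prodMk hasFDerivAt_snd
  have h1 := ((contDiff_osc ε).differentiable (by simp) (q.1.1, q.2)).hasFDerivAt.comp
    (f := fun q : (Plane × Plane) × Plane => (q.1.1, q.2)) q h0
  have h2 := h1.smul (hΨ.differentiableAt q).hasFDerivAt
  simp only [_root_.dirDeriv]
  rw [HasFDerivAt.fderiv (f := fun q : (Plane × Plane) × Plane => osc ε q.1.1 q.2 • Ψ q) h2]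
  simp [fderiv_osc]

theorem contDiff_osc_smul (hΨ : Amplitude m Ψ) (ε : ℝ) :
    ContDiff ℝ ∞ (fun q => osc ε q.1.1 q.2 • Ψ q) :=
  ((contDiff_osc ε).comp (by fun_prop : ContDiff ℝ ∞ fun q : (Plane × Plane) × Plane =>
    (q.1.1, q.2))).smul hΨ.contDiff

/-- A derivative in x brings down the factor iεv_j, of size 1 + |v|; a derivative in y annihilates
the phase. -/
theorem weightedSmooth_osc (ε : ℝ) :
    WeightedSmooth (fun i => ((pairBasis i, 0) : (Plane × Plane) × Plane)) Set.univ
      (fun _ q => 1 + ‖q.2‖) (fun _ => 1) (fun q => osc ε q.1.1 q.2) := by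
  have hs : ContDiff ℝ ∞ fun q : (Plane × Plane) × Plane => osc ε q.1.1 q.2 :=
    ContDiff.comp (g := fun q : Plane × Plane => osc ε q.1 q.2)
      (f := fun q : (Plane × Plane) × Plane => (q.1.1, q.2)) (contDiff_osc ε) (by fun_prop)
  have hlin : ∀ i, WeightedSmooth (fun i => ((pairBasis i, 0) : (Plane × Plane) × Plane)) Set.univ
      (fun _ q => 1 + ‖q.2‖) (fun q => 1 + ‖q.2‖)
      (fun q => Complex.I * ((ε * ⟪(pairBasis i).1, q.2⟫ : ℝ) : ℂ)) := by
    intro i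
    obtain ⟨L, hL⟩ : ∃ L : (Plane × Plane) × Plane →L[ℝ] ℂ, ∀ q,
        L q = Complex.I * ((ε * ⟪(pairBasis i).1, q.2⟫ : ℝ) : ℂ) :=
      ⟨(Complex.I • Complex.ofRealCLM).comp ((ε • innerSL ℝ (pairBasis i).1).comp
        (ContinuousLinearMap.snd ℝ (Plane × Plane) Plane)), fun q => by simp; ring⟩
    simp only [← hL]
    have hd : ∀ k, _root_.dirDeriv ((pairBasis k, 0) : (Plane × Plane) × Plane) L = fun _ => 0 := by
      intro k
      ext q
      simp [_root_.dirDeriv, hL]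
    have hb : ∃ C, ∀ q ∈ (Set.univ : Set ((Plane × Plane) × Plane)), ‖L q‖ ≤ C * (1 + ‖q.2‖) := by
      refine ⟨|ε| * ‖(pairBasis i).1‖, fun q _ => ?_⟩
      rw [hL, norm_mul, Complex.norm_I, one_mul, Complex.norm_real, norm_mul, Real.norm_eq_abs,
        mul_assoc]
      refine mul_le_mul_of_nonneg_left ((norm_inner_le_norm _ _).trans ?_) (abs_nonneg _)
      exact mul_le_mul_of_nonneg_left (by linarith) (norm_nonneg _)
    refine WeightedSmooth.of_deriv L.contDiff.contDiffOn hb fun k => ?_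
    rw [hd k]
    exact WeightedSmooth.zero_fun (fun q _ => by simp only [Pi.mul_apply]; positivity)
        (fun _ q _ => by positivity)
  refine ⟨hs.contDiffOn, fun n => ?_⟩
  induction n with
  | zero => exact ⟨1, fun q _ => by simp [norm_osc]⟩
  | succ n ih =>
    refine ⟨⟨1, fun q _ => by simp [norm_osc]⟩, fun i => ?_⟩
    have h1 := ((hlin i).words n).bilin isOpen_univ (ContinuousLinearMap.mul ℝ ℂ)
      (hlin i).smooth hs.contDiffOn ih
    rw [mul_comm] at h1
    refine h1.congr isOpen_univ fun q _ => ?_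
    have h0 : HasFDerivAt (fun q : (Plane × Plane) × Plane => (q.1.1, q.2)) _ q :=
      ((ContinuousLinearMap.fst ℝ Plane Plane).comp
        (ContinuousLinearMap.fst ℝ (Plane × Plane) Plane)).hasFDerivAt.prodMk hasFDerivAt_snd
    have h1 := ((contDiff_osc ε).differentiable (by simp) (q.1.1, q.2)).hasFDerivAt.comp
      (f := fun q : (Plane × Plane) × Plane => (q.1.1, q.2)) q h0
    simp only [_root_.dirDeriv]
    rw [HasFDerivAt.fderiv (f := fun q : (Plane × Plane) × Plane => osc ε q.1.1 q.2) h1]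
    simp [fderiv_osc]

theorem locallyDominated (hΨ : Amplitude m Ψ) (ε : ℝ) :
    LocallyDominated pairBasis Set.univ (fun v => (1 + ‖v‖) ^ 3)
      (fun q => osc ε q.1.1 q.2 • Ψ q) := by
  refine ⟨(hΨ.contDiff_osc_smul ε).contDiffOn, fun n p₀ _ => ?_⟩
  refine ⟨Metric.ball p₀ 1, Metric.isOpen_ball, Metric.mem_ball_self one_pos,
    Set.subset_univ _, ?_⟩
  -- Differentiating the phase n times costs (1 + |v|)^n; the three further powers of decay are what
  -- integrability over the plane requires.
  have h1 := ((hΨ (n + 3)).comp_linear isOpen_univ (fun p _ => (ampWeight_pos m _ p).le)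
    (ContinuousLinearMap.id ℝ ((Plane × Plane) × Plane)) (fun i => (pairBasis i, 0)))
  have h2 : WeightedSmooth (fun i => ((pairBasis i, 0) : (Plane × Plane) × Plane)) Set.univ
      (fun _ q => 1 + ‖q.2‖) (ampWeight m (n + 3)) Ψ :=
    h1.mono (fun _ _ _ => zero_le_one) (fun _ q _ => by linarith [norm_nonneg q.2])
      (fun p _ => (ampWeight_pos m _ p).le) subset_rfl (fun p _ => (ampWeight_pos m _ p).le)
      ⟨1, fun p _ => by simp⟩
  have h3' := ((weightedSmooth_osc ε).smul isOpen_univ h2).words n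
  have h3 := h3'.to_one (H := fun q : (Plane × Plane) × Plane => 1 + ‖q.2‖)
    (by intro _ q _; positivity) (fun _ _ _ => le_rfl)
    (by intro q _; linarith [norm_nonneg q.2])
    (by intro q _; simpa using (ampWeight_pos m _ q).le)
  -- On the unit ball around p₀ the growth factor (1 + |x|)^m is at most (2 + ‖p₀.1‖)^m.
  refine h3.mono (fun _ _ _ => zero_le_one) (fun _ _ _ => le_rfl) (fun q _ => ?_)
    (Set.subset_univ _) (fun q _ => by positivity) ⟨(2 + ‖p₀.1‖) ^ m, fun q hq => ?_⟩
  · have := ampWeight_pos m (n + 3) q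
    simp only [Pi.mul_apply, Pi.pow_apply]; positivity
  · simp only [Pi.mul_apply, Pi.pow_apply, one_mul, ampWeight]
    have hq1 : ‖q.1.1‖ ≤ 1 + ‖p₀.1‖ := by
      have h4 : ‖q.1 - p₀‖ < 1 := by simpa [dist_eq_norm] using hq.1
      have h5 : ‖q.1.1 - p₀.1‖ ≤ ‖q.1 - p₀‖ := norm_fst_le (q.1 - p₀)
      have h6 := norm_add_le (q.1.1 - p₀.1) p₀.1
      rw [sub_add_cancel] at h6
      linarith
    have h7 : 0 < 1 + ‖q.2‖ := by positivity
    rw [mul_assoc, pow_add, mul_inv, mul_assoc, mul_comm (((1 + ‖q.2‖) ^ 3)⁻¹), ← mul_assoc (_⁻¹),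
      inv_mul_cancel₀ (by positivity), one_mul]
    exact mul_le_mul_of_nonneg_right (pow_le_pow_left₀ (by positivity) (by linarith) m)
      (by positivity)

end Amplitude

/-- The oscillatory integral `∫ e^{i ε ⟨x, v⟩} Ψ(x, y, v) dv`. -/
noncomputable def oscIntegral (ε : ℝ) (Ψ : (Plane × Plane) × Plane → F) (p : Plane × Plane) : F :=
  ∫ v, osc ε p.1 v • Ψ (p, v)

namespace Amplitude

theorem contDiff_oscIntegral (hΨ : Amplitude m Ψ) (ε : ℝ) : ContDiff ℝ ∞ (oscIntegral ε Ψ) := by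
  have : FiniteDimensional ℝ (Plane × Plane) := inferInstance
  exact contDiffOn_univ.1 ((hΨ.locallyDominated ε).contDiffOn_integral isOpen_univ (by fun_prop)
    (fun v => by positivity) integrable_inv_cube)

/-- The amplitude of the derivative of an oscillatory integral. -/
noncomputable def derivAmp (ε : ℝ) (i : Fin 2 ⊕ Fin 2) (Ψ : (Plane × Plane) × Plane → F) :
    (Plane × Plane) × Plane → F :=
  fun q => _root_.dirDeriv (quadBasis (.inl i)) Ψ q +
    Sum.elim (fun j => (Complex.I * ε) • (((q.2 j : ℝ) : ℂ) • Ψ q)) (fun _ => 0) i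

theorem derivAmp_amplitude (hΨ : Amplitude m Ψ) (ε : ℝ) (i) : Amplitude m (derivAmp ε i Ψ) := by
  rcases i with j | j
  · exact (hΨ.dirDeriv _).add ((hΨ.coord_smul j).const_smul _)
  · have := hΨ.dirDeriv (quadBasis (.inl (.inr j)))
    convert this using 1
    ext q
    simp [derivAmp]

theorem dirDeriv_osc_eq (hΨ : Amplitude m Ψ) (ε : ℝ) (i) (q : (Plane × Plane) × Plane) :
    _root_.dirDeriv (pairBasis i, 0) (fun q => osc ε q.1.1 q.2 • Ψ q) q =
      osc ε q.1.1 q.2 • derivAmp ε i Ψ q := by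
  rw [hΨ.dirDeriv_osc, derivAmp, quadBasis_inl, smul_add]
  congr 1
  rcases i with j | j
  · simp only [Sum.elim_inl, pairBasis_inl, inner_zero_right, zero_add, inner_basisVec, smul_smul]
    congr 1
    push_cast
    ring
  · simp

theorem dirDeriv_oscIntegral (hΨ : Amplitude m Ψ) (ε : ℝ) (i) :
    _root_.dirDeriv (pairBasis i) (oscIntegral ε Ψ) = oscIntegral ε (derivAmp ε i Ψ) := by
  have : FiniteDimensional ℝ (Plane × Plane) := inferInstance
  ext p
  have h1 := (hΨ.locallyDominated ε).dirDeriv_integral isOpen_univ (by fun_prop)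
    (fun v => by positivity) integrable_inv_cube (Set.mem_univ p) i
  refine h1.trans ?_
  simp only [hΨ.dirDeriv_osc_eq]
  rfl

/-- Integration by parts in v: the derivative of the phase along v_j is iεx_j times the phase, and
1/(iε) = -iε because ε² = 1. -/
theorem coord_smul_oscIntegral (hΨ : Amplitude m Ψ) {ε : ℝ} (hε : ε ^ 2 = 1) (j : Fin 2)
    (p : Plane × Plane) : ((p.1 j : ℝ) : ℂ) • oscIntegral ε Ψ p =
      oscIntegral ε (fun q => (Complex.I * ε) • _root_.dirDeriv (quadBasis (.inr j)) Ψ q) p := by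
  have hslice : ∀ v, HasFDerivAt (fun v => Ψ (p, v))
      ((fderiv ℝ Ψ (p, v)).comp (.inr ℝ (Plane × Plane) Plane)) v := fun v =>
    (hΨ.differentiableAt (p, v)).hasFDerivAt.comp v (hasFDerivAt_prodMk_right p v)
  have hosc : ∀ v, HasFDerivAt (fun v => osc ε p.1 v)
      ((fderiv ℝ (fun q : Plane × Plane => osc ε q.1 q.2) (p.1, v)).comp
        (.inr ℝ Plane Plane)) v := fun v =>
    HasFDerivAt.comp (f := fun v => (p.1, v)) v
      ((contDiff_osc ε).differentiable (by simp) (p.1, v)).hasFDerivAt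
      (hasFDerivAt_prodMk_right p.1 v)
  have e1 : ∀ v, fderiv ℝ (fun v => Ψ (p, v)) v (basisVec j) =
      _root_.dirDeriv (quadBasis (.inr j)) Ψ (p, v) := fun v => by
    rw [(hslice v).fderiv]
    simp [_root_.dirDeriv]
  have e2 : ∀ v, fderiv ℝ (fun v => osc ε p.1 v) v (basisVec j) =
      (Complex.I * ε * ((p.1 j : ℝ) : ℂ)) * osc ε p.1 v := fun v => by
    rw [(hosc v).fderiv]
    simp only [ContinuousLinearMap.comp_apply, ContinuousLinearMap.inr_apply, fderiv_osc,
      inner_basisVec_right, inner_zero_left, add_zero]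
    push_cast
    ring
  have h := integral_smul_fderiv_eq_neg_fderiv_smul_of_integrable (μ := volume)
    (f := fun v => osc ε p.1 v) (g := fun v => Ψ (p, v)) (v := basisVec j) ?_ ?_
    (hΨ.integrable_osc ε p) (fun v _ => (hosc v).differentiableAt)
    (fun v _ => (hslice v).differentiableAt)
  · simp only [e1, e2, mul_smul] at h
    rw [integral_smul, integral_smul, integral_smul] at h
    simp only [oscIntegral]
    rw [show (fun v => osc ε p.1 v • (Complex.I * (ε : ℂ)) •
      _root_.dirDeriv (quadBasis (.inr j)) Ψ (p, v)) = fun v => (Complex.I * (ε : ℂ)) • osc ε p.1 v •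
      _root_.dirDeriv (quadBasis (.inr j)) Ψ (p, v) from funext fun v => smul_comm _ _ _,
      integral_smul, h, smul_neg, smul_smul, smul_smul, ← neg_smul, smul_smul]
    congr 1
    have hε' : (ε : ℂ) ^ 2 = 1 := by exact_mod_cast hε
    linear_combination (p.1 j : ℂ) * ((ε : ℂ) ^ 2 * Complex.I_sq - hε')
  · simp only [e2, mul_smul]
    exact (((hΨ.integrable_osc ε p).smul ((p.1 j : ℝ) : ℂ)).smul (ε : ℂ)).smul Complex.I
  · simp only [e1]
    exact (hΨ.dirDeriv _).integrable_osc ε p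

theorem bound_oscIntegral (hΨ : Amplitude m Ψ) (ε : ℝ) :
    ∃ C, ∀ p, ‖oscIntegral ε Ψ p‖ ≤ C * (1 + ‖p.1‖) ^ m := by
  obtain ⟨C, hC⟩ := hΨ.bound 3
  refine ⟨C * ∫ v : Plane, ((1 + ‖v‖) ^ 3)⁻¹, fun p => ?_⟩
  calc ‖oscIntegral ε Ψ p‖ ≤ ∫ v : Plane, (C * (1 + ‖p.1‖) ^ m) * ((1 + ‖v‖) ^ 3)⁻¹ := by
        refine norm_integral_le_of_norm_le (integrable_inv_cube.const_mul _)
          (Filter.Eventually.of_forall fun v => ?_)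
        rw [norm_smul, norm_osc, one_mul]
        exact (hC (p, v)).trans (by simp only [ampWeight]; rw [mul_assoc])
    _ = _ := by rw [integral_const_mul]; ring

/-- Functions on `ℝ² × ℝ²` rapidly decreasing in the first variable. -/
def _root_.Rapid (φ : Plane × Plane → F) : Prop :=
  ∀ N : ℕ, WeightedSmooth pairBasis Set.univ (fun _ _ => 1) (fun p => ((1 + ‖p.1‖) ^ N)⁻¹) φ

/-- Each factor x_j is exchanged for a derivative of the amplitude, which is again an amplitude with
the same growth exponent m. Using N + m factors overcomes the growth (1 + |x|)^m and leaves decay of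
order N. -/
theorem bound_rapid (hΨ : Amplitude m Ψ) {ε : ℝ} (hε : ε ^ 2 = 1) (N : ℕ) :
    ∃ C, ∀ p, ‖oscIntegral ε Ψ p‖ ≤ C * ((1 + ‖p.1‖) ^ N)⁻¹ := by
  have key : ∀ N : ℕ, ∀ Ψ : (Plane × Plane) × Plane → F, Amplitude m Ψ →
      ∃ C, ∀ p, (1 + ‖p.1‖) ^ N * ‖oscIntegral ε Ψ p‖ ≤ C * (1 + ‖p.1‖) ^ m := by
    intro N
    induction N with
    | zero => intro Ψ hΨ; simpa using hΨ.bound_oscIntegral ε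
    | succ N ih =>
      intro Ψ hΨ
      obtain ⟨C, hC⟩ := ih Ψ hΨ
      choose D hD using fun j => ih _ ((hΨ.dirDeriv (quadBasis (.inr j))).const_smul
        (Complex.I * ε))
      refine ⟨C + (D 0 + D 1), fun p => ?_⟩
      have h1 : ‖p.1‖ ≤ ‖p.1 0‖ + ‖p.1 1‖ := by
        rw [EuclideanSpace.norm_eq, Fin.sum_univ_two]
        refine Real.sqrt_le_iff.2 ⟨by positivity, ?_⟩
        nlinarith [norm_nonneg (p.1 0), norm_nonneg (p.1 1)]
      have h2 : ∀ j, (1 + ‖p.1‖) ^ N * (‖p.1 j‖ * ‖oscIntegral ε Ψ p‖) ≤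
          D j * (1 + ‖p.1‖) ^ m := by
        intro j
        have := hD j p
        rw [← hΨ.coord_smul_oscIntegral hε, norm_smul, Complex.norm_real] at this
        exact this
      have hn := norm_nonneg (oscIntegral ε Ψ p)
      have hp : 0 ≤ (1 + ‖p.1‖) ^ N := by positivity
      calc (1 + ‖p.1‖) ^ (N + 1) * ‖oscIntegral ε Ψ p‖
          = (1 + ‖p.1‖) ^ N * ‖oscIntegral ε Ψ p‖
            + (1 + ‖p.1‖) ^ N * (‖p.1‖ * ‖oscIntegral ε Ψ p‖) := by ring
        _ ≤ (1 + ‖p.1‖) ^ N * ‖oscIntegral ε Ψ p‖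
            + (1 + ‖p.1‖) ^ N * ((‖p.1 0‖ + ‖p.1 1‖) * ‖oscIntegral ε Ψ p‖) := by gcongr
        _ = (1 + ‖p.1‖) ^ N * ‖oscIntegral ε Ψ p‖
            + ((1 + ‖p.1‖) ^ N * (‖p.1 0‖ * ‖oscIntegral ε Ψ p‖)
            + (1 + ‖p.1‖) ^ N * (‖p.1 1‖ * ‖oscIntegral ε Ψ p‖)) := by ring
        _ ≤ C * (1 + ‖p.1‖) ^ m + (D 0 * (1 + ‖p.1‖) ^ m + D 1 * (1 + ‖p.1‖) ^ m) :=
            add_le_add (hC p) (add_le_add (h2 0) (h2 1))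
        _ = _ := by ring
  obtain ⟨C, hC⟩ := key (N + m) Ψ hΨ
  refine ⟨C, fun p => ?_⟩
  have h0 : 0 < 1 + ‖p.1‖ := by positivity
  have := hC p
  rw [pow_add, mul_comm ((1 + ‖p.1‖) ^ N), mul_assoc, mul_comm C] at this
  have h2 := le_of_mul_le_mul_left this (by positivity)
  rw [← div_eq_mul_inv, le_div_iff₀ (by positivity), mul_comm]
  exact h2

theorem rapid_oscIntegral (hΨ : Amplitude m Ψ) {ε : ℝ} (hε : ε ^ 2 = 1) :
    Rapid (oscIntegral ε Ψ) := by
  intro N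
  refine ⟨(hΨ.contDiff_oscIntegral ε).contDiffOn, fun n => ?_⟩
  induction n generalizing Ψ with
  | zero => exact (hΨ.bound_rapid hε N).imp fun C h p _ => h p
  | succ n ih =>
    refine ⟨(hΨ.bound_rapid hε N).imp fun C h p _ => h p, fun i => ?_⟩
    rw [hΨ.dirDeriv_oscIntegral]
    rw [show ((fun p : Plane × Plane => ((1 + ‖p.1‖) ^ N)⁻¹) * fun _ => (1 : ℝ)) =
      fun p : Plane × Plane => ((1 + ‖p.1‖) ^ N)⁻¹ by ext; simp]
    exact ih (hΨ.derivAmp_amplitude ε i)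

end Amplitude

end Oscillatory

/-! ### The Schwartz space and its Fourier transform. -/

namespace PlaneAction

open MeasureTheory
open scoped RealInnerProductSpace

variable {A : Type*} [CStarAlgebra A] (α : PlaneAction A)

/-- The function `(x, y) ↦ α_y(u(x))`. -/
noncomputable def pairLift (u : Plane → A) : Plane × Plane → A := fun p => α.act p.2 (u p.1)

/-- The derivation `δ_j` applied pointwise. -/
noncomputable def derFun₁ (j : Fin 2) (u : Plane → A) : Plane → A := fun x => α.der j (u x)

variable {α} {u v : Plane → A}

theorem pairLift_zero (u : Plane → A) (x : Plane) : α.pairLift u (x, 0) = u x := α.act_zero _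

theorem hasFDerivAt_of_pairLift (hu : ContDiff ℝ ∞ (α.pairLift u)) (x y : Plane) :
    HasFDerivAt u ((α.actL (-y)).comp ((fderiv ℝ (α.pairLift u) (x, y)).comp
      (.inl ℝ Plane Plane))) x := by
  have h1 := (hu.differentiable (by simp) (x, y)).hasFDerivAt
  have h3 := (α.actL (-y)).hasFDerivAt.comp x
    (h1.comp (f := fun x => (x, y)) x (hasFDerivAt_prodMk_left x y))
  refine h3.congr_of_eventuallyEq (Filter.Eventually.of_forall fun q => ?_)
  simp [pairLift, α.act_neg_act]

theorem isSmooth_of_pairLift (hu : ContDiff ℝ ∞ (α.pairLift u)) (x : Plane) :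
    α.IsSmooth (u x) :=
  ContDiff.comp (g := α.pairLift u) (f := fun y => (x, y)) hu (by fun_prop)

theorem pairLift_partialX (hu : ContDiff ℝ ∞ (α.pairLift u)) (j : Fin 2) :
    dirDeriv (pairBasis (.inl j)) (α.pairLift u) = α.pairLift (partialX j u) := by
  ext ⟨x, y⟩
  simp only [pairLift, partialX, dirDeriv]
  rw [(hasFDerivAt_of_pairLift hu x y).fderiv]
  simp [α.act_act_neg]

theorem pairLift_derFun (hu : ContDiff ℝ ∞ (α.pairLift u)) (j : Fin 2) :
    dirDeriv (pairBasis (.inr j)) (α.pairLift u) =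
      fun p => (-Complex.I) • α.pairLift (α.derFun₁ j u) p := by
  ext ⟨x, y⟩
  simp only [pairLift, derFun₁, dirDeriv]
  rw [act_der (isSmooth_of_pairLift hu x)]
  have h1 := (hu.differentiable (by simp) (x, y)).hasFDerivAt
  have h3 := h1.comp (f := fun y => (x, y)) y (hasFDerivAt_prodMk_right x y)
  rw [HasFDerivAt.fderiv (f := fun y => α.act y (u x)) h3, smul_smul]
  simp

theorem contDiff_partialX (hu : ContDiff ℝ ∞ (α.pairLift u)) (j : Fin 2) :
    ContDiff ℝ ∞ (α.pairLift (partialX j u)) := by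
  rw [← pairLift_partialX hu]
  exact contDiffOn_univ.1 (ContDiffOn.dirDeriv isOpen_univ hu.contDiffOn _)

theorem contDiff_derFun (hu : ContDiff ℝ ∞ (α.pairLift u)) (j : Fin 2) :
    ContDiff ℝ ∞ (α.pairLift (α.derFun₁ j u)) := by
  have h : α.pairLift (α.derFun₁ j u) =
      fun p => Complex.I • dirDeriv (pairBasis (.inr j)) (α.pairLift u) p := by
    ext p
    rw [pairLift_derFun hu, smul_smul]
    simp
  rw [h]
  exact (contDiffOn_univ.1 (ContDiffOn.dirDeriv isOpen_univ hu.contDiffOn _)).const_smul _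

theorem pairLift_injective {u v : Plane → A} (h : α.pairLift u = α.pairLift v) : u = v := by
  ext x
  rw [← pairLift_zero (α := α) u x, h, pairLift_zero]

theorem dirDeriv_comm {E F : Type*} [NormedAddCommGroup E] [NormedSpace ℝ E]
    [NormedAddCommGroup F] [NormedSpace ℝ F] {φ : E → F} (hφ : ContDiff ℝ ∞ φ) (v w : E) :
    dirDeriv v (dirDeriv w φ) = dirDeriv w (dirDeriv v φ) := by
  ext p
  have h1 : DifferentiableAt ℝ (fderiv ℝ φ) p :=
    (ContDiff.fderiv_right (m := ∞) hφ (by simp)).differentiable (by simp) p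
  have key : ∀ v w, dirDeriv v (dirDeriv w φ) p = fderiv ℝ (fderiv ℝ φ) p v w := by
    intro v w
    change fderiv ℝ (fun y => fderiv ℝ φ y w) p v = _
    rw [fderiv_clm_apply h1 (differentiableAt_const _)]
    simp
  rw [key, key]
  exact (hφ.contDiffAt.isSymmSndFDerivAt (by
    rw [minSmoothness_of_isRCLikeNormedField]
    exact WithTop.coe_le_coe.2 (le_top : (2 : ℕ∞) ≤ ⊤))) _ _

/-- The elementary operators on the Schwartz space. -/
noncomputable def schOp (α : PlaneAction A) : Fin 2 ⊕ Fin 2 → (Plane → A) → (Plane → A) :=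
  Sum.elim (fun j => partialX j) (fun j => α.derFun₁ j)

theorem contDiff_schOp (hu : ContDiff ℝ ∞ (α.pairLift u)) (i) :
    ContDiff ℝ ∞ (α.pairLift (α.schOp i u)) := by
  rcases i with j | j
  · exact contDiff_partialX hu j
  · exact contDiff_derFun hu j

theorem dirDeriv_pairLift (hu : ContDiff ℝ ∞ (α.pairLift u)) (i : Fin 2 ⊕ Fin 2) :
    dirDeriv (pairBasis i) (α.pairLift u) = fun p =>
      (Sum.elim (fun _ => 1) (fun _ => -Complex.I) i : ℂ) • α.pairLift (α.schOp i u) p := by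
  rcases i with j | j
  · rw [pairLift_partialX hu j]
    ext p
    simp [schOp]
  · exact pairLift_derFun hu j

theorem pairLift_schOp (hu : ContDiff ℝ ∞ (α.pairLift u)) (i : Fin 2 ⊕ Fin 2) :
    α.pairLift (α.schOp i u) = fun p =>
      (Sum.elim (fun _ => 1) (fun _ => Complex.I) i : ℂ) •
        dirDeriv (pairBasis i) (α.pairLift u) p := by
  ext p
  rw [dirDeriv_pairLift hu, smul_smul]
  rcases i with j | j <;> simp

theorem schOp_comm (hu : ContDiff ℝ ∞ (α.pairLift u)) (i k) :
    α.schOp i (α.schOp k u) = α.schOp k (α.schOp i u) := by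
  refine pairLift_injective (α := α) ?_
  have key : ∀ i k, α.pairLift (α.schOp i (α.schOp k u)) = fun p =>
      ((Sum.elim (fun _ => 1) (fun _ => Complex.I) i : ℂ) *
        (Sum.elim (fun _ => 1) (fun _ => Complex.I) k : ℂ)) •
        dirDeriv (pairBasis i) (dirDeriv (pairBasis k) (α.pairLift u)) p := by
    intro i k
    rw [pairLift_schOp (contDiff_schOp hu k)]
    ext p
    rw [mul_smul]
    congr 1
    rw [pairLift_schOp hu k]
    have h1 : ContDiff ℝ ∞ (dirDeriv (pairBasis k) (α.pairLift u)) :=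
      contDiffOn_univ.1 (ContDiffOn.dirDeriv isOpen_univ hu.contDiffOn _)
    change fderiv ℝ (fun p => (Sum.elim (fun _ => 1) (fun _ => Complex.I) k : ℂ) •
      dirDeriv (pairBasis k) (α.pairLift u) p) p (pairBasis i) = _
    rw [fderiv_fun_const_smul (h1.differentiable (by simp) p)]
    rfl
  rw [key, key, dirDeriv_comm hu]
  ext p
  rw [mul_comm]

theorem contDiff_iterate (i : Fin 2 ⊕ Fin 2) (n : ℕ) (hu : ContDiff ℝ ∞ (α.pairLift u)) :
    ContDiff ℝ ∞ (α.pairLift ((α.schOp i)^[n] u)) := by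
  induction n generalizing u with
  | zero => exact hu
  | succ n ih => exact ih (contDiff_schOp hu i)

theorem iterate_schOp (i k : Fin 2 ⊕ Fin 2) (n : ℕ) (hu : ContDiff ℝ ∞ (α.pairLift u)) :
    (α.schOp i)^[n] (α.schOp k u) = α.schOp k ((α.schOp i)^[n] u) := by
  induction n generalizing u with
  | zero => rfl
  | succ n ih =>
    rw [Function.iterate_succ_apply, Function.iterate_succ_apply, schOp_comm hu,
      ih (contDiff_schOp hu i)]

/-- Ordered words in the elementary operators. -/
noncomputable def schWord (α : PlaneAction A) (β γ : Fin 2 → ℕ) (u : Plane → A) : Plane → A :=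
  (α.schOp (.inr 0))^[γ 0] ((α.schOp (.inr 1))^[γ 1]
    ((α.schOp (.inl 0))^[β 0] ((α.schOp (.inl 1))^[β 1] u)))

theorem schWord_apply (β γ : Fin 2 → ℕ) (u : Plane → A) (x : Plane) :
    α.schWord β γ u x = α.derPow γ ((partialX 0)^[β 0] ((partialX 1)^[β 1] u) x) := by
  have hder : ∀ (j : Fin 2) (n : ℕ) (f : Plane → A) x,
      (α.schOp (.inr j))^[n] f x = (α.der j)^[n] (f x) := by
    intro j n
    induction n with
    | zero => intros; rfl
    | succ n ih => intro f x; rw [Function.iterate_succ_apply, ih]; rfl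
  rw [schWord, hder, hder, derPow]
  rfl

/-- Schwartz decay is stated for derivatives in one fixed order. The elementary operators commute,
so a new one can be moved to its place, where it raises an exponent by one. -/
theorem schWord_schOp (hu : ContDiff ℝ ∞ (α.pairLift u)) (β γ : Fin 2 → ℕ) (i) :
    ∃ β' γ', α.schWord β γ (α.schOp i u) = α.schWord β' γ' u := by
  rcases i with j | j <;> fin_cases j
  · refine ⟨![β 0 + 1, β 1], γ, ?_⟩
    change α.schWord β γ (α.schOp (.inl 0) u) = _
    rw [schWord, iterate_schOp _ _ _ hu, ← Function.iterate_succ_apply]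
    rfl
  · exact ⟨![β 0, β 1 + 1], γ, rfl⟩
  · refine ⟨β, ![γ 0 + 1, γ 1], ?_⟩
    change α.schWord β γ (α.schOp (.inr 0) u) = _
    have h1 := contDiff_iterate (.inl 1) (β 1) hu
    have h2 := contDiff_iterate (.inl 0) (β 0) h1
    rw [schWord, iterate_schOp _ _ _ hu, iterate_schOp _ _ _ h1, iterate_schOp _ _ _ h2,
      ← Function.iterate_succ_apply]
    rfl
  · refine ⟨β, ![γ 0, γ 1 + 1], ?_⟩
    change α.schWord β γ (α.schOp (.inr 1) u) = _
    have h1 := contDiff_iterate (.inl 1) (β 1) hu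
    rw [schWord, iterate_schOp _ _ _ hu, iterate_schOp _ _ _ h1, ← Function.iterate_succ_apply]
    rfl

theorem IsSchwartz.schOp (hu : α.IsSchwartz u) (i) : α.IsSchwartz (α.schOp i u) := by
  refine ⟨contDiff_schOp hu.smooth i, fun N β γ => ?_⟩
  obtain ⟨β', γ', h⟩ := schWord_schOp hu.smooth β γ i
  obtain ⟨C, hC⟩ := hu.decay N β' γ'
  refine ⟨C, fun x => ?_⟩
  rw [← schWord_apply, h, schWord_apply]
  exact hC x

theorem IsSchwartz.bound (hu : α.IsSchwartz u) (N : ℕ) :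
    ∃ C, ∀ x, ‖u x‖ ≤ C * ((1 + ‖x‖) ^ N)⁻¹ := by
  obtain ⟨C, hC⟩ := hu.decay 0 0 0
  obtain ⟨D, hD⟩ := hu.decay N 0 0
  -- The power of two comes from (1 + |x|)^N ≤ 2^(N-1) (1 + |x|^N).
  refine ⟨2 ^ (N - 1) * (C + D), fun x => ?_⟩
  have h1 : ‖u x‖ ≤ C := by simpa [derPow] using hC x
  have h2 : ‖x‖ ^ N * ‖u x‖ ≤ D := by simpa [derPow] using hD x
  have h3 := add_pow_le zero_le_one (norm_nonneg x) N
  rw [← div_eq_mul_inv, le_div_iff₀ (by positivity), mul_comm]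
  calc (1 + ‖x‖) ^ N * ‖u x‖ ≤ (2 ^ (N - 1) * (1 ^ N + ‖x‖ ^ N)) * ‖u x‖ := by gcongr
    _ = 2 ^ (N - 1) * (‖u x‖ + ‖x‖ ^ N * ‖u x‖) := by ring
    _ ≤ _ := by gcongr

theorem IsSchwartz.rapid (hu : α.IsSchwartz u) : Rapid (α.pairLift u) := by
  intro N
  refine ⟨hu.smooth.contDiffOn, fun n => ?_⟩
  have hb : ∀ u, α.IsSchwartz u → ∃ C, ∀ p ∈ (Set.univ : Set (Plane × Plane)),
      ‖α.pairLift u p‖ ≤ C * ((1 + ‖p.1‖) ^ N)⁻¹ := by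
    intro u hu
    obtain ⟨C, hC⟩ := hu.bound N
    exact ⟨C, fun p _ => by rw [pairLift, α.norm_act]; exact hC p.1⟩
  induction n generalizing u with
  | zero => exact hb u hu
  | succ n ih =>
    refine ⟨hb u hu, fun i => ?_⟩
    rw [show ((fun p : Plane × Plane => ((1 + ‖p.1‖) ^ N)⁻¹) * fun _ => (1 : ℝ)) =
      fun p : Plane × Plane => ((1 + ‖p.1‖) ^ N)⁻¹ by ext; simp, dirDeriv_pairLift hu.smooth]
    exact (ih (hu.schOp i)).clm isOpen_univ (ContinuousLinearMap.restrictScalars ℝ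
      ((Sum.elim (fun _ => 1) (fun _ => -Complex.I) i : ℂ) • ContinuousLinearMap.id ℂ A))
      (hu.schOp i).smooth.contDiffOn

theorem rapid_schOp (hu : Rapid (α.pairLift u)) (i) : Rapid (α.pairLift (α.schOp i u)) := by
  intro N
  rw [pairLift_schOp (contDiffOn_univ.1 (hu 0).smooth)]
  exact ((hu N).deriv_one isOpen_univ i).const_smul isOpen_univ _

theorem isSchwartz_of_rapid (hu : Rapid (α.pairLift u)) : α.IsSchwartz u := by
  refine ⟨contDiffOn_univ.1 (hu 0).smooth, fun N β γ => ?_⟩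
  have hit : ∀ i n u, Rapid (α.pairLift u) → Rapid (α.pairLift ((α.schOp i)^[n] u)) := by
    intro i n
    induction n with
    | zero => intro u hu; exact hu
    | succ n ih => intro u hu; exact ih _ (rapid_schOp hu i)
  have h : Rapid (α.pairLift (α.schWord β γ u)) :=
    hit _ _ _ (hit _ _ _ (hit _ _ _ (hit _ _ _ hu)))
  obtain ⟨C, hC⟩ := (h N).bound
  refine ⟨C, fun x => ?_⟩
  have h1 := hC (x, 0) trivial
  rw [pairLift_zero] at h1
  rw [← schWord_apply]
  have h2 : 0 < (1 + ‖x‖) ^ N := by positivity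
  rw [← div_eq_mul_inv, le_div_iff₀ h2] at h1
  refine le_trans ?_ h1
  rw [mul_comm]
  gcongr
  linarith

/-- This form treats derivatives in x and derivations alike, as directional derivatives of the lift,
and is the one that oscillatory integrals deliver. -/
theorem isSchwartz_iff : α.IsSchwartz u ↔ Rapid (α.pairLift u) :=
  ⟨IsSchwartz.rapid, isSchwartz_of_rapid⟩

/-! ### Fourier transform of Schwartz functions -/

theorem Rapid.amplitude {φ : Plane × Plane → A} (hφ : Rapid φ) :
    Amplitude 0 (fun q => φ (q.2, q.1.2)) := by
  intro N
  have := (hφ N).comp_linear isOpen_univ (fun p _ => by positivity)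
    ((ContinuousLinearMap.snd ℝ (Plane × Plane) Plane).prod
      ((ContinuousLinearMap.snd ℝ Plane Plane).comp
        (ContinuousLinearMap.fst ℝ (Plane × Plane) Plane))) quadBasis
  refine this.mono (fun _ _ _ => zero_le_one) (fun _ _ _ => le_rfl) (fun p _ => by positivity)
    (fun _ _ => trivial) (fun p _ => (ampWeight_pos 0 N p).le) ⟨1, fun p _ => ?_⟩
  simp [ampWeight]

theorem fourierHat_eq (u : Plane → A) (ξ : Plane) :
    fourierHat u ξ = ∫ x, osc (-1) ξ x • u x := by
  unfold fourierHat osc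
  congr 1
  ext x
  rw [real_inner_comm]
  push_cast
  ring_nf

/-- Since α_y passes under the integral sign, the lift is an oscillatory integral with ε = -1 in
which y is a mere parameter of the amplitude. -/
theorem pairLift_fourierHat (hu : α.IsSchwartz u) :
    α.pairLift (fourierHat u) = oscIntegral (-1) (fun q => α.pairLift u (q.2, q.1.2)) := by
  ext ⟨ξ, y⟩
  have h1 := (Rapid.amplitude hu.rapid).integrable_osc (-1) (ξ, 0)
  simp only [pairLift, oscIntegral, α.act_zero] at h1 ⊢
  rw [fourierHat_eq, ← α.actL_apply, ← (α.actL y).integral_comp_comm h1]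
  simp [map_smul]

theorem rapid_fourierHat (hu : α.IsSchwartz u) : Rapid (α.pairLift (fourierHat u)) := by
  rw [pairLift_fourierHat hu]
  exact (Rapid.amplitude hu.rapid).rapid_oscIntegral (by norm_num)

end PlaneAction

/-- `matApply B` as a continuous linear map. -/
noncomputable def matL (B : Matrix (Fin 2) (Fin 2) ℝ) : Plane →L[ℝ] Plane :=
  LinearMap.toContinuousLinearMap
    { toFun := PlaneAction.matApply B
      map_add' := fun x y => by
        simp only [PlaneAction.matApply, WithLp.ofLp_add, Matrix.mulVec_add, WithLp.toLp_add]
      map_smul' := fun c x => by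
        simp only [PlaneAction.matApply, WithLp.ofLp_smul, Matrix.mulVec_smul, WithLp.toLp_smul,
          RingHom.id_apply] }

@[simp] theorem matL_apply (B : Matrix (Fin 2) (Fin 2) ℝ) (x : Plane) :
    matL B x = PlaneAction.matApply B x := rfl

theorem matL_coord (B : Matrix (Fin 2) (Fin 2) ℝ) (x : Plane) (j : Fin 2) :
    matL B x j = B j 0 * x 0 + B j 1 * x 1 := by
  fin_cases j <;> simp [PlaneAction.matApply]

theorem plane_inner (x y : Plane) : inner ℝ x y = x 0 * y 0 + x 1 * y 1 := by
  simp [PiLp.inner_apply, Fin.sum_univ_two, mul_comm]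

theorem skew_entries {B : Matrix (Fin 2) (Fin 2) ℝ} (hB : B.transpose = -B) :
    B 0 0 = 0 ∧ B 1 1 = 0 ∧ B 0 1 = -B 1 0 := by
  have h := fun i j => congrFun (congrFun hB i) j
  have h0 := h 0 0
  have h1 := h 1 1
  have h2 := h 1 0
  simp only [Matrix.transpose_apply, Matrix.neg_apply] at h0 h1 h2
  exact ⟨by linarith, by linarith, h2⟩

theorem inner_matL_self {B : Matrix (Fin 2) (Fin 2) ℝ} (hB : B.transpose = -B) (x : Plane) :
    inner ℝ x (matL B x) = 0 := by
  obtain ⟨h0, h1, h2⟩ := skew_entries hB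
  rw [plane_inner, matL_coord, matL_coord, h0, h1, h2]
  ring

open MeasureTheory
open scoped RealInnerProductSpace FourierTransform

/-- A dilation by 2π reduces this to the inversion formula for the phase e^{2πi⟨x,w⟩}; its Jacobian
in the plane is the normalising factor (2π)². -/
theorem integral_osc_inversion {F : Type*} [NormedAddCommGroup F] [NormedSpace ℂ F]
    [CompleteSpace F] {u : Plane → F} (hc : Continuous u) (hu : Integrable u)
    (hu' : Integrable fun ξ => ∫ x, osc (-1) ξ x • u x) (x : Plane) :
    (((2 * Real.pi) ^ 2)⁻¹ : ℝ) • ∫ ξ, osc 1 x ξ • ∫ y, osc (-1) ξ y • u y = u x := by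
  have hpi : (0 : ℝ) < 2 * Real.pi := by positivity
  have h1 : ∀ w, 𝓕 u w = ∫ y, osc (-1) ((2 * Real.pi) • w) y • u y := by
    intro w
    rw [Real.fourier_eq']
    congr 1
    ext y
    rw [osc, real_inner_smul_left, real_inner_comm]
    push_cast
    ring_nf
  have h2 : Integrable (𝓕 u) := by
    have := (integrable_comp_smul_iff volume (fun ξ => ∫ x, osc (-1) ξ x • u x) hpi.ne').2 hu'
    exact this.congr (Filter.Eventually.of_forall fun w => (h1 w).symm)
  have h3 := congrFun (hc.fourierInv_fourier_eq hu h2) x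
  rw [Real.fourierInv_eq'] at h3
  rw [← h3]
  have h4 := Measure.integral_comp_smul volume
    (fun ξ => osc 1 x ξ • ∫ y, osc (-1) ξ y • u y) (2 * Real.pi)
  rw [finrank_euclideanSpace_fin, abs_of_pos (by positivity)] at h4
  rw [← h4]
  congr 1
  ext w
  rw [h1 w, osc, real_inner_smul_right, real_inner_comm]
  push_cast
  ring_nf

theorem WeightedSmooth.comp_add {ι E F : Type*} [NormedAddCommGroup E] [NormedSpace ℝ E]
    [NormedAddCommGroup F] [NormedSpace ℝ F] {e : ι → E} {U : Set E} {h : ι → E → ℝ} {w : E → ℝ}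
    {φ : E → F} (hφ : WeightedSmooth e U h w φ) (a : E) :
    WeightedSmooth e ((· + a) ⁻¹' U) (fun i p => h i (p + a)) (fun p => w (p + a))
      (fun p => φ (p + a)) := by
  refine ⟨hφ.smooth.comp (by fun_prop) (fun p hp => hp), fun n => ?_⟩
  have h := hφ.words n
  clear hφ
  induction n generalizing φ w with
  | zero =>
    obtain ⟨C, hC⟩ := h
    exact ⟨C, fun p hp => hC _ hp⟩
  | succ n ih =>
    obtain ⟨⟨C, hC⟩, h'⟩ := h
    refine ⟨⟨C, fun p hp => hC _ hp⟩, fun i => ?_⟩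
    have h1 := ih (h' i)
    have h2 : _root_.dirDeriv (e i) (fun p => φ (p + a)) =
        fun p => _root_.dirDeriv (e i) φ (p + a) := by
      ext p
      simp [_root_.dirDeriv, fderiv_comp_add_right]
    rw [h2]
    exact h1

/-! ### Twisted multipliers on the Schwartz space. -/

namespace PlaneAction

variable {A : Type*} [CStarAlgebra A] {α : PlaneAction A} {f g u v : Plane → A} {m m' : ℕ}

variable (α) in
/-- Symbols of polynomial growth without gain under differentiation. -/
def PolySymb (m : ℕ) (f : Plane → A) : Prop :=
  WeightedSmooth pairBasis Set.univ (fun _ _ => 1) (fun p => (1 + ‖p.1‖) ^ m) (α.pairLift f)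

theorem PolySymb.contDiff (hf : α.PolySymb m f) : ContDiff ℝ ∞ (α.pairLift f) :=
  contDiffOn_univ.1 hf.smooth

theorem PolySymb.mono (hf : α.PolySymb m f) (h : m ≤ m') : α.PolySymb m' f :=
  WeightedSmooth.mono hf (fun _ _ _ => zero_le_one) (fun _ _ _ => le_rfl)
    (fun p _ => by positivity) (fun _ _ => trivial) (fun p _ => by positivity)
    ⟨1, fun p _ => by
      rw [one_mul]
      exact pow_le_pow_right₀ (by linarith [norm_nonneg p.1]) h⟩

theorem pairLift_add : α.pairLift (fun ξ => f ξ + g ξ) =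
    fun p => α.pairLift f p + α.pairLift g p := by
  ext p
  simp [pairLift]

theorem pairLift_sub : α.pairLift (fun ξ => f ξ - g ξ) =
    fun p => α.pairLift f p - α.pairLift g p := by
  ext p
  simp [pairLift]

theorem pairLift_smul (c : Plane → ℂ) : α.pairLift (fun ξ => c ξ • f ξ) =
    fun p => c p.1 • α.pairLift f p := by
  ext p
  simp [pairLift]

theorem PolySymb.add (hf : α.PolySymb m f) (hg : α.PolySymb m g) :
    α.PolySymb m (fun ξ => f ξ + g ξ) := by
  rw [PolySymb, pairLift_add]
  exact WeightedSmooth.add isOpen_univ hf hg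

theorem PolySymb.sub (hf : α.PolySymb m f) (hg : α.PolySymb m g) :
    α.PolySymb m (fun ξ => f ξ - g ξ) := by
  rw [PolySymb, pairLift_sub]
  exact WeightedSmooth.sub isOpen_univ hf hg

theorem PolySymb.const_smul (hf : α.PolySymb m f) (c : ℂ) : α.PolySymb m (fun ξ => c • f ξ) := by
  rw [PolySymb, pairLift_smul]
  exact WeightedSmooth.const_smul isOpen_univ c hf

theorem pairLift_const_mul (a : A) : α.pairLift (fun ξ => a * f ξ) =
    fun p => α.act p.2 a * α.pairLift f p := by
  ext p
  simp [pairLift]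

theorem weightedSmooth_act {a : A} (ha : α.IsSmooth a) :
    WeightedSmooth pairBasis Set.univ (fun _ _ => 1) (fun _ => 1)
      (fun p : Plane × Plane => α.act p.2 a) := by
  have h1 : ∀ a, α.IsSmooth a → ContDiff ℝ ∞ (α.pairLift (fun _ => a)) := fun a ha =>
    ContDiff.comp (g := fun y => α.act y a) (f := Prod.snd) ha contDiff_snd
  refine ⟨(h1 a ha).contDiffOn, fun n => ?_⟩
  induction n generalizing a with
  | zero => exact ⟨‖a‖, fun p _ => by simp [α.norm_act]⟩
  | succ n ih =>
    refine ⟨⟨‖a‖, fun p _ => by simp [α.norm_act]⟩, fun i => ?_⟩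
    have h2 := dirDeriv_pairLift (h1 a ha) i
    simp only [show ((fun _ => (1 : ℝ)) : Plane × Plane → ℝ) * (fun _ => 1) =
      fun _ => 1 by ext; simp]
    change WordBound _ _ _ _ _ (_root_.dirDeriv (pairBasis i) (α.pairLift (fun _ => a)))
    rw [h2]
    rcases i with j | j
    · have h3 : α.schOp (.inl j) (fun _ => a) = fun _ => 0 := by
        ext x
        simp [schOp, partialX]
      rw [h3]
      refine WordBound.congr isOpen_univ ((WeightedSmooth.zero_fun (fun _ _ => zero_le_one)
        (fun _ _ _ => zero_le_one)).words n) (fun p _ => ?_)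
      simp [pairLift]
    · exact (ih (ha.der j)).clm isOpen_univ (ContinuousLinearMap.restrictScalars ℝ
        ((Sum.elim (fun _ => 1) (fun _ => -Complex.I) (Sum.inr j : Fin 2 ⊕ Fin 2) : ℂ) •
          ContinuousLinearMap.id ℂ A)) (h1 _ (ha.der j)).contDiffOn

theorem PolySymb.const_mul (hf : α.PolySymb m f) {a : A} (ha : α.IsSmooth a) :
    α.PolySymb m (fun ξ => a * f ξ) := by
  rw [PolySymb, pairLift_const_mul]
  refine (WeightedSmooth.mul isOpen_univ (weightedSmooth_act ha) hf).mono
    (fun _ _ _ => zero_le_one) (fun _ _ _ => le_rfl)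
    (fun p _ => by simp; positivity) (fun _ _ => trivial) (fun p _ => by positivity)
    ⟨1, fun p _ => by simp⟩

theorem polySymb_const {a : A} (ha : α.IsSmooth a) : α.PolySymb m (fun _ => a) :=
  (weightedSmooth_act ha).mono
    (fun _ _ _ => zero_le_one) (fun _ _ _ => le_rfl)
    (fun p _ => by simp) (fun _ _ => trivial) (fun p _ => by positivity)
    ⟨1, fun p _ => by simpa using one_le_pow₀ (by linarith [norm_nonneg p.1])⟩

theorem PolySymb.schOp (hf : α.PolySymb m f) (i) : α.PolySymb m (α.schOp i f) := by
  rw [PolySymb, pairLift_schOp hf.contDiff]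
  exact (WeightedSmooth.deriv_one isOpen_univ hf i).const_smul isOpen_univ _

theorem weightedSmooth_coord (j : Fin 2) :
    WeightedSmooth pairBasis Set.univ (fun _ _ => 1) (fun p => 1 + ‖p.1‖)
      (fun p : Plane × Plane => ((p.1 j : ℝ) : ℂ)) := by
  obtain ⟨L, hL⟩ : ∃ L : Plane × Plane →L[ℝ] ℂ, ∀ p, L p = ((p.1 j : ℝ) : ℂ) :=
    ⟨Complex.ofRealCLM.comp ((EuclideanSpace.proj j).comp (ContinuousLinearMap.fst ℝ Plane Plane)),
      fun p => rfl⟩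
  have hL' : (fun p : Plane × Plane => ((p.1 j : ℝ) : ℂ)) = L := by
    ext p
    rw [hL]
  rw [hL']
  refine WeightedSmooth.of_deriv L.contDiff.contDiffOn ⟨1, fun p _ => ?_⟩ fun i => ?_
  · rw [hL, Complex.norm_real]
    have := PiLp.norm_apply_le p.1 j
    linarith
  · have : dirDeriv (pairBasis i) L = fun _ => L (pairBasis i) := by
      ext p
      simp [dirDeriv]
    rw [this]
    refine WeightedSmooth.const (fun p _ => ?_) (fun _ _ _ => zero_le_one) ⟨1, fun p _ => ?_⟩ _
    · simp; positivity
    · simp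

theorem PolySymb.coord_smul (hf : α.PolySymb m f) (j : Fin 2) :
    α.PolySymb (m + 1) (fun ξ => ((ξ j : ℝ) : ℂ) • f ξ) := by
  rw [PolySymb, pairLift_smul]
  refine (WeightedSmooth.smul isOpen_univ (weightedSmooth_coord j) hf).mono
    (fun _ _ _ => zero_le_one) (fun _ _ _ => le_rfl)
    (fun p _ => by simp; positivity) (fun _ _ => trivial) (fun p _ => by positivity)
    ⟨1, fun p _ => ?_⟩
  simp [pow_succ, mul_comm]

/-- The amplitude of the multiplier with symbol `f` applied to `u`. -/
noncomputable def multAmp (α : PlaneAction A) (B : Matrix (Fin 2) (Fin 2) ℝ) (f u : Plane → A) :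
    (Plane × Plane) × Plane → A :=
  fun q => α.pairLift f (q.2 + matL B q.1.1, q.1.2 - q.1.1) *
    α.pairLift (fourierHat u) (q.2, q.1.2)

/-- The linear substitution in `multAmp`. -/
noncomputable def multSubst (B : Matrix (Fin 2) (Fin 2) ℝ) :
    (Plane × Plane) × Plane →L[ℝ] Plane × Plane :=
  ((ContinuousLinearMap.snd ℝ (Plane × Plane) Plane) + (matL B).comp
    ((ContinuousLinearMap.fst ℝ Plane Plane).comp (ContinuousLinearMap.fst ℝ _ Plane))).prod
  (((ContinuousLinearMap.snd ℝ Plane Plane) - (ContinuousLinearMap.fst ℝ Plane Plane)).comp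
    (ContinuousLinearMap.fst ℝ _ Plane))

theorem multSubst_apply (B : Matrix (Fin 2) (Fin 2) ℝ) (q : (Plane × Plane) × Plane) :
    multSubst B q = (q.2 + matL B q.1.1, q.1.2 - q.1.1) := rfl

/-- The linear substitution for the Fourier transform in `multAmp`. -/
noncomputable def hatSubst : (Plane × Plane) × Plane →L[ℝ] Plane × Plane :=
  (ContinuousLinearMap.snd ℝ (Plane × Plane) Plane).prod
    ((ContinuousLinearMap.snd ℝ Plane Plane).comp (ContinuousLinearMap.fst ℝ _ Plane))

theorem hatSubst_apply (q : (Plane × Plane) × Plane) : hatSubst q = (q.2, q.1.2) := rfl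

/-- The polynomial growth of the symbol at v + Bx is at most a constant times (1 + |x|)^m (1 +
|v|)^m, and m additional powers of decay of the Fourier transform pay for the factor in v. -/
theorem amplitude_multAmp (B : Matrix (Fin 2) (Fin 2) ℝ) (hf : α.PolySymb m f)
    (hu : Rapid (α.pairLift (fourierHat u))) : Amplitude m (α.multAmp B f u) := by
  intro N
  have h1 := WeightedSmooth.comp_linear isOpen_univ (fun p _ => by positivity) hf
    (multSubst B) quadBasis
  have h2 := WeightedSmooth.comp_linear isOpen_univ (fun p _ => by positivity) (hu (N + m))
    hatSubst quadBasis
  refine (WeightedSmooth.mul isOpen_univ h1 h2).mono (fun _ _ _ => zero_le_one)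
    (fun _ _ _ => le_rfl) (fun p _ => by simp only [Pi.mul_apply]; positivity) (fun _ _ => trivial)
    (fun p _ => (ampWeight_pos m N p).le) ⟨(1 + ‖matL B‖) ^ m, fun p _ => ?_⟩
  simp only [Pi.mul_apply, multSubst_apply, hatSubst_apply, ampWeight]
  have h3 : 1 + ‖p.2 + matL B p.1.1‖ ≤ (1 + ‖matL B‖) * ((1 + ‖p.1.1‖) * (1 + ‖p.2‖)) := by
    have h4 := norm_add_le p.2 (matL B p.1.1)
    have h5 := (matL B).le_opNorm p.1.1
    nlinarith [norm_nonneg (matL B), norm_nonneg p.1.1, norm_nonneg p.2,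
      mul_nonneg (norm_nonneg (matL B)) (norm_nonneg p.1.1),
      mul_nonneg (norm_nonneg (matL B)) (norm_nonneg p.2),
      mul_nonneg (norm_nonneg p.1.1) (norm_nonneg p.2),
      mul_nonneg (mul_nonneg (norm_nonneg (matL B)) (norm_nonneg p.1.1)) (norm_nonneg p.2)]
  have h6 : 0 < 1 + ‖p.2‖ := by positivity
  calc (1 + ‖p.2 + matL B p.1.1‖) ^ m * ((1 + ‖p.2‖) ^ (N + m))⁻¹
      ≤ ((1 + ‖matL B‖) * ((1 + ‖p.1.1‖) * (1 + ‖p.2‖))) ^ m * ((1 + ‖p.2‖) ^ (N + m))⁻¹ := by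
        gcongr
    _ = _ := by
        rw [mul_pow, mul_pow, pow_add]
        field_simp

section Skew

variable {B : Matrix (Fin 2) (Fin 2) ℝ}

/-- The substitution ξ ↦ ξ + Bx moves the twist from the Fourier transform to the symbol. The phase
does not change because ⟨x, Bx⟩ = 0. -/
theorem mult_eq (hB : B.transpose = -B) (f u : Plane → A) (x : Plane) :
    α.mult B f u x = (((2 * Real.pi) ^ 2)⁻¹ : ℝ) •
      ∫ ξ, osc 1 x ξ • (α.act (-x) (f (ξ + matL B x)) * fourierHat u ξ) := by
  rw [mult, ← integral_add_right_eq_self _ (matL B x)]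
  congr 2
  ext ξ
  rw [matL_apply, add_sub_cancel_right, inner_add_right, ← matL_apply, inner_matL_self hB, osc]
  simp

theorem pairLift_mult (hB : B.transpose = -B) (hf : α.PolySymb m f)
    (hu : Rapid (α.pairLift (fourierHat u))) :
    α.pairLift (α.mult B f u) =
      fun p => ((((2 * Real.pi) ^ 2)⁻¹ : ℝ) : ℂ) • oscIntegral 1 (α.multAmp B f u) p := by
  ext ⟨x, y⟩
  rw [pairLift, mult_eq hB, α.act_real_smul]
  have h1 := (amplitude_multAmp B hf hu).integrable_osc 1 (x, 0)
  simp only [multAmp, pairLift, zero_sub, α.act_zero] at h1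
  rw [← α.actL_apply, ← (α.actL y).integral_comp_comm h1]
  simp only [α.actL_apply, map_smul, map_mul, oscIntegral, multAmp, pairLift, sub_eq_add_neg,
    α.act_add]
  exact RCLike.real_smul_eq_coe_smul (K := ℂ) _ _

theorem IsSchwartz.mult (hB : B.transpose = -B) (hf : α.PolySymb m f) (hu : α.IsSchwartz u) :
    α.IsSchwartz (α.mult B f u) := by
  rw [isSchwartz_iff, pairLift_mult hB hf (rapid_fourierHat hu)]
  intro N
  exact (((amplitude_multAmp B hf (rapid_fourierHat hu)).rapid_oscIntegral
    (by norm_num)) N).const_smul isOpen_univ _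

theorem mult_apply (hB : B.transpose = -B) (hf : α.PolySymb m f)
    (hu : α.IsSchwartz u) (x : Plane) : α.mult B f u x =
      ((((2 * Real.pi) ^ 2)⁻¹ : ℝ) : ℂ) • oscIntegral 1 (α.multAmp B f u) (x, 0) := by
  rw [← pairLift_zero (α := α) (α.mult B f u) x, pairLift_mult hB hf (rapid_fourierHat hu)]

theorem Rapid.integrable {φ : Plane × Plane → A} (hφ : Rapid φ) (y : Plane) :
    Integrable fun x => φ (x, y) := by
  obtain ⟨C, hC⟩ := (hφ 3).bound
  refine ((Amplitude.integrable_inv_cube).const_mul C).mono' ?_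
    (Filter.Eventually.of_forall fun x => hC (x, y) trivial)
  exact ((hφ 3).smooth.continuousOn.comp_continuous (by fun_prop)
    (fun _ => trivial)).aestronglyMeasurable

theorem IsSchwartz.integrable (hu : α.IsSchwartz u) : Integrable u := by
  simpa [pairLift_zero] using Rapid.integrable hu.rapid 0

theorem IsSchwartz.integrable_fourierHat (hu : α.IsSchwartz u) : Integrable (fourierHat u) := by
  simpa [pairLift_zero] using Rapid.integrable (rapid_fourierHat hu) 0

theorem IsSchwartz.continuous (hu : α.IsSchwartz u) : Continuous u := by
  have := hu.smooth.continuous.comp (f := fun x => (x, (0 : Plane))) (by fun_prop)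
  simpa [Function.comp_def, α.act_zero] using this

theorem mult_one (hB : B.transpose = -B) (hu : α.IsSchwartz u) :
    α.mult B (fun _ => 1) u = u := by
  ext x
  rw [mult_eq hB]
  have h2 := hu.integrable_fourierHat
  have h3 : fourierHat u = fun ξ => ∫ x, osc (-1) ξ x • u x := by
    ext ξ
    exact fourierHat_eq u ξ
  rw [h3] at h2
  simp only [map_one, one_mul, h3]
  exact integral_osc_inversion hu.continuous hu.integrable h2 x

/-- The symbol of `D_j P_f`. -/
noncomputable def symOp (α : PlaneAction A) (B : Matrix (Fin 2) (Fin 2) ℝ) (j : Fin 2)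
    (f : Plane → A) : Plane → A :=
  fun ξ => ((ξ j : ℝ) : ℂ) • f ξ + α.der j (f ξ) -
    Complex.I • (B 0 j • partialX 0 f ξ + B 1 j • partialX 1 f ξ)

/-- The covariant derivative `-i ∂_j + (B x)_j`. -/
noncomputable def opD (B : Matrix (Fin 2) (Fin 2) ℝ) (j : Fin 2) (u : Plane → A) : Plane → A :=
  fun x => -Complex.I • partialX j u x + ((matL B x j : ℝ) : ℂ) • u x

theorem PolySymb.symOp (hf : α.PolySymb m f) (B : Matrix (Fin 2) (Fin 2) ℝ) (j : Fin 2) :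
    α.PolySymb (m + 1) (α.symOp B j f) := by
  have h : ∀ k, α.PolySymb (m + 1) (fun ξ => B k j • partialX k f ξ) := fun k =>
    ((hf.schOp (.inl k)).mono (Nat.le_succ m)).const_smul (B k j : ℂ)
  exact ((hf.coord_smul j).add ((hf.schOp (.inr j)).mono (Nat.le_succ m))).sub
    (((h 0).add (h 1)).const_smul Complex.I)

/-- The variable x enters through the argument v + Bx of the symbol, which produces column j of B,
and through the action by y - x, which produces the derivation. The Fourier transform does not see
it. -/
theorem dirDeriv_multAmp (hf : α.PolySymb m f) (hu : Rapid (α.pairLift (fourierHat u)))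
    (j : Fin 2) (x ξ : Plane) :
    dirDeriv (quadBasis (.inl (.inl j))) (α.multAmp B f u) ((x, 0), ξ) =
      α.act (-x) (B 0 j • partialX 0 f (ξ + matL B x) + B 1 j • partialX 1 f (ξ + matL B x) +
        Complex.I • α.der j (f (ξ + matL B x))) * fourierHat u ξ := by
  have h1 := (hf.contDiff.differentiable (by simp) (multSubst B ((x, 0), ξ))).hasFDerivAt
  have h2 := ((hu 0).smooth.diffAt isOpen_univ (p := hatSubst ((x, 0), ξ)) trivial).hasFDerivAt
  have h3 := (h1.comp (f := multSubst B) _ (multSubst B).hasFDerivAt).mul'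
    (h2.comp (f := hatSubst) _ hatSubst.hasFDerivAt)
  have h4 : dirDeriv (quadBasis (.inl (.inl j))) (α.multAmp B f u) ((x, 0), ξ) = _ :=
    congrArg (fun L => L (quadBasis (.inl (.inl j))))
      (HasFDerivAt.fderiv (f := α.multAmp B f u) h3)
  rw [h4]
  have h5 : hatSubst (quadBasis (.inl (.inl j))) = 0 := by
    simp [hatSubst_apply, quadBasis]
  have h6 : multSubst B (quadBasis (.inl (.inl j))) =
      B 0 j • pairBasis (.inl 0) + B 1 j • pairBasis (.inl 1) - pairBasis (.inr j) := by
    rw [multSubst_apply]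
    ext i
    · simp only [quadBasis, pairBasis]
      fin_cases j <;> fin_cases i <;> simp [planeBasis, matApply]
    · simp only [quadBasis, pairBasis]
      fin_cases j <;> fin_cases i <;> simp [planeBasis]
  simp only [add_apply, smul_apply, ContinuousLinearMap.comp_apply, h5, h6, map_zero, smul_zero,
    zero_add, map_sub, map_add, map_smul]
  have h7 : ∀ i, fderiv ℝ (α.pairLift f) (multSubst B ((x, 0), ξ)) (pairBasis i) = _ := fun i =>
    congrFun (dirDeriv_pairLift hf.contDiff i) (multSubst B ((x, 0), ξ))
  simp only [h7]
  simp only [Function.comp_apply, multSubst_apply, hatSubst_apply, pairLift, α.act_zero, zero_sub]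
  simp [schOp, derFun₁, α.act_real_smul, sub_eq_add_neg, add_mul]

/-- In -i∂_j of the oscillatory integral the phase contributes v_j, and the summand (Bx)_j completes
it to coordinate j of the argument v + Bx of the symbol. The derivative of the amplitude supplies
the remaining terms. -/
theorem opD_mult (hB : B.transpose = -B) (hf : α.PolySymb m f) (hu : α.IsSchwartz u) (j : Fin 2) :
    opD B j (α.mult B f u) = α.mult B (α.symOp B j f) u := by
  have hu' := rapid_fourierHat hu
  have hA := amplitude_multAmp B hf hu'
  have hv := hu.mult hB hf
  ext x
  rw [opD, mult_apply hB (hf.symOp B j) hu, mult_apply hB hf hu,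
    ← pairLift_zero (α := α) (partialX j _) x, ← pairLift_partialX hv.smooth,
    pairLift_mult hB hf hu']
  have h1 : dirDeriv (pairBasis (.inl j)) (fun p => ((((2 * Real.pi) ^ 2)⁻¹ : ℝ) : ℂ) •
      oscIntegral 1 (α.multAmp B f u) p) (x, 0) = ((((2 * Real.pi) ^ 2)⁻¹ : ℝ) : ℂ) •
      oscIntegral 1 (Amplitude.derivAmp 1 (.inl j) (α.multAmp B f u)) (x, 0) := by
    rw [← hA.dirDeriv_oscIntegral]
    change fderiv ℝ _ _ _ = _
    rw [fderiv_fun_const_smul ((hA.contDiff_oscIntegral 1).differentiable (by simp) _)]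
    rfl
  rw [h1, smul_comm, smul_comm ((matL B x j : ℝ) : ℂ), ← smul_add]
  congr 1
  have i1 := (hA.derivAmp_amplitude 1 (.inl j)).integrable_osc 1 (x, 0)
  have i2 := hA.integrable_osc 1 (x, 0)
  rw [oscIntegral, oscIntegral, oscIntegral, ← integral_smul, ← integral_smul,
    ← integral_add (f := fun ξ => -Complex.I • osc 1 (x, 0).1 ξ •
        Amplitude.derivAmp 1 (.inl j) (α.multAmp B f u) ((x, 0), ξ))
      (g := fun ξ => ((matL B x j : ℝ) : ℂ) • osc 1 (x, 0).1 ξ • α.multAmp B f u ((x, 0), ξ))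
      (i1.smul (-Complex.I)) (i2.smul ((matL B x j : ℝ) : ℂ))]
  congr 1
  ext ξ
  rw [smul_comm, smul_comm ((matL B x j : ℝ) : ℂ), ← smul_add]
  congr 1
  rw [Amplitude.derivAmp, dirDeriv_multAmp hf hu']
  simp only [multAmp, pairLift, symOp, α.act_zero, zero_sub, Sum.elim_inl, PiLp.add_apply,
    Complex.ofReal_add, map_add, map_sub, map_smul, add_smul, smul_add, add_mul, sub_mul,
    smul_mul_assoc, smul_smul, Complex.ofReal_one, mul_one]
  simp only [neg_mul, ← mul_assoc, Complex.I_mul_I, neg_neg, one_smul, neg_smul, one_mul]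
  abel

theorem polySymb_one : α.PolySymb m (fun _ => 1) := polySymb_const isSmooth_one

theorem symOp_one (B : Matrix (Fin 2) (Fin 2) ℝ) (j : Fin 2) :
    α.symOp B j (fun _ => 1) = fun ξ => ((ξ j : ℝ) : ℂ) • (1 : A) := by
  ext ξ
  simp [symOp, der_one, partialX]

/-- This is the composition rule for the constant symbol 1, whose multiplier is the identity. -/
theorem diffMult_eq (hB : B.transpose = -B) (hu : α.IsSchwartz u) (j : Fin 2) :
    α.diffMult B j u = opD B j u := by
  rw [diffMult, ← symOp_one (α := α) B j, ← opD_mult hB (polySymb_one (m := 0)) hu,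
    mult_one hB hu]

theorem diffMult_mult (hB : B.transpose = -B) (hf : α.PolySymb m f) (hu : α.IsSchwartz u)
    (j : Fin 2) : α.diffMult B j (α.mult B f u) = α.mult B (α.symOp B j f) u := by
  rw [diffMult_eq hB (hu.mult hB hf), opD_mult hB hf hu]

theorem IsSchwartz.diffMult (hB : B.transpose = -B) (hu : α.IsSchwartz u) (j : Fin 2) :
    α.IsSchwartz (α.diffMult B j u) := by
  rw [PlaneAction.diffMult, ← symOp_one (α := α) B j]
  exact hu.mult hB ((polySymb_one (m := 0)).symOp B j)

theorem mult_add (hB : B.transpose = -B) (hf : α.PolySymb m f) (hg : α.PolySymb m g)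
    (hu : α.IsSchwartz u) :
    α.mult B (fun ξ => f ξ + g ξ) u = fun x => α.mult B f u x + α.mult B g u x := by
  have hu' := rapid_fourierHat hu
  ext x
  rw [mult_apply hB hf hu, mult_apply hB hg hu, mult_apply hB (hf.add hg) hu, ← smul_add]
  congr 1
  rw [oscIntegral, oscIntegral, oscIntegral, ← integral_add
    ((amplitude_multAmp B hf hu').integrable_osc 1 _)
    ((amplitude_multAmp B hg hu').integrable_osc 1 _)]
  congr 1
  ext ξ
  simp [multAmp, pairLift, add_mul]

theorem mult_const_smul (hB : B.transpose = -B) (f u : Plane → A) (c : ℂ) :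
    α.mult B (fun ξ => c • f ξ) u = fun x => c • α.mult B f u x := by
  ext x
  rw [mult_eq hB, mult_eq hB, smul_comm c, ← integral_smul c]
  congr 1
  refine integral_congr_ae (Filter.Eventually.of_forall fun ξ => ?_)
  simp only [map_smul, smul_mul_assoc]
  rw [smul_comm]

theorem mult_const_mul (hB : B.transpose = -B) (hf : α.PolySymb m f) (hu : α.IsSchwartz u)
    (a : A) : α.mult B (fun ξ => a * f ξ) u = α.leftMul a (α.mult B f u) := by
  have h1 := fun x => (amplitude_multAmp B hf (rapid_fourierHat hu)).integrable_osc 1 (x, 0)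
  simp only [multAmp, pairLift, zero_sub, α.act_zero] at h1
  ext x
  rw [leftMul, mult_eq hB, mult_eq hB, mul_smul_comm, ← integral_const_mul_of_integrable (h1 x)]
  congr 1
  refine integral_congr_ae (Filter.Eventually.of_forall fun ξ => ?_)
  simp only [map_mul, mul_smul_comm, mul_assoc]

end Skew

end PlaneAction

/-! ### Elliptic multipliers, their action on symbols and the recursion for the expansion. -/

namespace PlaneAction

variable {A : Type*} [CStarAlgebra A] {α : PlaneAction A}

variable (α) in
/-- The data of an elliptic differential multiplier of order two with principal part
`h |η|²`. -/
structure Elliptic where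
  B : Matrix (Fin 2) (Fin 2) ℝ
  skew : B.transpose = -B
  τ : ℂ
  im_pos : 0 < τ.im
  h : A
  c₁ : A
  c₂ : A
  c₀ : A
  smooth_h : α.IsSmooth h
  smooth_c₁ : α.IsSmooth c₁
  smooth_c₂ : α.IsSmooth c₂
  smooth_c₀ : α.IsSmooth c₀
  selfAdjoint : IsSelfAdjoint h
  lower : ∃ c : ℝ, 0 < c ∧ ∀ x ∈ spectrum ℂ h, x.im = 0 ∧ c ≤ x.re

/-- The linear function `ξ₁ + s ξ₂`. -/
noncomputable def etaL (s : ℂ) (ξ : Plane) : ℂ := (ξ 0 : ℂ) + s * (ξ 1 : ℂ)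

theorem eta_eq (τ : ℂ) (ξ : Plane) : eta τ ξ = etaL (starRingEnd ℂ τ) ξ := rfl

theorem conj_eta (τ : ℂ) (ξ : Plane) : starRingEnd ℂ (eta τ ξ) = etaL τ ξ := by
  simp [eta, etaL]

theorem etaSq_eq (τ : ℂ) (ξ : Plane) :
    etaSq τ ξ = etaL (starRingEnd ℂ τ) ξ * etaL τ ξ := by
  rw [← eta_eq, ← conj_eta, Complex.mul_conj, Complex.normSq_eq_norm_sq, etaSq]

variable (α) in
/-- The derivation `δ₁ + s δ₂`. -/
noncomputable def derL (s : ℂ) (a : A) : A := α.der 0 a + s • α.der 1 a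

theorem IsSmooth.derL {a : A} (ha : α.IsSmooth a) (s : ℂ) : α.IsSmooth (α.derL s a) :=
  (ha.der 0).add ((ha.der 1).const_smul s)

theorem derL_add {a b : A} (ha : α.IsSmooth a) (hb : α.IsSmooth b) (s : ℂ) :
    α.derL s (a + b) = α.derL s a + α.derL s b := by
  simp only [derL, der_add ha hb, smul_add]
  abel

theorem derL_smul {a : A} (ha : α.IsSmooth a) (c s : ℂ) :
    α.derL s (c • a) = c • α.derL s a := by
  simp only [derL, der_const_smul ha, smul_add, smul_comm c s]

theorem derL_mul {a b : A} (ha : α.IsSmooth a) (hb : α.IsSmooth b) (s : ℂ) :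
    α.derL s (a * b) = a * α.derL s b + α.derL s a * b := by
  simp only [derL, der_mul ha hb, mul_add, add_mul, smul_add, mul_smul_comm, smul_mul_assoc]
  abel

theorem derL_one (s : ℂ) : α.derL s (1 : A) = 0 := by simp [derL, der_one]

theorem derL_comm {a : A} (ha : α.IsSmooth a) (s t : ℂ) :
    α.derL s (α.derL t a) = α.derL t (α.derL s a) := by
  simp only [derL, der_add (ha.der 0) ((ha.der 1).const_smul _), der_const_smul (ha.der 1),
    smul_add, der_comm ha 1 0, smul_comm s t]
  abel

/-- The derivative in `ξ` entering the twisted multipliers. -/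
noncomputable def crossL (B : Matrix (Fin 2) (Fin 2) ℝ) (s : ℂ) (f : Plane → ℂ → A) :
    Plane → ℂ → A := fun ξ z =>
  (-Complex.I * (B 0 0 + s * B 0 1)) • dXi 0 f ξ z +
    (-Complex.I * (B 1 0 + s * B 1 1)) • dXi 1 f ξ z

variable (α) in
/-- The symbol of `(D₁ + s D₂) P_f`. -/
noncomputable def symM (B : Matrix (Fin 2) (Fin 2) ℝ) (s : ℂ) (f : Plane → ℂ → A) :
    Plane → ℂ → A := fun ξ z => etaL s ξ • f ξ z + α.derL s (f ξ z) + crossL B s f ξ z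

/-- A scale of function spaces closed under the operations of the symbolic calculus. -/
structure SymScale (α : PlaneAction A) (s : ℝ) (C : ℝ → (Plane → ℂ → A) → Prop) : Prop where
  le_one : s ≤ 1
  -- No change for s = 1. For s = 0 this is the inclusion into order m + 1, the order that a product
  -- of η with a ξ-derivative has in type zero.
  up : ∀ {m f}, C m f → C (m + 1 - s) f
  add : ∀ {m f g}, C m f → C m g → C m (fun ξ z => f ξ z + g ξ z)
  smul : ∀ {m f} (c : ℂ), C m f → C m (fun ξ z => c • f ξ z)
  const_mul : ∀ {m f} {a : A}, α.IsSmooth a → C m f → C m (fun ξ z => a * f ξ z)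
  etaL : ∀ {m f} (s), C m f → C (m + 1) (fun ξ z => etaL s ξ • f ξ z)
  derL : ∀ {m f} (s), C m f → C m (fun ξ z => α.derL s (f ξ z))
  dXi : ∀ {m f} (j), C m f → C (m - s) (dXi j f)

namespace SymScale

variable {s m : ℝ} {C : ℝ → (Plane → ℂ → A) → Prop} {f : Plane → ℂ → A}

theorem crossL (hC : SymScale α s C) (B : Matrix (Fin 2) (Fin 2) ℝ) (t : ℂ) (hf : C m f) :
    C (m - s) (crossL B t f) :=
  hC.add (hC.smul _ (hC.dXi 0 hf)) (hC.smul _ (hC.dXi 1 hf))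

end SymScale

namespace Elliptic

variable (E : α.Elliptic)

/-- Part of degree one of the symbol map of `E`. -/
noncomputable def L₁ (f : Plane → ℂ → A) : Plane → ℂ → A := fun ξ z =>
  E.h * (etaL (starRingEnd ℂ E.τ) ξ • α.derL E.τ (f ξ z) +
      etaL E.τ ξ • α.derL (starRingEnd ℂ E.τ) (f ξ z)) +
    (E.c₁ * (etaL E.τ ξ • f ξ z) + E.c₂ * (etaL (starRingEnd ℂ E.τ) ξ • f ξ z))

/-- Part of degree zero of the symbol map of `E`. -/
noncomputable def L₀ (f : Plane → ℂ → A) : Plane → ℂ → A := fun ξ z =>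
  E.h * (etaL (starRingEnd ℂ E.τ) ξ • crossL E.B E.τ f ξ z +
      etaL E.τ ξ • crossL E.B (starRingEnd ℂ E.τ) f ξ z +
      α.derL (starRingEnd ℂ E.τ) (α.derL E.τ (f ξ z))) +
    (E.c₁ * α.derL E.τ (f ξ z) + E.c₂ * α.derL (starRingEnd ℂ E.τ) (f ξ z) + E.c₀ * f ξ z)

/-- Part of degree minus one of the symbol map of `E`. -/
noncomputable def Lneg₁ (f : Plane → ℂ → A) : Plane → ℂ → A := fun ξ z =>
  E.h * ((1 / 2 : ℂ) • (α.derL (starRingEnd ℂ E.τ) (crossL E.B E.τ f ξ z) +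
      crossL E.B (starRingEnd ℂ E.τ) (fun ξ z => α.derL E.τ (f ξ z)) ξ z +
      (α.derL E.τ (crossL E.B (starRingEnd ℂ E.τ) f ξ z) +
      crossL E.B E.τ (fun ξ z => α.derL (starRingEnd ℂ E.τ) (f ξ z)) ξ z))) +
    (E.c₁ * crossL E.B E.τ f ξ z + E.c₂ * crossL E.B (starRingEnd ℂ E.τ) f ξ z)

/-- Part of degree minus two of the symbol map of `E`. -/
noncomputable def Lneg₂ (f : Plane → ℂ → A) : Plane → ℂ → A := fun ξ z =>
  E.h * ((1 / 2 : ℂ) • (crossL E.B (starRingEnd ℂ E.τ) (crossL E.B E.τ f) ξ z +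
    crossL E.B E.τ (crossL E.B (starRingEnd ℂ E.τ) f) ξ z))

/-- The lower order part of the symbol map. -/
noncomputable def lower' (f : Plane → ℂ → A) : Plane → ℂ → A := fun ξ z =>
  E.L₁ f ξ z + E.L₀ f ξ z + E.Lneg₁ f ξ z + E.Lneg₂ f ξ z

/-- The symbol of `E P_f`. -/
noncomputable def sym (f : Plane → ℂ → A) : Plane → ℂ → A := fun ξ z =>
  E.h * ((1 / 2 : ℂ) • (α.symM E.B E.τ (α.symM E.B (starRingEnd ℂ E.τ) f) ξ z +
      α.symM E.B (starRingEnd ℂ E.τ) (α.symM E.B E.τ f) ξ z)) +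
    E.c₁ * α.symM E.B E.τ f ξ z + E.c₂ * α.symM E.B (starRingEnd ℂ E.τ) f ξ z + E.c₀ * f ξ z

end Elliptic

section Expansion

variable {Λ : Set ℂ} {f g : Plane → ℂ → A}

theorem SmoothOn.smulEtaL (hf : α.SmoothOn Λ f) (s : ℂ) :
    α.SmoothOn Λ (fun ξ z => PlaneAction.etaL s ξ • f ξ z) := by
  obtain ⟨L, hL⟩ : ∃ L : Plane →L[ℝ] ℂ, ∀ ξ, L ξ = PlaneAction.etaL s ξ :=
    ⟨Complex.ofRealCLM.comp (EuclideanSpace.proj 0) +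
      s • Complex.ofRealCLM.comp (EuclideanSpace.proj 1), fun ξ => by simp [PlaneAction.etaL]⟩
  have : (fun p : Plane × ℂ × Plane => PlaneAction.etaL s p.1) = fun p => L p.1 := by
    ext p
    rw [hL]
  refine SmoothOn.smul (c := fun ξ _ => PlaneAction.etaL s ξ) ?_ hf
  rw [this]
  fun_prop

theorem SmoothOn.const_smul (hf : α.SmoothOn Λ f) (c : ℂ) :
    α.SmoothOn Λ (fun ξ z => c • f ξ z) := hf.smul contDiff_const

theorem SmoothOn.derL (hΛ : IsOpen Λ) (hf : α.SmoothOn Λ f) (s : ℂ) :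
    α.SmoothOn Λ (fun ξ z => α.derL s (f ξ z)) :=
  (hf.derFun hΛ 0).add ((hf.derFun hΛ 1).const_smul s)

theorem symScale_smoothOn (hΛ : IsOpen Λ) : SymScale α 1 (fun _ f => α.SmoothOn Λ f) where
  le_one := le_rfl
  up := fun h => h
  add := fun h h' => h.add h'
  smul := fun c h => h.const_smul c
  const_mul := fun ha h => (SmoothOn.const ha).mul h
  etaL := fun s h => h.smulEtaL s
  derL := fun s h => h.derL hΛ s
  dXi := fun j h => h.dXi hΛ j

theorem SmoothOn.crossL (hΛ : IsOpen Λ) (hf : α.SmoothOn Λ f) (B) (s : ℂ) :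
    α.SmoothOn Λ (crossL B s f) :=
  (symScale_smoothOn hΛ).crossL (m := 0) B s hf

theorem SmoothOn.symM (hΛ : IsOpen Λ) (hf : α.SmoothOn Λ f) (B) (s : ℂ) :
    α.SmoothOn Λ (α.symM B s f) :=
  ((hf.smulEtaL s).add (hf.derL hΛ s)).add (hf.crossL hΛ B s)

theorem SmoothOn.differentiableAt_fst (hΛ : IsOpen Λ) (hf : α.SmoothOn Λ f) {z : ℂ} (hz : z ∈ Λ)
    (ξ : Plane) : DifferentiableAt ℝ (fun ξ => f ξ z) ξ :=
  (hf.hasFDerivAt_fst hΛ hz ξ 0).differentiableAt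

theorem crossL_add (hΛ : IsOpen Λ) (hf : α.SmoothOn Λ f) (hg : α.SmoothOn Λ g) {z : ℂ}
    (hz : z ∈ Λ) (B) (s : ℂ) (ξ : Plane) :
    crossL B s (fun ξ z => f ξ z + g ξ z) ξ z = crossL B s f ξ z + crossL B s g ξ z := by
  have h : ∀ j, dXi j (fun ξ z => f ξ z + g ξ z) ξ z = dXi j f ξ z + dXi j g ξ z := fun j => by
    simp only [dXi]
    rw [fderiv_fun_add (hf.differentiableAt_fst hΛ hz ξ) (hg.differentiableAt_fst hΛ hz ξ)]
    rfl
  simp only [crossL, h, smul_add]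
  abel

theorem crossL_smulEtaL (hΛ : IsOpen Λ) (hf : α.SmoothOn Λ f) {z : ℂ}
    (hz : z ∈ Λ) (B) (s t : ℂ) (ξ : Plane) :
    crossL B s (fun ξ z => etaL t ξ • f ξ z) ξ z = etaL t ξ • crossL B s f ξ z +
      (-Complex.I * (B 0 0 + s * B 0 1) + -Complex.I * (B 1 0 + s * B 1 1) * t) • f ξ z := by
  obtain ⟨L, hL⟩ : ∃ L : Plane →L[ℝ] ℂ, ∀ ξ, L ξ = etaL t ξ :=
    ⟨Complex.ofRealCLM.comp (EuclideanSpace.proj 0) +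
      t • Complex.ofRealCLM.comp (EuclideanSpace.proj 1), fun ξ => by simp [etaL]⟩
  have h : ∀ j, dXi j (fun ξ z => etaL t ξ • f ξ z) ξ z =
      etaL t ξ • dXi j f ξ z + etaL t (basisVec j) • f ξ z := fun j => by
    simp only [dXi, ← hL]
    rw [fderiv_fun_smul L.differentiableAt (hf.differentiableAt_fst hΛ hz ξ)]
    simp
  have h0 : etaL t (basisVec 0) = 1 := by simp [etaL, basisVec]
  have h1 : etaL t (basisVec 1) = t := by simp [etaL, basisVec]
  simp only [crossL, h, h0, h1, smul_add, smul_smul, add_smul, mul_one]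
  simp only [mul_comm (etaL t ξ)]
  abel

/-- The last scalar appears when the ξ-derivative of the outer factor hits the linear function of
the inner one; it is the trace of the non-commutativity of D₁ and D₂. -/
theorem symM_symM (hΛ : IsOpen Λ) (hf : α.SmoothOn Λ f) {z : ℂ} (hz : z ∈ Λ) (B) (s t : ℂ)
    (ξ : Plane) : α.symM B s (α.symM B t f) ξ z =
      (etaL s ξ * etaL t ξ) • f ξ z + (etaL s ξ • α.derL t (f ξ z) + etaL t ξ • α.derL s (f ξ z)) +
      (etaL s ξ • crossL B t f ξ z + etaL t ξ • crossL B s f ξ z + α.derL s (α.derL t (f ξ z))) +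
      (α.derL s (crossL B t f ξ z) + crossL B s (fun ξ z => α.derL t (f ξ z)) ξ z) +
      crossL B s (crossL B t f) ξ z +
      (-Complex.I * (B 0 0 + s * B 0 1) + -Complex.I * (B 1 0 + s * B 1 1) * t) • f ξ z := by
  have h1 := hf.smulEtaL t
  have h2 := hf.derL hΛ t
  have h3 := hf.crossL hΛ B t
  have hx : α.symM B s (α.symM B t f) ξ z = etaL s ξ • α.symM B t f ξ z +
    α.derL s (α.symM B t f ξ z) + crossL B s (α.symM B t f) ξ z := rfl
  have e1 : crossL B s (α.symM B t f) ξ z = etaL t ξ • crossL B s f ξ z +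
      (-Complex.I * (B 0 0 + s * B 0 1) + -Complex.I * (B 1 0 + s * B 1 1) * t) • f ξ z +
      crossL B s (fun ξ z => α.derL t (f ξ z)) ξ z + crossL B s (crossL B t f) ξ z := by
    rw [← crossL_smulEtaL hΛ hf hz, ← crossL_add hΛ h1 h2 hz, ← crossL_add hΛ (h1.add h2) h3 hz]
    rfl
  have e2 : α.derL s (α.symM B t f ξ z) = etaL t ξ • α.derL s (f ξ z) +
      α.derL s (α.derL t (f ξ z)) + α.derL s (crossL B t f ξ z) := by
    rw [← derL_smul (hf.isSmooth hz ξ), ← derL_add (h1.isSmooth hz ξ) (h2.isSmooth hz ξ),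
      ← derL_add ((h1.add h2).isSmooth hz ξ) (h3.isSmooth hz ξ)]
    rfl
  rw [hx, e1, e2]
  simp only [symM, smul_add, smul_smul]
  abel

namespace Elliptic

variable (E : α.Elliptic)

/-- The two orders of D_τ and D_τ^* produce opposite scalars, because B is skew, and these cancel in
the mean. The derivations commute, so the other terms group by degree. -/
theorem sym_eq (hΛ : IsOpen Λ) (hf : α.SmoothOn Λ f) {z : ℂ} (hz : z ∈ Λ) (ξ : Plane) :
    E.sym f ξ z = E.h * (etaSq E.τ ξ • f ξ z) + E.lower' f ξ z := by
  obtain ⟨b0, b1, b2⟩ := skew_entries E.skew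
  rw [sym, symM_symM hΛ hf hz, symM_symM hΛ hf hz, derL_comm (hf.isSmooth hz ξ) E.τ, etaSq_eq,
    mul_comm (etaL E.τ ξ) (etaL (starRingEnd ℂ E.τ) ξ)]
  simp only [lower', L₁, L₀, Lneg₁, Lneg₂, symM, b0, b1, b2]
  generalize f ξ z = F
  generalize starRingEnd ℂ E.τ = σ
  -- With B₀₀ = B₁₁ = 0 and B₀₁ = -B₁₀ the scalar changes sign when τ and its conjugate are
  -- exchanged.
  have hc : -Complex.I * (((0 : ℝ) : ℂ) + E.τ * ((-E.B 1 0 : ℝ) : ℂ)) +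
      -Complex.I * ((E.B 1 0 : ℂ) + E.τ * ((0 : ℝ) : ℂ)) * σ =
      -(-Complex.I * (((0 : ℝ) : ℂ) + σ * ((-E.B 1 0 : ℝ) : ℂ)) +
      -Complex.I * ((E.B 1 0 : ℂ) + σ * ((0 : ℝ) : ℂ)) * E.τ) := by
    push_cast
    ring
  rw [hc]
  generalize (-Complex.I * (((0 : ℝ) : ℂ) + σ * ((-E.B 1 0 : ℝ) : ℂ)) +
      -Complex.I * ((E.B 1 0 : ℂ) + σ * ((0 : ℝ) : ℂ)) * E.τ) = w
  have hhalf : ∀ x : A, E.h * x = E.h * ((1 / 2 : ℂ) • x) + E.h * ((1 / 2 : ℂ) • x) := fun x => by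
    rw [← mul_add, ← add_smul]
    norm_num
  simp only [smul_add, mul_add, neg_smul, smul_neg, mul_neg]
  rw [hhalf ((etaL σ ξ * etaL E.τ ξ) • F), hhalf (etaL σ ξ • α.derL E.τ F),
    hhalf (etaL E.τ ξ • α.derL σ F), hhalf (etaL σ ξ • crossL E.B E.τ f ξ z),
    hhalf (etaL E.τ ξ • crossL E.B σ f ξ z), hhalf (α.derL σ (α.derL E.τ F))]
  abel

end Elliptic

end Expansion

section Recursion

namespace Elliptic

variable (E : α.Elliptic) {s m : ℝ} {C : ℝ → (Plane → ℂ → A) → Prop} {f : Plane → ℂ → A}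

theorem scale_L₁ (hC : SymScale α s C) (hf : C m f) : C (m + 1) (E.L₁ f) :=
  hC.add (hC.const_mul E.smooth_h (hC.add (hC.etaL _ (hC.derL _ hf)) (hC.etaL _ (hC.derL _ hf))))
    (hC.add (hC.const_mul E.smooth_c₁ (hC.etaL _ hf)) (hC.const_mul E.smooth_c₂ (hC.etaL _ hf)))

theorem scale_L₀ (hC : SymScale α s C) (hf : C m f) : C (m + 1 - s) (E.L₀ f) := by
  have h1 : ∀ B t t', C (m + 1 - s) (fun ξ z => etaL t ξ • crossL B t' f ξ z) := fun B t t' => by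
    have := hC.etaL t (hC.crossL B t' hf)
    rwa [show m - s + 1 = m + 1 - s by ring] at this
  exact hC.add (hC.const_mul E.smooth_h (hC.add (hC.add (h1 _ _ _) (h1 _ _ _))
      (hC.up (hC.derL _ (hC.derL _ hf)))))
    (hC.up (hC.add (hC.add (hC.const_mul E.smooth_c₁ (hC.derL _ hf))
      (hC.const_mul E.smooth_c₂ (hC.derL _ hf))) (hC.const_mul E.smooth_c₀ hf)))

theorem scale_Lneg₁ (hC : SymScale α s C) (hf : C m f) : C (m - s) (E.Lneg₁ f) := by
  have h1 : ∀ B t t', C (m - s) (fun ξ z => α.derL t (crossL B t' f ξ z)) :=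
    fun B t t' => hC.derL t (hC.crossL B t' hf)
  have h2 : ∀ B t t', C (m - s) (crossL B t (fun ξ z => α.derL t' (f ξ z))) :=
    fun B t t' => hC.crossL B t (hC.derL t' hf)
  exact hC.add (hC.const_mul E.smooth_h (hC.smul _ (hC.add (hC.add (h1 _ _ _) (h2 _ _ _))
      (hC.add (h1 _ _ _) (h2 _ _ _)))))
    (hC.add (hC.const_mul E.smooth_c₁ (hC.crossL _ _ hf))
      (hC.const_mul E.smooth_c₂ (hC.crossL _ _ hf)))

theorem scale_Lneg₂ (hC : SymScale α s C) (hf : C m f) : C (m - s - s) (E.Lneg₂ f) :=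
  hC.const_mul E.smooth_h (hC.smul _ (hC.add (hC.crossL _ _ (hC.crossL _ _ hf))
    (hC.crossL _ _ (hC.crossL _ _ hf))))

/-- The leading parametrix `(h |η|² - z)⁻¹`. -/
noncomputable def b (ξ : Plane) (z : ℂ) : A :=
  Ring.inverse (etaSq E.τ ξ • E.h - z • (1 : A))

/-- The recursion producing the terms of the resolvent expansion: at stage `j` the four functions
are the homogeneous parts of the residual, of orders `-j, -j-1, -j-2, -j-3`. -/
noncomputable def residual : ℕ → Fin 4 → Plane → ℂ → A
  -- The start is the value of (sym - z) f - 1 at f = 0.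
  | 0 => ![fun _ _ => (-1 : ℂ) • 1, fun _ _ => 0, fun _ _ => 0, fun _ _ => 0]
  | j + 1 =>
    let c := residual j
    -- The principal part of sym - z sends t to -c 0 and so removes the top part. The other four
    -- parts of sym applied to t have orders -j-1 to -j-4 and join the residual, shifted by one
    -- place.
    let t : Plane → ℂ → A := fun ξ z => E.b ξ z * ((-1 : ℂ) • c 0 ξ z)
    ![fun ξ z => c 1 ξ z + E.L₁ t ξ z, fun ξ z => c 2 ξ z + E.L₀ t ξ z,
      fun ξ z => c 3 ξ z + E.Lneg₁ t ξ z, E.Lneg₂ t]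

/-- The terms of the resolvent expansion. -/
noncomputable def term (j : ℕ) : Plane → ℂ → A :=
  fun ξ z => E.b ξ z * ((-1 : ℂ) • E.residual j 0 ξ z)

theorem residual_succ (j : ℕ) : E.residual (j + 1) =
    ![fun ξ z => E.residual j 1 ξ z + E.L₁ (E.term j) ξ z,
      fun ξ z => E.residual j 2 ξ z + E.L₀ (E.term j) ξ z,
      fun ξ z => E.residual j 3 ξ z + E.Lneg₁ (E.term j) ξ z, E.Lneg₂ (E.term j)] := rfl

/-- Membership of the residuals and terms in a scale that contains the leading term. -/
theorem scale_residual (hC : SymScale α 1 C) (h1 : C 0 (fun _ _ => 1)) (h0 : ∀ m, C m (fun _ _ => 0))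
    (hb : ∀ {m f}, C m f → C (m - 2) (fun ξ z => E.b ξ z * f ξ z)) (j : ℕ) :
    ∀ i : Fin 4, C (-(j : ℝ) - (i : ℕ)) (E.residual j i) := by
  induction j with
  | zero =>
    intro i
    fin_cases i
    · have := hC.smul (-1) h1
      simpa [residual] using! this
    · exact h0 _
    · exact h0 _
    · exact h0 _
  | succ j ih =>
    have ht : C (-(j : ℝ) - 2) (E.term j) := by
      have := hb (hC.smul (-1) (ih 0))
      rw [show -(j : ℝ) - ((0 : Fin 4) : ℕ) - 2 = -(j : ℝ) - 2 by norm_num] at this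
      exact this
    intro i
    rw [residual_succ]
    have i1 := ih 1
    have i2 := ih 2
    have i3 := ih 3
    have t1 := E.scale_L₁ hC ht
    have t2 := E.scale_L₀ hC ht
    have t3 := E.scale_Lneg₁ hC ht
    have t4 := E.scale_Lneg₂ hC ht
    push_cast
    fin_cases i
    · rw [show -(j : ℝ) - 2 + 1 = -(j : ℝ) - ((1 : Fin 4) : ℕ) by norm_num; ring] at t1
      have := hC.add i1 t1
      norm_num at this ⊢
      rwa [show -1 + -(j : ℝ) = -(j : ℝ) - 1 by ring]
    · rw [show -(j : ℝ) - 2 + 1 - 1 = -(j : ℝ) - ((2 : Fin 4) : ℕ) by norm_num] at t2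
      have := hC.add i2 t2
      norm_num at this ⊢
      rwa [show -1 + -(j : ℝ) - 1 = -(j : ℝ) - 2 by ring]
    · rw [show -(j : ℝ) - 2 - 1 = -(j : ℝ) - ((3 : Fin 4) : ℕ) by norm_num; ring] at t3
      have := hC.add i3 t3
      norm_num at this ⊢
      rwa [show -1 + -(j : ℝ) - 2 = -(j : ℝ) - 3 by ring]
    · norm_num at t4 ⊢
      rwa [show -1 + -(j : ℝ) - 3 = -(j : ℝ) - 2 - 1 - 1 by ring]

theorem scale_term (hC : SymScale α 1 C) (h1 : C 0 (fun _ _ => 1)) (h0 : ∀ m, C m (fun _ _ => 0))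
    (hb : ∀ {m f}, C m f → C (m - 2) (fun ξ z => E.b ξ z * f ξ z)) (j : ℕ) :
    C (-2 - (j : ℝ)) (E.term j) := by
  have := hb (hC.smul (-1) (E.scale_residual hC h1 h0 hb j 0))
  rw [show -2 - (j : ℝ) = -(j : ℝ) - ((0 : Fin 4) : ℕ) - 2 by norm_num; ring]
  exact this

end Elliptic

end Recursion

end PlaneAction

/-! ### Homogeneity and ellipticity estimates for the terms. -/

namespace PlaneAction

variable {A : Type*} [CStarAlgebra A] {α : PlaneAction A}

section Scales

variable {Λ : Set ℂ} {s m : ℝ} {f : Plane → ℂ → A}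

theorem scalarSymb_etaL (hΛ : IsOpen Λ) (hs : s ≤ 1) (t : ℂ) :
    ScalarSymb Λ s 1 (fun ξ _ => etaL t ξ) :=
  (ScalarSymb.coord hs 0).add hΛ ((ScalarSymb.coord hs 1).const_mul hΛ t)

theorem symScale_symb (hΛ : IsOpen Λ) (hs1 : s ≤ 1) :
    SymScale α s (fun m f => α.Symb Λ s m f) where
  le_one := hs1
  up := fun h => h.mono (by linarith)
  add := fun h h' => h.add hΛ h'
  smul := fun c h => h.const_smul hΛ c
  const_mul := fun ha h => by
    have := (Symb.const (m := 0) (s := s) hΛ le_rfl ha).mul hΛ h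
    rwa [zero_add] at this
  etaL := fun t h => by
    have := Symb.smul hΛ (scalarSymb_etaL hΛ hs1 t) h
    rwa [add_comm] at this
  derL := fun t h => (h.derFun hΛ 0).add hΛ ((h.derFun hΛ 1).const_smul hΛ t)
  dXi := fun j h => h.dXi hΛ j

theorem isOpen_offRay : IsOpen offRay :=
  (isOpen_lt Complex.continuous_re continuous_const).union
    (isOpen_ne_fun Complex.continuous_im continuous_const)

variable (α) in
/-- Smooth functions on the complement of the ray that are homogeneous of degree `m`. -/
def Homog (m : ℝ) (f : Plane → ℂ → A) : Prop :=
  α.SmoothOn offRay f ∧ ∀ t : ℝ, 0 < t → ∀ ξ, ∀ z ∈ offRay,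
    f (t • ξ) ((t : ℂ) ^ 2 * z) = ((t ^ m : ℝ) : ℂ) • f ξ z

theorem etaL_smul (s : ℂ) (t : ℝ) (ξ : Plane) : etaL s (t • ξ) = t * etaL s ξ := by
  simp [etaL]
  ring

/-- Treating homogeneous functions as one more scale lets a single induction over the recursion give
both the homogeneity of the terms and their symbol estimates. -/
theorem symScale_homog : SymScale α 1 (fun m f => α.Homog m f) where
  le_one := le_rfl
  up := fun {m f} h => by
    have : m + 1 - 1 = m := by ring
    rwa [this]
  add := fun h h' => ⟨h.1.add h'.1, fun t ht ξ z hz => by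
    beta_reduce
    rw [h.2 t ht ξ z hz, h'.2 t ht ξ z hz, smul_add]⟩
  smul := fun c h => ⟨h.1.const_smul c, fun t ht ξ z hz => by
    beta_reduce
    rw [h.2 t ht ξ z hz, smul_comm]⟩
  const_mul := fun ha h => ⟨(SmoothOn.const ha).mul h.1, fun t ht ξ z hz => by
    beta_reduce
    rw [h.2 t ht ξ z hz, mul_smul_comm]⟩
  etaL := fun s h => ⟨h.1.smulEtaL s, fun t ht ξ z hz => by
    beta_reduce
    rw [h.2 t ht ξ z hz, etaL_smul, Real.rpow_add ht, Real.rpow_one, smul_smul, smul_smul]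
    push_cast
    ring_nf⟩
  derL := fun s h => ⟨h.1.derL isOpen_offRay s, fun t ht ξ z hz => by
    beta_reduce
    rw [h.2 t ht ξ z hz, derL_smul (h.1.isSmooth hz ξ)]⟩
  dXi := fun {m f} j h => ⟨h.1.dXi isOpen_offRay j, fun t ht ξ z hz => by
    have h1 : (fun ξ => f (t • ξ) ((t : ℂ) ^ 2 * z)) = fun ξ => (t ^ m : ℝ) • f ξ z := by
      ext ξ
      rw [h.2 t ht ξ z hz]
      exact (RCLike.real_smul_eq_coe_smul (K := ℂ) _ _).symm
    have h2 := congrArg (fun g => fderiv ℝ g ξ (basisVec j)) h1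
    rw [fderiv_comp_smul (f := fun ξ => f ξ ((t : ℂ) ^ 2 * z)),
      fderiv_fun_const_smul (h.1.differentiableAt_fst isOpen_offRay hz ξ)] at h2
    simp only [smul_apply] at h2
    have h3 : t • dXi j f (t • ξ) ((t : ℂ) ^ 2 * z) = (t ^ m : ℝ) • dXi j f ξ z := h2
    have h4 : ((t ^ (m - 1) : ℝ) : ℂ) • dXi j f ξ z = (t ^ (m - 1)) • dXi j f ξ z :=
      (RCLike.real_smul_eq_coe_smul (K := ℂ) _ _).symm
    rw [h4, Real.rpow_sub_one ht.ne', div_eq_inv_mul, mul_smul, ← h3, inv_smul_smul₀ ht.ne']⟩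

end Scales

namespace Elliptic

variable (E : α.Elliptic) {Λ : Set ℂ} {s m : ℝ} {f : Plane → ℂ → A}

/-- Continuous functional calculus of h: the element is the function x ↦ r x - z of h, so
invertibility and the norm of the inverse are read off the spectrum. -/
theorem symbol_spectrum (r : ℝ) (z : ℂ) {c : ℝ} (hc : 0 ≤ c)
    (h : ∀ x ∈ spectrum ℂ E.h, (r : ℂ) * x - z ≠ 0 ∧ ‖((r : ℂ) * x - z)⁻¹‖ ≤ c) :
    IsUnit ((r : ℂ) • E.h - z • (1 : A)) ∧
      ‖Ring.inverse ((r : ℂ) • E.h - z • (1 : A))‖ ≤ c := by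
  have hn : IsStarNormal E.h := E.selfAdjoint.isStarNormal
  have h1 : cfc (fun x : ℂ => (r : ℂ) * x - z) E.h = (r : ℂ) • E.h - z • (1 : A) := by
    rw [cfc_sub _ _ E.h, cfc_const_mul_id _ E.h, cfc_const z E.h, Algebra.algebraMap_eq_smul_one]
  rw [← h1]
  refine ⟨(isUnit_cfc_iff _ E.h).2 fun x hx => (h x hx).1, ?_⟩
  rw [← cfc_inv _ E.h fun x hx => (h x hx).1]
  exact norm_cfc_le hc fun x hx => (h x hx).2

/-- The spectrum of h is real and positive, so a vanishing value |η|² x - z would place z on the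
half line. -/
theorem isUnit_symbol (ξ : Plane) {z : ℂ} (hz : z ∈ offRay) :
    IsUnit (etaSq E.τ ξ • E.h - z • (1 : A)) := by
  obtain ⟨c, hc, hl⟩ := E.lower
  have hn : IsStarNormal E.h := E.selfAdjoint.isStarNormal
  have h1 : cfc (fun x : ℂ => etaSq E.τ ξ * x - z) E.h = etaSq E.τ ξ • E.h - z • (1 : A) := by
    rw [cfc_sub _ _ E.h, cfc_const_mul_id _ E.h, cfc_const z E.h, Algebra.algebraMap_eq_smul_one]
  rw [← h1]
  refine (isUnit_cfc_iff _ E.h).2 fun x hx h0 => ?_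
  obtain ⟨h2, h3⟩ := hl x hx
  rw [sub_eq_zero] at h0
  have h4 := congrArg Complex.re h0
  have h5 := congrArg Complex.im h0
  rw [etaSq, Complex.re_ofReal_mul] at h4
  rw [etaSq, Complex.im_ofReal_mul, h2, mul_zero] at h5
  rcases hz with hz | hz
  · have : 0 ≤ ‖eta E.τ ξ‖ ^ 2 * x.re := mul_nonneg (sq_nonneg _) (hc.le.trans h3)
    linarith
  · exact hz h5.symm

theorem smoothOn_symbol : α.SmoothOn Λ (fun ξ z => etaSq E.τ ξ • E.h - z • (1 : A)) := by
  have h1 := ((SmoothOn.const (Λ := Λ) E.smooth_h).smulEtaL E.τ).smulEtaL (starRingEnd ℂ E.τ)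
  have h2 : α.SmoothOn Λ (fun _ z => z • (1 : A)) :=
    SmoothOn.smul (by fun_prop) (SmoothOn.const isSmooth_one)
  refine (h1.add h2.neg).congr fun ξ z _ => ?_
  rw [etaSq_eq, smul_smul, sub_eq_add_neg]

theorem smoothOn_b : α.SmoothOn offRay E.b := by
  have h := E.smoothOn_symbol (Λ := offRay)
  have h2 : ContDiffOn ℝ ∞ (fun p => Ring.inverse
      (α.lift (fun ξ z => etaSq E.τ ξ • E.h - z • (1 : A)) p)) (tripleDom offRay) := by
    intro p hp
    have hu : IsUnit (α.lift (fun ξ z => etaSq E.τ ξ • E.h - z • (1 : A)) p) :=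
      (E.isUnit_symbol p.1 hp.2.1).map (α.act p.2.2)
    obtain ⟨u, hu⟩ := hu
    have := contDiffAt_ringInverse ℝ (n := ∞) u
    rw [hu] at this
    exact this.comp_contDiffWithinAt p (h.contDiffOn p hp)
  refine h2.congr fun p _ => ?_
  exact α.act_ringInverse _ _

theorem b_smul {t : ℝ} (ht : 0 < t) (ξ : Plane) (z : ℂ) :
    E.b (t • ξ) ((t : ℂ) ^ 2 * z) = ((t ^ (-2 : ℝ) : ℝ) : ℂ) • E.b ξ z := by
  have h1 : etaSq E.τ (t • ξ) = (t : ℂ) ^ 2 * etaSq E.τ ξ := by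
    rw [etaSq_eq, etaSq_eq, etaL_smul, etaL_smul]
    ring
  have ht' : (t : ℂ) ^ 2 ≠ 0 := by exact_mod_cast (pow_pos ht 2).ne'
  have hx : ∀ x : A, Ring.inverse ((t : ℂ) ^ 2 • x) = ((t : ℂ) ^ 2)⁻¹ • Ring.inverse x := by
    intro x
    by_cases hx : IsUnit x
    · have hx' : IsUnit ((t : ℂ) ^ 2 • x) := (isUnit_smul_iff (Units.mk0 _ ht') x).2 hx
      refine left_inv_eq_right_inv (Ring.inverse_mul_cancel _ hx') ?_
      rw [smul_mul_smul_comm, mul_inv_cancel₀ ht', Ring.mul_inverse_cancel _ hx, one_smul]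
    · have hx' : ¬ IsUnit ((t : ℂ) ^ 2 • x) := by
        intro h
        apply hx
        have := (isUnit_smul_iff (Units.mk0 _ ht') x).1
        exact this h
      rw [Ring.inverse_non_unit _ hx, Ring.inverse_non_unit _ hx', smul_zero]
  rw [b, h1, mul_smul, mul_smul, ← smul_sub, hx, Real.rpow_neg ht.le, b]
  norm_num

theorem homog_b_mul (hf : α.Homog m f) : α.Homog (m - 2) (fun ξ z => E.b ξ z * f ξ z) := by
  refine ⟨E.smoothOn_b.mul hf.1, fun t ht ξ z hz => ?_⟩
  beta_reduce
  rw [hf.2 t ht ξ z hz, E.b_smul ht, smul_mul_smul_comm, ← Complex.ofReal_mul, ← Real.rpow_add ht]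
  ring_nf

theorem homog_term (j : ℕ) : α.Homog (-2 - (j : ℝ)) (E.term j) :=
  E.scale_term symScale_homog ⟨SmoothOn.const isSmooth_one, fun t ht ξ z hz => by simp⟩
    (fun m => ⟨by simpa using (SmoothOn.const (isSmooth_one (α := α))).const_smul 0,
      fun t ht ξ z hz => by simp⟩) (fun h => E.homog_b_mul h) j

theorem smoothOn_term (j : ℕ) : α.SmoothOn offRay (E.term j) := (E.homog_term j).1

/-- Sets of spectral parameters uniformly off the ray and off the origin. -/
structure _root_.Sectorial (Λ : Set ℂ) : Prop where
  isOpen : IsOpen Λ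
  sector : ∃ ε : ℝ, 0 < ε ∧ ∀ z ∈ Λ, ∀ s : ℝ, 0 ≤ s → ε * (s + ‖z‖) ≤ ‖(s : ℂ) - z‖
  away : ∃ ρ : ℝ, 0 < ρ ∧ ∀ z ∈ Λ, ρ ≤ ‖z‖

theorem _root_.Sectorial.subset (hΛ : Sectorial Λ) : Λ ⊆ offRay := by
  intro z hz
  by_contra h
  simp only [offRay, Set.mem_ofPred_eq, not_or, not_lt, not_not] at h
  obtain ⟨ε, hε, h1⟩ := hΛ.sector
  obtain ⟨ρ, hρ, h2⟩ := hΛ.away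
  have h3 := h1 z hz z.re h.1
  have h4 : ((z.re : ℂ) - z) = 0 := by
    apply Complex.ext <;> simp [h.2]
  rw [h4, norm_zero] at h3
  have h5 := h2 z hz
  nlinarith [h.1]

/-- Because Im η = -(Im τ) ξ₂ and Im τ > 0, the map ξ ↦ η is a real linear isomorphism from the
plane to ℂ. -/
theorem norm_le_eta (τ : ℂ) (hτ : 0 < τ.im) :
    ∃ C : ℝ, 0 < C ∧ ∀ ξ : Plane, ‖ξ‖ ^ 2 ≤ C * ‖eta τ ξ‖ ^ 2 := by
  refine ⟨(2 * (1 + τ.re ^ 2) + 1 / 1) * (1 + (1 / τ.im) ^ 2) + 2, by positivity, fun ξ => ?_⟩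
  have h1 : (eta τ ξ).re = ξ 0 + τ.re * ξ 1 := by simp [eta]
  have h2 : (eta τ ξ).im = -(τ.im * ξ 1) := by simp [eta]
  have h3 : ‖eta τ ξ‖ ^ 2 = (ξ 0 + τ.re * ξ 1) ^ 2 + (τ.im * ξ 1) ^ 2 := by
    rw [← Complex.normSq_eq_norm_sq, Complex.normSq_apply, h1, h2]
    ring
  have h4 : ‖ξ‖ ^ 2 = ξ 0 ^ 2 + ξ 1 ^ 2 := by
    rw [EuclideanSpace.norm_sq_eq]
    simp [Fin.sum_univ_two]
  rw [h3, h4]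
  set a := ξ 0
  set b := ξ 1
  set y := (1 / τ.im) * (τ.im * b) with hy
  have hyb : y = b := by rw [hy]; field_simp
  have hb2 : b ^ 2 = (1 / τ.im) ^ 2 * (τ.im * b) ^ 2 := by rw [← mul_pow, ← hy, hyb]
  have ha : a ^ 2 ≤ 2 * (a + τ.re * b) ^ 2 + 2 * τ.re ^ 2 * b ^ 2 := by
    nlinarith [sq_nonneg (a + 2 * τ.re * b)]
  have h5 : (1 + 2 * τ.re ^ 2) * b ^ 2 ≤
      (1 + 2 * τ.re ^ 2) * ((1 / τ.im) ^ 2 * (τ.im * b) ^ 2) := by rw [← hb2]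
  have p1 : 0 ≤ (a + τ.re * b) ^ 2 := sq_nonneg _
  have p2 : 0 ≤ (τ.im * b) ^ 2 := sq_nonneg _
  have p3 : 0 ≤ (1 / τ.im) ^ 2 := sq_nonneg _
  have p4 : 0 ≤ τ.re ^ 2 := sq_nonneg _
  have p5 := mul_nonneg p3 p2
  have p6 := mul_nonneg p4 p1
  have p7 := mul_nonneg p4 p2
  have p8 := mul_nonneg p4 p5
  have p9 := mul_nonneg p3 p1
  have p10 := mul_nonneg p4 p9
  nlinarith

theorem symb_symbol (hΛ : IsOpen Λ) (hs : s ≤ 1) :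
    α.Symb Λ s 2 (fun ξ z => etaSq E.τ ξ • E.h - z • (1 : A)) := by
  have h1 := Symb.smul (α := α) hΛ (ScalarSymb.etaSq hΛ hs E.τ)
    (Symb.const (m := 0) hΛ le_rfl E.smooth_h)
  have h2 := Symb.smul (α := α) hΛ (ScalarSymb.param (Λ := Λ) hs)
    (Symb.const (m := 0) hΛ le_rfl isSmooth_one)
  rw [add_zero] at h1 h2
  exact h1.sub hΛ h2

/-- For x ≥ c in the spectrum the sector condition gives | |η|² x - z | ≥ ε (c|η|² + |z|). As |z|
stays away from zero, the right side dominates a multiple of 1 + |ξ|² + |z|. -/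
theorem norm_b_le (hΛ : Sectorial Λ) : ∃ C : ℝ, ∀ ξ, ∀ z ∈ Λ,
    ‖E.b ξ z‖ ≤ C * (1 + ‖ξ‖ + Real.sqrt ‖z‖) ^ (-2 : ℝ) := by
  obtain ⟨ε, hε, h1⟩ := hΛ.sector
  obtain ⟨ρ, hρ, h2⟩ := hΛ.away
  obtain ⟨c, hc, hl⟩ := E.lower
  obtain ⟨K, hK, h3⟩ := norm_le_eta E.τ E.im_pos
  -- The 3 comes from the square of a sum of three terms; 1/ρ, 1 and K/c pay for the summands 1, |z|
  -- and |ξ|².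
  refine ⟨3 * (1 / ρ + 1 + K / c) / ε, fun ξ z hz => ?_⟩
  set r := ‖eta E.τ ξ‖ ^ 2 with hr
  have hr0 : 0 ≤ r := by positivity
  have hz0 : 0 < ‖z‖ := hρ.trans_le (h2 z hz)
  have key : ‖Ring.inverse ((r : ℂ) • E.h - z • (1 : A))‖ ≤ (ε * (r * c + ‖z‖))⁻¹ := by
    refine (E.symbol_spectrum r z (by positivity) fun x hx => ?_).2
    obtain ⟨h4, h5⟩ := hl x hx
    have h6 : x = (x.re : ℂ) := by apply Complex.ext <;> simp [h4]
    have h7 := h1 z hz (r * x.re) (mul_nonneg hr0 (hc.le.trans h5))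
    have h8 : ε * (r * c + ‖z‖) ≤ ‖(r : ℂ) * x - z‖ := by
      rw [h6]
      push_cast at h7
      refine le_trans ?_ h7
      gcongr
    have h9 : 0 < ε * (r * c + ‖z‖) := by positivity
    exact ⟨norm_pos_iff.1 (h9.trans_le h8), by rw [norm_inv]; gcongr⟩
  refine key.trans ?_
  have hb : (0 : ℝ) < 1 + ‖ξ‖ + Real.sqrt ‖z‖ := by positivity
  rw [Real.rpow_neg hb.le, ← div_eq_mul_inv, le_div_iff₀ (by positivity),
    ← div_eq_inv_mul, div_le_iff₀ (by positivity)]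
  have e1 : (1 + ‖ξ‖ + Real.sqrt ‖z‖) ^ (2 : ℝ) ≤ 3 * (1 + ‖ξ‖ ^ 2 + ‖z‖) := by
    rw [Real.rpow_two]
    have := Real.sq_sqrt hz0.le
    nlinarith [sq_nonneg (1 - ‖ξ‖), sq_nonneg (1 - Real.sqrt ‖z‖), sq_nonneg (‖ξ‖ - Real.sqrt ‖z‖)]
  refine e1.trans ?_
  have e2 : 1 ≤ 1 / ρ * ‖z‖ := by
    rw [one_div, ← div_eq_inv_mul, le_div_iff₀ hρ, one_mul]
    exact h2 z hz
  have e3 : ‖ξ‖ ^ 2 ≤ K / c * (r * c) := by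
    have := h3 ξ
    field_simp
    linarith
  have e4 : 3 * (1 / ρ + 1 + K / c) / ε * (ε * (r * c + ‖z‖)) =
      3 * (1 / ρ + 1 + K / c) * (r * c + ‖z‖) := by field_simp
  rw [e4]
  have e5 : 0 ≤ (1 / ρ) * (r * c) := by positivity
  have e6 : 0 ≤ (K / c) * ‖z‖ := by positivity
  have e7 : 0 ≤ r * c := by positivity
  nlinarith

theorem symb_b (hΛ : Sectorial Λ) (hs : s ≤ 1) : α.Symb Λ s (-2) E.b := by
  obtain ⟨C, hC⟩ := E.norm_b_le hΛ
  have h := WeightedSmooth.ringInverse (isOpen_tripleDom hΛ.isOpen)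
    (fun i p _ => (symDrop_pos s i p).le) (fun p _ => (symWeight_pos 2 p).le)
    (w₂ := symWeight (-2)) (fun p _ => (symWeight_pos _ p).le) (E.symb_symbol hΛ.isOpen hs)
    (fun p hp => (E.isUnit_symbol p.1 (hΛ.subset hp.2.1)).map (α.act p.2.2))
    ⟨C, fun p hp => by
      have := hC p.1 p.2.1 hp.2.1
      rw [← α.norm_act p.2.2, b, α.act_ringInverse] at this
      exact this⟩
    ⟨1, fun p _ => by
      have := congrFun (symWeight_mul 2 (-2)) p
      rw [Pi.mul_apply] at this
      rw [this]
      simp [symWeight]⟩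
  refine WeightedSmooth.congr (isOpen_tripleDom hΛ.isOpen) h fun p _ => ?_
  exact (α.act_ringInverse _ _).symm

theorem symb_b_mul (hΛ : Sectorial Λ) (hs : s ≤ 1) (hf : α.Symb Λ s m f) :
    α.Symb Λ s (m - 2) (fun ξ z => E.b ξ z * f ξ z) := by
  have := (E.symb_b hΛ hs).mul hΛ.isOpen hf
  rwa [show -2 + m = m - 2 by ring] at this

theorem symb_term (hΛ : Sectorial Λ) (j : ℕ) : α.Symb Λ 1 (-2 - (j : ℝ)) (E.term j) :=
  E.scale_term (symScale_symb hΛ.isOpen le_rfl) (Symb.const hΛ.isOpen le_rfl isSmooth_one)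
    (fun _ => Symb.zero) (fun h => E.symb_b_mul hΛ le_rfl h) j

theorem symb_residual (hΛ : Sectorial Λ) (j : ℕ) (i : Fin 4) :
    α.Symb Λ 1 (-(j : ℝ) - (i : ℕ)) (E.residual j i) :=
  E.scale_residual (symScale_symb hΛ.isOpen le_rfl)
    (Symb.const hΛ.isOpen le_rfl isSmooth_one) (fun _ => Symb.zero)
    (fun h => E.symb_b_mul hΛ le_rfl h) j i

end Elliptic

end PlaneAction

/-! ### Partial sums, elliptic regularity and the passage from type zero to type one. -/

namespace PlaneAction

variable {A : Type*} [CStarAlgebra A] {α : PlaneAction A}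

section Types

variable {Λ : Set ℂ} {s m : ℝ} {f : Plane → ℂ → A}

theorem symDrop_zero : symDrop 0 = fun _ _ => 1 := by
  ext i p
  rcases i with i | i | i <;> simp [symDrop, symWeight]

theorem Symb.polySymb (hΛ : IsOpen Λ) (hf : α.Symb Λ s m f) (hs : 0 ≤ s) {z : ℂ} (hz : z ∈ Λ)
    {M : ℕ} (hM : m ≤ M) : α.PolySymb M (fun ξ => f ξ z) := by
  have h0 : WeightedSmooth tripleBasis (tripleDom Λ) (symDrop 0) (symWeight m) (α.lift f) :=
    hf.to_zero hs
  rw [symDrop_zero] at h0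
  have h1 := h0.comp_add (0, z, 0)
  have hU : IsOpen ((· + ((0 : Plane), z, (0 : Plane))) ⁻¹' (tripleDom Λ)) :=
    (isOpen_tripleDom hΛ).preimage (by fun_prop)
  have h2 := WeightedSmooth.comp_linear hU (fun p _ => (symWeight_pos m _).le) h1
    ((ContinuousLinearMap.fst ℝ Plane Plane).prod
      ((0 : Plane × Plane →L[ℝ] ℂ).prod (ContinuousLinearMap.snd ℝ Plane Plane))) pairBasis
  have h3 : (fun p : Plane × Plane => α.lift f (((ContinuousLinearMap.fst ℝ Plane Plane).prod
      ((0 : Plane × Plane →L[ℝ] ℂ).prod (ContinuousLinearMap.snd ℝ Plane Plane))) p +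
      ((0 : Plane), z, (0 : Plane)))) = α.pairLift (fun ξ => f ξ z) := by
    ext p
    simp [lift, pairLift]
  rw [h3] at h2
  refine h2.mono (fun _ _ _ => zero_le_one) (fun _ _ _ => le_rfl)
    (fun p _ => (symWeight_pos m _).le) (fun p _ => ?_) (fun p _ => by positivity)
    ⟨(1 + Real.sqrt ‖z‖) ^ M, fun p _ => ?_⟩
  · simp [tripleDom, hz]
  · refine (symWeight_mono hM _).trans ?_
    rw [symWeight, Real.rpow_natCast, ← mul_pow]
    simp only [ContinuousLinearMap.prod_apply, ContinuousLinearMap.coe_fst', Prod.fst_add,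
      add_zero, Prod.snd_add, zero_apply, zero_add]
    gcongr
    nlinarith [norm_nonneg p.1, Real.sqrt_nonneg ‖z‖, mul_nonneg (norm_nonneg p.1) (Real.sqrt_nonneg ‖z‖)]

/-- In type one a derivative must gain at most two orders. An order lower by 2n therefore already
provides all the gain that words of length n can ask for. -/
theorem wordBound_symDrop_one {F : Type*} [NormedAddCommGroup F] [NormedSpace ℝ F]
    {U : Set (Plane × ℂ × Plane)} {φ : Plane × ℂ × Plane → F} (n : ℕ)
    (h : WordBound tripleBasis U (symDrop 0) n (symWeight (m - 2 * n)) φ) :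
    WordBound tripleBasis U (symDrop 1) n (symWeight m) φ := by
  induction n generalizing m φ with
  | zero => simpa [WordBound] using h
  | succ n ih =>
    obtain ⟨⟨C, hC⟩, h'⟩ := h
    push_cast at hC h'
    refine ⟨⟨|C|, fun p hp => (hC p hp).trans ?_⟩, fun i => ?_⟩
    · exact mul_le_mul (le_abs_self C) (symWeight_mono (by linarith [n.cast_nonneg (α := ℝ)]) p)
        (symWeight_pos _ p).le (abs_nonneg C)
    · obtain ⟨d, hd, h2⟩ : ∃ d : ℝ, d ≤ 2 ∧ symDrop 1 i = symWeight (-d) := by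
        rcases i with i | i | i
        · exact ⟨1, by norm_num, rfl⟩
        · exact ⟨2, by norm_num, by simp [symDrop]⟩
        · exact ⟨0, by norm_num, by simp [symDrop]⟩
      rw [h2, symWeight_mul]
      refine ih ((h' i).mono (fun i p _ => (symDrop_pos 0 i p).le) (fun _ _ _ => le_rfl) ?_
        le_rfl (fun p _ => (symWeight_pos _ p).le) ⟨1, fun p _ => ?_⟩)
      · exact fun p _ => mul_nonneg (symWeight_pos _ p).le (symDrop_pos _ _ p).le
      · rw [symDrop_zero, one_mul, Pi.mul_apply, mul_one]
        exact symWeight_mono (by linarith) p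

/-- Symbols of type zero of all orders, up to symbols of type one. -/
theorem Symb.of_expansion (hΛ : IsOpen Λ) (h : ∀ M : ℕ, ∃ g, α.Symb Λ 1 m g ∧
    α.Symb Λ 0 (m - M) (fun ξ z => f ξ z - g ξ z)) : α.Symb Λ 1 m f := by
  have hsum : ∀ g : Plane → ℂ → A, Set.EqOn (fun p => α.lift (fun ξ z => f ξ z - g ξ z) p +
      α.lift g p) (α.lift f) (tripleDom Λ) := fun g p _ => by simp [lift]
  refine ⟨?_, fun n => ?_⟩
  · obtain ⟨g, hg, hfg⟩ := h 0
    exact (WeightedSmooth.smooth hfg |>.add (WeightedSmooth.smooth hg)).congr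
      fun p hp => (hsum g hp).symm
  · obtain ⟨g, hg, hfg⟩ := h (2 * n)
    refine WordBound.congr (isOpen_tripleDom hΛ) (WordBound.add (isOpen_tripleDom hΛ)
      (WeightedSmooth.smooth hfg) (WeightedSmooth.smooth hg)
      (wordBound_symDrop_one n ?_) (WeightedSmooth.words hg n)) (hsum g)
    have := WeightedSmooth.words hfg n
    push_cast at this
    exact this

end Types

namespace Elliptic

variable (E : α.Elliptic) {Λ : Set ℂ} {s m : ℝ} {f g : Plane → ℂ → A} {u : Plane → A}

/-- The differential multiplier on the Schwartz space. -/
noncomputable def op (u : Plane → A) : Plane → A :=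
  α.leftMul E.h (α.multLapl E.B E.τ u) + α.leftMul E.c₁ (α.multTauStar E.B E.τ u) +
    α.leftMul E.c₂ (α.multTau E.B E.τ u) + α.leftMul E.c₀ u

theorem _root_.PlaneAction.symM_eq (B) (s : ℂ) (f : Plane → ℂ → A) (ξ : Plane) (z : ℂ) :
    α.symM B s f ξ z = α.symOp B 0 (fun ξ => f ξ z) ξ + s • α.symOp B 1 (fun ξ => f ξ z) ξ := by
  have hr : ∀ (t : ℝ) (x : A), t • x = (t : ℂ) • x := RCLike.real_smul_eq_coe_smul (K := ℂ)
  have hd : ∀ j, dXi j f ξ z = partialX j (fun ξ => f ξ z) ξ := fun _ => rfl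
  simp only [symM, etaL, derL, crossL, symOp, hr, hd]
  module

theorem _root_.PlaneAction.PolySymb.symM {F : Plane → A} {M : ℕ} (hF : α.PolySymb M F) (B) (s : ℂ)
    (z : ℂ) : α.PolySymb (M + 1) (fun ξ => α.symM B s (fun ξ _ => F ξ) ξ z) := by
  simp only [symM_eq]
  exact (hF.symOp B 0).add ((hF.symOp B 1).const_smul s)

theorem combine_mult {F : Plane → A} {M : ℕ} (hF : α.PolySymb M F)
    (hu : α.IsSchwartz u) (s z : ℂ) :
    α.diffMult E.B 0 (α.mult E.B F u) + s • α.diffMult E.B 1 (α.mult E.B F u) =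
      α.mult E.B (fun ξ => α.symM E.B s (fun ξ _ => F ξ) ξ z) u := by
  simp only [symM_eq]
  rw [mult_add E.skew (hF.symOp E.B 0) ((hF.symOp E.B 1).const_smul s) hu,
    mult_const_smul E.skew, diffMult_mult E.skew hF hu, diffMult_mult E.skew hF hu]
  rfl

theorem polySymb_sym {F : Plane → A} {M : ℕ} (hF : α.PolySymb M F) (z : ℂ) :
    α.PolySymb (M + 2) (fun ξ => E.sym (fun ξ _ => F ξ) ξ z) := by
  have h1 : ∀ s t, α.PolySymb (M + 2)
      (fun ξ => α.symM E.B s (α.symM E.B t (fun ξ _ => F ξ)) ξ z) := fun s t =>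
    (hF.symM E.B t z).symM E.B s z
  have h2 : ∀ s, α.PolySymb (M + 2) (fun ξ => α.symM E.B s (fun ξ _ => F ξ) ξ z) := fun s =>
    (hF.symM E.B s z).mono (Nat.le_succ _)
  exact (((((h1 _ _).add (h1 _ _)).const_smul _).const_mul E.smooth_h).add
    ((h2 _).const_mul E.smooth_c₁)).add ((h2 _).const_mul E.smooth_c₂) |>.add
    ((hF.mono (by lia)).const_mul E.smooth_c₀)

/-- This carries the composition rule for a single D_j to the whole operator. The parameter z is a
dummy, present because `sym` acts on functions of (ξ, z). -/
theorem op_mult {F : Plane → A} {M : ℕ} (hF : α.PolySymb M F) (hu : α.IsSchwartz u) (z : ℂ) :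
    E.op (α.mult E.B F u) = α.mult E.B (fun ξ => E.sym (fun ξ _ => F ξ) ξ z) u := by
  have h1 : ∀ s t, α.PolySymb (M + 2)
      (fun ξ => α.symM E.B s (α.symM E.B t (fun ξ _ => F ξ)) ξ z) := fun s t =>
    (hF.symM E.B t z).symM E.B s z
  have h2 : ∀ s, α.PolySymb (M + 1) (fun ξ => α.symM E.B s (fun ξ _ => F ξ) ξ z) := fun s =>
    hF.symM E.B s z
  have h2' : ∀ s, α.PolySymb (M + 2) (fun ξ => α.symM E.B s (fun ξ _ => F ξ) ξ z) := fun s =>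
    (h2 s).mono (Nat.le_succ _)
  have e2 : ∀ s t, α.diffMult E.B 0 (α.mult E.B (fun ξ => α.symM E.B t (fun ξ _ => F ξ) ξ z) u) +
      s • α.diffMult E.B 1 (α.mult E.B (fun ξ => α.symM E.B t (fun ξ _ => F ξ) ξ z) u) =
      α.mult E.B (fun ξ => α.symM E.B s (α.symM E.B t (fun ξ _ => F ξ)) ξ z) u := fun s t =>
    E.combine_mult (h2 t) hu s z
  have hlap := ((h1 E.τ (starRingEnd ℂ E.τ)).add (h1 (starRingEnd ℂ E.τ) E.τ)).const_smul (1 / 2)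
  have e1 := fun s => E.combine_mult hF hu s z
  simp only [op, multLapl, multTau, multTauStar, e1, e2]
  unfold sym
  rw [mult_add E.skew (((hlap.const_mul E.smooth_h).add ((h2' _).const_mul E.smooth_c₁)).add
      ((h2' _).const_mul E.smooth_c₂)) ((hF.mono (by lia)).const_mul E.smooth_c₀) hu,
    mult_add E.skew ((hlap.const_mul E.smooth_h).add ((h2' _).const_mul E.smooth_c₁))
      ((h2' _).const_mul E.smooth_c₂) hu,
    mult_add E.skew (hlap.const_mul E.smooth_h) ((h2' _).const_mul E.smooth_c₁) hu,
    mult_const_mul E.skew hlap hu, mult_const_mul E.skew (h2 _) hu, mult_const_mul E.skew (h2 _) hu,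
    mult_const_mul E.skew hF hu, mult_const_smul E.skew, mult_add E.skew (h1 _ _) (h1 _ _) hu]
  rfl

/-- The partial sums of the resolvent expansion. -/
noncomputable def approx (N : ℕ) : Plane → ℂ → A := fun ξ z => ∑ j ∈ Finset.range N, E.term j ξ z

/-- The error of the `N`-th partial sum. -/
noncomputable def error (N : ℕ) : Plane → ℂ → A := fun ξ z =>
  E.residual N 0 ξ z + E.residual N 1 ξ z + E.residual N 2 ξ z + E.residual N 3 ξ z

theorem sym_add (hΛ : IsOpen Λ) (hf : α.SmoothOn Λ f) (hg : α.SmoothOn Λ g) {z : ℂ} (hz : z ∈ Λ)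
    (ξ : Plane) : E.sym (fun ξ z => f ξ z + g ξ z) ξ z = E.sym f ξ z + E.sym g ξ z := by
  have h1 : ∀ s, ∀ f g, α.SmoothOn Λ f → α.SmoothOn Λ g → ∀ ξ, ∀ z ∈ Λ,
      α.symM E.B s (fun ξ z => f ξ z + g ξ z) ξ z =
      α.symM E.B s f ξ z + α.symM E.B s g ξ z := by
    intro s f g hf hg ξ z hz
    simp only [symM]
    rw [crossL_add hΛ hf hg hz, derL_add (hf.isSmooth hz ξ) (hg.isSmooth hz ξ), smul_add]
    abel
  have h3 : ∀ s (f g : Plane → ℂ → A), (∀ ξ, f ξ z = g ξ z) →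
      α.symM E.B s f ξ z = α.symM E.B s g ξ z := by
    intro s f g h
    rw [symM_eq, symM_eq]
    have : (fun ξ => f ξ z) = fun ξ => g ξ z := funext h
    rw [this]
  have h2 : ∀ s t, α.symM E.B s (α.symM E.B t (fun ξ z => f ξ z + g ξ z)) ξ z =
      α.symM E.B s (α.symM E.B t f) ξ z + α.symM E.B s (α.symM E.B t g) ξ z := by
    intro s t
    rw [← h1 s _ _ (hf.symM hΛ E.B t) (hg.symM hΛ E.B t) ξ z hz]
    exact h3 s _ _ fun ξ => h1 t f g hf hg ξ z hz
  rw [sym, sym, sym, h2, h2, h1 _ f g hf hg ξ z hz, h1 _ f g hf hg ξ z hz]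
  simp only [smul_add, mul_add]
  abel

/-- Only multiplications, derivations and ξ-derivatives enter, so the value at z depends on the
slice at z alone. -/
theorem sym_congr {z : ℂ} (h : ∀ ξ, f ξ z = g ξ z) (ξ : Plane) : E.sym f ξ z = E.sym g ξ z := by
  have : (fun (ξ : Plane) (_ : ℂ) => f ξ z) = fun ξ _ => g ξ z := by
    ext ξ
    exact h ξ
  exact congrFun (congrFun (congrArg E.sym this) ξ) z

theorem smoothOn_approx (N : ℕ) : α.SmoothOn offRay (E.approx N) := by
  induction N with
  | zero =>
    have := (SmoothOn.const (Λ := offRay) (isSmooth_one (α := α))).const_smul 0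
    unfold approx
    simpa using! this
  | succ N ih =>
    refine (ih.add (E.smoothOn_term N)).congr fun ξ z _ => ?_
    exact Finset.sum_range_succ _ _

/-- The sum telescopes: the principal part applied to the N-th term cancels the top residual, and
the lower parts turn the remaining residuals into those of the next stage. -/
theorem sym_approx (N : ℕ) (ξ : Plane) {z : ℂ} (hz : z ∈ offRay) :
    E.sym (E.approx N) ξ z - z • E.approx N ξ z = 1 + E.error N ξ z := by
  induction N with
  | zero =>
    have h0 : E.sym (E.approx 0) ξ z = 0 := by
      have hs : α.SmoothOn offRay (fun _ _ => (0 : A)) := by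
        have := (SmoothOn.const (Λ := offRay) (isSmooth_one (α := α))).const_smul 0
        simpa using this
      have h := E.sym_add isOpen_offRay hs hs hz ξ
      simp only [add_zero] at h
      rw [left_eq_add] at h
      rw [← h]
      exact E.sym_congr (fun ξ => by simp [approx]) ξ
    rw [h0]
    simp [approx, error, residual]
  | succ N ih =>
    have ht := E.smoothOn_term N
    have h1 : E.sym (E.approx (N + 1)) ξ z = E.sym (E.approx N) ξ z + E.sym (E.term N) ξ z := by
      rw [← E.sym_add isOpen_offRay (E.smoothOn_approx N) ht hz]
      exact E.sym_congr (fun ξ => Finset.sum_range_succ _ _) ξ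
    have h2 : E.approx (N + 1) ξ z = E.approx N ξ z + E.term N ξ z := Finset.sum_range_succ _ _
    have h3 : E.h * (etaSq E.τ ξ • E.term N ξ z) - z • E.term N ξ z = -E.residual N 0 ξ z := by
      have h4 : E.h * (etaSq E.τ ξ • E.term N ξ z) - z • E.term N ξ z =
          (etaSq E.τ ξ • E.h - z • (1 : A)) * E.term N ξ z := by
        rw [sub_mul, smul_mul_assoc, smul_mul_assoc, one_mul, mul_smul_comm]
      rw [h4, term, b, Ring.mul_inverse_cancel_left _ _ (E.isUnit_symbol ξ hz), neg_one_smul]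
    rw [h1, h2, smul_add, add_sub_add_comm, ih, E.sym_eq isOpen_offRay ht hz,
      add_sub_right_comm, h3]
    simp only [error, residual_succ, lower']
    simp only [Matrix.cons_val_zero, Matrix.cons_val_one, Matrix.cons_val]
    abel

/-- In type zero a ξ-derivative gains nothing, so η times such a derivative has order m + 1. That is
still one less than the two orders which b gains. -/
theorem symb_lower (hΛ : IsOpen Λ) (hf : α.Symb Λ 0 m f) : α.Symb Λ 0 (m + 1) (E.lower' f) := by
  have hC := symScale_symb (α := α) (s := 0) hΛ zero_le_one
  have h1 := E.scale_L₁ hC hf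
  have h2 := E.scale_L₀ hC hf
  have h3 := E.scale_Lneg₁ hC hf
  have h4 := E.scale_Lneg₂ hC hf
  exact ((h1.add hΛ (h2.mono (by linarith))).add hΛ (h3.mono (by linarith))).add hΛ
    (h4.mono (by linarith))

/-- Elliptic regularity for symbols. -/
theorem symb_of_sym (hΛ : Sectorial Λ) {m' : ℝ} (hf : α.Symb Λ 0 m f) (hg : α.Symb Λ 0 m' g)
    (h : ∀ ξ, ∀ z ∈ Λ, E.sym f ξ z - z • f ξ z = g ξ z) : α.Symb Λ 0 (m' - 2) f := by
  -- The equation reads f = b (g - lower part of f). Each pass gains two orders from b and loses one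
  -- to the lower part, until the order m' - 2 imposed by g is reached.
  have step : ∀ n : ℕ, α.Symb Λ 0 (max (m - n) (m' - 2)) f := by
    intro n
    induction n with
    | zero => exact hf.mono (by simp)
    | succ n ih =>
      have h1 := E.symb_b_mul hΛ zero_le_one (((hg.mono (m' := (max (m - n) (m' - 2) + 1) ⊔ m')
        (le_max_right _ _)).sub hΛ.isOpen ((E.symb_lower hΛ.isOpen ih).mono (le_max_left _ _))))
      refine (h1.congr hΛ.isOpen fun ξ z hz => ?_).mono ?_
      · have hz' := hΛ.subset hz
        rw [← h ξ z hz, E.sym_eq hΛ.isOpen hf.smoothOn hz]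
        have h4 : E.h * (etaSq E.τ ξ • f ξ z) + E.lower' f ξ z - z • f ξ z - E.lower' f ξ z =
            (etaSq E.τ ξ • E.h - z • (1 : A)) * f ξ z := by
          rw [sub_mul, smul_mul_assoc, smul_mul_assoc, one_mul, mul_smul_comm]
          abel
        rw [h4, b, Ring.inverse_mul_cancel_left _ _ (E.isUnit_symbol ξ hz')]
      · push_cast
        rw [sub_le_iff_le_add]
        refine max_le ?_ ?_
        · rw [← le_sub_iff_add_le]
          refine max_le ?_ ?_
          · have := le_max_left (m - (n + 1)) (m' - 2)
            linarith
          · have := le_max_right (m - (n + 1)) (m' - 2)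
            linarith
        · have := le_max_right (m - (n + 1)) (m' - 2)
          linarith
  obtain ⟨n, hn⟩ := exists_nat_ge (m - (m' - 2))
  refine (step n).mono (max_le (by linarith) le_rfl)

theorem symb_error (hΛ : Sectorial Λ) (N : ℕ) : α.Symb Λ 1 (-(N : ℝ)) (E.error N) := by
  have h : ∀ i : Fin 4, α.Symb Λ 1 (-(N : ℝ)) (E.residual N i) := fun i =>
    (E.symb_residual hΛ N i).mono (by linarith [(i : ℕ).cast_nonneg (α := ℝ)])
  exact (((h 0).add hΛ.isOpen (h 1)).add hΛ.isOpen (h 2)).add hΛ.isOpen (h 3)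

theorem symb_approx_sub (hΛ : Sectorial Λ) (N M : ℕ) :
    α.Symb Λ 1 (-2 - (N : ℝ)) (fun ξ z => E.approx (N + M) ξ z - E.approx N ξ z) := by
  induction M with
  | zero => exact Symb.zero.congr hΛ.isOpen fun ξ z _ => by simp
  | succ M ih =>
    refine (ih.add hΛ.isOpen ((E.symb_term hΛ (N + M)).mono
      (by push_cast; linarith [M.cast_nonneg (α := ℝ)]))).congr hΛ.isOpen fun ξ z _ => ?_
    rw [← add_assoc]
    simp only [approx, Finset.sum_range_succ _ (N + M)]
    abel

/-- A symbol of type zero that inverts `E - z` has the resolvent expansion. -/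
theorem symb_resolvent (hΛ : Sectorial Λ) {r : Plane → ℂ → A} (hr : α.Symb Λ 0 0 r)
    (h : ∀ ξ, ∀ z ∈ Λ, E.sym r ξ z - z • r ξ z = 1) (N : ℕ) :
    α.Symb Λ 1 (-2 - (N : ℝ)) (fun ξ z => r ξ z - E.approx N ξ z) := by
  refine Symb.of_expansion hΛ.isOpen fun M =>
    ⟨_, E.symb_approx_sub hΛ N M, ?_⟩
  have hq : α.Symb Λ 0 0 (E.approx (N + M)) := by
    have h1 := (E.symb_approx_sub hΛ 0 (N + M)).to_zero zero_le_one
    refine (h1.mono (by norm_num)).congr hΛ.isOpen fun ξ z _ => ?_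
    simp [approx]
  have hs := ((E.symb_error hΛ (N + M)).to_zero zero_le_one).neg hΛ.isOpen
  have h2 : ∀ ξ, ∀ z ∈ Λ, E.sym (fun ξ z => r ξ z - E.approx (N + M) ξ z) ξ z -
      z • (r ξ z - E.approx (N + M) ξ z) = -E.error (N + M) ξ z := by
    intro ξ z hz
    have h3 := E.sym_add hΛ.isOpen (hr.sub hΛ.isOpen hq).smoothOn hq.smoothOn hz ξ
    simp only [sub_add_cancel] at h3
    have h4 := E.sym_approx (N + M) ξ (hΛ.subset hz)
    have h5 := h ξ z hz
    rw [smul_sub]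
    have h6 : E.sym (fun ξ z => r ξ z - E.approx (N + M) ξ z) ξ z =
      E.sym r ξ z - E.sym (E.approx (N + M)) ξ z := eq_sub_of_add_eq h3.symm
    rw [h6]
    have h7 : E.sym r ξ z - E.sym (E.approx (N + M)) ξ z - (z • r ξ z - z • E.approx (N + M) ξ z) =
      (E.sym r ξ z - z • r ξ z) - (E.sym (E.approx (N + M)) ξ z - z • E.approx (N + M) ξ z) := by
      abel
    rw [h7, h4, h5]
    abel
  -- The remainder after N + M terms solves the equation with a right side of order -N-M, hence has
  -- order -N-M-2 in type zero. Since M is free, type one follows.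
  have h8 := E.symb_of_sym hΛ (hr.sub hΛ.isOpen hq) hs h2
  refine (h8.mono ?_).congr hΛ.isOpen fun ξ z _ => ?_
  · push_cast
    linarith
  · abel

end Elliptic

end PlaneAction

open MeasureTheory Module
open scoped RealInnerProductSpace FourierTransform

/-! ### Integrable convolution kernels of symbols with integrable gradient. -/

section Kernel

variable {F : Type*} [NormedAddCommGroup F] [NormedSpace ℂ F] {g f : Plane → F}

/-- Smooth functions on the plane whose derivatives all decay like `|ζ|⁻³`. -/
def Decay (g : Plane → F) : Prop :=
  WeightedSmooth planeBasis Set.univ (fun _ _ => 1) (fun ζ => ((1 + ‖ζ‖) ^ 3)⁻¹) g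

/-- The inverse Fourier transform. -/
noncomputable def invFT (g : Plane → F) (v : Plane) : F :=
  (((2 * Real.pi) ^ 2)⁻¹ : ℝ) • ∫ ζ, osc 1 v ζ • g ζ

/-- The operator `1 - ∂₁² - ∂₂²`. -/
noncomputable def oneSubLap (g : Plane → F) : Plane → F := fun ζ =>
  g ζ - dirDeriv (planeBasis 0) (dirDeriv (planeBasis 0) g) ζ -
    dirDeriv (planeBasis 1) (dirDeriv (planeBasis 1) g) ζ

/-- The integrable weights in the kernel representation. -/
noncomputable def kerWeight (j : Fin 2) (v : Plane) : ℝ := v j / (‖v‖ ^ 2 * (1 + ‖v‖ ^ 2) ^ 2)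

namespace Decay

theorem deriv (hg : Decay g) (j : Fin 2) : Decay (dirDeriv (planeBasis j) g) :=
  WeightedSmooth.deriv_one isOpen_univ hg j

theorem oneSubLap (hg : Decay g) : Decay (oneSubLap g) :=
  (WeightedSmooth.sub isOpen_univ hg ((hg.deriv 0).deriv 0)).sub isOpen_univ ((hg.deriv 1).deriv 1)

theorem contDiff (hg : Decay g) : ContDiff ℝ ∞ g := contDiffOn_univ.1 hg.smooth

theorem integrable (hg : Decay g) : Integrable g := by
  obtain ⟨C, hC⟩ := hg.bound
  exact (Amplitude.integrable_inv_cube.const_mul C).mono' hg.contDiff.continuous.aestronglyMeasurable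
    (Filter.Eventually.of_forall fun x => hC x trivial)

end Decay

theorem continuous_osc (ε : ℝ) (v : Plane) : Continuous (osc ε v) :=
  (contDiff_osc ε).continuous.comp (f := fun ζ => (v, ζ)) (by fun_prop)

theorem MeasureTheory.Integrable.osc_smul (hg : Integrable g) (ε : ℝ) (v : Plane) :
    Integrable fun ζ => osc ε v ζ • g ζ :=
  hg.bdd_smul 1 (continuous_osc ε v).aestronglyMeasurable
    (Filter.Eventually.of_forall fun ζ => (norm_osc ε v ζ).le)

theorem osc_comm (ε : ℝ) (v w : Plane) : osc ε v w = osc ε w v := by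
  rw [osc, osc, real_inner_comm]

/-- Integration by parts against the phase, whose derivative along the basis is i v_j times itself.
-/
theorem coord_smul_invFT (hg : Decay g) (j : Fin 2) (v : Plane) :
    ((v j : ℝ) : ℂ) • invFT g v = Complex.I • invFT (dirDeriv (planeBasis j) g) v := by
  have hosc : ∀ ζ, HasFDerivAt (fun ζ => osc 1 v ζ)
      ((fderiv ℝ (fun q : Plane × Plane => osc 1 q.1 q.2) (v, ζ)).comp
        (.inr ℝ Plane Plane)) ζ := fun ζ =>
    HasFDerivAt.comp (f := fun ζ => (v, ζ)) ζ
      ((contDiff_osc 1).differentiable (by simp) (v, ζ)).hasFDerivAt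
      (hasFDerivAt_prodMk_right v ζ)
  have e2 : ∀ ζ, fderiv ℝ (fun ζ => osc 1 v ζ) ζ (planeBasis j) =
      (Complex.I * ((v j : ℝ) : ℂ)) * osc 1 v ζ := fun ζ => by
    rw [(hosc ζ).fderiv]
    have : inner ℝ v (planeBasis j) = v j := by
      rw [plane_inner]
      fin_cases j <;> simp [planeBasis]
    simp only [ContinuousLinearMap.comp_apply, ContinuousLinearMap.inr_apply, fderiv_osc,
      inner_zero_left, add_zero, this]
    push_cast
    ring
  have i1 := hg.integrable.osc_smul 1 v
  have h := integral_smul_fderiv_eq_neg_fderiv_smul_of_integrable (μ := volume)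
    (f := fun ζ => osc 1 v ζ) (g := g) (v := planeBasis j)
    (by
      simp only [e2, mul_smul]
      exact (i1.smul ((v j : ℝ) : ℂ)).smul Complex.I)
    ((hg.deriv j).integrable.osc_smul 1 v) i1 (fun ζ _ => (hosc ζ).differentiableAt)
    (fun ζ _ => hg.contDiff.differentiable (by simp) ζ)
  simp only [e2, mul_smul] at h
  rw [integral_smul, integral_smul] at h
  have h' : ∫ ζ, osc 1 v ζ • dirDeriv (planeBasis j) g ζ =
    -(Complex.I • ((v j : ℝ) : ℂ) • ∫ ζ, osc 1 v ζ • g ζ) := h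
  rw [invFT, invFT, smul_comm, smul_comm Complex.I, h', smul_neg, smul_smul Complex.I,
    Complex.I_mul_I, neg_one_smul, neg_neg]

theorem norm_sq_plane (v : Plane) : ‖v‖ ^ 2 = v 0 ^ 2 + v 1 ^ 2 := by
  rw [EuclideanSpace.norm_sq_eq]
  simp [Fin.sum_univ_two]

theorem invFT_oneSubLap (hg : Decay g) (v : Plane) :
    invFT (oneSubLap g) v = ((1 + ‖v‖ ^ 2 : ℝ) : ℂ) • invFT g v := by
  have h : ∀ j, invFT (dirDeriv (planeBasis j) (dirDeriv (planeBasis j) g)) v =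
      -(((v j : ℝ) : ℂ) * ((v j : ℝ) : ℂ)) • invFT g v := fun j => by
    rw [neg_smul, mul_smul, coord_smul_invFT hg, smul_comm, coord_smul_invFT (hg.deriv j),
      smul_smul, Complex.I_mul_I, neg_one_smul, neg_neg]
  have h2 : invFT (oneSubLap g) v = invFT g v -
      invFT (dirDeriv (planeBasis 0) (dirDeriv (planeBasis 0) g)) v -
      invFT (dirDeriv (planeBasis 1) (dirDeriv (planeBasis 1) g)) v := by
    have i0 := hg.integrable.osc_smul 1 v
    have i1 := ((hg.deriv 0).deriv 0).integrable.osc_smul 1 v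
    have i2 := ((hg.deriv 1).deriv 1).integrable.osc_smul 1 v
    simp only [invFT, ← smul_sub]
    have e1 := integral_sub i0 i1
    have e2 := integral_sub (i0.sub i1) i2
    simp only [Pi.sub_apply] at e2
    rw [← e1, ← e2]
    simp only [oneSubLap, smul_sub]
  rw [h2, h, h, norm_sq_plane]
  push_cast
  module

theorem norm_invFT_le (g : Plane → F) (v : Plane) :
    ‖invFT g v‖ ≤ ((2 * Real.pi) ^ 2)⁻¹ * ∫ ζ, ‖g ζ‖ := by
  rw [invFT, norm_smul, Real.norm_of_nonneg (by positivity)]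
  gcongr
  refine (norm_integral_le_integral_norm _).trans (le_of_eq ?_)
  simp [norm_smul, norm_osc]

theorem continuous_invFT (hg : Integrable g) : Continuous (invFT g) := by
  refine Continuous.const_smul ?_ _
  refine continuous_of_dominated (bound := fun ζ => ‖g ζ‖) (fun v => (hg.osc_smul 1 v).1)
    (fun v => Filter.Eventually.of_forall fun ζ => by rw [norm_smul, norm_osc, one_mul]) hg.norm
    (Filter.Eventually.of_forall fun ζ => ?_)
  exact ((contDiff_osc 1).continuous.comp (f := fun v => (v, ζ)) (by fun_prop)).smul
    continuous_const

theorem abs_kerWeight_le (j : Fin 2) (v : Plane) :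
    ‖kerWeight j v‖ ≤ ‖v‖⁻¹ * (1 + ‖v‖ ^ 2)⁻¹ := by
  rcases eq_or_ne v 0 with rfl | hv
  · simp [kerWeight]
  have h0 : 0 < ‖v‖ := norm_pos_iff.2 hv
  have h1 : ‖v j‖ ≤ ‖v‖ := PiLp.norm_apply_le v j
  rw [kerWeight, norm_div, Real.norm_of_nonneg (by positivity : 0 ≤ ‖v‖ ^ 2 * (1 + ‖v‖ ^ 2) ^ 2),
    div_le_iff₀ (by positivity)]
  calc ‖v j‖ ≤ ‖v‖ := h1
    _ ≤ ‖v‖ * (1 + ‖v‖ ^ 2) := by nlinarith [pow_pos h0 3]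
    _ = _ := by field_simp

theorem norm_mul_abs_kerWeight_le (j : Fin 2) (v : Plane) :
    ‖v‖ * ‖kerWeight j v‖ ≤ ‖v‖⁻¹ * (1 + ‖v‖ ^ 2)⁻¹ := by
  rcases eq_or_ne v 0 with rfl | hv
  · simp [kerWeight]
  have h0 : 0 < ‖v‖ := norm_pos_iff.2 hv
  have h1 : ‖v j‖ ≤ ‖v‖ := PiLp.norm_apply_le v j
  rw [kerWeight, norm_div, Real.norm_of_nonneg (by positivity : 0 ≤ ‖v‖ ^ 2 * (1 + ‖v‖ ^ 2) ^ 2),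
    mul_div_assoc', div_le_iff₀ (by positivity)]
  calc ‖v‖ * ‖v j‖ ≤ ‖v‖ * ‖v‖ := by gcongr
    _ ≤ ‖v‖ * (1 + ‖v‖ ^ 2) := by gcongr; nlinarith [sq_nonneg (‖v‖ - 1)]
    _ = _ := by field_simp

/-- In polar coordinates of the plane the Jacobian cancels the singularity |v|⁻¹ and leaves (1 +
y²)⁻¹. -/
theorem integrable_kerBound : Integrable fun v : Plane => ‖v‖⁻¹ * (1 + ‖v‖ ^ 2)⁻¹ := by
  rw [integrable_fun_norm_addHaar (μ := (volume : Measure Plane))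
    (f := fun y => y⁻¹ * (1 + y ^ 2)⁻¹)]
  refine (integrable_inv_one_add_sq.integrableOn (s := Set.Ioi 0)).congr_fun (fun y hy => ?_)
    measurableSet_Ioi
  have : (0 : ℝ) < y := hy
  simp only [finrank_euclideanSpace_fin, smul_eq_mul]
  norm_num
  field_simp

theorem measurable_kerWeight (j : Fin 2) : Measurable (kerWeight j) := by
  unfold kerWeight
  fun_prop

theorem integrable_kerWeight (j : Fin 2) : Integrable (kerWeight j) :=
  integrable_kerBound.mono' (measurable_kerWeight j).aestronglyMeasurable
    (Filter.Eventually.of_forall (abs_kerWeight_le j))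

theorem integrable_norm_mul_kerWeight (j : Fin 2) : Integrable fun v => ‖v‖ * ‖kerWeight j v‖ :=
  integrable_kerBound.mono' (by have := measurable_kerWeight j; fun_prop)
    (Filter.Eventually.of_forall fun v => by
      rw [Real.norm_of_nonneg (by positivity)]
      exact norm_mul_abs_kerWeight_le j v)

/-- The bounded factors in the kernel representation. -/
noncomputable def kerFactor (j : Fin 2) (f : Plane → F) : Plane → F :=
  invFT (oneSubLap (oneSubLap (dirDeriv (planeBasis j) f)))

/-- The kernel of the symbol `f`. -/
noncomputable def ker (f : Plane → F) (v : Plane) : F :=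
  ∑ j, kerWeight j v • (Complex.I • kerFactor j f v)

theorem integral_osc_invFT [CompleteSpace F] {g : Plane → F} (hg : Decay g)
    (hi : Integrable (invFT g)) (ξ : Plane) : ∫ v, osc (-1) ξ v • invFT g v = g ξ := by
  have hc : ((2 * Real.pi) ^ 2 : ℝ) ≠ 0 := by positivity
  have hosc : ∀ v w, osc 1 (-v) w = osc (-1) v w := fun v w => by
    simp [osc]
  have h1 : ∀ v, ∫ x, osc (-1) v x • g x = ((2 * Real.pi) ^ 2 : ℝ) • invFT g (-v) := fun v => by
    rw [invFT, smul_inv_smul₀ hc]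
    simp only [hosc]
  have h2 := integral_osc_inversion hg.contDiff.continuous hg.integrable (by
    simp only [h1]
    exact (hi.comp_neg).smul ((2 * Real.pi) ^ 2 : ℝ)) ξ
  rw [← h2, ← integral_neg_eq_self]
  simp only [h1]
  rw [← integral_smul]
  congr 1
  ext v
  have h3 : osc (-1) ξ (-v) = osc 1 ξ v := by simp [osc]
  rw [h3, smul_comm (osc 1 ξ v), inv_smul_smul₀ hc]

theorem bounded_kerFactor (f : Plane → F) (j : Fin 2) : ∃ C, ∀ v, ‖kerFactor j f v‖ ≤ C :=
  ⟨_, norm_invFT_le _⟩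

/-- The Riemann–Lebesgue lemma, rescaled by 2π. -/
theorem tendsto_integral_osc [CompleteSpace F] (g : Plane → F) :
    Filter.Tendsto (fun ξ => ∫ v, osc (-1) ξ v • g v) (Filter.cocompact Plane) (nhds 0) := by
  have h := tendsto_integral_exp_inner_smul_cocompact (V := Plane) g
  have hpi : (2 * Real.pi)⁻¹ ≠ 0 := by positivity
  have h2 : Filter.Tendsto (fun ξ : Plane => (2 * Real.pi)⁻¹ • ξ) (Filter.cocompact Plane)
      (Filter.cocompact Plane) := (Homeomorph.smulOfNeZero _ hpi).isClosedEmbedding.tendsto_cocompact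
  refine (h.comp h2).congr fun ξ => ?_
  simp only [Function.comp_apply]
  congr 1
  ext v
  rw [osc, real_inner_smul_right, real_inner_comm, Circle.smul_def, Real.fourierChar_apply]
  congr 2
  have : (Real.pi : ℂ) ≠ 0 := by exact_mod_cast Real.pi_ne_zero
  push_cast
  field_simp

section

variable (hd : ∀ j, Decay (dirDeriv (planeBasis j) f))

include hd

theorem continuous_kerFactor (j : Fin 2) : Continuous (kerFactor j f) :=
  continuous_invFT (hd j).oneSubLap.oneSubLap.integrable

theorem integrable_ker_term (j : Fin 2) :
    Integrable fun v => kerWeight j v • (Complex.I • kerFactor j f v) := by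
  obtain ⟨C, hC⟩ := bounded_kerFactor f j
  exact (integrable_kerWeight j).smul_bdd C
    ((continuous_kerFactor hd j).const_smul Complex.I).aestronglyMeasurable
    (Filter.Eventually.of_forall fun v => by
      rw [norm_smul, Complex.norm_I, one_mul]; exact hC v)

theorem integrable_ker : Integrable (ker f) :=
  integrable_finsetSum _ fun j _ => integrable_ker_term hd j

theorem integrable_norm_mul_ker : Integrable fun v => ‖v‖ * ‖ker f v‖ := by
  choose C hC using bounded_kerFactor f
  have h1 : Integrable fun v : Plane => ∑ j, ‖v‖ * ‖kerWeight j v‖ * C j :=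
    integrable_finsetSum _ fun j _ => (integrable_norm_mul_kerWeight j).mul_const (C j)
  refine h1.mono' (continuous_norm.aestronglyMeasurable.mul (integrable_ker hd).1.norm)
    (Filter.Eventually.of_forall fun v => ?_)
  rw [norm_mul, norm_norm, norm_norm, ker]
  calc ‖v‖ * ‖∑ j, kerWeight j v • (Complex.I • kerFactor j f v)‖
      ≤ ‖v‖ * ∑ j, ‖kerWeight j v‖ * C j := by
        gcongr
        refine (norm_sum_le _ _).trans (Finset.sum_le_sum fun j _ => ?_)
        rw [norm_smul, norm_smul, Complex.norm_I, one_mul]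
        gcongr
        exact hC j v
    _ = _ := by rw [Finset.mul_sum]; simp only [mul_assoc]

theorem invFT_deriv_symm (hf : ContDiff ℝ ∞ f) (j k : Fin 2) (v : Plane) :
    ((v k : ℝ) : ℂ) • invFT (dirDeriv (planeBasis j) f) v =
      ((v j : ℝ) : ℂ) • invFT (dirDeriv (planeBasis k) f) v := by
  rw [coord_smul_invFT (hd j), coord_smul_invFT (hd k), PlaneAction.dirDeriv_comm hf]

/-- Off the origin the powers of 1 + |v|² cancel and the kernel is i Σ_j v_j |v|⁻² times the inverse
transform of ∂_j f. Symmetry of second derivatives lets v_k and v_j be exchanged, after which Σ_j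
v_j² / |v|² = 1 remains. -/
theorem coord_smul_ker (hf : ContDiff ℝ ∞ f) (k : Fin 2) {v : Plane} (hv : v ≠ 0) :
    ((v k : ℝ) : ℂ) • ker f v = Complex.I • invFT (dirDeriv (planeBasis k) f) v := by
  have h0 : 0 < ‖v‖ := norm_pos_iff.2 hv
  have h1 : ∀ j, kerFactor j f v = (((1 + ‖v‖ ^ 2) ^ 2 : ℝ) : ℂ) •
      invFT (dirDeriv (planeBasis j) f) v := fun j => by
    rw [kerFactor, invFT_oneSubLap (hd j).oneSubLap, invFT_oneSubLap (hd j), smul_smul]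
    push_cast
    ring_nf
  have hr : ∀ (t : ℝ) (x : F), t • x = (t : ℂ) • x := RCLike.real_smul_eq_coe_smul (K := ℂ)
  have h2 : ∀ j, ((v k : ℝ) : ℂ) • (kerWeight j v • (Complex.I • kerFactor j f v)) =
      (Complex.I * ((v j ^ 2 / ‖v‖ ^ 2 : ℝ) : ℂ)) • invFT (dirDeriv (planeBasis k) f) v := by
    intro j
    rw [h1, hr, smul_smul, smul_smul, smul_smul]
    have h3 : ((v k : ℝ) : ℂ) * (kerWeight j v : ℂ) * Complex.I *
        (((1 + ‖v‖ ^ 2) ^ 2 : ℝ) : ℂ) = (Complex.I * ((v j / ‖v‖ ^ 2 : ℝ) : ℂ)) * (v k : ℂ) := by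
      have h4 : kerWeight j v * (1 + ‖v‖ ^ 2) ^ 2 = v j / ‖v‖ ^ 2 := by
        rw [kerWeight]
        field_simp
      rw [← h4]
      push_cast
      ring
    rw [h3, mul_smul, invFT_deriv_symm hd hf, smul_smul]
    congr 1
    push_cast
    ring
  rw [ker, Finset.smul_sum]
  simp only [h2]
  rw [Fin.sum_univ_two, ← add_smul, ← mul_add, ← Complex.ofReal_add, ← add_div, ← norm_sq_plane,
    div_self (by positivity), Complex.ofReal_one, mul_one]

/-- Up to a unimodular factor it is v_k times the kernel, and |v| times the kernel is integrable. -/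
theorem integrable_invFT_deriv (hf : ContDiff ℝ ∞ f) (k : Fin 2) :
    Integrable (invFT (dirDeriv (planeBasis k) f)) := by
  refine ((integrable_norm_mul_ker hd).mono' (continuous_invFT (hd k).integrable).aestronglyMeasurable
    ?_)
  have h0 : ∀ᵐ v : Plane, v ≠ 0 := by
    simp [ae_iff]
  filter_upwards [h0] with v hv
  have h1 := congrArg norm (coord_smul_ker hd hf k hv)
  rw [norm_smul, norm_smul, Complex.norm_I, one_mul, Complex.norm_real] at h1
  rw [← h1]
  gcongr
  exact PiLp.norm_apply_le v k

theorem hasFDerivAt_integral_ker (ξ : Plane) :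
    HasFDerivAt (fun ξ => ∫ v, osc (-1) ξ v • ker f v)
      (∫ v, (innerSL ℝ v).smulRight ((-Complex.I * osc (-1) ξ v) • ker f v)) ξ := by
  have hi := integrable_ker hd
  refine hasFDerivAt_integral_of_dominated_of_fderiv_le (𝕜 := ℝ) (s := Set.univ)
    (F := fun ξ v => osc (-1) ξ v • ker f v)
    (F' := fun ξ v => (innerSL ℝ v).smulRight ((-Complex.I * osc (-1) ξ v) • ker f v))
    (bound := fun v => ‖v‖ * ‖ker f v‖) Filter.univ_mem
    (Filter.Eventually.of_forall fun ξ => (hi.osc_smul (-1) ξ).1) (hi.osc_smul (-1) ξ) ?_ ?_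
    (integrable_norm_mul_ker hd) ?_
  · have h1 : AEStronglyMeasurable (fun v => (-Complex.I * osc (-1) ξ v) • ker f v) :=
      ((continuous_osc (-1) ξ).const_mul (-Complex.I)).aestronglyMeasurable.smul hi.1
    exact (ContinuousLinearMap.smulRightL ℝ Plane F).aestronglyMeasurable_comp₂
      (innerSL ℝ).continuous.aestronglyMeasurable h1
  · refine Filter.Eventually.of_forall fun v ξ _ => ?_
    rw [ContinuousLinearMap.norm_smulRight_apply, innerSL_apply_norm, norm_smul, norm_mul, norm_osc,
      norm_neg, Complex.norm_I, one_mul, one_mul]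
  · refine Filter.Eventually.of_forall fun v ξ _ => ?_
    have h1 : HasFDerivAt (fun ξ => osc (-1) ξ v)
      ((fderiv ℝ (fun q : Plane × Plane => osc (-1) q.1 q.2) (ξ, v)).comp
        (.inl ℝ Plane Plane)) ξ :=
      HasFDerivAt.comp (f := fun ξ => (ξ, v)) ξ
        ((contDiff_osc (-1)).differentiable (by simp) (ξ, v)).hasFDerivAt
        (hasFDerivAt_prodMk_left ξ v)
    have h2 := h1.smul_const (ker f v)
    convert h2 using 1
    ext w
    simp only [ContinuousLinearMap.smulRight_apply, ContinuousLinearMap.comp_apply,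
      ContinuousLinearMap.inl_apply, fderiv_osc, inner_zero_right, zero_add, innerSL_apply_apply]
    rw [real_inner_comm, RCLike.real_smul_eq_coe_smul (K := ℂ), smul_smul]
    congr 1
    push_cast
    simp
    ring

theorem dirDeriv_integral_ker [CompleteSpace F] (hf : ContDiff ℝ ∞ f) (k : Fin 2) (ξ : Plane) :
    fderiv ℝ (fun ξ => ∫ v, osc (-1) ξ v • ker f v) ξ (planeBasis k) =
      dirDeriv (planeBasis k) f ξ := by
  have hi := integrable_ker hd
  rw [(hasFDerivAt_integral_ker hd ξ).fderiv, ContinuousLinearMap.integral_apply,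
    ← integral_osc_invFT (hd k) (integrable_invFT_deriv hd hf k)]
  · refine integral_congr_ae ?_
    have h0 : ∀ᵐ v : Plane, v ≠ 0 := by
      simp [ae_iff]
    filter_upwards [h0] with v hv
    have h1 := coord_smul_ker hd hf k hv
    have h2 : inner ℝ v (planeBasis k) = v k := by
      rw [plane_inner]
      fin_cases k <;> simp [planeBasis]
    have hr : ∀ (t : ℝ) (x : F), t • x = (t : ℂ) • x := RCLike.real_smul_eq_coe_smul (K := ℂ)
    rw [ContinuousLinearMap.smulRight_apply, innerSL_apply_apply, h2, hr, smul_comm, h1, smul_smul]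
    congr 1
    linear_combination (-osc (-1) ξ v) * Complex.I_sq
  · have h1 : AEStronglyMeasurable (fun v => (-Complex.I * osc (-1) ξ v) • ker f v) :=
      ((continuous_osc (-1) ξ).const_mul (-Complex.I)).aestronglyMeasurable.smul hi.1
    refine (integrable_norm_mul_ker hd).mono' ((ContinuousLinearMap.smulRightL ℝ Plane
      F).aestronglyMeasurable_comp₂ (innerSL ℝ).continuous.aestronglyMeasurable h1)
      (Filter.Eventually.of_forall fun v => ?_)
    rw [ContinuousLinearMap.norm_smulRight_apply, innerSL_apply_norm, norm_smul, norm_mul, norm_osc,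
      norm_neg, Complex.norm_I, one_mul, one_mul]

/-- Inversion applies to the gradient of f but perhaps not to f, which need not be integrable. Both
sides have the same gradient and both tend to zero at infinity, so their constant difference
vanishes. -/
theorem integral_osc_ker [CompleteSpace F] (hf : ContDiff ℝ ∞ f)
    (h0 : Filter.Tendsto f (Filter.cocompact Plane) (nhds 0)) (ξ : Plane) :
    ∫ v, osc (-1) ξ v • ker f v = f ξ := by
  have hdf : ∀ ξ, DifferentiableAt ℝ f ξ := fun ξ => hf.differentiable (by simp) ξ
  have hdk := hasFDerivAt_integral_ker hd
  have hconst : ∀ x y, (fun ξ => f ξ - ∫ v, osc (-1) ξ v • ker f v) x =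
      (fun ξ => f ξ - ∫ v, osc (-1) ξ v • ker f v) y := by
    refine is_const_of_fderiv_eq_zero (𝕜 := ℝ)
      (fun ξ => (hdf ξ).sub (hdk ξ).differentiableAt) fun ξ => ?_
    rw [fderiv_fun_sub (hdf ξ) (hdk ξ).differentiableAt]
    refine ContinuousLinearMap.coe_injective (planeBasis.ext fun k => ?_)
    have := dirDeriv_integral_ker hd hf k ξ
    simp only [ContinuousLinearMap.coe_coe, sub_apply, this, zero_apply, dirDeriv, sub_self]
  have h1 := h0.sub (tendsto_integral_osc (F := F) (ker f))
  rw [sub_zero] at h1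
  have h2 : Filter.Tendsto (fun _ : Plane => f ξ - ∫ v, osc (-1) ξ v • ker f v)
      (Filter.cocompact Plane) (nhds 0) := h1.congr fun x => hconst x ξ
  have h3 := tendsto_nhds_unique h2 tendsto_const_nhds
  exact (sub_eq_zero.1 h3.symm).symm

end

end Kernel

open MeasureTheory Module
open scoped RealInnerProductSpace BoundedContinuousFunction

namespace PlaneAction

variable {A : Type*} [CStarAlgebra A] {α : PlaneAction A}

/-! ### Inverse Fourier transforms depending on parameters -/

section Parameter

variable {F : Type*} [NormedAddCommGroup F] [NormedSpace ℂ F]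

theorem integrable_weight_smul (g : Plane →ᵇ F) :
    Integrable fun ζ : Plane => ((1 + ‖ζ‖) ^ 3)⁻¹ • g ζ :=
  Amplitude.integrable_inv_cube.smul_bdd _ g.continuous.aestronglyMeasurable
    (Filter.Eventually.of_forall g.norm_coe_le_norm)

/-- The inverse Fourier transform after multiplication by the weight `(1 + |ζ|)⁻³`. -/
noncomputable def weightedInvFT : (Plane →ᵇ F) →L[ℝ] (Plane →ᵇ F) :=
  LinearMap.mkContinuous
    { toFun := fun g => BoundedContinuousFunction.ofNormedAddCommGroup
        (invFT fun ζ => ((1 + ‖ζ‖) ^ 3)⁻¹ • g ζ) (continuous_invFT (integrable_weight_smul g)) _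
        (norm_invFT_le _)
      map_add' := fun g g' => by
        ext v
        change invFT (fun ζ => ((1 + ‖ζ‖) ^ 3)⁻¹ • (g + g') ζ) v =
          invFT (fun ζ => ((1 + ‖ζ‖) ^ 3)⁻¹ • g ζ) v + invFT (fun ζ => ((1 + ‖ζ‖) ^ 3)⁻¹ • g' ζ) v
        simp only [invFT, BoundedContinuousFunction.add_apply, smul_add]
        rw [integral_add ((integrable_weight_smul g).osc_smul 1 v)
          ((integrable_weight_smul g').osc_smul 1 v), smul_add]
      map_smul' := fun c g => by
        ext v
        change invFT (fun ζ => ((1 + ‖ζ‖) ^ 3)⁻¹ • (c • g) ζ) v =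
          c • invFT (fun ζ => ((1 + ‖ζ‖) ^ 3)⁻¹ • g ζ) v
        simp only [invFT, BoundedContinuousFunction.smul_apply]
        rw [smul_comm c, ← integral_smul c]
        congr 1
        refine integral_congr_ae (Filter.Eventually.of_forall fun ζ => ?_)
        simp only [smul_comm _ c] }
    (((2 * Real.pi) ^ 2)⁻¹ * ∫ ζ : Plane, (((1 + ‖ζ‖) ^ 3)⁻¹ : ℝ) : ℝ) fun g => by
      refine (BoundedContinuousFunction.norm_ofNormedAddCommGroup_le _ (by positivity) fun v =>
        norm_invFT_le _ v).trans ?_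
      rw [mul_assoc, ← integral_mul_const]
      refine mul_le_mul_of_nonneg_left ?_ (by positivity)
      refine integral_mono (integrable_weight_smul g).norm
        (Amplitude.integrable_inv_cube.mul_const _) fun ζ => ?_
      simp only
      rw [norm_smul, Real.norm_of_nonneg (by positivity)]
      exact mul_le_mul_of_nonneg_left (g.norm_coe_le_norm ζ) (by positivity)

theorem weightedInvFT_apply (g : Plane →ᵇ F) (v : Plane) :
    weightedInvFT g v = invFT (fun ζ => ((1 + ‖ζ‖) ^ 3)⁻¹ • g ζ) v := rfl

variable {Λ : Set ℂ} {φ : Plane × ℂ × Plane → F}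

/-- Translation in the first variable. -/
noncomputable def transL : (Plane × ℂ × Plane) × Plane →L[ℝ] Plane × ℂ × Plane :=
  ContinuousLinearMap.fst ℝ _ Plane +
    (ContinuousLinearMap.inl ℝ Plane (ℂ × Plane)).comp (ContinuousLinearMap.snd ℝ _ Plane)

theorem transL_apply (p : Plane × ℂ × Plane) (ζ : Plane) :
    transL (p, ζ) = (p.1 + ζ, p.2) := by
  simp [transL, Prod.ext_iff]

/-- Functions on `ℝ² × Λ × ℝ²` with all derivatives of order `m`. -/
abbrev Flat (Λ : Set ℂ) (m : ℝ) (φ : Plane × ℂ × Plane → F) : Prop :=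
  WeightedSmooth tripleBasis (tripleDom Λ) (fun _ _ => 1) (symWeight m) φ

/-- A Peetre inequality: 1 + |ζ| ≤ (1 + |ξ|)(1 + |ξ + ζ| + |z|^{1/2}). It provides an integrable
majorant locally uniform in the translation ξ. -/
theorem symWeight_trans_le (p : Plane × ℂ × Plane) (ζ : Plane) :
    symWeight (-3) (p.1 + ζ, p.2) ≤ (1 + ‖p.1‖) ^ 3 * ((1 + ‖ζ‖) ^ 3)⁻¹ := by
  have h0 : 0 < 1 + ‖p.1 + ζ‖ + Real.sqrt ‖p.2.1‖ := by positivity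
  have h1 : 1 + ‖ζ‖ ≤ (1 + ‖p.1‖) * (1 + ‖p.1 + ζ‖ + Real.sqrt ‖p.2.1‖) := by
    have h2 : ‖ζ‖ ≤ ‖p.1 + ζ‖ + ‖p.1‖ := by
      calc ‖ζ‖ = ‖(p.1 + ζ) - p.1‖ := by simp
        _ ≤ _ := norm_sub_le _ _
    nlinarith [norm_nonneg p.1, norm_nonneg (p.1 + ζ), Real.sqrt_nonneg ‖p.2.1‖,
      mul_nonneg (norm_nonneg p.1) (norm_nonneg (p.1 + ζ)),
      mul_nonneg (norm_nonneg p.1) (Real.sqrt_nonneg ‖p.2.1‖)]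
  rw [symWeight, Real.rpow_neg h0.le, ← div_eq_mul_inv, inv_eq_one_div, div_le_div_iff₀
    (by positivity) (by positivity), one_mul]
  have h3 : (1 + ‖p.1 + ζ‖ + Real.sqrt ‖p.2.1‖) ^ (3 : ℝ) =
      (1 + ‖p.1 + ζ‖ + Real.sqrt ‖p.2.1‖) ^ (3 : ℕ) := by
    rw [← Real.rpow_natCast]
    norm_num
  rw [h3, ← mul_pow]
  gcongr

theorem Flat.locallyDominated (hΛ : IsOpen Λ) (hφ : Flat Λ (-3) φ) :
    LocallyDominated tripleBasis (tripleDom Λ) (fun ζ : Plane => (1 + ‖ζ‖) ^ 3)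
      (fun q => φ (transL q)) := by
  have hU := isOpen_tripleDom hΛ
  have h1 := WeightedSmooth.comp_linear hU (fun p _ => (symWeight_pos (-3) p).le) hφ transL
    (fun i => ((tripleBasis i, 0) : (Plane × ℂ × Plane) × Plane))
  have hsub : tripleDom Λ ×ˢ (Set.univ : Set Plane) ⊆ transL ⁻¹' (tripleDom Λ) := fun q hq => by
    rw [Set.mem_preimage, show q = (q.1, q.2) from rfl, transL_apply]
    exact ⟨trivial, hq.1.2⟩
  refine ⟨h1.smooth.mono hsub, fun n p₀ hp₀ => ?_⟩
  refine ⟨tripleDom Λ ∩ {p | ‖p.1‖ < ‖p₀.1‖ + 1}, hU.inter (isOpen_lt (by fun_prop) (by fun_prop)),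
    ⟨hp₀, by simp⟩, Set.inter_subset_left, ?_⟩
  refine (h1.words n).mono (fun _ _ _ => zero_le_one) (fun _ _ _ => le_rfl)
    (fun q _ => (symWeight_pos _ _).le)
    ((Set.prod_mono Set.inter_subset_left le_rfl).trans hsub) (fun q _ => by positivity)
    ⟨(1 + (‖p₀.1‖ + 1)) ^ 3, fun q hq => ?_⟩
  rw [show q = (q.1, q.2) from rfl, transL_apply]
  refine (symWeight_trans_le q.1 q.2).trans ?_
  have h : ‖q.1.1‖ < ‖p₀.1‖ + 1 := hq.1.2
  have := h.le
  gcongr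

/-- The family of inverse Fourier transforms in the first variable. -/
noncomputable def paramInvFT (φ : Plane × ℂ × Plane → F) (p : Plane × ℂ × Plane) : Plane →ᵇ F :=
  weightedInvFT (toBCF fun ζ => (1 + ‖ζ‖) ^ 3 • φ (transL (p, ζ)))

theorem continuous_cube : Continuous fun ζ : Plane => (1 + ‖ζ‖) ^ 3 := by fun_prop

theorem paramInvFT_apply (hΛ : IsOpen Λ) (hφ : Flat Λ (-3) φ) {p : Plane × ℂ × Plane}
    (hp : p ∈ tripleDom Λ) (v : Plane) :
    paramInvFT φ p v = invFT (fun ζ => φ (p.1 + ζ, p.2)) v := by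
  rw [paramInvFT, weightedInvFT_apply]
  congr 1
  ext ζ
  rw [(hφ.locallyDominated hΛ).toBCF_apply (isOpen_tripleDom hΛ) continuous_cube
    (fun ζ => by positivity) hp, inv_smul_smul₀ (by positivity), transL_apply]

theorem paramInvFT_contDiffOn (hΛ : IsOpen Λ) (hφ : Flat Λ (-3) φ) :
    ContDiffOn ℝ ∞ (paramInvFT φ) (tripleDom Λ) :=
  (weightedInvFT (F := F)).contDiff.comp_contDiffOn ((hφ.locallyDominated hΛ).contDiffOn
    (isOpen_tripleDom hΛ) continuous_cube (fun ζ => by positivity))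

theorem dirDeriv_paramInvFT (hΛ : IsOpen Λ) (hφ : Flat Λ (-3) φ) (i) :
    Set.EqOn (paramInvFT (dirDeriv (tripleBasis i) φ)) (dirDeriv (tripleBasis i) (paramInvFT φ))
      (tripleDom Λ) := by
  intro p hp
  have hU := isOpen_tripleDom hΛ
  have hL := hφ.locallyDominated hΛ
  have h1 := hL.dirDeriv_toBCF hU continuous_cube (fun ζ => by positivity) hp i
  have h2 := (hL.contDiffOn hU continuous_cube (fun ζ => by positivity)).diffAt hU hp
  have h3 := (weightedInvFT (F := F)).hasFDerivAt.comp p h2.hasFDerivAt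
  have h4 : dirDeriv (tripleBasis i) (paramInvFT φ) p = weightedInvFT (dirDeriv (tripleBasis i)
      (fun p => toBCF fun ζ => (1 + ‖ζ‖) ^ 3 • φ (transL (p, ζ))) p) :=
    congrArg (fun L => L (tripleBasis i)) (HasFDerivAt.fderiv (f := paramInvFT φ) h3)
  rw [h4, h1, paramInvFT]
  congr 3
  ext ζ
  have h5 : transL (p, ζ) ∈ tripleDom Λ := by
    rw [transL_apply]
    exact ⟨trivial, hp.2⟩
  have h6 := (hφ.smooth.diffAt hU h5).hasFDerivAt.comp (p, ζ) transL.hasFDerivAt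
  have h7 : dirDeriv ((tripleBasis i, 0) : (Plane × ℂ × Plane) × Plane)
      (fun q => φ (transL q)) (p, ζ) = fderiv ℝ φ (transL (p, ζ)) (transL (tripleBasis i, 0)) :=
    congrArg (fun L => L ((tripleBasis i, 0) : (Plane × ℂ × Plane) × Plane))
      (HasFDerivAt.fderiv (f := fun q => φ (transL q)) h6)
  have h8 : transL ((tripleBasis i, 0) : (Plane × ℂ × Plane) × Plane) = tripleBasis i := by
    rw [transL_apply, add_zero]
  rw [h7, h8]
  rfl

/-- Three orders are spent on integrability over the plane; the d further orders are bounded by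
their value in z alone. -/
theorem integral_weight_le (z : ℂ) {d : ℝ} (hd : 0 ≤ d) (hz : 0 < ‖z‖) (y : Plane) :
    ∫ ζ : Plane, symWeight (-3 - d) (ζ, z, y) ≤
      (Real.sqrt ‖z‖) ^ (-d) * ∫ ζ : Plane, ((1 + ‖ζ‖) ^ 3)⁻¹ := by
  rw [← integral_const_mul]
  have hb : ∀ ζ : Plane, symWeight (-3 - d) (ζ, z, y) ≤
      (Real.sqrt ‖z‖) ^ (-d) * ((1 + ‖ζ‖) ^ 3)⁻¹ := fun ζ => by
    have h0 : 0 < 1 + ‖ζ‖ + Real.sqrt ‖z‖ := by positivity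
    have h1 : 0 < Real.sqrt ‖z‖ := Real.sqrt_pos.2 hz
    rw [symWeight, show -3 - d = -d + -3 by ring, Real.rpow_add h0]
    have h2 : (1 + ‖ζ‖ + Real.sqrt ‖z‖) ^ (-3 : ℝ) ≤ ((1 + ‖ζ‖) ^ 3)⁻¹ := by
      rw [Real.rpow_neg h0.le]
      have h3 : (1 + ‖ζ‖ + Real.sqrt ‖z‖) ^ (3 : ℝ) = (1 + ‖ζ‖ + Real.sqrt ‖z‖) ^ (3 : ℕ) := by
        rw [← Real.rpow_natCast]
        norm_num
      rw [h3]
      exact inv_anti₀ (by positivity) (pow_le_pow_left₀ (by positivity)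
        (by linarith [Real.sqrt_nonneg ‖z‖]) 3)
    have h4 : (1 + ‖ζ‖ + Real.sqrt ‖z‖) ^ (-d) ≤ (Real.sqrt ‖z‖) ^ (-d) :=
      Real.rpow_le_rpow_of_nonpos h1 (by linarith [norm_nonneg ζ]) (by linarith)
    exact mul_le_mul h4 h2 (by positivity) (by positivity)
  have hi : Integrable fun ζ : Plane => (Real.sqrt ‖z‖) ^ (-d) * ((1 + ‖ζ‖) ^ 3)⁻¹ :=
    Amplitude.integrable_inv_cube.const_mul _
  refine integral_mono (hi.mono' ?_ (Filter.Eventually.of_forall fun ζ => ?_)) hi hb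
  · refine Continuous.aestronglyMeasurable ?_
    unfold symWeight
    refine Continuous.rpow_const (by fun_prop) fun ζ => Or.inl ?_
    positivity
  · rw [Real.norm_of_nonneg (symWeight_pos _ _).le]
    exact hb ζ

theorem norm_paramInvFT_le (hΛ : IsOpen Λ) (hφ : Flat Λ (-3) φ) {p : Plane × ℂ × Plane}
    (hp : p ∈ tripleDom Λ) :
    ‖paramInvFT φ p‖ ≤ ((2 * Real.pi) ^ 2)⁻¹ * ∫ ζ : Plane, ‖φ (ζ, p.2)‖ := by
  rw [BoundedContinuousFunction.norm_le (by positivity)]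
  intro v
  rw [paramInvFT_apply hΛ hφ hp]
  refine (norm_invFT_le _ v).trans (le_of_eq ?_)
  rw [← integral_add_left_eq_self (fun ζ => ‖φ (ζ, p.2)‖) p.1]

theorem integrable_symWeight (z : ℂ) (y : Plane) :
    Integrable fun ζ : Plane => symWeight (-3) (ζ, z, y) := by
  refine Amplitude.integrable_inv_cube.mono' ?_ (Filter.Eventually.of_forall fun ζ => ?_)
  · refine Continuous.aestronglyMeasurable ?_
    unfold symWeight
    refine Continuous.rpow_const (by fun_prop) fun ζ => Or.inl ?_
    positivity
  · rw [Real.norm_of_nonneg (symWeight_pos _ _).le]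
    simpa using symWeight_trans_le (0, z, y) ζ

theorem Flat.integrable_slice (hφ : Flat Λ (-3) φ) {z : ℂ} (hz : z ∈ Λ) (y : Plane) :
    Integrable fun ζ : Plane => φ (ζ, z, y) := by
  obtain ⟨C, hC⟩ := WeightedSmooth.bound hφ
  refine ((integrable_symWeight z y).const_mul C).mono' ?_ (Filter.Eventually.of_forall fun ζ =>
    hC _ (mem_tripleDom hz ζ y))
  exact (hφ.smooth.continuousOn.comp_continuous (by fun_prop)
    fun ζ => mem_tripleDom hz ζ y).aestronglyMeasurable

theorem weightedSmooth_paramInvFT (hΛ : IsOpen Λ) (hΛ0 : ∀ z ∈ Λ, 0 < ‖z‖) (hφ : Flat Λ (-3) φ) :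
    WeightedSmooth tripleBasis (tripleDom Λ) (fun _ _ => 1) (fun _ => 1) (paramInvFT φ) := by
  have hb : ∀ φ : Plane × ℂ × Plane → F, Flat Λ (-3) φ →
      ∃ C, ∀ p ∈ tripleDom Λ, ‖paramInvFT φ p‖ ≤ C * 1 := by
    intro φ hφ
    obtain ⟨C, hC⟩ := WeightedSmooth.bound hφ
    refine ⟨((2 * Real.pi) ^ 2)⁻¹ * (|C| * ∫ ζ : Plane, ((1 + ‖ζ‖) ^ 3)⁻¹), fun p hp => ?_⟩
    rw [mul_one]
    refine (norm_paramInvFT_le hΛ hφ hp).trans (mul_le_mul_of_nonneg_left ?_ (by positivity))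
    have h1 := integral_weight_le p.2.1 le_rfl (hΛ0 _ hp.2.1) p.2.2
    rw [neg_zero, Real.rpow_zero, one_mul, sub_zero] at h1
    refine le_trans ?_ (mul_le_mul_of_nonneg_left h1 (abs_nonneg C))
    rw [← integral_const_mul]
    refine integral_mono (hφ.integrable_slice hp.2.1 p.2.2).norm
      ((integrable_symWeight _ _).const_mul _) fun ζ => ?_
    refine (hC (ζ, p.2) ⟨trivial, hp.2⟩).trans ?_
    exact mul_le_mul_of_nonneg_right (le_abs_self C) (symWeight_pos _ _).le
  refine ⟨paramInvFT_contDiffOn hΛ hφ, fun n => ?_⟩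
  induction n generalizing φ with
  | zero => exact hb φ hφ
  | succ n ih =>
    refine ⟨hb φ hφ, fun i => ?_⟩
    rw [show ((fun _ => (1 : ℝ)) : Plane × ℂ × Plane → ℝ) * (fun _ => 1) = fun _ => 1 by
      ext; simp]
    exact (ih (WeightedSmooth.deriv_one (isOpen_tripleDom hΛ) hφ i)).congr (isOpen_tripleDom hΛ)
      (dirDeriv_paramInvFT hΛ hφ i)

end Parameter

end PlaneAction

open MeasureTheory Module
open scoped RealInnerProductSpace BoundedContinuousFunction

namespace PlaneAction

variable {A : Type*} [CStarAlgebra A] {α : PlaneAction A}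

/-! ### The composition of multipliers on the level of symbols -/

section KernelOperator

variable (α) (B : Matrix (Fin 2) (Fin 2) ℝ) (j : Fin 2)

/-- The bounded factor of the integrand of `kerOp`. -/
noncomputable def kerIntegrand (G w : Plane →ᵇ A) (ζ v : Plane) : A :=
  osc (-1) ζ v • ((Complex.I • G v) * α.act v (w (ζ - matL B v)))

variable {B j}

theorem norm_kerIntegrand_le (G w : Plane →ᵇ A) (ζ v : Plane) :
    ‖α.kerIntegrand B G w ζ v‖ ≤ ‖G‖ * ‖w‖ := by
  rw [kerIntegrand, norm_smul, norm_osc, one_mul]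
  refine (norm_mul_le _ _).trans ?_
  rw [norm_smul, Complex.norm_I, one_mul, α.norm_act]
  exact mul_le_mul (G.norm_coe_le_norm v) (w.norm_coe_le_norm _) (norm_nonneg _) (norm_nonneg _)

theorem continuous_kerIntegrand (G w : Plane →ᵇ A) :
    Continuous fun q : Plane × Plane => α.kerIntegrand B G w q.1 q.2 := by
  have h1 : Continuous fun q : Plane × Plane => w (q.1 - matL B q.2) :=
    w.continuous.comp (by fun_prop)
  have h2 : Continuous fun q : Plane × Plane => Complex.I • G q.2 :=
    (G.continuous.comp continuous_snd).const_smul Complex.I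
  exact (contDiff_osc (-1)).continuous.smul (h2.mul (α.continuous_act_comp continuous_snd h1))

variable (j)

theorem integrable_kerIntegrand (G w : Plane →ᵇ A) (ζ : Plane) :
    Integrable fun v => kerWeight j v • α.kerIntegrand B G w ζ v :=
  (integrable_kerWeight j).smul_bdd (‖G‖ * ‖w‖)
    ((continuous_kerIntegrand α G w).comp (f := fun v => (ζ, v))
      (by fun_prop)).aestronglyMeasurable
    (Filter.Eventually.of_forall (norm_kerIntegrand_le α G w ζ))

theorem norm_integral_kerIntegrand_le (G w : Plane →ᵇ A) (ζ : Plane) :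
    ‖∫ v, kerWeight j v • α.kerIntegrand B G w ζ v‖ ≤
      (∫ v, ‖kerWeight j v‖) * ‖G‖ * ‖w‖ := by
  rw [mul_assoc, ← integral_mul_const]
  refine norm_integral_le_of_norm_le ((integrable_kerWeight j).norm.mul_const _)
    (Filter.Eventually.of_forall fun v => ?_)
  rw [norm_smul]
  exact mul_le_mul_of_nonneg_left (norm_kerIntegrand_le α G w ζ v) (norm_nonneg _)

theorem continuous_integral_kerIntegrand (G w : Plane →ᵇ A) :
    Continuous fun ζ => ∫ v, kerWeight j v • α.kerIntegrand B G w ζ v := by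
  refine continuous_of_dominated (bound := fun v => ‖kerWeight j v‖ * (‖G‖ * ‖w‖))
    (fun ζ => (integrable_kerIntegrand α j G w ζ).1)
    (fun ζ => Filter.Eventually.of_forall fun v => ?_)
    ((integrable_kerWeight j).norm.mul_const _) (Filter.Eventually.of_forall fun v => ?_)
  · rw [norm_smul]
    exact mul_le_mul_of_nonneg_left (norm_kerIntegrand_le α G w ζ v) (norm_nonneg _)
  · exact ((continuous_kerIntegrand α G w).comp (f := fun ζ => (ζ, v)) (by fun_prop)).const_smul _

variable (B)

/-- The bilinear operator sending a factor of a kernel and a symbol to a symbol. -/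
noncomputable def kerOp : (Plane →ᵇ A) →L[ℝ] (Plane →ᵇ A) →L[ℝ] (Plane →ᵇ A) :=
  LinearMap.mkContinuous₂
    (LinearMap.mk₂ ℝ
      (fun G w => BoundedContinuousFunction.ofNormedAddCommGroup
        (fun ζ => ∫ v, kerWeight j v • α.kerIntegrand B G w ζ v)
        (continuous_integral_kerIntegrand α j G w) _ (norm_integral_kerIntegrand_le α j G w))
      (fun G G' w => by
        ext ζ
        change (∫ v, kerWeight j v • α.kerIntegrand B (G + G') w ζ v) =
          (∫ v, kerWeight j v • α.kerIntegrand B G w ζ v) +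
          ∫ v, kerWeight j v • α.kerIntegrand B G' w ζ v
        rw [← integral_add (integrable_kerIntegrand α j G w ζ)
          (integrable_kerIntegrand α j G' w ζ)]
        refine integral_congr_ae (Filter.Eventually.of_forall fun v => ?_)
        simp only [kerIntegrand, BoundedContinuousFunction.add_apply, smul_add, add_mul])
      (fun c G w => by
        ext ζ
        change (∫ v, kerWeight j v • α.kerIntegrand B (c • G) w ζ v) =
          c • ∫ v, kerWeight j v • α.kerIntegrand B G w ζ v
        rw [← integral_smul c]
        refine integral_congr_ae (Filter.Eventually.of_forall fun v => ?_)
        simp only [kerIntegrand, BoundedContinuousFunction.smul_apply]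
        rw [smul_comm Complex.I c, smul_mul_assoc, smul_comm _ c, smul_comm _ c])
      (fun G w w' => by
        ext ζ
        change (∫ v, kerWeight j v • α.kerIntegrand B G (w + w') ζ v) =
          (∫ v, kerWeight j v • α.kerIntegrand B G w ζ v) +
          ∫ v, kerWeight j v • α.kerIntegrand B G w' ζ v
        rw [← integral_add (integrable_kerIntegrand α j G w ζ)
          (integrable_kerIntegrand α j G w' ζ)]
        refine integral_congr_ae (Filter.Eventually.of_forall fun v => ?_)
        simp only [kerIntegrand, BoundedContinuousFunction.add_apply, map_add, smul_add, mul_add])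
      (fun c G w => by
        ext ζ
        change (∫ v, kerWeight j v • α.kerIntegrand B G (c • w) ζ v) =
          c • ∫ v, kerWeight j v • α.kerIntegrand B G w ζ v
        rw [← integral_smul c]
        refine integral_congr_ae (Filter.Eventually.of_forall fun v => ?_)
        simp only [kerIntegrand, BoundedContinuousFunction.smul_apply, act_real_smul]
        rw [mul_smul_comm, smul_comm _ c, smul_comm _ c]))
    (∫ v, ‖kerWeight j v‖) fun G w =>
      BoundedContinuousFunction.norm_ofNormedAddCommGroup_le _ (by positivity) fun ζ =>
        norm_integral_kerIntegrand_le α j G w ζ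

theorem kerOp_apply (G w : Plane →ᵇ A) (ζ : Plane) :
    kerOp α B j G w ζ = ∫ v, kerWeight j v • α.kerIntegrand B G w ζ v := rfl

/-- Translation in the plane combined with the action. -/
noncomputable def twist (ξ y : Plane) (w : Plane →ᵇ A) : Plane →ᵇ A :=
  BoundedContinuousFunction.ofNormedAddCommGroup (fun ζ => α.act y (w (ξ + ζ)))
    (α.continuous_act_comp continuous_const (w.continuous.comp (by fun_prop))) ‖w‖ fun ζ => by
      rw [α.norm_act]
      exact w.norm_coe_le_norm _

theorem twist_apply (ξ y : Plane) (w : Plane →ᵇ A) (ζ : Plane) :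
    α.twist ξ y w ζ = α.act y (w (ξ + ζ)) := rfl

theorem twist_add (ξ y : Plane) (w w' : Plane →ᵇ A) :
    α.twist ξ y (w + w') = α.twist ξ y w + α.twist ξ y w' := by
  ext ζ
  simp [twist_apply]

theorem twist_sum {ι : Type*} (s : Finset ι) (ξ y : Plane) (w : ι → Plane →ᵇ A) :
    α.twist ξ y (∑ i ∈ s, w i) = ∑ i ∈ s, α.twist ξ y (w i) :=
  map_sum (AddMonoidHom.mk' (α.twist ξ y) (α.twist_add ξ y)) w s

theorem twist_one (ξ y : Plane) : α.twist ξ y 1 = 1 := by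
  ext ζ
  simp [twist_apply]

/-- Translating the result by ξ multiplies the kernel by the phase e^{-i⟨ξ,v⟩}, and α_y commutes
with α_v because the acting group is abelian. -/
theorem kerOp_twist (ξ y : Plane) {G G' : Plane →ᵇ A}
    (h : ∀ v, G' v = osc (-1) ξ v • α.act y (G v)) (w : Plane →ᵇ A) :
    kerOp α B j G' (α.twist ξ y w) = α.twist ξ y (kerOp α B j G w) := by
  ext ζ
  rw [twist_apply, kerOp_apply, kerOp_apply, ← α.actL_apply y,
    ← (α.actL y).integral_comp_comm (integrable_kerIntegrand α j G w _)]
  refine integral_congr_ae (Filter.Eventually.of_forall fun v => ?_)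
  have h1 : osc (-1) (ξ + ζ) v = osc (-1) ζ v * osc (-1) ξ v := by
    simp only [osc, inner_add_left, ← Complex.exp_add]
    congr 1
    push_cast
    ring
  have h2 : α.act v (α.act y (w (ξ + (ζ - matL B v)))) =
      α.act y (α.act v (w (ξ + ζ - matL B v))) := by
    rw [← α.act_add, ← α.act_add, add_comm v y, add_sub_assoc]
  simp only [actL_apply, kerIntegrand, map_smul, map_mul, twist_apply, h, h1, h2]
  rw [smul_comm Complex.I, smul_mul_assoc, smul_smul, smul_mul_assoc]

end KernelOperator

end PlaneAction

open MeasureTheory Module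
open scoped RealInnerProductSpace BoundedContinuousFunction

namespace PlaneAction

variable {A : Type*} [CStarAlgebra A] {α : PlaneAction A}

/-! ### Left composition with a symbol as a smooth family of operators. -/

section KernelSymbols

/-- The operator `1 - ∂₁² - ∂₂²` in the first variable. -/
noncomputable def lapXi (f : Plane → ℂ → A) : Plane → ℂ → A := fun ξ z =>
  f ξ z - dXi 0 (dXi 0 f) ξ z - dXi 1 (dXi 1 f) ξ z

/-- The symbols whose inverse Fourier transforms are the bounded factors of the kernel of `f`. -/
noncomputable def kerSymb (j : Fin 2) (f : Plane → ℂ → A) : Plane → ℂ → A :=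
  lapXi (lapXi (dXi j f))

variable {Λ : Set ℂ} {m : ℝ} {f : Plane → ℂ → A} {z : ℂ}

theorem Symb.lapXi (hΛ : IsOpen Λ) (hf : α.Symb Λ 1 m f) : α.Symb Λ 1 m (lapXi f) :=
  (hf.sub hΛ (((hf.dXi hΛ 0).dXi hΛ 0).mono (by linarith))).sub hΛ
    (((hf.dXi hΛ 1).dXi hΛ 1).mono (by linarith))

theorem Symb.kerSymb (hΛ : IsOpen Λ) (hf : α.Symb Λ 1 m f) (j : Fin 2) :
    α.Symb Λ 1 (m - 1) (kerSymb j f) :=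
  ((hf.dXi hΛ j).lapXi hΛ).lapXi hΛ

theorem Symb.flat (hf : α.Symb Λ 1 m f) {m' : ℝ} (hm : m ≤ m') : Flat Λ m' (α.lift f) := by
  have h := (hf.to_zero zero_le_one).mono hm
  rwa [Symb, symDrop_zero] at h

theorem Flat.decay (hΛ : IsOpen Λ) (hf : Flat Λ (-3) (α.lift f)) (hz : z ∈ Λ) :
    Decay fun ξ => f ξ z := by
  have h1 := hf.comp_add (0, z, 0)
  have hU : IsOpen ((· + ((0 : Plane), z, (0 : Plane))) ⁻¹' (tripleDom Λ)) :=
    (isOpen_tripleDom hΛ).preimage (by fun_prop)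
  have h2 := WeightedSmooth.comp_linear hU (fun p _ => (symWeight_pos _ _).le) h1
    (ContinuousLinearMap.inl ℝ Plane (ℂ × Plane)) planeBasis
  have h3 : (fun ξ : Plane => α.lift f (ContinuousLinearMap.inl ℝ Plane (ℂ × Plane) ξ +
      ((0 : Plane), z, (0 : Plane)))) = fun ξ => f ξ z := by
    ext p
    simp [lift, α.act_zero]
  rw [h3] at h2
  refine h2.mono (fun _ _ _ => zero_le_one) (fun _ _ _ => le_rfl)
    (fun p _ => (symWeight_pos _ _).le) (fun p _ => ?_) (fun p _ => by positivity)
    ⟨1, fun ζ _ => ?_⟩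
  · simp [tripleDom, hz]
  · have := symWeight_trans_le (0, z, 0) ζ
    simpa using this

theorem dirDeriv_slice (j : Fin 2) :
    dirDeriv (planeBasis j) (fun ξ => f ξ z) = fun ξ => dXi j f ξ z := by
  rw [planeBasis_apply]
  rfl

theorem oneSubLap_slice : oneSubLap (fun ξ => f ξ z) = fun ξ => lapXi f ξ z := by
  ext ξ
  simp only [oneSubLap, dirDeriv_slice, lapXi]

theorem Symb.decay_slice (hΛ : IsOpen Λ) (hf : α.Symb Λ 1 (-2) f) (hz : z ∈ Λ) (j : Fin 2) :
    Decay (dirDeriv (planeBasis j) fun ξ => f ξ z) := by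
  rw [dirDeriv_slice]
  exact ((hf.dXi hΛ j).flat (by norm_num)).decay hΛ hz

theorem SmoothOn.contDiff_slice (hf : α.SmoothOn Λ f) (hz : z ∈ Λ) :
    ContDiff ℝ ∞ fun ξ => f ξ z := by
  have h : ContDiffOn ℝ ∞ (fun ξ : Plane => α.lift f (ξ, z, 0)) Set.univ :=
    hf.contDiffOn.comp (by fun_prop) fun ξ _ => mem_tripleDom hz ξ 0
  simpa [contDiffOn_univ, lift, α.act_zero] using h

theorem Symb.tendsto_slice (hf : α.Symb Λ 1 (-2) f) (hz : z ∈ Λ) :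
    Filter.Tendsto (fun ξ => f ξ z) (Filter.cocompact Plane) (nhds 0) := by
  obtain ⟨C, hC⟩ := hf.bound
  have h1 : Filter.Tendsto (fun ξ : Plane => C * (1 + ‖ξ‖ + Real.sqrt ‖z‖) ^ (-2 : ℝ))
      (Filter.cocompact Plane) (nhds (C * 0)) := by
    refine ((tendsto_rpow_neg_atTop (by norm_num : (0 : ℝ) < 2)).comp ?_).const_mul C
    exact Filter.tendsto_atTop_add_const_right _ _
      (Filter.tendsto_atTop_add_const_left _ _ (tendsto_norm_cocompact_atTop (E := Plane)))
  rw [mul_zero] at h1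
  exact squeeze_zero_norm (fun ξ => hC ξ z hz) h1

theorem Symb.integral_osc_ker (hΛ : IsOpen Λ) (hf : α.Symb Λ 1 (-2) f) (hz : z ∈ Λ) (ξ : Plane) :
    ∫ v, osc (-1) ξ v • ker (fun ξ => f ξ z) v = f ξ z :=
  _root_.integral_osc_ker (hf.decay_slice hΛ hz) (hf.smoothOn.contDiff_slice hz)
    (hf.tendsto_slice hz) ξ

theorem Symb.integrable_ker (hΛ : IsOpen Λ) (hf : α.Symb Λ 1 (-2) f) (hz : z ∈ Λ) :
    Integrable (ker fun ξ => f ξ z) := _root_.integrable_ker (hf.decay_slice hΛ hz)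

variable (α) in
/-- Composition with the symbol `f` from the left, conjugated by translations and the action. -/
noncomputable def composeL (B : Matrix (Fin 2) (Fin 2) ℝ) (f : Plane → ℂ → A)
    (p : Plane × ℂ × Plane) : (Plane →ᵇ A) →L[ℝ] (Plane →ᵇ A) :=
  ∑ j, kerOp α B j (paramInvFT (α.lift (kerSymb j f)) p)

variable {B : Matrix (Fin 2) (Fin 2) ℝ}

theorem composeL_apply (hΛ : IsOpen Λ) (hf : α.Symb Λ 1 (-2) f) (hz : z ∈ Λ) (w : Plane →ᵇ A)
    (ζ : Plane) : composeL α B f (0, z, 0) w ζ =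
      ∫ v, osc (-1) ζ v • (ker (fun ξ => f ξ z) v * α.act v (w (ζ - matL B v))) := by
  rw [composeL, _root_.sum_apply, BoundedContinuousFunction.coe_sum, Finset.sum_apply]
  simp only [kerOp_apply]
  rw [← integral_finsetSum _ fun j _ => integrable_kerIntegrand α j _ w ζ]
  refine integral_congr_ae (Filter.Eventually.of_forall fun v => ?_)
  have h1 : ∀ j, paramInvFT (α.lift (kerSymb j f)) (0, z, 0) v =
      kerFactor j (fun ξ => f ξ z) v := fun j => by
    rw [paramInvFT_apply hΛ ((hf.kerSymb hΛ j).flat (by norm_num)) (mem_tripleDom hz 0 0),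
      kerFactor, dirDeriv_slice, oneSubLap_slice, oneSubLap_slice]
    simp only [zero_add, lift, α.act_zero, kerSymb]
  simp only [kerIntegrand, h1, ker, Finset.sum_mul, Finset.smul_sum]
  refine Finset.sum_congr rfl fun j _ => ?_
  rw [smul_comm (kerWeight j v)]
  simp only [smul_mul_assoc]

/-- A translation in the inverse Fourier transform shows that the kernel factor at (ξ, z, y) is
e^{-i⟨ξ,v⟩} α_y of the one at (0, z, 0). Thus the operator at (ξ, z, y) is the conjugate of the
composition operator at the parameter z. -/
theorem composeL_twist (hΛ : IsOpen Λ) (hf : α.Symb Λ 1 (-2) f) (hz : z ∈ Λ) (ξ y : Plane)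
    (w : Plane →ᵇ A) : composeL α B f (ξ, z, y) (α.twist ξ y w) =
      α.twist ξ y (composeL α B f (0, z, 0) w) := by
  rw [composeL, composeL, _root_.sum_apply, _root_.sum_apply, twist_sum]
  refine Finset.sum_congr rfl fun j _ => kerOp_twist α B j ξ y (fun v => ?_) w
  have hk := (hf.kerSymb hΛ j).flat (m' := -3) (by norm_num)
  rw [paramInvFT_apply hΛ hk (mem_tripleDom hz ξ y), paramInvFT_apply hΛ hk (mem_tripleDom hz 0 0),
    invFT, invFT, act_real_smul, smul_comm (osc (-1) ξ v)]
  congr 1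
  have hi := ((hk.decay hΛ hz).integrable.osc_smul 1 v)
  have h2 : ∀ ζ, α.lift (kerSymb j f) (0 + ζ, z, 0) = kerSymb j f ζ z := fun ζ => by
    simp [lift, α.act_zero]
  simp only [h2]
  rw [← actL_apply α y, ← (α.actL y).integral_comp_comm hi, ← integral_smul,
    ← integral_add_left_eq_self
      (fun ζ => osc (-1) ξ v • (α.actL y) (osc 1 v ζ • kerSymb j f ζ z)) ξ]
  refine integral_congr_ae (Filter.Eventually.of_forall fun ζ => ?_)
  have h1 : osc 1 v ζ = osc (-1) ξ v * osc 1 v (ξ + ζ) := by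
    rw [osc_comm (-1) ξ v]
    simp only [osc, inner_add_right, ← Complex.exp_add]
    congr 1
    push_cast
    ring
  simp only [actL_apply, map_smul, smul_smul, lift, h1]

theorem weightedSmooth_composeL (hΛ : IsOpen Λ) (hΛ0 : ∀ z ∈ Λ, 0 < ‖z‖)
    (hf : α.Symb Λ 1 (-2) f) :
    WeightedSmooth tripleBasis (tripleDom Λ) (fun _ _ => 1) (fun _ => 1) (composeL α B f) := by
  have hU := isOpen_tripleDom hΛ
  exact WeightedSmooth.sum _ hU (fun _ _ => zero_le_one) (fun _ _ _ => zero_le_one) fun j _ =>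
    (weightedSmooth_paramInvFT hΛ hΛ0 ((hf.kerSymb hΛ j).flat (by norm_num))).clm
      (G := (Plane →ᵇ A) →L[ℝ] (Plane →ᵇ A)) hU (kerOp α B j)

/-- The kernel factors come from ξ-derivatives of f, of order -4. Three orders are integrated and
the fourth leaves |z|^{-1/2}, which makes inversion possible for large parameters. -/
theorem norm_composeL_le (hΛ : IsOpen Λ) (hΛ0 : ∀ z ∈ Λ, 0 < ‖z‖) (hf : α.Symb Λ 1 (-3) f) :
    ∃ C, ∀ p ∈ tripleDom Λ, ‖composeL α B f p‖ ≤ C * (Real.sqrt ‖p.2.1‖)⁻¹ := by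
  have h : ∀ j, ∃ C, ∀ p ∈ tripleDom Λ,
      ‖paramInvFT (α.lift (kerSymb j f)) p‖ ≤ C * (Real.sqrt ‖p.2.1‖)⁻¹ := by
    intro j
    have hk := hf.kerSymb hΛ j
    have hk3 := hk.flat (m' := -3) (by norm_num)
    obtain ⟨C, hC⟩ := WeightedSmooth.bound hk
    refine ⟨((2 * Real.pi) ^ 2)⁻¹ * (|C| * ∫ ζ : Plane, ((1 + ‖ζ‖) ^ 3)⁻¹), fun p hp => ?_⟩
    refine (norm_paramInvFT_le hΛ hk3 hp).trans ?_
    rw [mul_assoc]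
    refine mul_le_mul_of_nonneg_left ?_ (by positivity)
    have h1 := integral_weight_le p.2.1 zero_le_one (hΛ0 _ hp.2.1) p.2.2
    rw [Real.rpow_neg_one] at h1
    calc ∫ ζ : Plane, ‖α.lift (kerSymb j f) (ζ, p.2)‖
        ≤ ∫ ζ : Plane, |C| * symWeight (-3 - 1) (ζ, p.2.1, p.2.2) := by
          refine integral_mono (hk3.integrable_slice hp.2.1 p.2.2).norm ?_ fun ζ => ?_
          · refine Integrable.const_mul ((integrable_symWeight p.2.1 p.2.2).mono' ?_
              (Filter.Eventually.of_forall fun ζ => ?_)) _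
            · refine Continuous.aestronglyMeasurable ?_
              unfold symWeight
              refine Continuous.rpow_const (by fun_prop) fun ζ => Or.inl ?_
              positivity
            · rw [Real.norm_of_nonneg (symWeight_pos _ _).le]
              exact symWeight_mono (by norm_num) _
          · refine (hC (ζ, p.2) ⟨trivial, hp.2⟩).trans ?_
            exact mul_le_mul_of_nonneg_right (le_abs_self C) (symWeight_pos _ _).le
      _ ≤ |C| * ((Real.sqrt ‖p.2.1‖)⁻¹ * ∫ ζ : Plane, ((1 + ‖ζ‖) ^ 3)⁻¹) := by
          rw [integral_const_mul]
          exact mul_le_mul_of_nonneg_left h1 (abs_nonneg C)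
      _ = _ := by ring
  choose C hC using h
  refine ⟨∑ j, ‖kerOp α B j‖ * C j, fun p hp => ?_⟩
  rw [composeL, Finset.sum_mul]
  refine (norm_sum_le _ _).trans (Finset.sum_le_sum fun j _ => ?_)
  rw [mul_assoc]
  exact ((kerOp α B j).le_opNorm _).trans (mul_le_mul_of_nonneg_left (hC j p hp) (norm_nonneg _))

end KernelSymbols

theorem _root_.Sectorial.inter_norm {Λ : Set ℂ} (hΛ : Sectorial Λ) (R : ℝ) :
    Sectorial (Λ ∩ {z | R < ‖z‖}) where
  isOpen := hΛ.isOpen.inter (isOpen_lt continuous_const continuous_norm)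
  sector := by
    obtain ⟨ε, hε, h⟩ := hΛ.sector
    exact ⟨ε, hε, fun z hz => h z hz.1⟩
  away := by
    obtain ⟨ρ, hρ, h⟩ := hΛ.away
    exact ⟨ρ, hρ, fun z hz => h z hz.1⟩

/-! ### Inversion among symbols of type zero. -/

section Parametrix

variable {Λ : Set ℂ} {B : Matrix (Fin 2) (Fin 2) ℝ} {s q : Plane → ℂ → A}

/-- Inversion of `1 + s` in the algebra of symbols, for large parameters. -/
theorem exists_inverse_symbol (hΛ : Sectorial Λ) (hs : α.Symb Λ 1 (-3) s)
    (hq : α.Symb Λ 1 (-2) q) : ∃ R : ℝ, 0 < R ∧ ∃ W : ℂ → Plane →ᵇ A,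
      α.Symb (Λ ∩ {z | R < ‖z‖}) 0 0 (fun ξ z => W z ξ) ∧
      α.Symb (Λ ∩ {z | R < ‖z‖}) 0 0 (fun ξ z => composeL α B q (0, z, 0) (W z) ξ) ∧
      ∀ z ∈ Λ, R < ‖z‖ → ∀ ξ, W z ξ + composeL α B s (0, z, 0) (W z) ξ = 1 := by
  have hΛ0 : ∀ z ∈ Λ, 0 < ‖z‖ := fun z hz => by
    obtain ⟨ρ, hρ, h⟩ := hΛ.away
    exact hρ.trans_le (h z hz)
  have hs2 : α.Symb Λ 1 (-2) s := hs.mono (by norm_num)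
  obtain ⟨C, hC⟩ := norm_composeL_le (B := B) hΛ.isOpen hΛ0 hs
  -- This radius makes C |z|^{-1/2} at most 1/2 for |z| > R.
  set R : ℝ := (2 * |C| + 1) ^ 2 with hR
  have hR0 : 0 < R := by positivity
  set Λ' := Λ ∩ {z | R < ‖z‖} with hΛ'
  have hΛs := hΛ.inter_norm R
  have hU := isOpen_tripleDom hΛs.isOpen
  have hsub : tripleDom Λ' ⊆ tripleDom Λ :=
    Set.prod_mono subset_rfl (Set.prod_mono Set.inter_subset_left subset_rfl)
  have hsmall : ∀ p ∈ tripleDom Λ', ‖composeL α B s p‖ ≤ 1 / 2 := by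
    intro p hp
    refine (hC p (hsub hp)).trans ?_
    have h1 : 2 * |C| + 1 < Real.sqrt ‖p.2.1‖ := Real.lt_sqrt_of_sq_lt hp.2.1.2
    have h2 : 0 < Real.sqrt ‖p.2.1‖ := lt_trans (by positivity) h1
    rw [← div_eq_mul_inv, div_le_iff₀ h2]
    linarith [le_abs_self C]
  have hunit : ∀ p ∈ tripleDom Λ', IsUnit (1 + composeL α B s p) := fun p hp => by
    have := isUnit_one_sub_of_norm_lt_one (x := -composeL α B s p)
      (by rw [norm_neg]; exact (hsmall p hp).trans_lt (by norm_num))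
    simpa using this
  have hone : ∀ p ∈ tripleDom Λ',
      (1 + composeL α B s p) * Ring.inverse (1 + composeL α B s p) = 1 := fun p hp =>
    Ring.mul_inverse_cancel _ (hunit p hp)
  have hbd : ∀ p ∈ tripleDom Λ', ‖Ring.inverse (1 + composeL α B s p)‖ ≤ 2 := by
    intro p hp
    set T := composeL α B s p
    set Q := Ring.inverse (1 + T) with hQ
    refine ContinuousLinearMap.opNorm_le_bound _ (by norm_num) fun w => ?_
    have h1 : Q w + T (Q w) = w := congrArg (fun L => L w) (hone p hp)
    have h2 : ‖T (Q w)‖ ≤ 1 / 2 * ‖Q w‖ :=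
      (T.le_opNorm _).trans (mul_le_mul_of_nonneg_right (hsmall p hp) (norm_nonneg _))
    have h3 : ‖Q w‖ ≤ ‖w‖ + ‖T (Q w)‖ := by
      calc ‖Q w‖ = ‖w - T (Q w)‖ := congrArg norm (eq_sub_of_add_eq h1)
        _ ≤ _ := norm_sub_le _ _
    linarith
  have hWs : ∀ f, α.Symb Λ 1 (-2) f → WeightedSmooth tripleBasis (tripleDom Λ')
      (fun _ _ => 1) (fun _ => 1) (composeL α B f) := fun f hf =>
    (weightedSmooth_composeL hΛ.isOpen hΛ0 hf).mono (fun _ _ _ => zero_le_one)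
      (fun _ _ _ => le_rfl) (fun _ _ => zero_le_one) hsub (fun _ _ => zero_le_one)
      ⟨1, fun _ _ => by norm_num⟩
  have hinv : WeightedSmooth tripleBasis (tripleDom Λ') (fun _ _ => 1) (fun _ => 1)
      (fun p => Ring.inverse (1 + composeL α B s p)) := by
    refine WeightedSmooth.ringInverse (R := (Plane →ᵇ A) →L[ℝ] (Plane →ᵇ A)) hU (fun _ _ _ => zero_le_one)
      (fun _ _ => zero_le_one) (fun _ _ => zero_le_one) (WeightedSmooth.add hU
        (WeightedSmooth.const (fun _ _ => zero_le_one) (fun _ _ _ => zero_le_one)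
          ⟨1, fun _ _ => by norm_num⟩ (1 : (Plane →ᵇ A) →L[ℝ] (Plane →ᵇ A))) (hWs s hs2)) hunit ⟨2, fun p hp => ?_⟩
      ⟨1, fun _ _ => by norm_num⟩
    rw [mul_one]
    exact hbd p hp
  set W : ℂ → Plane →ᵇ A := fun z => Ring.inverse (1 + composeL α B s (0, z, 0)) 1 with hW
  have hWeq : ∀ z ∈ Λ', W z + composeL α B s (0, z, 0) (W z) = 1 := fun z hz =>
    congrArg (fun L => L 1) (hone (0, z, 0) (mem_tripleDom hz 0 0))
  -- The constant symbol 1 is fixed by the twists, so conjugation and uniqueness of the inverse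
  -- identify the value of the inverse at 1 with the twist of W. Smoothness of the operator inverse
  -- in p thereby becomes smoothness of the symbol W, derivations included.
  have htw : ∀ p ∈ tripleDom Λ', Ring.inverse (1 + composeL α B s p) 1 =
      α.twist p.1 p.2.2 (W p.2.1) := by
    rintro ⟨ξ, z, y⟩ hp
    have h1 : (1 + composeL α B s (ξ, z, y)) (α.twist ξ y (W z)) = 1 := by
      change α.twist ξ y (W z) + composeL α B s (ξ, z, y) (α.twist ξ y (W z)) = 1
      rw [composeL_twist hΛ.isOpen hs2 hp.2.1.1, ← twist_add, hWeq z hp.2.1, twist_one]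
    rw [← h1, ← mul_apply_eq_comp, Ring.inverse_mul_cancel _ (hunit _ hp)]
    rfl
  -- Applying an operator to 1 and evaluating at the origin turns the twist by (ξ, y) into α_y(W z
  -- ξ), the lift of the symbol.
  set ev : ((Plane →ᵇ A) →L[ℝ] (Plane →ᵇ A)) →L[ℝ] A :=
    (BoundedContinuousFunction.evalCLM ℝ (0 : Plane)).comp
      (ContinuousLinearMap.apply ℝ (Plane →ᵇ A) (1 : Plane →ᵇ A)) with hev
  have hw1 : symWeight 0 = fun _ => (1 : ℝ) := by
    ext p
    simp [symWeight]
  refine ⟨R, hR0, W, ?_, ?_, fun z hz hzR ξ => ?_⟩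
  · rw [Symb, symDrop_zero, hw1]
    refine (hinv.clm (F := (Plane →ᵇ A) →L[ℝ] (Plane →ᵇ A)) (G := A) hU ev).congr hU fun p hp => ?_
    change (Ring.inverse (1 + composeL α B s p) 1 : Plane →ᵇ A) 0 = _
    rw [htw p hp, twist_apply, add_zero]
    rfl
  · have h2 := (WeightedSmooth.mul (R := (Plane →ᵇ A) →L[ℝ] (Plane →ᵇ A)) hU (hWs q hq) hinv).clm (F := (Plane →ᵇ A) →L[ℝ] (Plane →ᵇ A)) (G := A) hU ev
    rw [show ((fun _ => (1 : ℝ)) : Plane × ℂ × Plane → ℝ) * (fun _ => 1) = fun _ => 1 by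
      ext; simp] at h2
    rw [Symb, symDrop_zero, hw1]
    refine h2.congr hU fun p hp => ?_
    change (composeL α B q p (Ring.inverse (1 + composeL α B s p) 1) : Plane →ᵇ A) 0 = _
    rw [htw p hp, show p = (p.1, p.2.1, p.2.2) from rfl,
      composeL_twist hΛ.isOpen hq hp.2.1.1, twist_apply, add_zero]
    rfl
  · have := congrArg (fun w : Plane →ᵇ A => w ξ) (hWeq z ⟨hz, hzR⟩)
    simpa using this

end Parametrix

end PlaneAction

open MeasureTheory Module
open scoped RealInnerProductSpace BoundedContinuousFunction

theorem inner_matL_skew {B : Matrix (Fin 2) (Fin 2) ℝ} (hB : B.transpose = -B) (x v : Plane) :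
    inner ℝ x (matL B v) = -inner ℝ (matL B x) v := by
  obtain ⟨h0, h1, h2⟩ := skew_entries hB
  rw [plane_inner, plane_inner, matL_coord, matL_coord, matL_coord, matL_coord, h0, h1, h2]
  ring

namespace PlaneAction

variable {A : Type*} [CStarAlgebra A] {α : PlaneAction A}

/-! ### Convolution form and composition of multipliers. -/

section Composition

variable {B : Matrix (Fin 2) (Fin 2) ℝ} {f g u κ : Plane → A}

theorem mult_eq_osc (B : Matrix (Fin 2) (Fin 2) ℝ) (f u : Plane → A) (x : Plane) :
    α.mult B f u x = (((2 * Real.pi) ^ 2)⁻¹ : ℝ) •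
      ∫ ξ, osc 1 x ξ • (α.act (-x) (f ξ) * fourierHat u (ξ - matL B x)) := by
  rw [mult]
  congr 2
  ext ξ
  simp [osc]

theorem act_integral_mul {φ : Plane → A} (hφ : Integrable φ) (y : Plane) (b : A) :
    α.act y (∫ v, φ v) * b = ∫ v, α.act y (φ v) * b :=
  ((((ContinuousLinearMap.mul ℝ A).flip b).comp (α.actL y)).integral_comp_comm hφ).symm

theorem mul_integral {φ : Plane → A} (hφ : Integrable φ) (a : A) :
    a * ∫ v, φ v = ∫ v, a * φ v :=
  ((ContinuousLinearMap.mul ℝ A a).integral_comp_comm hφ).symm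

theorem fourier_inversion (hu : α.IsSchwartz u) (x : Plane) :
    (((2 * Real.pi) ^ 2)⁻¹ : ℝ) • ∫ ξ, osc 1 x ξ • fourierHat u ξ = u x := by
  have h2 := hu.integrable_fourierHat
  have h3 : fourierHat u = fun ξ => ∫ x, osc (-1) ξ x • u x := by
    ext ξ
    exact fourierHat_eq u ξ
  rw [h3] at h2
  simp only [h3]
  exact integral_osc_inversion hu.continuous hu.integrable h2 x

theorem continuous_osc_uncurry (ε : ℝ) : Continuous fun q : Plane × Plane => osc ε q.1 q.2 :=
  (contDiff_osc ε).continuous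

/-- Multipliers whose symbols are Fourier transforms are convolution operators. -/
theorem mult_eq_kernel (hB : B.transpose = -B) (hκ : Integrable κ)
    (hf : ∀ ξ, f ξ = ∫ v, osc (-1) ξ v • κ v) (hu : α.IsSchwartz u) (x : Plane) :
    α.mult B f u x = ∫ v, osc (-1) (matL B x) v • (α.act (-x) (κ v) * u (x - v)) := by
  set Ψ : Plane → Plane → A := fun ξ v =>
    osc 1 x ξ • osc (-1) (ξ + matL B x) v • (α.act (-x) (κ v) * fourierHat u ξ) with hΨ
  have hû := hu.integrable_fourierHat
  have hκ' : Integrable fun v => α.act (-x) (κ v) := (α.actL (-x)).integrable_comp hκ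
  have hprod : Integrable (Function.uncurry Ψ) (volume.prod volume) := by
    have h1 : Integrable (fun q : Plane × Plane => α.act (-x) (κ q.2) * fourierHat u q.1)
        (volume.prod volume) :=
      hû.op_fst_snd (op := fun a b => b * a) (by fun_prop) ⟨1, fun a b => by
        rw [one_mul, mul_comm ‖a‖]; exact norm_mul_le _ _⟩ hκ'
    have c1 : Continuous fun q : Plane × Plane => osc 1 x q.1 :=
      (continuous_osc_uncurry 1).comp (f := fun q : Plane × Plane => (x, q.1)) (by fun_prop)
    have c2 : Continuous fun q : Plane × Plane => osc (-1) (q.1 + matL B x) q.2 :=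
      (continuous_osc_uncurry (-1)).comp
        (f := fun q : Plane × Plane => (q.1 + matL B x, q.2)) (by fun_prop)
    exact (h1.bdd_smul 1 c2.aestronglyMeasurable (Filter.Eventually.of_forall fun q =>
      (norm_osc _ _ _).le)).bdd_smul 1 c1.aestronglyMeasurable
      (Filter.Eventually.of_forall fun q => (norm_osc _ _ _).le)
  have h1 : ∀ ξ, osc 1 x ξ • (α.act (-x) (f (ξ + matL B x)) * fourierHat u ξ) = ∫ v, Ψ ξ v := by
    intro ξ
    rw [hf, act_integral_mul (hκ.osc_smul _ _), ← integral_smul]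
    simp only [map_smul, smul_mul_assoc, hΨ]
  have h2 : ∀ v, (((2 * Real.pi) ^ 2)⁻¹ : ℝ) • ∫ ξ, Ψ ξ v =
      osc (-1) (matL B x) v • (α.act (-x) (κ v) * u (x - v)) := by
    intro v
    have h3 : ∀ ξ, Ψ ξ v =
        osc (-1) (matL B x) v • (α.act (-x) (κ v) * (osc 1 (x - v) ξ • fourierHat u ξ)) := by
      intro ξ
      have h4 : osc 1 x ξ * osc (-1) (ξ + matL B x) v =
          osc (-1) (matL B x) v * osc 1 (x - v) ξ := by
        simp only [osc, inner_add_right, inner_sub_left, ← Complex.exp_add, real_inner_comm v]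
        congr 1
        push_cast
        ring
      simp only [hΨ, mul_smul_comm, smul_smul, h4]
    simp only [h3]
    rw [integral_smul, ← mul_integral (hû.osc_smul _ _), ← fourier_inversion hu (x - v),
      smul_comm, mul_smul_comm]
  rw [mult_eq hB]
  simp only [h1]
  rw [integral_integral_swap hprod, ← integral_smul]
  simp only [h2]

theorem PolySymb.continuous_pairLift {m : ℕ} (hg : α.PolySymb m g) : Continuous (α.pairLift g) :=
  hg.contDiff.continuous

theorem PolySymb.bounded (hg : α.PolySymb 0 g) : ∃ C, ∀ ξ, ‖g ξ‖ ≤ C := by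
  obtain ⟨C, hC⟩ := WeightedSmooth.bound hg
  exact ⟨C, fun ξ => by simpa [pairLift, α.act_zero] using hC (ξ, 0) trivial⟩

/-- Writing the first multiplier as a twisted convolution and the second as a Fourier integral,
Fubini and the shift ξ ↦ ξ - Bv collect everything into one Fourier integral. Boundedness of g and
integrability of the kernel and of û justify the exchange. -/
theorem mult_mult (hB : B.transpose = -B) (hκ : Integrable κ)
    (hf : ∀ ξ, f ξ = ∫ v, osc (-1) ξ v • κ v) (hg : α.PolySymb 0 g) (hu : α.IsSchwartz u) :
    α.mult B f (α.mult B g u) =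
      α.mult B (fun ξ => ∫ v, osc (-1) ξ v • (κ v * α.act v (g (ξ - matL B v)))) u := by
  ext x
  obtain ⟨C, hC⟩ := hg.bounded
  have hû := hu.integrable_fourierHat.comp_sub_right (matL B x)
  set b : Plane → Plane → A := fun ξ v => α.act v (g (ξ - matL B v)) with hb
  have hbc : Continuous fun q : Plane × Plane => b q.1 q.2 :=
    hg.continuous_pairLift.comp (f := fun q : Plane × Plane => (q.1 - matL B q.2, q.2))
      (by fun_prop)
  have hbn : ∀ ξ v, ‖b ξ v‖ ≤ C := fun ξ v => by
    rw [hb, α.norm_act]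
    exact hC _
  have hκb : ∀ ξ, Integrable fun v => κ v * b ξ v := fun ξ =>
    hκ.mul_bdd (c := C) (hbc.comp (f := fun v => (ξ, v)) (by fun_prop)).aestronglyMeasurable
      (Filter.Eventually.of_forall (hbn ξ))
  set Ψ : Plane → Plane → A := fun ξ v => osc 1 x ξ • osc (-1) ξ v •
    (α.act (-x) (κ v * b ξ v) * fourierHat u (ξ - matL B x)) with hΨ
  have hprod : Integrable (Function.uncurry Ψ) (volume.prod volume) := by
    have c1 : Continuous fun q : Plane × Plane => osc 1 x q.1 :=
      (continuous_osc_uncurry 1).comp (f := fun q : Plane × Plane => (x, q.1)) (by fun_prop)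
    have hm : AEStronglyMeasurable (fun q : Plane × Plane =>
        α.act (-x) (κ q.2 * b q.1 q.2) * fourierHat u (q.1 - matL B x)) (volume.prod volume) :=
      ((α.actL (-x)).continuous.comp_aestronglyMeasurable
        (hκ.1.comp_snd.mul hbc.aestronglyMeasurable)).mul hû.1.comp_fst
    have h1 : Integrable (fun q : Plane × Plane =>
        α.act (-x) (κ q.2 * b q.1 q.2) * fourierHat u (q.1 - matL B x)) (volume.prod volume) := by
      refine ((hû.norm.mul_prod hκ.norm).const_mul C).mono' hm
        (Filter.Eventually.of_forall fun q => ?_)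
      refine (norm_mul_le _ _).trans ?_
      rw [α.norm_act]
      calc ‖κ q.2 * b q.1 q.2‖ * ‖fourierHat u (q.1 - matL B x)‖
          ≤ (‖κ q.2‖ * C) * ‖fourierHat u (q.1 - matL B x)‖ := by
            refine mul_le_mul_of_nonneg_right ((norm_mul_le _ _).trans ?_) (norm_nonneg _)
            exact mul_le_mul_of_nonneg_left (hbn _ _) (norm_nonneg _)
        _ = _ := by ring
    exact (h1.bdd_smul 1 (continuous_osc_uncurry (-1)).aestronglyMeasurable
      (Filter.Eventually.of_forall fun q =>
      (norm_osc _ _ _).le)).bdd_smul 1 c1.aestronglyMeasurable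
      (Filter.Eventually.of_forall fun q => (norm_osc _ _ _).le)
  have h1 : ∀ ξ, osc 1 x ξ • (α.act (-x) (∫ v, osc (-1) ξ v • (κ v * b ξ v)) *
      fourierHat u (ξ - matL B x)) = ∫ v, Ψ ξ v := by
    intro ξ
    rw [act_integral_mul ((hκb ξ).osc_smul _ _), ← integral_smul]
    simp only [map_smul, smul_mul_assoc, hΨ]
  have h2 : ∀ v, (((2 * Real.pi) ^ 2)⁻¹ : ℝ) • ∫ ξ, Ψ ξ v =
      osc (-1) (matL B x) v • (α.act (-x) (κ v) * α.mult B g u (x - v)) := by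
    intro v
    have h3 : ∀ ξ, Ψ ξ v = osc (-1) (matL B x) v • (α.act (-x) (κ v) *
        (osc 1 (x - v) (ξ - matL B v) • (α.act (-(x - v)) (g (ξ - matL B v)) *
          fourierHat u (ξ - matL B v - matL B (x - v))))) := by
      intro ξ
      -- Skewness enters through ⟨x, Bv⟩ = -⟨Bx, v⟩ and ⟨v, Bv⟩ = 0.
      have h4 : osc 1 x ξ * osc (-1) ξ v =
          osc (-1) (matL B x) v * osc 1 (x - v) (ξ - matL B v) := by
        simp only [osc, inner_sub_left, inner_sub_right, ← Complex.exp_add, inner_matL_self hB,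
          inner_matL_skew hB x v, real_inner_comm v]
        congr 1
        push_cast
        ring
      have h5 : ξ - matL B v - matL B (x - v) = ξ - matL B x := by
        rw [map_sub]
        abel
      have h6 : α.act (-(x - v)) (g (ξ - matL B v)) = α.act (-x) (b ξ v) := by
        rw [hb, ← α.act_add, neg_sub, sub_eq_neg_add]
      simp only [hΨ, mul_smul_comm, smul_smul, h4, h5, h6, map_mul, mul_assoc]
    have h7 : Integrable fun ξ => osc 1 (x - v) ξ •
        (α.act (-(x - v)) (g ξ) * fourierHat u (ξ - matL B (x - v))) := by
      refine Integrable.osc_smul ?_ _ _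
      refine (hu.integrable_fourierHat.comp_sub_right (matL B (x - v))).bdd_mul (c := C) ?_
        (Filter.Eventually.of_forall fun ξ => by rw [α.norm_act]; exact hC ξ)
      exact (hg.continuous_pairLift.comp (f := fun ξ => (ξ, -(x - v)))
        (by fun_prop)).aestronglyMeasurable
    simp only [h3]
    rw [integral_smul, ← mul_integral (h7.comp_sub_right (matL B v)),
      integral_sub_right_eq_self (fun ξ => osc 1 (x - v) ξ •
        (α.act (-(x - v)) (g ξ) * fourierHat u (ξ - matL B (x - v)))), mult_eq_osc,
      smul_comm, mul_smul_comm]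
  rw [mult_eq_kernel hB hκ hf (hu.mult hB hg), mult_eq_osc]
  change _ = (((2 * Real.pi) ^ 2)⁻¹ : ℝ) • ∫ ξ, osc 1 x ξ •
    (α.act (-x) (∫ v, osc (-1) ξ v • (κ v * b ξ v)) * fourierHat u (ξ - matL B x))
  simp only [h1]
  rw [integral_integral_swap hprod, ← integral_smul]
  simp only [h2]

end Composition

namespace Elliptic

variable (E : α.Elliptic) {Λ : Set ℂ}

/-- A right inverse of `P - z` for large parameters, with a symbol of order `0`. -/
theorem exists_right_inverse (hΛ : Sectorial Λ) : ∃ R : ℝ, 0 < R ∧ ∃ r : Plane → ℂ → A,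
    α.Symb (Λ ∩ {z | R < ‖z‖}) 0 0 r ∧ ∀ z ∈ Λ, R < ‖z‖ → ∀ u, α.IsSchwartz u →
      E.op (α.mult E.B (fun ξ => r ξ z) u) - z • α.mult E.B (fun ξ => r ξ z) u = u := by
  -- Three terms are taken because an error of order -3 is what gives composition operators of norm
  -- O(|z|^{-1/2}).
  have hs : α.Symb Λ 1 (-3) (E.error 3) := by simpa using! E.symb_error hΛ 3
  have hq : α.Symb Λ 1 (-2) (E.approx 3) := by
    simpa [approx] using! E.symb_approx_sub hΛ 0 3
  have hs2 := hs.mono (m' := -2) (by norm_num)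
  obtain ⟨R, hR, W, hW, hr, hWs⟩ := exists_inverse_symbol (B := E.B) hΛ hs hq
  refine ⟨R, hR, _, hr, fun z hz hzR u hu => ?_⟩
  have hΛ' := (hΛ.inter_norm R).isOpen
  have hz' : z ∈ Λ ∩ {z | R < ‖z‖} := ⟨hz, hzR⟩
  have hWp : α.PolySymb 0 (fun ξ => W z ξ) := hW.polySymb hΛ' le_rfl hz' (by norm_num)
  have hqp : α.PolySymb 0 (fun ξ => E.approx 3 ξ z) :=
    hq.polySymb hΛ.isOpen zero_le_one hz (by norm_num)
  have hsp : α.PolySymb 0 (fun ξ => E.error 3 ξ z) :=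
    hs.polySymb hΛ.isOpen zero_le_one hz (by norm_num)
  have hv := hu.mult E.skew hWp
  have hcomp : ∀ f, α.Symb Λ 1 (-2) f → α.mult E.B (fun ξ => f ξ z)
      (α.mult E.B (fun ξ => W z ξ) u) =
      α.mult E.B (fun ξ => composeL α E.B f (0, z, 0) (W z) ξ) u := fun f hf => by
    rw [mult_mult E.skew (hf.integrable_ker hΛ.isOpen hz)
      (fun ξ => (hf.integral_osc_ker hΛ.isOpen hz ξ).symm) hWp hu]
    simp only [composeL_apply hΛ.isOpen hf hz]
  have key : ∀ v, α.IsSchwartz v → E.op (α.mult E.B (fun ξ => E.approx 3 ξ z) v) -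
      z • α.mult E.B (fun ξ => E.approx 3 ξ z) v =
      v + α.mult E.B (fun ξ => E.error 3 ξ z) v := fun v hv => by
    have h1 : E.op (α.mult E.B (fun ξ => E.approx 3 ξ z) v) =
        α.mult E.B (fun ξ => z • E.approx 3 ξ z + (1 + E.error 3 ξ z)) v := by
      rw [E.op_mult hqp hv z]
      congr 1
      ext ξ
      rw [← E.sym_approx 3 ξ (hΛ.subset hz), add_sub_cancel]
      exact E.sym_congr (fun _ => rfl) ξ
    rw [h1, mult_add E.skew (hqp.const_smul z) (polySymb_one.add hsp) hv,
      mult_add E.skew polySymb_one hsp hv, mult_const_smul E.skew, mult_one E.skew hv]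
    ext x
    simp
  -- With q the partial sum and s its error, (P - z) P_q P_W u = P_W u + P_s P_W u, the multiplier
  -- of the sum of W and the composition of s with W, which is 1.
  rw [← hcomp _ hq, key _ hv, hcomp _ hs2]
  have hsW : α.PolySymb 0 (fun ξ => composeL α E.B (E.error 3) (0, z, 0) (W z) ξ) := by
    have : (fun ξ => composeL α E.B (E.error 3) (0, z, 0) (W z) ξ) = fun ξ => 1 - W z ξ :=
      funext fun ξ => eq_sub_of_add_eq' (hWs z hz hzR ξ)
    rw [this]
    exact polySymb_one.sub hWp
  have h2 := mult_add E.skew hWp hsW hu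
  simp only [hWs z hz hzR, mult_one E.skew hu] at h2
  exact h2.symm

end Elliptic

end PlaneAction

open MeasureTheory Module
open scoped RealInnerProductSpace BoundedContinuousFunction

namespace PlaneAction

variable {A : Type*} [CStarAlgebra A] {α : PlaneAction A}

/-! ### Symbols are determined by their multipliers. -/

section Injectivity

variable {B : Matrix (Fin 2) (Fin 2) ℝ} {g : Plane → A} {m : ℕ}

theorem dirDeriv_comp_fst {F : Type*} [NormedAddCommGroup F] [NormedSpace ℝ F] {Φ : Plane → F}
    (hΦ : ContDiff ℝ ∞ Φ) (v : Plane × Plane) :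
    dirDeriv v (fun p : Plane × Plane => Φ p.1) = fun p => dirDeriv v.1 Φ p.1 := by
  ext p
  exact congrArg (fun L => L v) (HasFDerivAt.fderiv (f := fun p : Plane × Plane => Φ p.1)
    ((hΦ.differentiable (by simp) p.1).hasFDerivAt.comp p hasFDerivAt_fst))

theorem rapid_comp_fst {F : Type*} [NormedAddCommGroup F] [NormedSpace ℂ F] {Φ : Plane → F}
    (hΦ : ContDiff ℝ ∞ Φ) (hc : HasCompactSupport Φ) :
    Rapid (fun p : Plane × Plane => Φ p.1) := by
  intro N
  refine ⟨(hΦ.comp contDiff_fst).contDiffOn, fun n => ?_⟩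
  have hb : ∀ Φ : Plane → F, ContDiff ℝ ∞ Φ → HasCompactSupport Φ → ∃ C, ∀ p ∈ Set.univ,
      ‖(fun p : Plane × Plane => Φ p.1) p‖ ≤ C * ((1 + ‖p.1‖) ^ N)⁻¹ := by
    intro Φ hΦ hc
    have h1 : Continuous fun x => (1 + ‖x‖) ^ N • Φ x :=
      (by fun_prop : Continuous fun x : Plane => (1 + ‖x‖) ^ N).smul hΦ.continuous
    obtain ⟨C, hC⟩ := hc.smul_left.exists_bound_of_continuous h1
    refine ⟨C, fun p _ => ?_⟩
    have h2 : ‖((1 + ‖p.1‖) ^ N : ℝ) • Φ p.1‖ ≤ C := hC p.1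
    rw [norm_smul, Real.norm_of_nonneg (by positivity)] at h2
    rw [← div_eq_mul_inv, le_div_iff₀ (by positivity), mul_comm]
    exact h2
  induction n generalizing Φ with
  | zero => exact hb Φ hΦ hc
  | succ n ih =>
    refine ⟨hb Φ hΦ hc, fun i => ?_⟩
    rw [dirDeriv_comp_fst hΦ]
    have h1 : ContDiff ℝ ∞ (dirDeriv (pairBasis i).1 Φ) :=
      contDiffOn_univ.1 ((contDiffOn_univ.2 hΦ).dirDeriv isOpen_univ _)
    have h2 := ih h1 (hc.fderiv_apply (𝕜 := ℝ) _)
    convert h2 using 1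
    ext p
    simp

theorem isSchwartz_smul_one {φ : Plane → ℝ} (hφ : ContDiff ℝ ∞ φ) (hc : HasCompactSupport φ) :
    α.IsSchwartz (fun x => φ x • (1 : A)) := by
  rw [isSchwartz_iff]
  have : α.pairLift (fun x => φ x • (1 : A)) = fun p => φ p.1 • (1 : A) := by
    ext p
    simp [pairLift, act_real_smul]
  rw [this]
  exact rapid_comp_fst (Φ := fun x => φ x • (1 : A)) (hφ.smul contDiff_const) hc.smul_right

theorem IsSchwartz.fourierHat {u : Plane → A} (hu : α.IsSchwartz u) :
    α.IsSchwartz (fourierHat u) := isSchwartz_iff.2 (rapid_fourierHat hu)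

/-- For u the Fourier transform of a test function φ, û is a multiple of the reflected φ, and the
value of P_g u at the origin is the integral of φ(ξ) g(-ξ). All of these vanish, and g is
continuous. -/
theorem eq_zero_of_mult_eq_zero (hB : B.transpose = -B) (hg : α.PolySymb m g)
    (h : ∀ u, α.IsSchwartz u → α.mult B g u = 0) : g = 0 := by
  have hc : Continuous g := by
    have := hg.contDiff.continuous.comp (f := fun ξ => (ξ, (0 : Plane))) (by fun_prop)
    simpa [Function.comp_def, pairLift, α.act_zero] using this
  have hpi : ((2 * Real.pi) ^ 2 : ℝ) ≠ 0 := by positivity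
  have h1 : ∀ φ : Plane → ℝ, ContDiff ℝ ∞ φ → HasCompactSupport φ →
      ∫ ξ, φ ξ • g (-ξ) = 0 := by
    intro φ hφ hφc
    have hv : α.IsSchwartz (fun x => φ x • (1 : A)) := isSchwartz_smul_one hφ hφc
    have h2 := congrFun (h _ hv.fourierHat) 0
    have h3 : ∀ ξ, PlaneAction.fourierHat (PlaneAction.fourierHat fun x => φ x • (1 : A)) ξ =
        ((2 * Real.pi) ^ 2 : ℝ) • φ (-ξ) • (1 : A) := fun ξ => by
      rw [fourierHat_eq, ← fourier_inversion hv (-ξ), smul_inv_smul₀ hpi]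
      simp [osc]
    rw [mult_eq hB] at h2
    simp only [h3, map_zero, add_zero, neg_zero, α.act_zero, osc, inner_zero_left, mul_zero,
      Complex.ofReal_zero, Complex.exp_zero, one_smul, mul_smul_comm, mul_one, Pi.zero_apply] at h2
    rw [integral_smul, smul_smul, inv_mul_cancel₀ hpi, one_smul] at h2
    rw [← integral_neg_eq_self]
    simpa using h2
  have h2 := ae_eq_zero_of_integral_contDiff_smul_eq_zero (μ := (volume : Measure Plane))
    (hc.comp continuous_neg).locallyIntegrable h1
  have h3 := (Continuous.ae_eq_iff_eq volume (hc.comp continuous_neg) continuous_zero).1 h2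
  ext ξ
  simpa using congrFun h3 (-ξ)

end Injectivity

namespace Elliptic

variable (E : α.Elliptic) {Λ : Set ℂ}

/-- An operator identity on Schwartz functions is an identity of multipliers, hence of symbols; this
hands the right inverse over to elliptic regularity. -/
theorem sym_eq_one_of_right_inverse (hΛ : IsOpen Λ) {r : Plane → ℂ → A} (hr : α.Symb Λ 0 0 r)
    {z : ℂ} (hz : z ∈ Λ) (h : ∀ u, α.IsSchwartz u →
      E.op (α.mult E.B (fun ξ => r ξ z) u) - z • α.mult E.B (fun ξ => r ξ z) u = u) (ξ : Plane) :
    E.sym r ξ z - z • r ξ z = 1 := by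
  have hrp : α.PolySymb 0 (fun ξ => r ξ z) := hr.polySymb hΛ le_rfl hz (by norm_num)
  have h1 := E.polySymb_sym hrp z
  have h2 := (hrp.const_smul (-z)).mono (Nat.zero_le (0 + 2))
  have h3 : α.PolySymb (0 + 2) (fun _ => -1) := by
    simpa using (polySymb_one (α := α) (m := 0 + 2)).const_smul (-1)
  have h4 := eq_zero_of_mult_eq_zero E.skew ((h1.add h2).add h3) fun u hu => by
    have h5 : α.mult E.B (fun _ => -1) u = -u := by
      have := mult_const_smul E.skew (fun _ => (1 : A)) u (α := α) (-1)
      simp only [mult_one E.skew hu, neg_one_smul] at this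
      exact this
    have h6 := h u hu
    rw [E.op_mult hrp hu z] at h6
    rw [mult_add E.skew (h1.add h2) h3 hu, mult_add E.skew h1 h2 hu, mult_const_smul E.skew, h5]
    ext x
    have h7 := congrFun h6 x
    simp only [Pi.sub_apply, Pi.smul_apply] at h7
    simp only [Pi.neg_apply, Pi.zero_apply, neg_smul, ← sub_eq_add_neg]
    rw [h7, sub_self]
  have h8 := congrFun h4 ξ
  rw [E.sym_congr (f := r) (g := fun ξ _ => r ξ z) (fun _ => rfl) ξ]
  simp only [Pi.zero_apply, neg_smul] at h8
  rw [← sub_eq_zero, ← h8]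
  abel

end Elliptic

end PlaneAction

open MeasureTheory Module
open scoped RealInnerProductSpace BoundedContinuousFunction

/-! ### Boundedness on the Hilbert module. -/

section Order

variable {A : Type*} [CStarAlgebra A] [PartialOrder A] [StarOrderedRing A]

/-- Positivity of the square of c^{1/2} p - c^{-1/2} q. -/
theorem star_mul_add_star_mul_le (c : ℝ) (hc : 0 < c) (p q : A) :
    star p * q + star q * p ≤ c • (star p * p) + c⁻¹ • (star q * q) := by
  have hs : 0 < Real.sqrt c := Real.sqrt_pos.2 hc
  have h := star_mul_self_nonneg (Real.sqrt c • p - (Real.sqrt c)⁻¹ • q)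
  have h1 : star (Real.sqrt c • p - (Real.sqrt c)⁻¹ • q) *
      (Real.sqrt c • p - (Real.sqrt c)⁻¹ • q) =
      (c • (star p * p) + c⁻¹ • (star q * q)) - (star p * q + star q * p) := by
    simp only [star_sub, star_smul, star_trivial, sub_mul, mul_sub, smul_mul_smul_comm,
      ← mul_inv, Real.mul_self_sqrt hc.le, mul_inv_cancel₀ hs.ne', inv_mul_cancel₀ hs.ne', one_smul]
    abel
  rw [h1] at h
  exact sub_nonneg.1 h

/-- The Cauchy–Schwarz inequality for convolutions with operator valued kernels. -/
theorem star_integral_mul_integral_le {κ y : Plane → A} (hκ : Integrable κ) {C : ℝ}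
    (hC : ∀ v, ‖y v‖ ≤ C) (hy : AEStronglyMeasurable y) {K : ℝ} (hK : ∫ v, ‖κ v‖ ≤ K)
    (hK0 : 0 < K) :
    star (∫ v, κ v * y v) * ∫ v, κ v * y v ≤ K • ∫ v, ‖κ v‖ • (star (y v) * y v) := by
  have hi : Integrable fun v => κ v * y v :=
    hκ.mul_bdd (c := C) hy (Filter.Eventually.of_forall hC)
  have hy2 : Integrable fun v => ‖κ v‖ • (star (y v) * y v) :=
    hκ.norm.smul_bdd (C * C) (hy.star.mul hy) (Filter.Eventually.of_forall fun v => by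
      refine (norm_mul_le _ _).trans ?_
      rw [norm_star]
      exact mul_le_mul (hC v) (hC v) (norm_nonneg _) ((norm_nonneg _).trans (hC v)))
  set w := ∫ v, κ v * y v with hw
  have hpt : ∀ v, star w * (κ v * y v) + star (κ v * y v) * w ≤
      (‖κ v‖ * K⁻¹) • (star w * w) + K • (‖κ v‖ • (star (y v) * y v)) := by
    intro v
    rcases eq_or_ne (κ v) 0 with h0 | h0
    · simp [h0]
    have hs : 0 < ‖κ v‖ := norm_pos_iff.2 h0
    -- With this weight the terms in w integrate to at most one copy of star w * w, which is then
    -- cancelled from the two on the left.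
    refine (star_mul_add_star_mul_le (‖κ v‖ * K⁻¹) (by positivity) w (κ v * y v)).trans ?_
    refine add_le_add_right ?_ _
    have h2 : star (κ v * y v) * (κ v * y v) ≤ (‖κ v‖ * ‖κ v‖) • (star (y v) * y v) := by
      have := CStarAlgebra.star_left_conjugate_le_norm_smul (a := y v) (b := star (κ v) * κ v)
        (IsSelfAdjoint.star_mul_self _)
      rw [CStarRing.norm_star_mul_self] at this
      simpa [mul_assoc] using this
    refine (smul_le_smul_of_nonneg_left h2 (by positivity)).trans (le_of_eq ?_)
    rw [smul_smul, smul_smul]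
    congr 1
    field_simp
  have his : Integrable fun v => star (κ v * y v) :=
    ((starL' ℝ : A ≃L[ℝ] A) : A →L[ℝ] A).integrable_comp hi
  have i1 : Integrable fun v => star w * (κ v * y v) := hi.const_mul _
  have i2 : Integrable fun v => star (κ v * y v) * w := his.mul_const _
  have i3 : Integrable fun v => (‖κ v‖ * K⁻¹) • (star w * w) := (hκ.norm.mul_const _).smul_const _
  have i4 : Integrable fun v => K • (‖κ v‖ • (star (y v) * y v)) := hy2.smul K
  have h := integral_mono (i1.add i2) (i3.add i4) hpt
  have e1 := integral_add i1 i2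
  have e2 := integral_add i3 i4
  simp only [Pi.add_apply] at h
  rw [e1, e2, ← PlaneAction.mul_integral hi, integral_smul_const, integral_mul_const,
    integral_smul] at h
  have e3 : ∫ v, star (κ v * y v) * w = star w * w := by
    have h3 := ((ContinuousLinearMap.mul ℝ A).flip w).integral_comp_comm his
    have h4 : ∫ v, star (κ v * y v) = star w := by
      exact ((starL' ℝ : A ≃L[ℝ] A) : A →L[ℝ] A).integral_comp_comm hi
    rw [← h4]
    exact h3
  rw [e3, ← hw] at h
  have h5 : ((∫ v, ‖κ v‖) * K⁻¹) • (star w * w) ≤ star w * w := by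
    have : (∫ v, ‖κ v‖) * K⁻¹ ≤ 1 := by
      rw [← div_eq_mul_inv, div_le_one hK0]
      exact hK
    simpa using smul_le_smul_of_nonneg_right this (star_mul_self_nonneg w)
  exact le_of_add_le_add_left (h.trans (add_le_add_left h5 _))

end Order

namespace PlaneAction

variable {A : Type*} [CStarAlgebra A] {α : PlaneAction A}

theorem IsSchwartz.bounded {u : Plane → A} (hu : α.IsSchwartz u) : ∃ C, ∀ x, ‖u x‖ ≤ C := by
  obtain ⟨C, hC⟩ := (hu.rapid 0).bound
  exact ⟨C, fun x => by simpa [pairLift, α.act_zero] using hC (x, 0) trivial⟩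

theorem IsSchwartz.integrable_star_mul {u w : Plane → A} (hu : α.IsSchwartz u)
    (hw : α.IsSchwartz w) : Integrable fun x => star (u x) * w x := by
  obtain ⟨C, hC⟩ := hu.bounded
  exact hw.integrable.bdd_mul (c := C) hu.continuous.star.aestronglyMeasurable
    (Filter.Eventually.of_forall fun x => by rw [norm_star]; exact hC x)

/-- Convolution operators with integrable kernels are bounded on the Hilbert module. -/
theorem norm_integral_mult_le {B : Matrix (Fin 2) (Fin 2) ℝ} (hB : B.transpose = -B)
    {f κ : Plane → A} (hκ : Integrable κ) (hf : ∀ ξ, f ξ = ∫ v, osc (-1) ξ v • κ v) :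
    ∃ C, ∀ u, α.IsSchwartz u → α.IsSchwartz (α.mult B f u) →
      ‖∫ x, star (α.mult B f u x) * α.mult B f u x‖ ≤ C * ‖∫ x, star (u x) * u x‖ := by
  let _ := CStarAlgebra.spectralOrder A
  have _ := CStarAlgebra.spectralOrderedRing A
  -- The summand 1 keeps K positive also for a vanishing kernel.
  set K : ℝ := (∫ v, ‖κ v‖) + 1 with hK
  have hK0 : 0 < K := by positivity
  refine ⟨K * ∫ v, ‖κ v‖, fun u hu hw => ?_⟩
  obtain ⟨C, hC⟩ := hu.bounded
  have hU := hu.integrable_star_mul hu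
  have hpt : ∀ x, star (α.mult B f u x) * α.mult B f u x ≤
      K • ∫ v, ‖κ v‖ • (star (u (x - v)) * u (x - v)) := by
    intro x
    have hκ2 : Integrable fun v => osc (-1) (matL B x) v • α.act (-x) (κ v) :=
      ((α.actL (-x)).integrable_comp hκ).osc_smul _ _
    have hn : ∀ v, ‖osc (-1) (matL B x) v • α.act (-x) (κ v)‖ = ‖κ v‖ := fun v => by
      rw [norm_smul, norm_osc, one_mul, α.norm_act]
    have h1 := star_integral_mul_integral_le hκ2 (y := fun v => u (x - v)) (fun v => hC _)
      (hu.continuous.comp (by fun_prop)).aestronglyMeasurable (K := K)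
      (by simp only [hn, hK]; linarith) hK0
    simp only [hn, smul_mul_assoc] at h1
    rwa [← mult_eq_kernel hB hκ hf hu x] at h1
  have hprod : Integrable (fun q : Plane × Plane => ‖κ q.2‖ • (star (u (q.1 - q.2)) *
      u (q.1 - q.2))) (volume.prod volume) := by
    have h1 : Integrable (fun q : Plane × Plane => ‖κ q.2‖ • (star (u q.1) * u q.1))
        (volume.prod volume) :=
      hU.op_fst_snd (op := fun a (b : ℝ) => b • a) (by fun_prop) ⟨1, fun a b => by
        rw [one_mul, norm_smul, mul_comm]⟩ hκ.norm
    exact (measurePreserving_sub_prod volume volume).integrable_comp_of_integrable h1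
  have hint : Integrable fun x => ∫ v, ‖κ v‖ • (star (u (x - v)) * u (x - v)) :=
    hprod.integral_prod_left
  have h2 := integral_mono (hw.integrable_star_mul hw) (hint.smul K) hpt
  have h3 : ∫ x, K • ∫ v, ‖κ v‖ • (star (u (x - v)) * u (x - v)) =
      (K * ∫ v, ‖κ v‖) • ∫ x, star (u x) * u x := by
    rw [integral_smul, integral_integral_swap hprod, mul_smul, ← integral_smul_const]
    congr 2
    ext v
    rw [integral_smul, integral_sub_right_eq_self (fun x => star (u x) * u x)]
  simp only [Pi.smul_apply] at h2
  rw [h3] at h2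
  have h4 := CStarAlgebra.norm_le_norm_of_nonneg_of_le
    (integral_nonneg fun x => star_mul_self_nonneg (α.mult B f u x)) h2
  rwa [norm_smul, Real.norm_of_nonneg (by positivity)] at h4

end PlaneAction

open MeasureTheory Module
open scoped RealInnerProductSpace BoundedContinuousFunction

namespace PlaneAction

variable {A : Type*} [CStarAlgebra A] {α : PlaneAction A}

/-! ### The module inner product, the formal adjoint and the resolvent. -/

section Pairing

variable {u v w : Plane → A}

theorem IsSchwartz.add (hu : α.IsSchwartz u) (hv : α.IsSchwartz v) : α.IsSchwartz (u + v) := by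
  rw [isSchwartz_iff]
  intro N
  have h := WeightedSmooth.add isOpen_univ (hu.rapid N) (hv.rapid N)
  rwa [← pairLift_add] at h

theorem IsSchwartz.const_smul (hu : α.IsSchwartz u) (c : ℂ) : α.IsSchwartz (c • u) := by
  rw [isSchwartz_iff]
  intro N
  have h := WeightedSmooth.const_smul isOpen_univ c (hu.rapid N)
  rwa [← pairLift_smul (fun _ => c)] at h

theorem IsSchwartz.sub (hu : α.IsSchwartz u) (hv : α.IsSchwartz v) : α.IsSchwartz (u - v) := by
  have := hu.add (hv.const_smul (-1))
  rwa [neg_one_smul, ← sub_eq_add_neg] at this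

theorem IsSchwartz.differentiable (hu : α.IsSchwartz u) (x : Plane) : DifferentiableAt ℝ u x :=
  (hasFDerivAt_of_pairLift hu.smooth x 0).differentiableAt

theorem IsSchwartz.partialX (hu : α.IsSchwartz u) (j : Fin 2) : α.IsSchwartz (partialX j u) :=
  hu.schOp (.inl j)

theorem IsSchwartz.leftMul {B : Matrix (Fin 2) (Fin 2) ℝ} (hB : B.transpose = -B)
    (hu : α.IsSchwartz u) {a : A} (ha : α.IsSmooth a) : α.IsSchwartz (α.leftMul a u) := by
  have h := hu.mult hB (polySymb_const (m := 0) ha)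
  have e := mult_const_mul hB (polySymb_one (α := α) (m := 0)) hu a
  simp only [mul_one] at e
  rwa [e, mult_one hB hu] at h

theorem leftMul_add (a : A) (u v : Plane → A) :
    α.leftMul a (u + v) = α.leftMul a u + α.leftMul a v := by
  ext x
  simp [leftMul, mul_add]

theorem leftMul_smul (a : A) (c : ℂ) (u : Plane → A) :
    α.leftMul a (c • u) = c • α.leftMul a u := by
  ext x
  simp [leftMul]

theorem leftMul_add_left (a b : A) (u : Plane → A) :
    α.leftMul (a + b) u = α.leftMul a u + α.leftMul b u := by
  ext x
  simp [leftMul, add_mul]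

theorem leftMul_smul_left (c : ℂ) (a : A) (u : Plane → A) :
    α.leftMul (c • a) u = c • α.leftMul a u := by
  ext x
  simp [leftMul]

/-- The `A`-valued inner product of the Hilbert module. -/
noncomputable def pairing (v u : Plane → A) : A := ∫ x, star (v x) * u x

theorem pairing_add_left (hv : α.IsSchwartz v) (hw : α.IsSchwartz w) (hu : α.IsSchwartz u) :
    pairing (v + w) u = pairing v u + pairing w u := by
  rw [pairing, pairing, pairing, ← integral_add (hv.integrable_star_mul hu)
    (hw.integrable_star_mul hu)]
  simp [add_mul]

theorem pairing_add_right (hv : α.IsSchwartz v) (hw : α.IsSchwartz w) (hu : α.IsSchwartz u) :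
    pairing v (w + u) = pairing v w + pairing v u := by
  rw [pairing, pairing, pairing, ← integral_add (hv.integrable_star_mul hw)
    (hv.integrable_star_mul hu)]
  simp [mul_add]

theorem pairing_smul_right (c : ℂ) (v u : Plane → A) : pairing v (c • u) = c • pairing v u := by
  rw [pairing, pairing, ← integral_smul c]
  simp

theorem pairing_smul_left (c : ℂ) (v u : Plane → A) :
    pairing (c • v) u = starRingEnd ℂ c • pairing v u := by
  rw [pairing, pairing, ← integral_smul]
  simp

theorem pairing_leftMul (a : A) (v u : Plane → A) :
    pairing (α.leftMul a v) u = pairing v (α.leftMul (star a) u) := by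
  simp only [pairing, leftMul, star_mul, mul_assoc, map_star]

variable {B : Matrix (Fin 2) (Fin 2) ℝ}

theorem hasFDerivAt_act_neg {a : A} (ha : α.IsSmooth a) (x : Plane) :
    HasFDerivAt (fun x => α.act (-x) a)
      (-(fderiv ℝ (fun x => α.act x a) (-x))) x := by
  have h := (ha.differentiableAt (-x)).hasFDerivAt.comp x (hasFDerivAt_id x).neg
  refine h.congr_fderiv ?_
  ext v
  simp

theorem partialX_leftMul (hv : α.IsSchwartz v) {a : A} (ha : α.IsSmooth a) (j : Fin 2)
    (x : Plane) : partialX j (α.leftMul a v) x =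
      α.act (-x) a * partialX j v x + Complex.I • (α.act (-x) (α.der j a) * v x) := by
  have h := (hasFDerivAt_act_neg ha x).mul' (hv.differentiable x).hasFDerivAt
  have h2 : fderiv ℝ (α.leftMul a v) x = _ := HasFDerivAt.fderiv (f := α.leftMul a v) h
  simp only [partialX, h2, act_der ha, smul_mul_assoc, smul_smul, Complex.I_mul_I]
  simp

theorem diffMult_leftMul (hB : B.transpose = -B) (hv : α.IsSchwartz v) {a : A}
    (ha : α.IsSmooth a) (j : Fin 2) : α.diffMult B j (α.leftMul a v) =
      α.leftMul a (α.diffMult B j v) + α.leftMul (α.der j a) v := by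
  rw [diffMult_eq hB (hv.leftMul hB ha), diffMult_eq hB hv]
  ext x
  simp only [opD, Pi.add_apply, partialX_leftMul hv ha, leftMul, mul_add, mul_smul_comm, smul_add,
    smul_smul]
  have : -Complex.I * Complex.I = 1 := by simp
  rw [this]
  module

theorem diffMult_add (hB : B.transpose = -B) (hu : α.IsSchwartz u) (hv : α.IsSchwartz v)
    (j : Fin 2) : α.diffMult B j (u + v) = α.diffMult B j u + α.diffMult B j v := by
  rw [diffMult_eq hB (hu.add hv), diffMult_eq hB hu, diffMult_eq hB hv]
  ext x
  have : partialX j (u + v) x = partialX j u x + partialX j v x := by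
    simp only [partialX, fderiv_add (hu.differentiable x) (hv.differentiable x), _root_.add_apply]
  simp only [opD, Pi.add_apply, this, smul_add]
  abel

theorem diffMult_smul (hB : B.transpose = -B) (hu : α.IsSchwartz u) (c : ℂ)
    (j : Fin 2) : α.diffMult B j (c • u) = c • α.diffMult B j u := by
  rw [diffMult_eq hB (hu.const_smul c), diffMult_eq hB hu]
  ext x
  have : partialX j (c • u) x = c • partialX j u x := by
    simp only [partialX, fderiv_const_smul (hu.differentiable x), _root_.smul_apply]
  simp only [opD, Pi.smul_apply, this, smul_add]
  rw [smul_comm c, smul_comm c]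

/-- Integration by parts makes -i∂_j symmetric, and (Bx)_j is real. The product of (Bx)_j with a
Schwartz function is Schwartz since it equals D_j u + i∂_j u. -/
theorem pairing_diffMult (hB : B.transpose = -B) (hu : α.IsSchwartz u) (hv : α.IsSchwartz v)
    (j : Fin 2) : pairing (α.diffMult B j v) u = pairing v (α.diffMult B j u) := by
  have hcoord : α.IsSchwartz fun x => ((matL B x j : ℝ) : ℂ) • u x := by
    have h := (hu.diffMult hB j).add ((hu.partialX j).const_smul Complex.I)
    convert h using 1
    ext x
    rw [diffMult_eq hB hu]
    simp [opD]
  have hcoord' : α.IsSchwartz fun x => ((matL B x j : ℝ) : ℂ) • v x := by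
    have h := (hv.diffMult hB j).add ((hv.partialX j).const_smul Complex.I)
    convert h using 1
    ext x
    rw [diffMult_eq hB hv]
    simp [opD]
  have hd : ∀ {u : Plane → A}, α.IsSchwartz u → α.diffMult B j u =
      -Complex.I • partialX j u + fun x => ((matL B x j : ℝ) : ℂ) • u x := fun hu =>
    diffMult_eq hB hu j
  have hst : ∀ x, HasFDerivAt (fun x => star (v x))
      (((starL' ℝ : A ≃L[ℝ] A) : A →L[ℝ] A).comp (fderiv ℝ v x)) x := fun x =>
    ((starL' ℝ : A ≃L[ℝ] A) : A →L[ℝ] A).hasFDerivAt.comp x (hv.differentiable x).hasFDerivAt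
  have hibp : pairing v (partialX j u) = -pairing (partialX j v) u :=
    integral_bilinear_hasFDerivAt_right_eq_neg_left_of_integrable
      (B := ContinuousLinearMap.mul ℝ A) (v := basisVec j)
      (f := fun x => star (v x)) (g := u)
      ((hv.partialX j).integrable_star_mul hu) (hv.integrable_star_mul (hu.partialX j))
      (hv.integrable_star_mul hu) (fun x _ => hst x)
      (fun x _ => (hu.differentiable x).hasFDerivAt)
  rw [hd hu, hd hv, pairing_add_left ((hv.partialX j).const_smul _) hcoord' hu,
    pairing_add_right hv ((hu.partialX j).const_smul _) hcoord, pairing_smul_left,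
    pairing_smul_right, hibp]
  congr 1
  · simp
  · simp [pairing]

variable (α B) in
/-- The multiplier `D₁ + s D₂`. -/
noncomputable def multL (s : ℂ) (u : Plane → A) : Plane → A :=
  α.diffMult B 0 u + s • α.diffMult B 1 u

theorem IsSchwartz.multL (hB : B.transpose = -B) (hu : α.IsSchwartz u) (s : ℂ) :
    α.IsSchwartz (α.multL B s u) :=
  (hu.diffMult hB 0).add ((hu.diffMult hB 1).const_smul s)

theorem multL_add (hB : B.transpose = -B) (hu : α.IsSchwartz u) (hv : α.IsSchwartz v) (s : ℂ) :
    α.multL B s (u + v) = α.multL B s u + α.multL B s v := by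
  simp only [multL, diffMult_add hB hu hv, smul_add]
  abel

theorem multL_smul (hB : B.transpose = -B) (hu : α.IsSchwartz u) (c s : ℂ) :
    α.multL B s (c • u) = c • α.multL B s u := by
  simp only [multL, diffMult_smul hB hu, smul_add, smul_comm c s]

theorem multL_leftMul (hB : B.transpose = -B) (hv : α.IsSchwartz v) {a : A}
    (ha : α.IsSmooth a) (s : ℂ) : α.multL B s (α.leftMul a v) =
      α.leftMul a (α.multL B s v) + α.leftMul (α.derL s a) v := by
  simp only [multL, diffMult_leftMul hB hv ha, derL, leftMul_add, leftMul_smul, leftMul_add_left,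
    leftMul_smul_left, smul_add]
  abel

theorem pairing_multL (hB : B.transpose = -B) (hu : α.IsSchwartz u) (hv : α.IsSchwartz v)
    (s : ℂ) : pairing (α.multL B s v) u = pairing v (α.multL B (starRingEnd ℂ s) u) := by
  rw [multL, multL, pairing_add_left (hv.diffMult hB 0) ((hv.diffMult hB 1).const_smul s) hu,
    pairing_add_right hv (hu.diffMult hB 0) ((hu.diffMult hB 1).const_smul _), pairing_smul_left,
    pairing_smul_right, pairing_diffMult hB hu hv, pairing_diffMult hB hu hv]

end Pairing

namespace Elliptic

variable (E : α.Elliptic) {u v : Plane → A}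

/-- The formal adjoint. -/
noncomputable def adjoint : α.Elliptic where
  B := E.B
  skew := E.skew
  τ := E.τ
  im_pos := E.im_pos
  h := E.h
  c₁ := α.derL (starRingEnd ℂ E.τ) E.h + star E.c₂
  c₂ := α.derL E.τ E.h + star E.c₁
  c₀ := α.derL E.τ (α.derL (starRingEnd ℂ E.τ) E.h) + α.derL (starRingEnd ℂ E.τ) (star E.c₁) +
    α.derL E.τ (star E.c₂) + star E.c₀
  smooth_h := E.smooth_h
  smooth_c₁ := (E.smooth_h.derL _).add E.smooth_c₂.star
  smooth_c₂ := (E.smooth_h.derL _).add E.smooth_c₁.star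
  smooth_c₀ := ((((E.smooth_h.derL _).derL _).add (E.smooth_c₁.star.derL _)).add
    (E.smooth_c₂.star.derL _)).add E.smooth_c₀.star
  selfAdjoint := E.selfAdjoint
  lower := E.lower

/-- The Laplace multiplier. -/
noncomputable def lap (u : Plane → A) : Plane → A :=
  (1 / 2 : ℂ) • (α.multL E.B E.τ (α.multL E.B (starRingEnd ℂ E.τ) u) +
    α.multL E.B (starRingEnd ℂ E.τ) (α.multL E.B E.τ u))

theorem op_eq (u : Plane → A) : E.op u = α.leftMul E.h (E.lap u) +
    α.leftMul E.c₁ (α.multL E.B E.τ u) + α.leftMul E.c₂ (α.multL E.B (starRingEnd ℂ E.τ) u) +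
      α.leftMul E.c₀ u := rfl

theorem isSchwartz_lap (hu : α.IsSchwartz u) : α.IsSchwartz (E.lap u) :=
  (((hu.multL E.skew _).multL E.skew _).add ((hu.multL E.skew _).multL E.skew _)).const_smul _

theorem isSchwartz_op (hu : α.IsSchwartz u) : α.IsSchwartz (E.op u) :=
  ((((E.isSchwartz_lap hu).leftMul E.skew E.smooth_h).add
    ((hu.multL E.skew _).leftMul E.skew E.smooth_c₁)).add
    ((hu.multL E.skew _).leftMul E.skew E.smooth_c₂)).add (hu.leftMul E.skew E.smooth_c₀)

/-- The formal adjoint has its coefficients to the right of the D's. The Leibniz rule moves them to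
the left, and the derivatives of coefficients that arise are those built into the adjoint data; its
principal part is unchanged because h is self-adjoint. -/
theorem adjoint_op (hv : α.IsSchwartz v) : E.adjoint.op v =
    E.lap (α.leftMul E.h v) + α.multL E.B (starRingEnd ℂ E.τ) (α.leftMul (star E.c₁) v) +
      α.multL E.B E.τ (α.leftMul (star E.c₂) v) + α.leftMul (star E.c₀) v := by
  have hm : ∀ s, α.IsSchwartz (α.multL E.B s v) := hv.multL E.skew
  have h1 : ∀ s t, α.multL E.B s (α.multL E.B t (α.leftMul E.h v)) =
      α.leftMul E.h (α.multL E.B s (α.multL E.B t v)) + α.leftMul (α.derL s E.h) (α.multL E.B t v) +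
      (α.leftMul (α.derL t E.h) (α.multL E.B s v) + α.leftMul (α.derL s (α.derL t E.h)) v) :=
    fun s t => by
      rw [multL_leftMul E.skew hv E.smooth_h, multL_add E.skew ((hm t).leftMul E.skew E.smooth_h)
        (hv.leftMul E.skew (E.smooth_h.derL t)), multL_leftMul E.skew (hm t) E.smooth_h,
        multL_leftMul E.skew hv (E.smooth_h.derL t)]
  rw [op_eq]
  simp only [lap, adjoint, h1, multL_leftMul E.skew hv E.smooth_c₁.star,
    multL_leftMul E.skew hv E.smooth_c₂.star, leftMul_add_left, leftMul_smul, leftMul_add,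
    derL_comm E.smooth_h (starRingEnd ℂ E.τ) E.τ]
  module

theorem pairing_adjoint_op (hu : α.IsSchwartz u) (hv : α.IsSchwartz v) :
    pairing (E.adjoint.op v) u = pairing v (E.op u) := by
  have hl : ∀ {a}, α.IsSmooth a → α.IsSchwartz (α.leftMul a v) := hv.leftMul E.skew
  have hlap : ∀ {w}, α.IsSchwartz w → pairing (E.lap w) u = pairing w (E.lap u) := fun {w} hw => by
    have hw' := hw.multL E.skew
    have hu' := hu.multL E.skew
    rw [lap, lap, pairing_smul_left, pairing_smul_right,
      pairing_add_left ((hw' _).multL E.skew _) ((hw' _).multL E.skew _) hu,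
      pairing_add_right hw ((hu' _).multL E.skew _) ((hu' _).multL E.skew _),
      pairing_multL E.skew hu (hw' _), pairing_multL E.skew hu (hw' _),
      pairing_multL E.skew (hu' _) hw, pairing_multL E.skew (hu' _) hw]
    simp [map_ofNat (starRingEnd ℂ) 2]
  have s1 := E.isSchwartz_lap (hl E.smooth_h)
  have s2 := (hl E.smooth_c₁.star).multL E.skew (starRingEnd ℂ E.τ)
  have s3 := (hl E.smooth_c₂.star).multL E.skew E.τ
  have t1 := (E.isSchwartz_lap hu).leftMul E.skew E.smooth_h
  have t2 := (hu.multL E.skew E.τ).leftMul E.skew E.smooth_c₁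
  have t3 := (hu.multL E.skew (starRingEnd ℂ E.τ)).leftMul E.skew E.smooth_c₂
  rw [E.adjoint_op hv, E.op_eq, pairing_add_left ((s1.add s2).add s3) (hl E.smooth_c₀.star) hu,
    pairing_add_left (s1.add s2) s3 hu, pairing_add_left s1 s2 hu,
    pairing_add_right hv ((t1.add t2).add t3) (hu.leftMul E.skew E.smooth_c₀),
    pairing_add_right hv (t1.add t2) t3, pairing_add_right hv t1 t2, hlap (hl E.smooth_h),
    pairing_multL E.skew hu (hl E.smooth_c₁.star), pairing_multL E.skew hu (hl E.smooth_c₂.star),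
    pairing_leftMul, pairing_leftMul, pairing_leftMul, pairing_leftMul]
  simp only [star_star, Complex.conj_conj, E.selfAdjoint.star_eq]

/-- Duality: writing a test function as (P^* - z̄) v and moving the operator to u shows that u pairs
to zero with every test function. -/
theorem eq_zero_of_op_eq_smul {z : ℂ} (hu : α.IsSchwartz u) (h : E.op u = z • u)
    (hs : ∀ w, α.IsSchwartz w → ∃ v, α.IsSchwartz v ∧
      E.adjoint.op v - starRingEnd ℂ z • v = w) : u = 0 := by
  have h1 : ∀ φ : Plane → ℝ, ContDiff ℝ ∞ φ → HasCompactSupport φ → ∫ x, φ x • u x = 0 := by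
    intro φ hφ hφc
    obtain ⟨v, hv, hvw⟩ := hs _ (isSchwartz_smul_one (α := α) hφ hφc)
    have h2 := E.pairing_adjoint_op hu hv
    rw [h, sub_eq_iff_eq_add.1 hvw, pairing_add_left (isSchwartz_smul_one hφ hφc)
      (hv.const_smul _) hu, pairing_smul_left, pairing_smul_right, Complex.conj_conj,
      add_eq_right] at h2
    simpa [pairing] using h2
  have h2 := ae_eq_zero_of_integral_contDiff_smul_eq_zero (μ := (volume : Measure Plane))
    hu.continuous.locallyIntegrable h1
  exact (Continuous.ae_eq_iff_eq volume hu.continuous continuous_zero).1 h2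

theorem _root_.Sectorial.conj {Λ : Set ℂ} (hΛ : Sectorial Λ) :
    Sectorial (starRingEnd ℂ ⁻¹' Λ) where
  isOpen := hΛ.isOpen.preimage Complex.continuous_conj
  sector := by
    obtain ⟨ε, hε, h⟩ := hΛ.sector
    refine ⟨ε, hε, fun z hz s hs => ?_⟩
    have := h _ hz s hs
    rwa [← Complex.conj_ofReal s, ← map_sub, Complex.norm_conj, Complex.norm_conj] at this
  away := by
    obtain ⟨ρ, hρ, h⟩ := hΛ.away
    refine ⟨ρ, hρ, fun z hz => ?_⟩
    have := h _ hz
    rwa [Complex.norm_conj] at this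

theorem op_sub (hu : α.IsSchwartz u) (hv : α.IsSchwartz v) :
    E.op (u - v) = E.op u - E.op v := by
  have hm : ∀ s, α.multL E.B s (u - v) = α.multL E.B s u + (-1 : ℂ) • α.multL E.B s v := fun s => by
    rw [← multL_smul E.skew hv, ← multL_add E.skew hu (hv.const_smul _), neg_one_smul,
      ← sub_eq_add_neg]
  have hmm : ∀ s t, α.multL E.B s (α.multL E.B t u + (-1 : ℂ) • α.multL E.B t v) =
      α.multL E.B s (α.multL E.B t u) + (-1 : ℂ) • α.multL E.B s (α.multL E.B t v) := fun s t => by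
    rw [multL_add E.skew (hu.multL E.skew _) ((hv.multL E.skew _).const_smul _),
      multL_smul E.skew (hv.multL E.skew _)]
  have hl : ∀ a, α.leftMul a (u - v) = α.leftMul a u + (-1 : ℂ) • α.leftMul a v := fun a => by
    rw [← leftMul_smul, ← leftMul_add, neg_one_smul, ← sub_eq_add_neg]
  simp only [op_eq, lap, hm, hmm, hl, leftMul_add, leftMul_smul]
  module

/-- The resolvent for large parameters in a sector. -/
theorem exists_resolvent {Λ : Set ℂ} (hΛ : Sectorial Λ) : ∃ R : ℝ, 0 < R ∧ ∃ r : Plane → ℂ → A,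
    (∀ z ∈ Λ, R < ‖z‖ → α.IsBoundedInverse (fun u => E.op u - z • u)
      (α.mult E.B fun ξ => r ξ z)) ∧
    ∀ N : ℕ, α.Symb (Λ ∩ {z | R < ‖z‖}) 1 (-2 - (N : ℝ)) (fun ξ z => r ξ z - E.approx N ξ z) := by
  obtain ⟨R, hR, r, hr, hri⟩ := E.exists_right_inverse hΛ
  -- The right inverse of the adjoint at conjugate parameters is used only to prove injectivity.
  obtain ⟨R', hR', r', hr', hri'⟩ := E.adjoint.exists_right_inverse hΛ.conj
  set Λ' := Λ ∩ {z | max R R' < ‖z‖} with hΛ'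
  have hΛs : Sectorial Λ' := hΛ.inter_norm _
  have hr2 : α.Symb Λ' 0 0 r := hr.mono_set fun z hz =>
    ⟨hz.1, lt_of_le_of_lt (le_max_left R R') (show max R R' < ‖z‖ from hz.2)⟩
  have hN := E.symb_resolvent hΛs hr2 fun ξ z hz =>
    E.sym_eq_one_of_right_inverse hΛs.isOpen hr2 hz
      (hri z hz.1 ((le_max_left _ _).trans_lt hz.2)) ξ
  refine ⟨max R R', lt_max_of_lt_left hR, r, fun z hz hzR => ?_, hN⟩
  have hz' : z ∈ Λ' := ⟨hz, hzR⟩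
  have hz1 : R < ‖z‖ := (le_max_left _ _).trans_lt hzR
  have hz2 : R' < ‖starRingEnd ℂ z‖ := by
    rw [Complex.norm_conj]
    exact (le_max_right _ _).trans_lt hzR
  have hzc : starRingEnd ℂ z ∈ starRingEnd ℂ ⁻¹' Λ := by simpa using hz
  have hrp : α.PolySymb 0 (fun ξ => r ξ z) := hr2.polySymb hΛs.isOpen le_rfl hz' (by norm_num)
  have hrp' : α.PolySymb 0 (fun ξ => r' ξ (starRingEnd ℂ z)) :=
    hr'.polySymb (hΛ.conj.inter_norm R').isOpen le_rfl ⟨hzc, hz2⟩ (by norm_num)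
  have hT : ∀ u, α.IsSchwartz u → α.IsSchwartz (α.mult E.B (fun ξ => r ξ z) u) := fun u hu =>
    hu.mult E.skew hrp
  have hQ : ∀ u, α.IsSchwartz u → α.IsSchwartz (E.op u - z • u) := fun u hu =>
    (E.isSchwartz_op hu).sub (hu.const_smul z)
  have hinj : ∀ u v, α.IsSchwartz u → α.IsSchwartz v → E.op u - z • u = E.op v - z • v →
      u = v := by
    intro u v hu hv h
    refine sub_eq_zero.1 (E.eq_zero_of_op_eq_smul (hu.sub hv) (z := z) ?_ fun w hw =>
      ⟨_, hw.mult E.skew hrp', hri' _ hzc hz2 w hw⟩)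
    rw [E.op_sub hu hv, smul_sub, ← sub_eq_zero]
    rw [← sub_eq_zero] at h
    rw [← h]
    abel
  have h2 : α.Symb Λ' 1 (-2) r := by
    have := hN 0
    simpa [approx] using! this
  refine ⟨⟨fun u hu => hQ u hu, fun u hu v hv h => hinj u v hu hv h, fun w hw =>
    ⟨_, hT w hw, hri z hz hz1 w hw⟩⟩, ⟨fun u hu => ?_, fun w hw => hri z hz hz1 w hw⟩, ?_⟩
  · exact hinj _ _ (hT _ (hQ u hu)) hu (hri z hz hz1 _ (hQ u hu))
  -- Order -2 in type one, the case N = 0 of the expansion, is enough for an integrable kernel.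
  · obtain ⟨C, hC⟩ := norm_integral_mult_le (α := α) E.skew (h2.integrable_ker hΛs.isOpen hz')
      fun ξ => (h2.integral_osc_ker hΛs.isOpen hz' ξ).symm
    exact ⟨C, fun u hu => hC u hu (hT u hu)⟩

end Elliptic

end PlaneAction

open MeasureTheory Module
open scoped RealInnerProductSpace BoundedContinuousFunction

/-! ### Sectors off the half line and the rotation of the plane. -/

namespace PlaneAction

variable {A : Type*} [CStarAlgebra A] {α : PlaneAction A}

/-- With t = s / (1 + s) the quotient (s - z) / (1 + s) is t - (1 - t) z, a continuous function
without zeros on the compact set [0, 1] × K. -/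
theorem offRay_separation {K : Set ℂ} (hK : IsCompact K) (h : K ⊆ offRay) :
    ∃ ε : ℝ, 0 < ε ∧ ∀ z ∈ K, ∀ s : ℝ, 0 ≤ s → ε * (1 + s) ≤ ‖(s : ℂ) - z‖ := by
  have hc : IsCompact (Set.Icc (0 : ℝ) 1 ×ˢ K) := isCompact_Icc.prod hK
  obtain ⟨ε, hε, h1⟩ := hc.exists_forall_le' (a := (0 : ℝ))
    (f := fun p => ‖(p.1 : ℂ) - ((1 - p.1 : ℝ) : ℂ) * p.2‖)
    (by fun_prop) (by
      rintro ⟨t, z⟩ ⟨⟨h0, h1⟩, hz⟩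
      refine norm_pos_iff.2 fun h2 => ?_
      simp only at h0 h1 hz h2
      have h3 := congrArg Complex.re h2
      have h4 := congrArg Complex.im h2
      simp only [Complex.sub_re, Complex.sub_im, Complex.re_ofReal_mul, Complex.im_ofReal_mul,
        Complex.ofReal_re, Complex.ofReal_im, Complex.zero_re, Complex.zero_im] at h3 h4
      have ht : 0 < 1 - t := by
        refine lt_of_le_of_ne (by linarith) fun h5 => ?_
        rw [← h5] at h3
        linarith
      rcases h hz with h6 | h6
      · nlinarith
      · exact h6 ((mul_eq_zero.1 (by linarith)).resolve_left ht.ne'))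
  refine ⟨ε, hε, fun z hz s hs => ?_⟩
  have hs1 : 0 < 1 + s := by linarith
  have h2 := h1 (s / (1 + s), z) ⟨⟨by positivity, by rw [div_le_one hs1]; linarith⟩, hz⟩
  have hs2 : (1 + (s : ℂ)) ≠ 0 := by exact_mod_cast hs1.ne'
  have h3 : (s : ℂ) - z = ((1 + s : ℝ) : ℂ) *
      (((s / (1 + s) : ℝ) : ℂ) - ((1 - s / (1 + s) : ℝ) : ℂ) * z) := by
    push_cast
    field_simp
    ring
  rw [h3, norm_mul, Complex.norm_real, Real.norm_of_nonneg hs1.le, mul_comm]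
  exact mul_le_mul_of_nonneg_left h2 hs1.le

theorem exists_sectorial_nhds {z : ℂ} (hz : z ∈ offRay) : ∃ Λ, Sectorial Λ ∧ z ∈ Λ := by
  obtain ⟨r, hr, h1⟩ := Metric.nhds_basis_closedBall.mem_iff.1 (isOpen_offRay.mem_nhds hz)
  obtain ⟨ε, hε, h2⟩ := offRay_separation (isCompact_closedBall z r) h1
  have hM : 0 < 1 + ‖z‖ + r := by positivity
  refine ⟨Metric.ball z r, ⟨Metric.isOpen_ball, ⟨ε / (1 + ‖z‖ + r), by positivity,
    fun w hw s hs => ?_⟩, ⟨ε, hε, fun w hw => ?_⟩⟩, Metric.mem_ball_self hr⟩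
  · refine le_trans ?_ (h2 w (Metric.ball_subset_closedBall hw) s hs)
    have h3 : ‖w‖ ≤ ‖z‖ + r := by
      have := norm_sub_norm_le w z
      have := mem_ball_iff_norm.1 hw
      linarith
    rw [div_mul_eq_mul_div, div_le_iff₀ hM, mul_assoc]
    refine mul_le_mul_of_nonneg_left ?_ hε.le
    nlinarith [norm_nonneg z]
  · simpa using h2 w (Metric.ball_subset_closedBall hw) 0 le_rfl

/-- Dividing by |z| reduces the estimate to the unit sphere, where the closure of the cone is
compact and off the half line. -/
theorem IsResolventCone.sectorial {Γ : Set ℂ} (hΓ : IsResolventCone Γ) :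
    Sectorial (Γ ∩ {z | 1 < ‖z‖}) := by
  have hK : IsCompact (closure Γ ∩ Metric.sphere (0 : ℂ) 1) :=
    (isCompact_sphere 0 1).inter_left isClosed_closure
  obtain ⟨ε, hε, h1⟩ := offRay_separation hK fun z hz =>
    hΓ.off_ray z hz.1 (norm_ne_zero_iff.1 (by rw [mem_sphere_zero_iff_norm.1 hz.2]; norm_num))
  refine ⟨hΓ.isOpen.inter (isOpen_lt continuous_const continuous_norm), ⟨ε, hε,
    fun z hz s hs => ?_⟩, ⟨1, one_pos, fun z hz => (show 1 < ‖z‖ from hz.2).le⟩⟩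
  have hz0 : 0 < ‖z‖ := one_pos.trans hz.2
  have hz1 : (‖z‖ : ℂ) ≠ 0 := by exact_mod_cast hz0.ne'
  have h2 := h1 (((‖z‖⁻¹ : ℝ) : ℂ) * z)
    ⟨subset_closure (hΓ.cone z hz.1 _ (inv_pos.2 hz0)), by
      rw [mem_sphere_zero_iff_norm, norm_mul, Complex.norm_real, norm_inv, norm_norm,
        inv_mul_cancel₀ hz0.ne']⟩ (s / ‖z‖) (by positivity)
  have h3 : (s : ℂ) - z = (‖z‖ : ℂ) * (((s / ‖z‖ : ℝ) : ℂ) - ((‖z‖⁻¹ : ℝ) : ℂ) * z) := by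
    push_cast
    field_simp
  rw [h3, norm_mul, Complex.norm_real, norm_norm]
  calc ε * (s + ‖z‖) = ‖z‖ * (ε * (1 + s / ‖z‖)) := by field_simp; ring
    _ ≤ _ := by gcongr

/-- The map ξ ↦ η identifies the plane with ℂ, and the matrix is multiplication by i in the
coordinates ξ; it squares to -1, which gives its inverse. -/
theorem exists_rotation {τ : ℂ} (hτ : 0 < τ.im) : ∃ J : Plane ≃ₗ[ℝ] Plane, ∀ ξ,
    etaL (starRingEnd ℂ τ) (J ξ) = Complex.I * etaL (starRingEnd ℂ τ) ξ ∧
    etaL τ (J ξ) = -Complex.I * etaL τ ξ := by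
  set M : Matrix (Fin 2) (Fin 2) ℝ :=
    !![τ.re / τ.im, τ.im + τ.re ^ 2 / τ.im; -1 / τ.im, -τ.re / τ.im] with hM
  have h0 : ∀ ξ, matL M ξ 0 = τ.re / τ.im * ξ 0 + (τ.im + τ.re ^ 2 / τ.im) * ξ 1 := fun ξ => by
    rw [matL_coord]
    simp [hM]
  have h1 : ∀ ξ, matL M ξ 1 = -1 / τ.im * ξ 0 + -τ.re / τ.im * ξ 1 := fun ξ => by
    rw [matL_coord]
    simp [hM]
  have hJJ : ∀ ξ, matL M (matL M ξ) = -ξ := fun ξ => by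
    ext i
    fin_cases i
    · simp only [Fin.zero_eta, h0, h1, PiLp.neg_apply]
      field_simp
      ring
    · simp only [Fin.mk_one, h0, h1, PiLp.neg_apply]
      field_simp
      ring
  have hη : ∀ ξ, etaL (starRingEnd ℂ τ) (matL M ξ) = Complex.I * etaL (starRingEnd ℂ τ) ξ :=
    fun ξ => by
      apply Complex.ext
      · simp only [etaL, h0, h1, Complex.add_re, Complex.mul_re, Complex.ofReal_re,
          Complex.conj_re, Complex.conj_im, Complex.ofReal_im, Complex.I_re, Complex.I_im,
          Complex.add_im, Complex.mul_im]
        field_simp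
        ring
      · simp only [etaL, h0, h1, Complex.add_re, Complex.mul_re, Complex.ofReal_re,
          Complex.conj_re, Complex.conj_im, Complex.ofReal_im, Complex.I_re, Complex.I_im,
          Complex.add_im, Complex.mul_im]
        field_simp
        ring
  refine ⟨LinearEquiv.ofLinearMap (matL M : Plane →ₗ[ℝ] Plane) (-(matL M : Plane →ₗ[ℝ] Plane))
    (LinearMap.ext fun ξ => by
      change matL M (-matL M ξ) = ξ
      rw [map_neg, hJJ, neg_neg])
    (LinearMap.ext fun ξ => by
      change -matL M (matL M ξ) = ξ
      rw [hJJ, neg_neg]),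
    fun ξ => ⟨hη ξ, ?_⟩⟩
  have := congrArg (starRingEnd ℂ) (hη ξ)
  rw [← eta_eq, ← eta_eq, map_mul, conj_eta, conj_eta, Complex.conj_I] at this
  exact this

/-- The change of variables gives -I = c I for the integral I with a Jacobian factor c ≥ 0, so (1 +
c) I = 0 whatever the determinant is. -/
theorem integral_eq_zero_of_odd {F : Type*} [NormedAddCommGroup F] [NormedSpace ℝ F]
    (J : Plane ≃ₗ[ℝ] Plane) {D : Plane → F} (h : ∀ ξ, D (J ξ) = -D ξ) : ∫ ξ, D ξ = 0 := by
  have h1 := Measure.map_linearMap_addHaar_eq_smul_addHaar (volume : Measure Plane)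
    (f := (J : Plane →ₗ[ℝ] Plane)) (LinearEquiv.isUnit_det' J).ne_zero
  have h2 : ∫ ξ, D (J ξ) = ∫ ξ, D ξ ∂(Measure.map (J : Plane →ₗ[ℝ] Plane) volume) :=
    (J.toContinuousLinearEquiv.toHomeomorph.measurableEmbedding.integral_map D).symm
  rw [h1, integral_smul_measure] at h2
  simp only [h] at h2
  rw [integral_neg] at h2
  set c := (ENNReal.ofReal |(LinearMap.det (J : Plane →ₗ[ℝ] Plane))⁻¹|).toReal with hc
  have hc0 : 0 ≤ c := ENNReal.toReal_nonneg
  have h3 : (1 + c) • ∫ ξ, D ξ = 0 := by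
    rw [add_smul, one_smul, ← h2]
    abel
  exact (smul_eq_zero.1 h3).resolve_left (by positivity)

end PlaneAction

open MeasureTheory Module
open scoped RealInnerProductSpace BoundedContinuousFunction

/-! ### The closed formulas for the second and third terms. -/

namespace PlaneAction

variable {A : Type*} [CStarAlgebra A] {α : PlaneAction A}

namespace Elliptic

variable (E : α.Elliptic) {Λ : Set ℂ} {z : ℂ}

theorem isSmooth_b (hz : z ∈ offRay) (ξ : Plane) : α.IsSmooth (E.b ξ z) :=
  E.smoothOn_b.isSmooth hz ξ

theorem symbol_mul_b (hz : z ∈ offRay) (ξ : Plane) :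
    (etaSq E.τ ξ • E.h - z • (1 : A)) * E.b ξ z = 1 :=
  Ring.mul_inverse_cancel _ (E.isUnit_symbol ξ hz)

theorem b_mul_symbol (hz : z ∈ offRay) (ξ : Plane) :
    E.b ξ z * (etaSq E.τ ξ • E.h - z • (1 : A)) = 1 :=
  Ring.inverse_mul_cancel _ (E.isUnit_symbol ξ hz)

theorem etaSq_smul_b_mul_h (hz : z ∈ offRay) (ξ : Plane) :
    etaSq E.τ ξ • (E.b ξ z * E.h) = 1 + z • E.b ξ z := by
  have := E.b_mul_symbol hz ξ
  rw [mul_sub, mul_smul_comm, mul_smul_comm, mul_one] at this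
  exact eq_add_of_sub_eq this

theorem derL_b (hz : z ∈ offRay) (ξ : Plane) (t : ℂ) :
    α.derL t (E.b ξ z) = -(etaSq E.τ ξ • (E.b ξ z * α.derL t E.h * E.b ξ z)) := by
  have hb := E.isSmooth_b hz ξ
  have h1 := congrArg (α.derL t) (E.symbol_mul_b hz ξ)
  have hs := E.smooth_h.const_smul (etaSq E.τ ξ)
  have h1' := (isSmooth_one (α := α)).const_smul z
  have h2 : α.derL t (etaSq E.τ ξ • E.h - z • (1 : A)) = etaSq E.τ ξ • α.derL t E.h := by
    have := derL_add (hs.sub h1') h1' t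
    rw [sub_add_cancel, derL_smul isSmooth_one, derL_one, smul_zero, add_zero,
      derL_smul E.smooth_h] at this
    exact this.symm
  rw [derL_mul (hs.sub h1') hb, derL_one, h2] at h1
  have h3 := congrArg (E.b ξ z * ·) h1
  simp only [mul_add, mul_zero, ← mul_assoc, E.b_mul_symbol hz ξ, one_mul] at h3
  rw [eq_neg_of_add_eq_zero_left h3, mul_smul_comm, smul_mul_assoc]

theorem dXi_b (hz : z ∈ offRay) (ξ : Plane) (j : Fin 2) :
    dXi j E.b ξ z = -((etaL (starRingEnd ℂ E.τ) (basisVec j) * etaL E.τ ξ +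
      etaL (starRingEnd ℂ E.τ) ξ * etaL E.τ (basisVec j)) • (E.b ξ z * E.h * E.b ξ z)) := by
  have hL : ∀ t : ℂ, ∃ L : Plane →L[ℝ] ℂ, ∀ ξ, L ξ = PlaneAction.etaL t ξ := fun t =>
    ⟨Complex.ofRealCLM.comp (EuclideanSpace.proj 0) +
      t • Complex.ofRealCLM.comp (EuclideanSpace.proj 1), fun ξ => by simp [PlaneAction.etaL]⟩
  obtain ⟨L, h1⟩ := hL (starRingEnd ℂ E.τ)
  obtain ⟨L', h2⟩ := hL E.τ
  have hb := (E.smoothOn_b.differentiableAt_fst isOpen_offRay hz ξ).hasFDerivAt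
  have hm : HasFDerivAt (fun ξ => (L ξ * L' ξ) • E.h - z • (1 : A))
      ((L ξ • L' + L' ξ • L).smulRight E.h) ξ :=
    ((L.hasFDerivAt.mul L'.hasFDerivAt).smul_const E.h).sub_const _
  have hp := hm.mul' hb
  have h3 : (fun ξ => ((L ξ * L' ξ) • E.h - z • (1 : A)) * E.b ξ z) = fun _ => 1 := by
    ext ξ
    rw [h1, h2, ← etaSq_eq, E.symbol_mul_b hz]
  have h4 := DFunLike.congr_fun (hp.unique ((hasFDerivAt_const (1 : A) ξ).congr_of_eventuallyEq
    (Filter.Eventually.of_forall fun ξ => congrFun h3 ξ))) (basisVec j)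
  have h5 : ((L ξ * L' ξ) • E.h - z • (1 : A)) * dXi j E.b ξ z +
      (L ξ * L' (basisVec j) + L' ξ * L (basisVec j)) • E.h * E.b ξ z = 0 := h4
  have h6 := congrArg (E.b ξ z * ·) h5
  simp only [mul_add, mul_zero, ← mul_assoc] at h6
  rw [h1, h2, h1, h2, ← etaSq_eq, E.b_mul_symbol hz ξ, one_mul, mul_smul_comm,
    smul_mul_assoc] at h6
  rw [eq_neg_of_add_eq_zero_left h6]
  congr 2
  ring

/-- The ξ-gradient of b is the gradient of |η|² times -b h b, and the two linear factors recombine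
to the same gradient. The sum is the contraction of the skew matrix B with one vector taken twice.
-/
theorem cross_b (hz : z ∈ offRay) (ξ : Plane) :
    etaL (starRingEnd ℂ E.τ) ξ • crossL E.B E.τ E.b ξ z +
      etaL E.τ ξ • crossL E.B (starRingEnd ℂ E.τ) E.b ξ z = 0 := by
  obtain ⟨b0, b1, b2⟩ := skew_entries E.skew
  have e0 : ∀ t, etaL t (basisVec 0) = 1 := fun t => by simp [etaL, basisVec]
  have e1 : ∀ t, etaL t (basisVec 1) = t := fun t => by simp [etaL, basisVec]
  simp only [crossL, E.dXi_b hz, b0, b1, b2, e0, e1]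
  push_cast
  match_scalars
  ring

/-- Coefficient of `η` in the second term of the resolvent expansion, as a function of the first
term. -/
noncomputable def fstCoeff (β : A) : A := -(β * (E.h * α.derL E.τ β + E.c₂ * β))

/-- Coefficient of `η̄` in the second term of the resolvent expansion, as a function of the first
term. -/
noncomputable def sndCoeff (β : A) : A :=
  -(β * (E.h * α.derL (starRingEnd ℂ E.τ) β + E.c₁ * β))

theorem isSmooth_fstCoeff {β : A} (hβ : α.IsSmooth β) : α.IsSmooth (E.fstCoeff β) := by
  have := (hβ.mul ((E.smooth_h.mul (hβ.derL E.τ)).add (E.smooth_c₂.mul hβ))).const_smul (-1)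
  rwa [neg_one_smul] at this

theorem isSmooth_sndCoeff {β : A} (hβ : α.IsSmooth β) : α.IsSmooth (E.sndCoeff β) := by
  have := (hβ.mul ((E.smooth_h.mul (hβ.derL (starRingEnd ℂ E.τ))).add
    (E.smooth_c₁.mul hβ))).const_smul (-1)
  rwa [neg_one_smul] at this

theorem term_zero : E.term 0 = E.b := by
  ext ξ z
  simp [term, residual]

theorem residual_one_zero : E.residual 1 0 = E.L₁ E.b := by
  ext ξ z
  rw [residual_succ]
  simp [residual, term_zero]

theorem residual_one_one : E.residual 1 1 = E.L₀ E.b := by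
  ext ξ z
  rw [residual_succ]
  simp [residual, term_zero]

theorem term_one (ξ : Plane) (z : ℂ) : E.term 1 ξ z =
    etaL (starRingEnd ℂ E.τ) ξ • E.fstCoeff (E.b ξ z) + etaL E.τ ξ • E.sndCoeff (E.b ξ z) := by
  rw [term, residual_one_zero, L₁, fstCoeff, sndCoeff]
  simp only [mul_add, mul_smul_comm, smul_add, smul_neg]
  module

theorem term_two (ξ : Plane) (z : ℂ) : E.term 2 ξ z =
    -(E.b ξ z * (E.L₀ E.b ξ z + E.L₁ (E.term 1) ξ z)) := by
  rw [term, residual_succ]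
  simp only [Matrix.cons_val_zero, residual_one_one, neg_one_smul, mul_neg]

/-- The part of the third term of the resolvent expansion that is even under rotations. -/
noncomputable def evenPart (ξ : Plane) (z : ℂ) : A :=
  E.L₀ E.b ξ z + etaSq E.τ ξ • (E.h * (α.derL E.τ (E.sndCoeff (E.b ξ z)) +
      α.derL (starRingEnd ℂ E.τ) (E.fstCoeff (E.b ξ z))) +
    (E.c₁ * E.fstCoeff (E.b ξ z) + E.c₂ * E.sndCoeff (E.b ξ z)))

/-- The part of the third term of the resolvent expansion that is odd under rotations. -/
noncomputable def oddPart (ξ : Plane) (z : ℂ) : A :=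
  etaL (starRingEnd ℂ E.τ) ξ • etaL (starRingEnd ℂ E.τ) ξ •
      (E.h * α.derL E.τ (E.fstCoeff (E.b ξ z)) + E.c₂ * E.fstCoeff (E.b ξ z)) +
    etaL E.τ ξ • etaL E.τ ξ • (E.h * α.derL (starRingEnd ℂ E.τ) (E.sndCoeff (E.b ξ z)) +
      E.c₁ * E.sndCoeff (E.b ξ z))

theorem term_two_eq (hz : z ∈ offRay) (ξ : Plane) : E.term 2 ξ z =
    -(E.b ξ z * E.evenPart ξ z) - E.b ξ z * E.oddPart ξ z := by
  have hb := E.isSmooth_b hz ξ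
  have hp := E.isSmooth_fstCoeff hb
  have hq := E.isSmooth_sndCoeff hb
  have h1 : ∀ t, α.derL t (E.term 1 ξ z) =
      etaL (starRingEnd ℂ E.τ) ξ • α.derL t (E.fstCoeff (E.b ξ z)) +
      etaL E.τ ξ • α.derL t (E.sndCoeff (E.b ξ z)) := fun t => by
    rw [term_one, derL_add (hp.const_smul _) (hq.const_smul _), derL_smul hp, derL_smul hq]
  rw [term_two, L₁, h1, h1, term_one, evenPart, oddPart, etaSq_eq]
  simp only [mul_add, mul_smul_comm, smul_add, smul_smul]
  module

theorem integrable_oddPart (hz : z ∈ offRay) :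
    Integrable fun ξ => E.b ξ z * E.oddPart ξ z := by
  obtain ⟨Λ, hΛ, hzΛ⟩ := exists_sectorial_nhds hz
  have hC := symScale_symb (α := α) (s := 1) hΛ.isOpen le_rfl
  have hb := E.symb_b hΛ (le_refl (1 : ℝ))
  have hneg : ∀ {m f}, α.Symb Λ 1 m f → α.Symb Λ 1 m (fun ξ z => -f ξ z) := fun h => h.neg hΛ.isOpen
  have hp : α.Symb Λ 1 (-2 - 2) (fun ξ z => E.fstCoeff (E.b ξ z)) :=
    hneg (E.symb_b_mul hΛ le_rfl (hC.add (hC.const_mul E.smooth_h (hC.derL _ hb))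
      (hC.const_mul E.smooth_c₂ hb)))
  have hq : α.Symb Λ 1 (-2 - 2) (fun ξ z => E.sndCoeff (E.b ξ z)) :=
    hneg (E.symb_b_mul hΛ le_rfl (hC.add (hC.const_mul E.smooth_h (hC.derL _ hb))
      (hC.const_mul E.smooth_c₁ hb)))
  -- The coefficients have order -4, two factors η raise this to -2 and the outer b gives -4, below
  -- the threshold -3 for integrability.
  have hD : α.Symb Λ 1 (-2 - 2 + 1 + 1 - 2) (fun ξ z => E.b ξ z * E.oddPart ξ z) :=
    E.symb_b_mul hΛ le_rfl (hC.add
      (hC.etaL _ (hC.etaL _ (hC.add (hC.const_mul E.smooth_h (hC.derL _ hp))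
        (hC.const_mul E.smooth_c₂ hp))))
      (hC.etaL _ (hC.etaL _ (hC.add (hC.const_mul E.smooth_h (hC.derL _ hq))
        (hC.const_mul E.smooth_c₁ hq)))))
  have := (hD.flat (m' := -3) (by norm_num)).integrable_slice hzΛ 0
  simpa only [lift, α.act_zero] using this

/-- Under the rotation η ↦ iη the quantities |η|² and b are unchanged while η² and η̄² change sign.
-/
theorem integral_oddPart (z : ℂ) : ∫ ξ, E.b ξ z * E.oddPart ξ z = 0 := by
  obtain ⟨J, hJ⟩ := exists_rotation E.im_pos
  refine integral_eq_zero_of_odd J fun ξ => ?_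
  obtain ⟨h1, h2⟩ := hJ ξ
  have hI := Complex.I_mul_I
  have h3 : E.b (J ξ) z = E.b ξ z := by
    rw [b, b, etaSq_eq, etaSq_eq, h1, h2]
    congr 3
    linear_combination (-(etaL (starRingEnd ℂ E.τ) ξ * etaL E.τ ξ)) * hI
  rw [← mul_neg, h3]
  congr 1
  simp only [oddPart, h1, h2, h3, smul_smul]
  rw [show Complex.I * etaL (starRingEnd ℂ E.τ) ξ * (Complex.I * etaL (starRingEnd ℂ E.τ) ξ) =
      -(etaL (starRingEnd ℂ E.τ) ξ * etaL (starRingEnd ℂ E.τ) ξ) by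
        linear_combination (etaL (starRingEnd ℂ E.τ) ξ * etaL (starRingEnd ℂ E.τ) ξ) * hI,
    show -Complex.I * etaL E.τ ξ * (-Complex.I * etaL E.τ ξ) = -(etaL E.τ ξ * etaL E.τ ξ) by
        linear_combination (etaL E.τ ξ * etaL E.τ ξ) * hI]
  module

end Elliptic

end PlaneAction

open MeasureTheory Module
open scoped RealInnerProductSpace BoundedContinuousFunction

namespace PlaneAction

variable {A : Type*} [CStarAlgebra A] {α : PlaneAction A}

/-- The algebra behind the closed formula, with s = |η|², x and y the two first derivatives of h, b₁
and b₂ the corresponding derivatives of b, and w its second derivative. The ε₁ε₂ terms return to the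
form with |η|² through the identities for s b x b and s b y b. -/
theorem even_words {R : Type*} [Ring R] [Algebra ℂ R] {b h x y b₁ b₂ w c : R} {s : ℂ} (z e₁ e₂ : ℂ)
    (hx : s • (b * x * b) = -b₁) (hy : s • (b * y * b) = -b₂) :
    -(b * (h * w + (e₁ • x * b₂ + e₂ • y * b₁ + c * b) +
      (h * (-(s • (b * h * w) + z • (b₂ * b₁) - e₁ • w) +
          -(s • (b * h * w) + z • (b₁ * b₂) - e₂ • w)) +
        (e₁ • x * -(b₂ + z • (b * b₂) - e₂ • b₂) +
          e₂ • y * -(b₁ + z • (b * b₁) - e₁ • b₁))))) =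
    ((2 * s) • (b * h) - (1 + e₁ + e₂) • (1 : R)) * b * h * w +
      z • (b * h * (b₂ * b₁ + b₁ * b₂)) + (e₁ * z) • (b * x * b * b₂) +
      (e₂ * z) • (b * y * b * b₁) + (e₁ * e₂ * s) • (b * (x * b * y + y * b * x) * b) -
      b * c * b := by
  have h1 : s • (b * (x * b * y + y * b * x) * b) = -(b * x * b₂) - b * y * b₁ := by
    have h2 : b * (x * b * y + y * b * x) * b = b * x * (b * y * b) + b * y * (b * x * b) := by
      noncomm_ring
    rw [h2, smul_add, ← mul_smul_comm s (b * x) (b * y * b),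
      ← mul_smul_comm s (b * y) (b * x * b), hx, hy]
    noncomm_ring
  rw [mul_smul (e₁ * e₂) s, h1]
  simp only [mul_add, sub_mul, mul_sub, mul_neg, mul_smul_comm, smul_mul_assoc, one_mul,
    ← mul_assoc, smul_add, smul_sub, smul_neg]
  module

namespace Elliptic

variable (E : α.Elliptic) {z : ℂ}

/-- Multiplying the coefficients of η and η̄ by |η|² and using |η|² b h = 1 + z b removes all
explicit factors |η|² and h. They are then differentiated in this form, |η|² being a scalar for the
derivations, and the ξ-derivative terms drop out by `cross_b`. -/
theorem neg_b_mul_evenPart {e₁ e₂ : ℂ} (h₁ : E.c₁ = e₁ • α.derL (starRingEnd ℂ E.τ) E.h)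
    (h₂ : E.c₂ = e₂ • α.derL E.τ E.h) (hz : z ∈ offRay) (ξ : Plane) :
    -(E.b ξ z * E.evenPart ξ z) =
      ((2 * etaSq E.τ ξ) • (E.b ξ z * E.h) - (1 + e₁ + e₂) • (1 : A)) * E.b ξ z * E.h *
        α.derL (starRingEnd ℂ E.τ) (α.derL E.τ (E.b ξ z)) +
      z • (E.b ξ z * E.h * (α.derL E.τ (E.b ξ z) * α.derL (starRingEnd ℂ E.τ) (E.b ξ z) +
        α.derL (starRingEnd ℂ E.τ) (E.b ξ z) * α.derL E.τ (E.b ξ z))) +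
      (e₁ * z) • (E.b ξ z * α.derL (starRingEnd ℂ E.τ) E.h * E.b ξ z * α.derL E.τ (E.b ξ z)) +
      (e₂ * z) • (E.b ξ z * α.derL E.τ E.h * E.b ξ z * α.derL (starRingEnd ℂ E.τ) (E.b ξ z)) +
      (e₁ * e₂ * etaSq E.τ ξ) • (E.b ξ z * (α.derL (starRingEnd ℂ E.τ) E.h * E.b ξ z *
        α.derL E.τ E.h + α.derL E.τ E.h * E.b ξ z * α.derL (starRingEnd ℂ E.τ) E.h) * E.b ξ z) -
      E.b ξ z * E.c₀ * E.b ξ z := by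
  have hx : ∀ t, etaSq E.τ ξ • (E.b ξ z * α.derL t E.h * E.b ξ z) = -α.derL t (E.b ξ z) :=
    fun t => by rw [E.derL_b hz, neg_neg]
  have hbh := E.etaSq_smul_b_mul_h hz ξ
  have hb := E.isSmooth_b hz ξ
  have hp := E.isSmooth_fstCoeff hb
  have hq := E.isSmooth_sndCoeff hb
  have hcoeff : ∀ (t : ℂ) (e : ℂ),
      etaSq E.τ ξ • -(E.b ξ z * (E.h * α.derL t (E.b ξ z) + e • α.derL t E.h * E.b ξ z)) =
      -(α.derL t (E.b ξ z) + z • (E.b ξ z * α.derL t (E.b ξ z)) - e • α.derL t (E.b ξ z)) := by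
    intro t e
    rw [smul_neg, mul_add, smul_add, ← mul_assoc, ← smul_mul_assoc, hbh, smul_mul_assoc,
      mul_smul_comm, ← mul_assoc, smul_comm, hx, add_mul, one_mul, smul_mul_assoc, smul_neg]
    abel
  -- After the product rule, 1 + z b in front of the second derivative is turned back into |η|² b h,
  -- the form in which the final expression is stated.
  have hdcoeff : ∀ (t u : ℂ) (e : ℂ), α.derL u
      (-(α.derL t (E.b ξ z) + z • (E.b ξ z * α.derL t (E.b ξ z)) - e • α.derL t (E.b ξ z))) =
      -(etaSq E.τ ξ • (E.b ξ z * E.h * α.derL u (α.derL t (E.b ξ z))) +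
        z • (α.derL u (E.b ξ z) * α.derL t (E.b ξ z)) - e • α.derL u (α.derL t (E.b ξ z))) := by
    intro t u e
    have hd := hb.derL t
    have hbd := hb.mul hd
    have e0 : ∀ D, etaSq E.τ ξ • (E.b ξ z * E.h * D) = D + z • (E.b ξ z * D) := fun D => by
      rw [← smul_mul_assoc, hbh, add_mul, one_mul, smul_mul_assoc]
    have e1 : -(α.derL t (E.b ξ z) + z • (E.b ξ z * α.derL t (E.b ξ z)) -
        e • α.derL t (E.b ξ z)) =
        (e - 1) • α.derL t (E.b ξ z) + (-z) • (E.b ξ z * α.derL t (E.b ξ z)) := by module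
    rw [e0, e1, derL_add (hd.const_smul _) (hbd.const_smul _), derL_smul hd, derL_smul hbd,
      derL_mul hb hd]
    module
  have hsp := hcoeff E.τ e₂
  have hsq := hcoeff (starRingEnd ℂ E.τ) e₁
  rw [← h₂] at hsp
  rw [← h₁] at hsq
  change etaSq E.τ ξ • E.fstCoeff (E.b ξ z) = _ at hsp
  change etaSq E.τ ξ • E.sndCoeff (E.b ξ z) = _ at hsq
  have hdp := hdcoeff E.τ (starRingEnd ℂ E.τ) e₂
  have hdq := hdcoeff (starRingEnd ℂ E.τ) E.τ e₁
  rw [← hsp, derL_smul hp] at hdp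
  rw [← hsq, derL_smul hq, derL_comm hb E.τ (starRingEnd ℂ E.τ)] at hdq
  rw [← even_words z e₁ e₂ (hx (starRingEnd ℂ E.τ)) (hx E.τ), ← hdp, ← hdq, ← hsp, ← hsq, evenPart, L₀, E.cross_b hz,
    zero_add, h₁, h₂]
  simp only [smul_add, mul_add, mul_smul_comm]

end Elliptic

/-- The spectrum of k is compact, real and omits 0, so the squares of its points have a positive
lower bound. -/
theorem lower_spectrum_sq {k : A} (hk : IsSelfAdjoint k) (hu : IsUnit k) :
    ∃ c : ℝ, 0 < c ∧ ∀ x ∈ spectrum ℂ (k ^ 2), x.im = 0 ∧ c ≤ x.re := by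
  have hr : ∀ y ∈ spectrum ℂ k, y = (y.re : ℂ) := fun y hy => hk.mem_spectrum_eq_re hy
  obtain ⟨c, hc, h⟩ := (spectrum.isCompact (𝕜 := ℂ) k).exists_forall_le' (a := (0 : ℝ))
    (f := fun y => y.re ^ 2) (by fun_prop) fun y hy => by
      have h1 : y.re ≠ 0 := fun h0 => by
        have h2 := hr y hy
        rw [h0, Complex.ofReal_zero] at h2
        exact spectrum.zero_notMem ℂ hu (h2 ▸ hy)
      positivity
  refine ⟨c, hc, fun x hx => ?_⟩
  rw [spectrum.map_pow_of_pos k two_pos] at hx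
  obtain ⟨y, hy, rfl⟩ := hx
  have h1 := h y hy
  have h2 : y.im = 0 := by
    rw [hr y hy]
    exact Complex.ofReal_im _
  simp only [pow_two, Complex.mul_re, Complex.mul_im, h2] at h1 ⊢
  constructor
  · ring
  · linarith

/-- The perturbed Laplace multiplier as an elliptic multiplier. -/
noncomputable def perturbedLaplacian (α : PlaneAction A) (B : Matrix (Fin 2) (Fin 2) ℝ)
    (hB : B.transpose = -B) (τ : ℂ) (hτ : 0 < τ.im) (k : A) (hk : α.IsSmooth k)
    (hk_sa : IsSelfAdjoint k) (hk_unit : IsUnit k) (a₀ : A) (ha₀ : α.IsSmooth a₀) (ε₁ ε₂ : ℝ) :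
    α.Elliptic where
  B := B
  skew := hB
  τ := τ
  im_pos := hτ
  h := k ^ 2
  c₁ := (ε₁ : ℂ) • α.dtau τ (k ^ 2)
  c₂ := (ε₂ : ℂ) • α.dtauStar τ (k ^ 2)
  c₀ := a₀
  smooth_h := by
    rw [pow_two]
    exact hk.mul hk
  smooth_c₁ := by
    rw [pow_two]
    exact ((hk.mul hk).dtau τ).const_smul _
  smooth_c₂ := by
    rw [pow_two]
    exact ((hk.mul hk).dtauStar τ).const_smul _
  smooth_c₀ := ha₀
  selfAdjoint := hk_sa.pow 2
  lower := lower_spectrum_sq hk_sa hk_unit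

end PlaneAction

theorem mainTheorem7 {A : Type*} [CStarAlgebra A] (α : PlaneAction A)
    (B : Matrix (Fin 2) (Fin 2) ℝ) (hB : B.transpose = -B)
    (τ : ℂ) (hτ : 0 < τ.im)
    (k : A) (hk : α.IsSmooth k) (hk_sa : IsSelfAdjoint k) (hk_unit : IsUnit k)
    (a₀ : A) (ha₀ : α.IsSmooth a₀) (ε₁ ε₂ : ℝ) :
    -- `b j` is the homogeneous component of order `-2 - j`
    ∃ b : ℕ → Plane → ℂ → A,
      (∀ j, α.SmoothOn PlaneAction.offRay (b j)) ∧
      (∀ j, ∀ t : ℝ, 0 < t → ∀ ξ : Plane, ∀ z ∈ PlaneAction.offRay,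
        b j (t • ξ) ((t : ℂ) ^ 2 * z) = ((t ^ (2 + j))⁻¹ : ℝ) • b j ξ z) ∧
      -- the resolvent and its symbol
      (∀ Γ : Set ℂ, PlaneAction.IsResolventCone Γ →
        ∃ R : ℝ, 0 < R ∧ ∃ r : Plane → ℂ → A,
          (∀ z ∈ Γ, R < ‖z‖ →
            α.IsBoundedInverse (fun u => α.opP B τ k a₀ ε₁ ε₂ u - z • u)
              (α.mult B fun ξ => r ξ z)) ∧
          (∀ N : ℕ, α.IsParamSymbol (-2 - (N : ℝ)) (Γ ∩ {z | R < ‖z‖})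
            (fun ξ z => r ξ z - ∑ j ∈ Finset.range N, b j ξ z))) ∧
      -- the closed formulas
      (∀ ξ : Plane, ∀ z ∈ PlaneAction.offRay,
        IsUnit (PlaneAction.etaSq τ ξ • k ^ 2 - z • (1 : A)) ∧
        b 0 ξ z = PlaneAction.bSym τ k ξ z ∧
        b 1 ξ z = α.b3Formula τ k ε₁ ε₂ ξ z) ∧
      (∀ z ∈ PlaneAction.offRay,
        MeasureTheory.Integrable (fun ξ : Plane => b 2 ξ z - α.b4Formula τ k a₀ ε₁ ε₂ ξ z) ∧
        ∫ ξ : Plane, (b 2 ξ z - α.b4Formula τ k a₀ ε₁ ε₂ ξ z) = 0) := by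
  set E := α.perturbedLaplacian B hB τ hτ k hk hk_sa hk_unit a₀ ha₀ ε₁ ε₂ with hE
  have hop : ∀ u, α.opP B τ k a₀ ε₁ ε₂ u = E.op u := fun u => by
    simp only [PlaneAction.opP, PlaneAction.Elliptic.op, hE, PlaneAction.perturbedLaplacian,
      PlaneAction.leftMul_smul_left]
  refine ⟨E.term, E.smoothOn_term, fun j t ht ξ z hz => ?_, fun Γ hΓ => ?_, fun ξ z hz =>
    ⟨E.isUnit_symbol ξ hz, by rw [E.term_zero]; rfl, ?_⟩, fun z hz => ?_⟩
  · rw [(E.homog_term j).2 t ht ξ z hz]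
    refine (RCLike.real_smul_eq_coe_smul (K := ℂ) _ _).symm.trans ?_
    congr 1
    rw [← Real.rpow_natCast, ← Real.rpow_neg ht.le]
    congr 1
    push_cast
    ring
  · obtain ⟨R, hR, r, h1, h2⟩ := E.exists_resolvent hΓ.sectorial
    have hset : Γ ∩ {z | max 1 R < ‖z‖} = Γ ∩ {z | 1 < ‖z‖} ∩ {z | R < ‖z‖} := by
      ext z
      simp only [Set.mem_inter_iff, Set.mem_ofPred_eq, max_lt_iff, and_assoc]
    -- The cone becomes sectorial only after a neighbourhood of the origin is removed, here the
    -- closed unit disc.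
    refine ⟨max 1 R, by positivity, r, fun z hz hzR => ?_, fun N => ?_⟩
    · rw [max_lt_iff] at hzR
      simp only [hop]
      exact h1 z ⟨hz, hzR.1⟩ hzR.2
    · rw [hset]
      exact (h2 N).isParamSymbol (hΓ.sectorial.inter_norm R).isOpen
  · rw [E.term_one]
    have h1 : E.b ξ z = PlaneAction.bSym τ k ξ z := rfl
    rw [PlaneAction.b3Formula, PlaneAction.a1Sym, PlaneAction.conj_eta, PlaneAction.eta_eq, ← h1]
    change PlaneAction.etaL (starRingEnd ℂ τ) ξ • -(E.b ξ z * (k ^ 2 * α.dtauStar τ (E.b ξ z) +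
        (ε₂ : ℂ) • α.dtauStar τ (k ^ 2) * E.b ξ z)) +
      PlaneAction.etaL τ ξ • -(E.b ξ z * (k ^ 2 * α.dtau τ (E.b ξ z) +
        (ε₁ : ℂ) • α.dtau τ (k ^ 2) * E.b ξ z)) = _
    simp only [mul_add, add_mul, mul_smul_comm, smul_mul_assoc, ← mul_assoc]
    module
  -- The even part of the third term is exactly the closed formula, so the difference is minus b
  -- times the odd part, which is integrable with integral zero.
  · have hD : ∀ ξ, E.term 2 ξ z - α.b4Formula τ k a₀ ε₁ ε₂ ξ z =
        -(E.b ξ z * E.oddPart ξ z) := fun ξ => by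
      have h1 : α.b4Formula τ k a₀ ε₁ ε₂ ξ z = -(E.b ξ z * E.evenPart ξ z) :=
        (E.neg_b_mul_evenPart (e₁ := (ε₁ : ℂ)) (e₂ := (ε₂ : ℂ)) rfl rfl hz ξ).symm
      rw [h1, E.term_two_eq hz]
      abel
    simp only [hD]
    exact ⟨(E.integrable_oddPart hz).neg, by
      rw [MeasureTheory.integral_neg, E.integral_oddPart, neg_zero]⟩
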